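/- **Setting.** A binary memoryless symmetric (BMS) channel is described by its symmetric $L$-density $\mathsf c$ (law of the log-likelihood ratio $L\in[-\infty,\infty]$ given input $+1$; equivalently the law of $D=\tanh(L/2)\in[-1,1]$), and $H(\mathsf c)=H(X\mid Y)$ denotes its entropy in bits for uniform input $X\in\{\pm1\}$. A family $\{\mathsf c_t\}$ is *smooth* if $t\mapsto\int\varphi\,d\mathsf c_t$ is continuously differentiable on $(0,1)$ for every $C^1$ function $\varphi$ of $D\in[-1,1]$, and *degraded* if $\mathsf c_{t}$ is physically degraded with respect to $\mathsf c_{s}$ for $s\le t$. Let $\{\mathrm{BMS}(h)\}_{h\in[0,1]}$ be a smooth and degraded family parameterized by entropy, $H(\mathrm{BMS}(h))=h$. Let $(\lambda,\rho)$, $\lambda(x)=\sum_i\lambda_ix^{i-1}$, $\rho(x)=\sum_i\rho_ix^{i-1}$, be an edge-perspective degree distribution pair (polynomials with nonnegative coefficients, $\lambda(1)=\rho(1)=1$), with design rate $r=1-\int_0^1\rho/\int_0^1\lambda$. Let $G$ be uniformly random in the ensemble $\mathrm{LDPC}(n,\lambda,\rho)$ (uniform matching of variable sockets with check sockets), $n\to\infty$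 along any sequence of block lengths with bounded node degrees and with fractions of nodes of each degree equal to, or converging to, those prescribed by $(\lambda,\rho)$. Assume that the expected rate $\mathbb E_G[\frac1n\log_2|C(G)|]$ of the code $C(G)\subseteq\{\pm1\}^n$ converges to $r$. For a uniformly random codeword $X$ all of whose bits are sent through $\mathrm{BMS}(h)$, with output $Y$, let $$g_i(G,h)=\frac{\partial H(X_i\mid Y)}{\partial h_i},\qquad g_i^{\mathrm{BP},\ell}(G,h)=\frac{\partial H(X_i\mid \Phi_i^{\mathrm{BP},\ell},Y_i)}{\partial h_i},$$ where $h_i$ is the parameter of the channel of bit $i$ alone, and $\Phi_i^{\mathrm{BP},\ell}$ (a function of the outputs other than $Y_i$) is the extrinsic estimate of bit $i$ after $\ell$ rounds of belief propagation (flooding schedule) on the Tanner graph $G$. Put $$g(h)=\limsup_{n\to\infty}\mathbb E_G\Big[\frac1n\sum_i g_i(G,h)\Big],\qquad g^{\mathrm{BP}}(h)=\lim_{\ell\to\infty}\lim_{n\to\infty}\mathbb E_G\Big[\frac1n\sum_i g_i^{\mathrm{BP},\ell}(G,h)\Big].$$ The *BP fixed point* for a channel $\mathsf c$ is the weak limit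 of density evolution $\mathsf a\mapsto\mathsf c\star\lambda(\rho(\mathsf a))$ started at the density $\Delta_0$ carrying no information. Assume that the BP fixed-point family is *smooth and complete*: there are channels $\mathsf c_x=\mathrm{BMS}(\eta(x))$, $\eta(x)\in[0,1]$, and densities $\mathsf f_x$, $x\in[0,1]$, such that $\mathsf f_x$ is the BP fixed point for $\mathsf c_x$, $\mathsf f_x=\mathsf c_x\star\lambda(\rho(\mathsf f_x))$, $H(\mathsf f_x)=x$, and both $\{\mathsf f_x\}$ and $\{\mathsf c_x\}$ are smooth in $x$. **Corollary.** For almost every $h\in[0,1]$ all the derivatives above exist, the limits defining $g^{\mathrm{BP}}(h)$ exist, and $$g(h)=g^{\mathrm{BP}}(h).$$ -/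

import Mathlib

open MeasureTheory ProbabilityTheory Filter Topology Set

namespace Gexit

/-! ### Binary memoryless symmetric channels

A BMS channel is described by the law, under the input `+1`, of its canonical output.
The canonical output is recorded as the soft bit `D = tanh (L / 2)`, i.e. `D = P(+1 | y) - P(-1 | y)`
for the uniform prior, an affine coordinate on the simplex of posteriors.  The log-likelihood ratio
`L ∈ [-∞, ∞]` and `D ∈ [-1, 1]` determine each other. -/

/-- A symmetric `L`-density, in the coordinate `D = tanh (L / 2)`.  The symmetry
`a (-l) = exp (-l) * a l` says in this coordinate that `(1 - d) a(dd)` is invariant under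
`d ↦ -d`; it expresses that the output `d` is its own posterior mean.
The same objects serve as channels and as message densities. -/
structure LDensity where
  law : Measure ℝ
  isProb : IsProbabilityMeasure law
  supported : law (Icc (-1) 1)ᶜ = 0
  symmetric : (law.withDensity fun d => ENNReal.ofReal (1 - d)).map (fun d => -d) =
    law.withDensity fun d => ENNReal.ofReal (1 - d)

attribute [instance] LDensity.isProb

/-- The entropy `H(X | Y)` (in bits) of a uniform `X ∈ {+1, -1}` observed through the channel `a`:
the posterior probability of `-1` given `D = d` is `(1 - d) / 2`. -/
noncomputable def LDensity.entropy (a : LDensity) : ℝ :=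
  (∫ d, Real.binEntropy ((1 - d) / 2) ∂a.law) / Real.log 2

/-- `b` is physically degraded with respect to `a`: the channel `b` is `a` followed by a further
channel `κ`.  Under the input `-1` the output of `a` is `-D`. -/
def LDensity.IsDegradedOf (b a : LDensity) : Prop :=
  ∃ κ : Kernel ℝ ℝ, IsMarkovKernel κ ∧ b.law = a.law.bind κ ∧
    b.law.map (fun d => -d) = (a.law.map (fun d => -d)).bind κ

/-- Smoothness of a family of channels in its parameter: the expectation of every continuously
differentiable function on the (compact) simplex is continuously differentiable in the parameter.
It is asked for interior parameters only. -/
def SmoothFamily (a : ℝ → LDensity) : Prop :=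
  ∀ φ : ℝ → ℝ, ContDiff ℝ 1 φ → ContDiffOn ℝ 1 (fun t => ∫ d, φ d ∂(a t).law) (Ioo 0 1)

/-- The family is ordered by physical degradation on `[0, 1]`. -/
def DegradedFamily (a : ℝ → LDensity) : Prop :=
  ∀ s ∈ Icc (0 : ℝ) 1, ∀ t ∈ Icc (0 : ℝ) 1, s ≤ t → (a t).IsDegradedOf (a s)

/-- The family is parameterized by its entropy, which ranges over `[0, 1]`. -/
def EntropyParameterized (a : ℝ → LDensity) : Prop :=
  ∀ h ∈ Icc (0 : ℝ) 1, (a h).entropy = h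

/-! ### Degree distributions and density evolution -/

/-- A degree distribution pair from the edge perspective, `λ(x) = ∑ λ_i x ^ (i - 1)` and
`ρ(x) = ∑ ρ_i x ^ (i - 1)`: the coefficient of `x ^ k` is the fraction of edges attached to nodes
of degree `k + 1`. -/
structure DegreePair where
  lam : Polynomial ℝ
  rho : Polynomial ℝ
  lam_nonneg : ∀ k, 0 ≤ lam.coeff k
  rho_nonneg : ∀ k, 0 ≤ rho.coeff k
  lam_one : lam.eval 1 = 1
  rho_one : rho.eval 1 = 1

/-- `∫ λ` over the unit interval. -/
noncomputable def DegreePair.intLam (P : DegreePair) : ℝ := ∫ x in (0 : ℝ)..1, P.lam.eval x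

/-- `∫ ρ` over the unit interval. -/
noncomputable def DegreePair.intRho (P : DegreePair) : ℝ := ∫ x in (0 : ℝ)..1, P.rho.eval x

/-- The design rate `1 - ∫ ρ / ∫ λ`. -/
noncomputable def DegreePair.designRate (P : DegreePair) : ℝ := 1 - P.intRho / P.intLam

/-- Number of variable nodes of degree `d` per variable node. -/
noncomputable def DegreePair.varFraction (P : DegreePair) : ℕ → ℝ
  | 0 => 0
  | k + 1 => P.lam.coeff k / (k + 1) / P.intLam

/-- Number of check nodes of degree `d` per variable node. -/
noncomputable def DegreePair.checkFraction (P : DegreePair) : ℕ → ℝ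
  | 0 => 0
  | k + 1 => P.rho.coeff k / (k + 1) / P.intLam

/-- The variable-node rule for independent messages: addition of log-likelihood ratios,
`tanh (∑ L_i / 2)` in terms of `d_i = tanh (L_i / 2)`. -/
noncomputable def varRule {ι : Type*} (s : Finset ι) (d : ι → ℝ) : ℝ :=
  (∏ i ∈ s, (1 + d i) - ∏ i ∈ s, (1 - d i)) / (∏ i ∈ s, (1 + d i) + ∏ i ∈ s, (1 - d i))

/-- The variable-node rule for two messages. -/
noncomputable def varRule₂ (u v : ℝ) : ℝ := (u + v) / (1 + u * v)

/-- `a ⋆ b`: the law of the sum of two independent log-likelihood ratios. -/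
noncomputable def varConv (a b : Measure ℝ) : Measure ℝ :=
  (a.prod b).map fun p => varRule₂ p.1 p.2

/-- `λ(a) = ∑ λ_i a^{⋆ (i - 1)}`. -/
noncomputable def varPoly (p : Polynomial ℝ) (a : Measure ℝ) : Measure ℝ :=
  ∑ k ∈ p.support, ENNReal.ofReal (p.coeff k) •
    (Measure.pi fun _ : Fin k => a).map (varRule Finset.univ)

/-- `ρ(a) = ∑ ρ_i a^{⊠ (i - 1)}`; at a check node the soft bits multiply. -/
noncomputable def checkPoly (p : Polynomial ℝ) (a : Measure ℝ) : Measure ℝ :=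
  ∑ k ∈ p.support, ENNReal.ofReal (p.coeff k) •
    (Measure.pi fun _ : Fin k => a).map fun d => ∏ i, d i

/-- One step of density evolution, `a ↦ c ⋆ λ(ρ(a))`. -/
noncomputable def DegreePair.deStep (P : DegreePair) (c a : Measure ℝ) : Measure ℝ :=
  varConv c (varPoly P.lam (checkPoly P.rho a))

/-- Density evolution for belief propagation, started from the density without information. -/
noncomputable def DegreePair.deIter (P : DegreePair) (c : Measure ℝ) (l : ℕ) : Measure ℝ :=
  (P.deStep c)^[l] (Measure.dirac 0)

/-- `f` is the BP fixed-point density for the channel `c`: the weak limit of density evolution. -/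
def DegreePair.IsBPFixedPoint (P : DegreePair) (c f : LDensity) : Prop :=
  ∀ φ : ℝ → ℝ, Continuous φ →
    Tendsto (fun l => ∫ d, φ d ∂(P.deIter c.law l)) atTop (𝓝 (∫ d, φ d ∂f.law))

/-- Densities `f x` and channels `BMS (η x)`, `x ∈ [0, 1]`, taken from the family `c`, form a
complete fixed-point family. -/
structure IsCompleteFixedPointFamily (P : DegreePair) (c : ℝ → LDensity)
    (η : ℝ → ℝ) (f : ℝ → LDensity) : Prop where
  mem : ∀ x ∈ Icc (0 : ℝ) 1, η x ∈ Icc (0 : ℝ) 1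
  fixed : ∀ x ∈ Icc (0 : ℝ) 1, (f x).law = P.deStep (c (η x)).law (f x).law
  smooth_density : SmoothFamily f
  smooth_channel : SmoothFamily fun x => c (η x)
  entropy_eq : ∀ x ∈ Icc (0 : ℝ) 1, (f x).entropy = x

/-- The BP fixed-point family of `c` is smooth and complete: indexed by the entropy of the
fixed-point density, the BP fixed points form a complete fixed-point family. -/
def HasCompleteBPFamily (P : DegreePair) (c : ℝ → LDensity) : Prop :=
  ∃ (η : ℝ → ℝ) (f : ℝ → LDensity), IsCompleteFixedPointFamily P c η f ∧
    ∀ x ∈ Icc (0 : ℝ) 1, P.IsBPFixedPoint (c (η x)) (f x)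

/-! ### The LDPC ensemble -/

/-- Node degrees of a Tanner graph with `n` variable nodes and `m` check nodes; a node of degree
`d` has `d` sockets, and there are as many variable sockets as check sockets. -/
structure SocketEnsemble where
  n : ℕ
  m : ℕ
  vdeg : Fin n → ℕ
  cdeg : Fin m → ℕ
  sum_eq : ∑ i, vdeg i = ∑ j, cdeg j

abbrev SocketEnsemble.VSocket (E : SocketEnsemble) : Type := Σ i : Fin E.n, Fin (E.vdeg i)

abbrev SocketEnsemble.CSocket (E : SocketEnsemble) : Type := Σ j : Fin E.m, Fin (E.cdeg j)

/-- The Tanner graphs of the ensemble: all matchings of variable sockets with check sockets. -/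
abbrev SocketEnsemble.Graph (E : SocketEnsemble) : Type := E.VSocket ≃ E.CSocket

/-- Expectation over a uniformly random graph of the ensemble. -/
noncomputable def SocketEnsemble.avg (E : SocketEnsemble) (F : E.Graph → ℝ) : ℝ :=
  (∑ G : E.Graph, F G) / Fintype.card E.Graph

/-- `E 0, E 1, …` is a sequence of ensembles `LDPC(n, λ, ρ)` with block length `n → ∞`: degrees are
bounded and the numbers of nodes of each degree are the prescribed ones (exactly, or up to a
rounding that is negligible as `n → ∞`). -/
structure IsLDPCSequence (P : DegreePair) (E : ℕ → SocketEnsemble) : Prop where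
  length_tendsto : Tendsto (fun k => (E k).n) atTop atTop
  bounded : ∃ B : ℕ, ∀ k, (∀ i, (E k).vdeg i ≤ B) ∧ ∀ j, (E k).cdeg j ≤ B
  var_fraction : ∀ d, Tendsto
    (fun k => (Fintype.card {i // (E k).vdeg i = d} : ℝ) / (E k).n) atTop (𝓝 (P.varFraction d))
  check_fraction : ∀ d, Tendsto
    (fun k => (Fintype.card {j // (E k).cdeg j = d} : ℝ) / (E k).n) atTop (𝓝 (P.checkFraction d))

/-- The code of a graph, over the alphabet `{+1, -1}`: at each check node the bits of the attached
edges (with multiplicity) multiply to `+1`. -/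
def SocketEnsemble.code (E : SocketEnsemble) (G : E.Graph) : Set (Fin E.n → ℤˣ) :=
  {x | ∀ j, ∏ s : Fin (E.cdeg j), x (G.symm ⟨j, s⟩).1 = 1}

/-- The rate of the code of `G`. -/
noncomputable def SocketEnsemble.rate (E : SocketEnsemble) (G : E.Graph) : ℝ :=
  Real.logb 2 (E.code G).ncard / E.n

/-! ### Belief propagation -/

/-- Message from the check node to the variable node along the edge at a variable socket, after
`l` rounds of belief propagation (flooding schedule, soft-bit form) with channel outputs `y`.
A round sends from variable socket `t` the variable-node rule applied to the channel output and to
the messages received on the other sockets of the node, and a check node returns the product of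
the messages received on its other sockets. -/
noncomputable def SocketEnsemble.checkMsg (E : SocketEnsemble) (G : E.Graph) (y : Fin E.n → ℝ) :
    ℕ → E.VSocket → ℝ
  | 0, _ => 0
  | l + 1, e => ∏ s ∈ Finset.univ.erase (G e).2,
      let t : E.VSocket := G.symm ⟨(G e).1, s⟩
      varRule₂ (y t.1)
        (varRule (Finset.univ.erase t.2) fun b => E.checkMsg G y l ⟨t.1, b⟩)

/-- The extrinsic BP estimate of bit `i` after `l` rounds, in soft-bit form.  It is a function of
the outputs other than `y i`: these are what BP is run on, with output `i` erased. -/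
noncomputable def SocketEnsemble.bpEstimate (E : SocketEnsemble) (G : E.Graph) (l : ℕ)
    (i : Fin E.n) (y : Fin E.n → ℝ) : ℝ :=
  varRule Finset.univ fun b => E.checkMsg G (Function.update y i 0) l ⟨i, b⟩

/-! ### Conditional entropies and GEXIT functions -/

/-- The conditional entropy `H(X | Y)`, in bits, of a finitely-valued `X`: the expectation of the
entropy of the conditional probabilities `P(X = a | Y)`. -/
noncomputable def condEntropy {Ω A S : Type*} [MeasurableSpace Ω] [Fintype A]
    [MeasurableSpace S] (μ : Measure Ω) (X : Ω → A) (Y : Ω → S) : ℝ :=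
  (∫ ω, ∑ a, Real.negMulLog
    ((μ[(X ⁻¹' {a}).indicator (fun _ => (1 : ℝ)) | MeasurableSpace.comap Y inferInstance]) ω) ∂μ)
    / Real.log 2

/-- A uniformly random codeword of `G`, together with independent channel noise; bit `i` is sent
through the channel `c i`. -/
noncomputable def SocketEnsemble.joint (E : SocketEnsemble) (G : E.Graph)
    (c : Fin E.n → LDensity) : Measure ((Fin E.n → ℤˣ) × (Fin E.n → ℝ)) :=
  (uniformOn (E.code G)).prod (Measure.pi fun i => (c i).law)

/-- The channel outputs `Y i = X i * D i`. -/
def SocketEnsemble.output (E : SocketEnsemble) (ω : (Fin E.n → ℤˣ) × (Fin E.n → ℝ)) :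
    Fin E.n → ℝ :=
  fun i => ((ω.1 i : ℤ) : ℝ) * ω.2 i

/-- `H(X_i | Y)` when bit `i` is sent through `c t` and all other bits through `c h`. -/
noncomputable def SocketEnsemble.mapEntropy (E : SocketEnsemble) (G : E.Graph) (c : ℝ → LDensity)
    (h : ℝ) (i : Fin E.n) (t : ℝ) : ℝ :=
  condEntropy (E.joint G (Function.update (fun _ => c h) i (c t))) (fun ω => ω.1 i) E.output

/-- `H(X_i | Φ_i, Y_i)`, where `Φ_i` is the extrinsic BP estimate after `l` rounds, when bit `i` is
sent through `c t` and all other bits through `c h`. -/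
noncomputable def SocketEnsemble.bpEntropy (E : SocketEnsemble) (G : E.Graph) (c : ℝ → LDensity)
    (l : ℕ) (h : ℝ) (i : Fin E.n) (t : ℝ) : ℝ :=
  condEntropy (E.joint G (Function.update (fun _ => c h) i (c t))) (fun ω => ω.1 i)
    fun ω => (E.bpEstimate G l i (E.output ω), E.output ω i)

/-- The (MAP) GEXIT function of bit `i`, for transmission of all bits through `c h`. -/
noncomputable def SocketEnsemble.mapGexit (E : SocketEnsemble) (G : E.Graph) (c : ℝ → LDensity)
    (i : Fin E.n) (h : ℝ) : ℝ :=
  deriv (E.mapEntropy G c h i) h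

/-- The BP GEXIT function of bit `i` after `l` rounds. -/
noncomputable def SocketEnsemble.bpGexit (E : SocketEnsemble) (G : E.Graph) (c : ℝ → LDensity)
    (l : ℕ) (i : Fin E.n) (h : ℝ) : ℝ :=
  deriv (E.bpEntropy G c l h i) h

/-- The asymptotic (MAP) GEXIT function `limsup_n E_G [ (1/n) ∑_i g_i (G, h) ]`. -/
noncomputable def asymptoticMapGexit (E : ℕ → SocketEnsemble) (c : ℝ → LDensity) (h : ℝ) :
    EReal :=
  limsup (fun k => (((E k).avg fun G => (∑ i, (E k).mapGexit G c i h) / (E k).n : ℝ) : EReal))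
    atTop

/-- The asymptotic BP GEXIT function at `h` exists and has the value `g`:
`g = lim_l lim_n E_G [ (1/n) ∑_i g_i^{BP, l} (G, h) ]`. -/
def IsAsymptoticBPGexit (E : ℕ → SocketEnsemble) (c : ℝ → LDensity) (h g : ℝ) : Prop :=
  ∃ gl : ℕ → ℝ,
    (∀ l, Tendsto (fun k => (E k).avg fun G => (∑ i, (E k).bpGexit G c l i h) / (E k).n)
      atTop (𝓝 (gl l))) ∧
    Tendsto gl atTop (𝓝 g)

end Gexit

/-! Everything rests on one expansion. The information in a soft bit is `info x = ∑ coef k * x ^ (2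
* k + 2)` with positive coefficients, even moments multiply at a check node, and `info_duality`
relates the two node types: I(a ⋆ b) + I(a ⊠ b) = I(a) + I(b). Writing a_k for the moment of order
2k + 2, this gives I(a ⋆ b) = ∑ coef k * (a_k + b_k - a_k b_k) (`hasSum_mutualInfo_add`).

Consequently the derivative of the entropy of a bit in the parameter of its own channel is ∑ w_k(h)
(1 - M_k), where the M_k are the even moments of the conditional mean of the bit given its extrinsic
observation (`IsChannelFamily.hasDerivAt_condEntropy`). The weights w_k(h) ≥ 0 depend on the channel
family only, and parameterization by entropy makes them sum to 1 for almost every h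
(`ae_hasSum_weight`). The MAP and BP curves have this form with the same weights, so comparing them
means comparing moments.

Three facts are combined. (1) The BP estimate is a function of the extrinsic outputs, so MAP moments
dominate BP moments, and in the limit the MAP curve does not exceed the BP curve `bpLimit`
(`tendsto_excess`). (2) The area under the average MAP curve is at least the rate, because H(X | Y)
grows from 0 to log |C| as the channels degrade (`rate_le_integral`). (3) The area under `bpLimit`
is at most the design rate: along the complete family of fixed points the Stieltjes sums are
dominated by increments of a potential whose end values differ by at most r log 2 (`potential_step`,
`integral_bpLimit_le`). When the rate tends to r the areas are squeezed, the MAP averages converge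
to `bpLimit` in L¹, and the limsup equals `bpLimit` almost everywhere.

The law of BP on a random graph comes from exploring the matching edge by edge. Only lower bounds
for averages of nonnegative functions are propagated (`exists_messageBound`), so collisions are
simply discarded; upper bounds follow from the test function 1 - φ.

One obstruction remains: a bit that is constant on the code is known without any observation,
whatever BP computes. Near the useless channel such bits lower the MAP area, so facts (1)-(3) show
that, up to a vanishing fraction, they are just the bits attached to a check node of degree one
(`eventually_forced_le`). BP recognizes these after one round. -/

namespace Gexit

/-! ### The information kernel and its power series -/

/-- The coefficient of `x ^ (2 k + 2)` in the power series of `info`. -/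
noncomputable def coef (k : ℕ) : ℝ := 1 / ((2 * k + 1) * (2 * k + 2))

/-- `info x = log 2 - h₂ ((1 - x) / 2)`, the information (in nats) in a soft bit `x`. -/
noncomputable def info (x : ℝ) : ℝ :=
  ((1 + x) * Real.log (1 + x) + (1 - x) * Real.log (1 - x)) / 2

lemma coef_pos (k : ℕ) : 0 < coef k := by unfold coef; positivity

lemma coef_eq (k : ℕ) : coef k = 1 / (2 * k + 1) - 1 / (2 * k + 2) := by
  unfold coef; field_simp; ring

lemma coef_summable : Summable coef := by
  have h : Summable fun n : ℕ => 1 / ((n + 1 : ℕ) : ℝ) ^ 2 :=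
    (summable_nat_add_iff 1).2 (Real.summable_one_div_nat_pow.2 one_lt_two)
  refine Summable.of_nonneg_of_le (fun k => (coef_pos k).le) (fun k => ?_) h
  unfold coef
  push_cast
  gcongr
  nlinarith [(Nat.cast_nonneg k : (0 : ℝ) ≤ k)]

lemma info_neg (x : ℝ) : info (-x) = info x := by
  unfold info; rw [sub_neg_eq_add, ← sub_eq_add_neg]; ring

lemma continuous_info : Continuous info := by
  unfold info
  have := Real.continuous_mul_log
  fun_prop

lemma info_one : info 1 = Real.log 2 := by
  unfold info; norm_num

/-- Here `info x` equals (x / 2) log ((1 + x) / (1 - x)) + (1 / 2) log (1 - x ^ 2). The two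
classical series combine with coefficient 1 / (2k + 1) - 1 / (2k + 2), which is `coef k`. -/
lemma info_hasSum_of_lt {x : ℝ} (hx : |x| < 1) :
    HasSum (fun k => coef k * x ^ (2 * k + 2)) (info x) := by
  have h1 := (Real.hasSum_log_sub_log_of_abs_lt_one hx).mul_left (x / 2)
  have hx2 : |x ^ 2| < 1 := by
    rw [abs_pow]; exact pow_lt_one₀ (abs_nonneg x) hx two_ne_zero
  have h2 := (Real.hasSum_pow_div_log_of_abs_lt_one hx2).mul_left (1 / 2)
  have h := h1.sub h2
  obtain ⟨hl, hr⟩ := abs_lt.1 hx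
  have e : info x = x / 2 * (Real.log (1 + x) - Real.log (1 - x)) -
      1 / 2 * -Real.log (1 - x ^ 2) := by
    have : Real.log (1 - x ^ 2) = Real.log (1 + x) + Real.log (1 - x) := by
      rw [← Real.log_mul (by linarith) (by linarith)]; congr 1; ring
    rw [this]; unfold info; ring
  rw [e]
  refine h.congr_fun fun k => ?_
  have : (2 * (k : ℝ) + 1) ≠ 0 := by positivity
  have : (k : ℝ) + 1 ≠ 0 := by positivity
  rw [coef_eq]
  field_simp
  ring

/-- The endpoints are included by continuity: the series converges uniformly on the closed interval
because `coef` is summable, and `info` is continuous since t log t is. -/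
lemma info_hasSum {x : ℝ} (hx : x ∈ Icc (-1 : ℝ) 1) :
    HasSum (fun k => coef k * x ^ (2 * k + 2)) (info x) := by
  have hb : ∀ k, ∀ y ∈ Icc (-1 : ℝ) 1, ‖coef k * y ^ (2 * k + 2)‖ ≤ coef k := by
    intro k y hy
    rw [norm_mul, norm_pow, Real.norm_of_nonneg (coef_pos k).le]
    exact mul_le_of_le_one_right (coef_pos k).le (pow_le_one₀ (norm_nonneg _) (abs_le.2 hy))
  have hc : ContinuousOn (fun y => ∑' k, coef k * y ^ (2 * k + 2)) (Icc (-1 : ℝ) 1) :=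
    continuousOn_tsum (fun k => by fun_prop) coef_summable hb
  have hs : Summable fun k => coef k * x ^ (2 * k + 2) :=
    Summable.of_norm_bounded coef_summable fun k => hb k x hx
  have heq : EqOn (fun y => ∑' k, coef k * y ^ (2 * k + 2)) info (Ioo (-1 : ℝ) 1) :=
    fun y hy => (info_hasSum_of_lt (abs_lt.2 hy)).tsum_eq
  have hcl := heq.of_subset_closure hc continuous_info.continuousOn Ioo_subset_Icc_self
    (by rw [closure_Ioo (by norm_num)])
  rw [← hcl hx]
  exact hs.hasSum

lemma coef_hasSum : HasSum coef (Real.log 2) := by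
  have := info_hasSum (x := 1) (by norm_num)
  simpa [info_one] using this

lemma info_nonneg {x : ℝ} (hx : x ∈ Icc (-1 : ℝ) 1) : 0 ≤ info x :=
  (info_hasSum hx).nonneg fun k => mul_nonneg (coef_pos k).le
    ((even_two_mul k).add even_two |>.pow_nonneg x)

lemma info_le {x : ℝ} (hx : x ∈ Icc (-1 : ℝ) 1) : info x ≤ Real.log 2 :=
  hasSum_le (fun k => mul_le_of_le_one_right (coef_pos k).le (by
    rw [← Even.pow_abs ((even_two_mul k).add even_two)]
    exact pow_le_one₀ (abs_nonneg x) (abs_le.2 hx))) (info_hasSum hx) coef_hasSum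

lemma binEntropy_eq (x : ℝ) :
    Real.binEntropy ((1 - x) / 2) = Real.log 2 - info x := by
  have key : ∀ p : ℝ, Real.negMulLog (p / 2) = -(p * Real.log p) / 2 + p * Real.log 2 / 2 := by
    intro p
    rcases eq_or_ne p 0 with rfl | hp
    · simp
    · rw [Real.negMulLog, Real.log_div hp two_ne_zero]; ring
  rw [Real.binEntropy_eq_negMulLog_add_negMulLog_one_sub,
    show 1 - (1 - x) / 2 = (1 + x) / 2 by ring, key, key]
  unfold info; ring

lemma negMulLog_add (x : ℝ) :
    Real.negMulLog ((1 + x) / 2) + Real.negMulLog ((1 - x) / 2) = Real.log 2 - info x := by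
  rw [← binEntropy_eq, Real.binEntropy_eq_negMulLog_add_negMulLog_one_sub,
    show 1 - (1 - x) / 2 = (1 + x) / 2 by ring, add_comm]

/-! ### The variable-node rule and its duality with the check-node rule -/

lemma varRule₂_mem {u d : ℝ} (hu : u ∈ Icc (-1 : ℝ) 1) (hd : d ∈ Icc (-1 : ℝ) 1) :
    varRule₂ u d ∈ Icc (-1 : ℝ) 1 := by
  obtain ⟨h1, h2⟩ := hu
  obtain ⟨h3, h4⟩ := hd
  have h0 : 0 ≤ 1 + u * d := by nlinarith
  unfold varRule₂
  rcases h0.eq_or_lt with h | h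
  · rw [← h]; simp
  · constructor
    · rw [le_div_iff₀ h]; nlinarith
    · rw [div_le_iff₀ h]; nlinarith

/-- The cleared form survives the contradictory case u d = -1, where division returns 0: then (1 +
u)(1 + d) = u + d and (1 - u)(1 - d) = -(u + d) are both nonnegative, so u + d = 0. -/
lemma mul_varRule₂ {u d : ℝ} (hu : u ∈ Icc (-1 : ℝ) 1) (hd : d ∈ Icc (-1 : ℝ) 1) :
    (1 + u * d) * varRule₂ u d = u + d := by
  obtain ⟨h1, h2⟩ := hu
  obtain ⟨h3, h4⟩ := hd
  unfold varRule₂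
  rcases eq_or_ne (1 + u * d) 0 with h | h
  · rw [h]
    have : (1 + u) * (1 + d) = u + d := by linear_combination h
    have : (1 - u) * (1 - d) = -(u + d) := by linear_combination h
    have : 0 ≤ (1 + u) * (1 + d) := mul_nonneg (by linarith) (by linarith)
    have : 0 ≤ (1 - u) * (1 - d) := mul_nonneg (by linarith) (by linarith)
    linarith
  · field_simp

lemma one_add_mul_nonneg {u d : ℝ} (hu : u ∈ Icc (-1 : ℝ) 1) (hd : d ∈ Icc (-1 : ℝ) 1) :
    0 ≤ 1 + u * d := by
  obtain ⟨h1, h2⟩ := hu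
  obtain ⟨h3, h4⟩ := hd
  nlinarith

/-- With c = 1 + u d and V the combined soft bit, c (1 ± V) = (1 ± u)(1 ± d); the logarithm of c
splits off. The convention 0 log 0 = 0 covers the degenerate cases. -/
lemma mul_info_varRule₂ {u d : ℝ} (hu : u ∈ Icc (-1 : ℝ) 1) (hd : d ∈ Icc (-1 : ℝ) 1) :
    (1 + u * d) * info (varRule₂ u d) =
      ((1 + u) * (1 + d) * Real.log ((1 + u) * (1 + d)) +
        (1 - u) * (1 - d) * Real.log ((1 - u) * (1 - d))) / 2 -
        (1 + u * d) * Real.log (1 + u * d) := by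
  have hm := mul_varRule₂ hu hd
  have h0 := one_add_mul_nonneg hu hd
  set c := 1 + u * d with hc
  set V := varRule₂ u d
  have e1 : (1 + u) * (1 + d) = c * (1 + V) := by
    linear_combination hc - hm
  have e2 : (1 - u) * (1 - d) = c * (1 - V) := by
    linear_combination hm + hc
  rw [e1, e2]
  rcases h0.eq_or_lt with h | h
  · simp [← h]
  have key : ∀ p : ℝ, c * p * Real.log (c * p) = c * (p * Real.log p) + c * p * Real.log c := by
    intro p
    rcases eq_or_ne p 0 with rfl | hp
    · simp
    · rw [Real.log_mul h.ne' hp]; ring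
  rw [key, key]
  unfold info; ring

/-- Combining independent soft bits: entropies of variable-node and check-node outputs add up. -/
lemma info_duality {u d : ℝ} (hu : u ∈ Icc (-1 : ℝ) 1) (hd : d ∈ Icc (-1 : ℝ) 1) :
    ((1 + u * d) * info (varRule₂ u d) + (1 + u * -d) * info (varRule₂ u (-d))) / 2 =
      info u + info d - info (u * d) := by
  have hd' : -d ∈ Icc (-1 : ℝ) 1 := ⟨by linarith [hd.2], by linarith [hd.1]⟩
  rw [mul_info_varRule₂ hu hd, mul_info_varRule₂ hu hd']
  have key : ∀ p q : ℝ, p * q * Real.log (p * q) = q * (p * Real.log p) + p * (q * Real.log q) := by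
    intro p q
    rcases eq_or_ne p 0 with rfl | hp
    · simp
    rcases eq_or_ne q 0 with rfl | hq
    · simp
    · rw [Real.log_mul hp hq]; ring
  rw [key, key, key, key]
  unfold info
  rw [sub_neg_eq_add, ← sub_eq_add_neg, mul_neg, ← sub_eq_add_neg]
  ring

end Gexit
namespace Gexit

/-! ### The algebra of symmetric densities -/

@[fun_prop]
lemma measurable_varRule₂ : Measurable fun p : ℝ × ℝ => varRule₂ p.1 p.2 := by
  unfold varRule₂; fun_prop

/-- `exp (-L)` in terms of `D = tanh (L / 2)`; this map is an involution. -/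
noncomputable def lratio (d : ℝ) : ℝ := (1 - d) / (1 + d)

@[fun_prop]
lemma measurable_lratio : Measurable lratio := by unfold lratio; fun_prop

lemma lratio_lratio {d : ℝ} (hd : -1 < d) : lratio (lratio d) = d := by
  have : 1 + d ≠ 0 := by linarith
  unfold lratio
  field_simp
  ring

lemma one_add_mul_pos {u v : ℝ} (hu : u ∈ Ioc (-1 : ℝ) 1) (hv : v ∈ Ioc (-1 : ℝ) 1) :
    0 < 1 + u * v := by
  obtain ⟨h1, h2⟩ := hu
  obtain ⟨h3, h4⟩ := hv
  nlinarith [mul_pos (by linarith : 0 < 1 + u) (by linarith : 0 < 1 + v),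
    mul_nonneg (by linarith : 0 ≤ 1 - u) (by linarith : 0 ≤ 1 - v)]

/-- Adding log-likelihood ratios multiplies likelihood ratios. Through `lratio`, the variable-node
convolution becomes multiplicative convolution. The value -1 is excluded because its ratio is
infinite. -/
lemma lratio_varRule₂ {u v : ℝ} (hu : u ∈ Ioc (-1 : ℝ) 1) (hv : v ∈ Ioc (-1 : ℝ) 1) :
    lratio (varRule₂ u v) = lratio u * lratio v := by
  have h := one_add_mul_pos hu hv
  have h1 : 0 < 1 + u := by linarith [hu.1]
  have h2 : 0 < 1 + v := by linarith [hv.1]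
  have e1 : 1 + varRule₂ u v = (1 + u) * (1 + v) / (1 + u * v) := by
    unfold varRule₂; field_simp; ring
  have e2 : 1 - varRule₂ u v = (1 - u) * (1 - v) / (1 + u * v) := by
    unfold varRule₂; field_simp; ring
  unfold lratio
  rw [e1, e2]
  field_simp

lemma lratio_prod_eq {ι : Type*} (s : Finset ι) {d : ι → ℝ} (hd : ∀ i ∈ s, d i ∈ Ioc (-1 : ℝ) 1) :
    varRule s d = lratio (∏ i ∈ s, lratio (d i)) ∧ 0 ≤ ∏ i ∈ s, lratio (d i) := by
  have hp : 0 < ∏ i ∈ s, (1 + d i) := Finset.prod_pos fun i hi => by linarith [(hd i hi).1]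
  have hq : 0 ≤ ∏ i ∈ s, (1 - d i) := Finset.prod_nonneg fun i hi => by linarith [(hd i hi).2]
  unfold varRule lratio
  rw [Finset.prod_div_distrib]
  refine ⟨?_, by positivity⟩
  field_simp

lemma lratio_mem {x : ℝ} (hx : 0 ≤ x) : lratio x ∈ Ioc (-1 : ℝ) 1 := by
  unfold lratio
  constructor
  · rw [lt_div_iff₀ (by linarith)]; linarith
  · rw [div_le_iff₀ (by linarith)]; linarith

lemma varRule_mem {ι : Type*} (s : Finset ι) {d : ι → ℝ}
    (hd : ∀ i ∈ s, d i ∈ Ioc (-1 : ℝ) 1) : varRule s d ∈ Ioc (-1 : ℝ) 1 := by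
  obtain ⟨h1, h2⟩ := lratio_prod_eq s hd
  rw [h1]; exact lratio_mem h2

lemma lratio_varRule {ι : Type*} (s : Finset ι) {d : ι → ℝ}
    (hd : ∀ i ∈ s, d i ∈ Ioc (-1 : ℝ) 1) : lratio (varRule s d) = ∏ i ∈ s, lratio (d i) := by
  obtain ⟨h1, h2⟩ := lratio_prod_eq s hd
  rw [h1, lratio_lratio (by linarith)]

namespace LDensity

lemma ext_law {a b : LDensity} (h : a.law = b.law) : a = b := by
  cases a; cases b; simpa using h

lemma ae_mem (a : LDensity) : ∀ᵐ d ∂a.law, d ∈ Icc (-1 : ℝ) 1 := by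
  rw [ae_iff]; exact a.supported

lemma lintegral_symm (a : LDensity) {f : ℝ → ENNReal} (hf : Measurable f) :
    ∫⁻ d, ENNReal.ofReal (1 - d) * f (-d) ∂a.law = ∫⁻ d, ENNReal.ofReal (1 - d) * f d ∂a.law := by
  have hm : Measurable fun d : ℝ => ENNReal.ofReal (1 - d) := by fun_prop
  have h1 := lintegral_withDensity_eq_lintegral_mul a.law hm hf
  have h2 := lintegral_withDensity_eq_lintegral_mul a.law hm (hf.comp measurable_neg)
  simp only [Pi.mul_apply, Function.comp_apply] at h1 h2
  rw [← h1, ← h2]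
  conv_rhs => rw [← a.symmetric]
  rw [lintegral_map hf measurable_neg]

/-- Certainty of the wrong sign has probability zero. Symmetry tested on the indicator of {1} gives
mass 2 a({-1}) on one side and 0 on the other, where the factor 1 - d vanishes. Soft bits therefore
lie almost surely in (-1, 1], where the variable-node rule never divides by zero. -/
lemma law_neg_one (a : LDensity) : a.law {-1} = 0 := by
  have h := a.lintegral_symm (f := ({1} : Set ℝ).indicator 1)
    (measurable_one.indicator (measurableSet_singleton 1))
  have e1 : (fun d : ℝ => ENNReal.ofReal (1 - d) * ({1} : Set ℝ).indicator 1 (-d)) =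
      ({-1} : Set ℝ).indicator fun _ => 2 := by
    funext d
    by_cases hd : d = -1
    · subst hd; norm_num
    · have : -d ≠ 1 := fun h => hd (by linarith)
      simp [hd, this]
  have e2 : (fun d : ℝ => ENNReal.ofReal (1 - d) * ({1} : Set ℝ).indicator 1 d) = fun _ => 0 := by
    funext d
    by_cases hd : d = 1
    · subst hd; simp
    · simp [hd]
  rw [e1, e2, lintegral_indicator (measurableSet_singleton _)] at h
  simpa using h

lemma ae_mem_Ioc (a : LDensity) : ∀ᵐ d ∂a.law, d ∈ Ioc (-1 : ℝ) 1 := by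
  have h : ∀ᵐ d ∂a.law, d ≠ -1 := by
    rw [ae_iff]; simpa using a.law_neg_one
  filter_upwards [a.ae_mem, h] with d h1 h2
  exact ⟨lt_of_le_of_ne h1.1 (Ne.symm h2), h1.2⟩

lemma ae_prod (a b : LDensity) :
    ∀ᵐ p ∂a.law.prod b.law, p.1 ∈ Ioc (-1 : ℝ) 1 ∧ p.2 ∈ Ioc (-1 : ℝ) 1 :=
  (Measure.quasiMeasurePreserving_fst.ae a.ae_mem_Ioc).and
    (Measure.quasiMeasurePreserving_snd.ae b.ae_mem_Ioc)

/-- A density is symmetric if `(1 - d) a(dd)` integrates `f` and its reflection equally. -/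
def ofSymm (μ : Measure ℝ) [IsProbabilityMeasure μ] (h1 : ∀ᵐ d ∂μ, d ∈ Icc (-1 : ℝ) 1)
    (h2 : ∀ f : ℝ → ENNReal, Measurable f →
      ∫⁻ d, ENNReal.ofReal (1 - d) * f (-d) ∂μ = ∫⁻ d, ENNReal.ofReal (1 - d) * f d ∂μ) :
    LDensity where
  law := μ
  isProb := inferInstance
  supported := by rw [ae_iff] at h1; exact h1
  symmetric := by
    have hm : Measurable fun d : ℝ => ENNReal.ofReal (1 - d) := by fun_prop
    refine Measure.ext_of_lintegral _ fun f hf => ?_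
    rw [lintegral_map hf measurable_neg]
    have e1 := lintegral_withDensity_eq_lintegral_mul μ hm hf
    have e2 := lintegral_withDensity_eq_lintegral_mul μ hm (hf.comp measurable_neg)
    simp only [Pi.mul_apply, Function.comp_apply] at e1 e2
    rw [e1, e2]
    exact h2 f hf

/-- Both monoid structures are on densities: `0` is the useless channel, neutral for adding
log-likelihood ratios, and `1` is the perfect channel, neutral for multiplying soft bits. -/
noncomputable instance : Zero LDensity :=
  ⟨ofSymm (Measure.dirac 0) ((ae_dirac_iff (p := fun d => d ∈ Icc (-1 : ℝ) 1) measurableSet_Icc).2 (by norm_num))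
    fun f hf => by rw [lintegral_dirac, lintegral_dirac]; simp⟩

noncomputable instance : One LDensity :=
  ⟨ofSymm (Measure.dirac 1) ((ae_dirac_iff (p := fun d => d ∈ Icc (-1 : ℝ) 1) measurableSet_Icc).2 (by norm_num))
    fun f hf => by rw [lintegral_dirac, lintegral_dirac]; simp⟩

lemma law_zero : (0 : LDensity).law = Measure.dirac 0 := rfl

lemma law_one : (1 : LDensity).law = Measure.dirac 1 := rfl

lemma lintegral_flip_left (a b : LDensity) {f : ℝ × ℝ → ENNReal} (hf : Measurable f) :
    ∫⁻ p, ENNReal.ofReal (1 - p.1) * f (-p.1, p.2) ∂a.law.prod b.law =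
      ∫⁻ p, ENNReal.ofReal (1 - p.1) * f p ∂a.law.prod b.law := by
  rw [lintegral_prod_symm _ (by fun_prop), lintegral_prod_symm _ (by fun_prop)]
  refine lintegral_congr fun y => ?_
  exact a.lintegral_symm (f := fun x => f (x, y)) (by fun_prop)

lemma lintegral_flip_right (a b : LDensity) {f : ℝ × ℝ → ENNReal} (hf : Measurable f) :
    ∫⁻ p, ENNReal.ofReal (1 - p.2) * f (p.1, -p.2) ∂a.law.prod b.law =
      ∫⁻ p, ENNReal.ofReal (1 - p.2) * f p ∂a.law.prod b.law := by
  rw [lintegral_prod _ (by fun_prop), lintegral_prod _ (by fun_prop)]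
  refine lintegral_congr fun y => ?_
  exact b.lintegral_symm (f := fun x => f (y, x)) (by fun_prop)

/-- Check-node convolution. -/
noncomputable instance : Mul LDensity :=
  ⟨fun a b =>
    haveI : IsProbabilityMeasure ((a.law.prod b.law).map fun p => p.1 * p.2) :=
      Measure.isProbabilityMeasure_map (by fun_prop)
    ofSymm ((a.law.prod b.law).map fun p => p.1 * p.2)
    ((ae_map_iff (by fun_prop) measurableSet_Icc).2 (by
      filter_upwards [a.ae_prod b] with p hp
      have := abs_mul p.1 p.2
      refine abs_le.1 ?_
      rw [this]
      exact mul_le_one₀ (abs_le.2 ⟨hp.1.1.le, hp.1.2⟩) (abs_nonneg _)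
        (abs_le.2 ⟨hp.2.1.le, hp.2.2⟩)))
    fun f hf => by
      rw [lintegral_map (by fun_prop) (by fun_prop), lintegral_map (by fun_prop) (by fun_prop)]
      -- The identity 1 - u v = (1 - u)(1 + v) / 2 + (1 - v)(1 + u) / 2 splits the weight into two
      -- parts, each of which allows reflection of one coordinate.
      have key : ∀ g : ℝ → ENNReal, Measurable g →
          ∫⁻ p, ENNReal.ofReal (1 - p.1 * p.2) * g (p.1 * p.2) ∂a.law.prod b.law =
          ∫⁻ p, ENNReal.ofReal (1 - p.1) * (ENNReal.ofReal ((1 + p.2) / 2) * g (p.1 * p.2))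
            ∂a.law.prod b.law +
          ∫⁻ p, ENNReal.ofReal (1 - p.2) * (ENNReal.ofReal ((1 + p.1) / 2) * g (p.1 * p.2))
            ∂a.law.prod b.law := by
        intro g hg
        rw [← lintegral_add_left (by fun_prop)]
        refine lintegral_congr_ae ?_
        filter_upwards [a.ae_prod b] with p hp
        obtain ⟨⟨h1, h2⟩, h3, h4⟩ := hp
        rw [← mul_assoc, ← mul_assoc, ← add_mul, ← ENNReal.ofReal_mul (by linarith),
          ← ENNReal.ofReal_mul (by linarith), ← ENNReal.ofReal_add
            (mul_nonneg (by linarith) (by linarith)) (mul_nonneg (by linarith) (by linarith))]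
        congr 2
        ring
      rw [key f hf, key (fun d => f (-d)) (by fun_prop)]
      congr 1
      · rw [← a.lintegral_flip_left b (by fun_prop)]
        simp only [neg_mul, neg_neg]
      · rw [← a.lintegral_flip_right b (by fun_prop)]
        simp only [mul_neg, neg_neg]⟩

/-- Variable-node convolution. -/
noncomputable instance : Add LDensity :=
  ⟨fun a b =>
    haveI : IsProbabilityMeasure ((a.law.prod b.law).map fun p => varRule₂ p.1 p.2) :=
      Measure.isProbabilityMeasure_map (by fun_prop)
    ofSymm ((a.law.prod b.law).map fun p => varRule₂ p.1 p.2)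
    ((ae_map_iff (by fun_prop) measurableSet_Icc).2 (by
      filter_upwards [a.ae_prod b] with p hp
      exact varRule₂_mem (Ioc_subset_Icc_self hp.1) (Ioc_subset_Icc_self hp.2)))
    fun f hf => by
      rw [lintegral_map (by fun_prop) (by fun_prop), lintegral_map (by fun_prop) (by fun_prop)]
      -- Since 1 - V = (1 - u)(1 - v) / (1 + u v), both coordinates can be reflected, one after the
      -- other; together the reflections change V to -V.
      have key : ∀ g : ℝ → ENNReal, Measurable g →
          ∫⁻ p, ENNReal.ofReal (1 - varRule₂ p.1 p.2) * g (varRule₂ p.1 p.2) ∂a.law.prod b.law =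
          ∫⁻ p, ENNReal.ofReal (1 - p.1) * (ENNReal.ofReal (1 - p.2) *
            (ENNReal.ofReal (1 / (1 + p.1 * p.2)) * g (varRule₂ p.1 p.2)))
            ∂a.law.prod b.law := by
        intro g hg
        refine lintegral_congr_ae ?_
        filter_upwards [a.ae_prod b] with p hp
        have hpos := one_add_mul_pos hp.1 hp.2
        obtain ⟨⟨h1, h2⟩, h3, h4⟩ := hp
        rw [← mul_assoc, ← mul_assoc, ← ENNReal.ofReal_mul (by linarith),
          ← ENNReal.ofReal_mul (mul_nonneg (by linarith) (by linarith))]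
        congr 2
        unfold varRule₂
        field_simp
        ring
      have e : ∀ u v, varRule₂ (-u) (-v) = -varRule₂ u v := by
        intro u v; unfold varRule₂; rw [neg_mul_neg, ← neg_add, neg_div]
      rw [key f hf, key (fun d => f (-d)) (by fun_prop)]
      rw [← a.lintegral_flip_left b (f := fun p => (ENNReal.ofReal (1 - p.2) *
            (ENNReal.ofReal (1 / (1 + p.1 * p.2)) * f (varRule₂ p.1 p.2)))) (by fun_prop)]
      have comm : ∀ x y z : ENNReal, x * (y * z) = y * (x * z) := fun x y z => by ring
      simp_rw [comm (ENNReal.ofReal (1 - _)) (ENNReal.ofReal (1 - Prod.snd _))]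
      rw [← a.lintegral_flip_right b (f := fun p => (ENNReal.ofReal (1 - p.1) *
            (ENNReal.ofReal (1 / (1 + -p.1 * p.2)) * f (varRule₂ (-p.1) p.2)))) (by fun_prop)]
      simp only [neg_mul_neg, e]⟩

lemma law_mul (a b : LDensity) : (a * b).law = (a.law.prod b.law).map fun p => p.1 * p.2 := rfl

lemma law_add (a b : LDensity) : (a + b).law = varConv a.law b.law := rfl

lemma law_mul_mconv (a b : LDensity) : (a * b).law = Measure.mconv a.law b.law := rfl

lemma law_map_lratio_lratio (a : LDensity) : (a.law.map lratio).map lratio = a.law := by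
  rw [Measure.map_map (by fun_prop) (by fun_prop)]
  conv_rhs => rw [← Measure.map_id (μ := a.law)]
  refine Measure.map_congr ?_
  filter_upwards [a.ae_mem_Ioc] with d hd
  exact lratio_lratio hd.1

lemma ext_lratio {a b : LDensity} (h : a.law.map lratio = b.law.map lratio) : a = b :=
  ext_law (by rw [← a.law_map_lratio_lratio, h, b.law_map_lratio_lratio])

/-- This transports the commutative monoid laws of multiplicative convolution to `+`. Nothing is
lost in the passage, as `lratio` is an involution almost everywhere. -/
lemma map_lratio_add (a b : LDensity) :
    (a + b).law.map lratio = Measure.mconv (a.law.map lratio) (b.law.map lratio) := by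
  rw [law_add, varConv, Measure.map_map (by fun_prop) (by fun_prop), Measure.mconv,
    Measure.map_prod_map _ _ (by fun_prop) (by fun_prop),
    Measure.map_map (by fun_prop) (by fun_prop)]
  refine Measure.map_congr ?_
  filter_upwards [a.ae_prod b] with p hp
  exact lratio_varRule₂ hp.1 hp.2

noncomputable instance : AddCommMonoid LDensity where
  add_assoc a b c := ext_lratio (by simp only [map_lratio_add]; exact Measure.mconv_assoc _ _ _)
  add_comm a b := ext_lratio (by simp only [map_lratio_add]; exact Measure.mconv_comm _ _)
  zero_add a := ext_lratio (by
    rw [map_lratio_add, law_zero, Measure.map_dirac' measurable_lratio, show lratio 0 = 1 by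
      simp [lratio], Measure.dirac_one_mconv])
  add_zero a := ext_lratio (by
    rw [map_lratio_add, law_zero, Measure.map_dirac' measurable_lratio, show lratio 0 = 1 by
      simp [lratio], Measure.mconv_dirac_one])
  nsmul := nsmulRec

noncomputable instance : CommMonoid LDensity where
  mul_assoc a b c := ext_law (by simp only [law_mul_mconv]; exact Measure.mconv_assoc _ _ _)
  mul_comm a b := ext_law (by simp only [law_mul_mconv]; exact Measure.mconv_comm _ _)
  one_mul a := ext_law (by rw [law_mul_mconv, law_one, Measure.dirac_one_mconv])
  mul_one a := ext_law (by rw [law_mul_mconv, law_one, Measure.mconv_dirac_one])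

/-! Independent messages. -/

lemma map_prod_eq {Ω ι : Type*} [MeasurableSpace Ω] {μ : Measure Ω} [IsProbabilityMeasure μ]
    {X : ι → Ω → ℝ} (hX : ∀ i, Measurable (X i)) (hi : iIndepFun X μ) (a : ι → LDensity)
    (ha : ∀ i, μ.map (X i) = (a i).law) (s : Finset ι) :
    μ.map (fun ω => ∏ i ∈ s, X i ω) = (∏ i ∈ s, a i).law := by
  classical
  induction s using Finset.induction_on with
  | empty => simp [law_one, Measure.map_const]
  | insert i s his ih =>
    simp only [Finset.prod_insert his]
    have h := (hi.indepFun_finsetProd_of_notMem hX his).symm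
    rw [law_mul_mconv, ← ha i, ← ih]
    have := h.map_mul_eq_map_mconv_map (hX i) (by fun_prop)
    rw [← show (∏ j ∈ s, X j) = fun ω => ∏ i ∈ s, X i ω by funext ω; simp, ← this]
    congr 1
    funext ω
    simp

/-- After `lratio` the rule is a product of independent factors, so the check-node argument applies;
the almost sure range (-1, 1] permits going back. -/
lemma map_varRule_eq {Ω ι : Type*} [MeasurableSpace Ω] {μ : Measure Ω} [IsProbabilityMeasure μ]
    {X : ι → Ω → ℝ} (hX : ∀ i, Measurable (X i)) (hi : iIndepFun X μ) (a : ι → LDensity)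
    (ha : ∀ i, μ.map (X i) = (a i).law) (s : Finset ι) :
    μ.map (fun ω => varRule s fun i => X i ω) = (∑ i ∈ s, a i).law := by
  classical
  have key : μ.map (fun ω => ∏ i ∈ s, lratio (X i ω)) = (∑ i ∈ s, a i).law.map lratio := by
    have hX' : ∀ i, Measurable fun ω => lratio (X i ω) := fun i => by fun_prop
    have hi' : iIndepFun (fun i ω => lratio (X i ω)) μ :=
      hi.comp (fun _ => lratio) fun _ => measurable_lratio
    have ha' : ∀ i, μ.map (fun ω => lratio (X i ω)) = (a i).law.map lratio := fun i => by
      rw [← ha i, Measure.map_map (by fun_prop) (hX i)]; rfl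
    induction s using Finset.induction_on with
    | empty =>
      simp [law_zero, Measure.map_const, Measure.map_dirac' measurable_lratio, lratio]
    | insert i s his ih =>
      simp only [Finset.prod_insert his, Finset.sum_insert his]
      have h := (hi'.indepFun_finsetProd_of_notMem hX' his).symm
      rw [map_lratio_add, ← ha' i, ← ih]
      have := h.map_mul_eq_map_mconv_map (hX' i) (by fun_prop)
      rw [← show (∏ j ∈ s, fun ω => lratio (X j ω)) = fun ω => ∏ i ∈ s, lratio (X i ω) by
        funext ω; simp, ← this]
      congr 1
      funext ω
      simp
  rw [← law_map_lratio_lratio, ← key, Measure.map_map (by fun_prop) (by fun_prop)]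
  refine Measure.map_congr ?_
  have hm : ∀ i ∈ s, ∀ᵐ ω ∂μ, X i ω ∈ Ioc (-1 : ℝ) 1 := fun i _ => by
    have := (a i).ae_mem_Ioc
    rw [← ha i] at this
    exact ae_of_ae_map (hX i).aemeasurable this
  filter_upwards [(Finset.eventually_all s).2 hm] with ω hω
  exact (lratio_prod_eq s hω).1

end LDensity
end Gexit
namespace Gexit

/-! ### Integration against the law of a soft bit for a uniform input -/

lemma integrable_of_bdd {α : Type*} [MeasurableSpace α] {μ : Measure α} [IsFiniteMeasure μ]
    {F : α → ℝ} (hF : Measurable F) {M : ℝ} (h : ∀ᵐ x ∂μ, |F x| ≤ M) : Integrable F μ :=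
  Integrable.of_bound hF.aestronglyMeasurable M h

lemma neg_mem_Icc {d : ℝ} (hd : d ∈ Icc (-1 : ℝ) 1) : -d ∈ Icc (-1 : ℝ) 1 :=
  ⟨by linarith [hd.2], by linarith [hd.1]⟩

lemma mul_mem_Icc {u v : ℝ} (hu : u ∈ Icc (-1 : ℝ) 1) (hv : v ∈ Icc (-1 : ℝ) 1) :
    u * v ∈ Icc (-1 : ℝ) 1 := by
  refine abs_le.1 ?_
  rw [abs_mul]
  exact mul_le_one₀ (abs_le.2 hu) (abs_nonneg _) (abs_le.2 hv)

lemma abs_one_add_le {d : ℝ} (hd : d ∈ Icc (-1 : ℝ) 1) : |1 + d| ≤ 2 :=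
  abs_le.2 ⟨by linarith [hd.1], by linarith [hd.2]⟩

@[fun_prop]
lemma measurable_info : Measurable info := continuous_info.measurable

namespace LDensity

/-- The law of the soft bit for a uniform input. -/
noncomputable def even (a : LDensity) : Measure ℝ :=
  (1 / 2 : ENNReal) • (a.law + a.law.map fun d => -d)

instance (a : LDensity) : IsProbabilityMeasure a.even := ⟨by
  have : (a.law.map fun d => -d) univ = 1 := by
    rw [Measure.map_apply measurable_neg MeasurableSet.univ]; simp
  simp only [even, Measure.smul_apply, Measure.add_apply, this, measure_univ, smul_eq_mul]
  rw [one_add_one_eq_two, one_div, ENNReal.inv_mul_cancel two_ne_zero ENNReal.ofNat_ne_top]⟩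

lemma ae_even_iff (a : LDensity) {p : ℝ → Prop} (hp : MeasurableSet {x | p x}) :
    (∀ᵐ d ∂a.even, p d) ↔ (∀ᵐ d ∂a.law, p d) ∧ ∀ᵐ d ∂a.law, p (-d) := by
  rw [even, Measure.ae_ennreal_smul_measure_iff (by simp), ae_add_measure_iff,
    ae_map_iff (by fun_prop) hp]

lemma ae_mem_even (a : LDensity) : ∀ᵐ d ∂a.even, d ∈ Icc (-1 : ℝ) 1 :=
  (a.ae_even_iff measurableSet_Icc).2 ⟨a.ae_mem, by
    filter_upwards [a.ae_mem] with d hd using neg_mem_Icc hd⟩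

lemma ae_even_prod (a b : LDensity) :
    ∀ᵐ p ∂a.even.prod b.even, p.1 ∈ Icc (-1 : ℝ) 1 ∧ p.2 ∈ Icc (-1 : ℝ) 1 :=
  (Measure.quasiMeasurePreserving_fst.ae a.ae_mem_even).and
    (Measure.quasiMeasurePreserving_snd.ae b.ae_mem_even)

lemma map_neg_even (a : LDensity) : a.even.map (fun d => -d) = a.even := by
  have h : Measurable fun d : ℝ => -d := measurable_neg
  rw [even, Measure.map_smul, Measure.map_add _ _ h, Measure.map_map h h]
  have : ((fun d : ℝ => -d) ∘ fun d => -d) = id := by funext d; simp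
  rw [this, Measure.map_id, add_comm]

lemma measurePreserving_neg_even (a : LDensity) :
    MeasurePreserving (fun d : ℝ => -d) a.even a.even :=
  ⟨measurable_neg, a.map_neg_even⟩

lemma integral_even_neg (a : LDensity) (F : ℝ → ℝ) :
    ∫ d, F (-d) ∂a.even = ∫ d, F d ∂a.even :=
  a.measurePreserving_neg_even.integral_comp (MeasurableEquiv.neg ℝ).measurableEmbedding F

/-- This is Bayes' rule: the posterior probability of +1 is (1 + d) / 2, so the likelihood of +1
relative to a uniform input is 1 + d. It moves integrals to the reflection-invariant measure `even`.
-/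
lemma law_eq_withDensity (a : LDensity) :
    a.law = a.even.withDensity fun d => ENNReal.ofReal (1 + d) := by
  refine Measure.ext_of_lintegral _ fun f hf => ?_
  rw [lintegral_withDensity_eq_lintegral_mul _ (by fun_prop) hf, even, lintegral_smul_measure,
    lintegral_add_measure, lintegral_map (by fun_prop) measurable_neg]
  simp only [Pi.mul_apply, ← sub_eq_add_neg]
  rw [a.lintegral_symm hf, ← lintegral_add_left (by fun_prop)]
  have : ∫⁻ d, (ENNReal.ofReal (1 + d) * f d + ENNReal.ofReal (1 - d) * f d) ∂a.law =
      ∫⁻ d, 2 * f d ∂a.law := by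
    refine lintegral_congr_ae ?_
    filter_upwards [a.ae_mem] with d hd
    rw [← add_mul, ← ENNReal.ofReal_add (by linarith [hd.1]) (by linarith [hd.2])]
    congr 1
    rw [show 1 + d + (1 - d) = 2 by ring]; simp
  rw [this, lintegral_const_mul _ hf, smul_eq_mul, ← mul_assoc, one_div,
    ENNReal.inv_mul_cancel two_ne_zero ENNReal.ofNat_ne_top, one_mul]

lemma integral_law (a : LDensity) (F : ℝ → ℝ) :
    ∫ d, F d ∂a.law = ∫ d, (1 + d) * F d ∂a.even := by
  conv_lhs => rw [law_eq_withDensity]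
  rw [integral_withDensity_eq_integral_toReal_smul (by fun_prop) (by simp)]
  refine integral_congr_ae ?_
  filter_upwards [a.ae_mem_even] with d hd
  rw [ENNReal.toReal_ofReal (by linarith [hd.1]), smul_eq_mul]

lemma integral_even (a : LDensity) {F : ℝ → ℝ} (hF : Measurable F) {M : ℝ}
    (hM : ∀ d ∈ Icc (-1 : ℝ) 1, |F d| ≤ M) :
    ∫ d, F d ∂a.even = (∫ d, F d ∂a.law + ∫ d, F (-d) ∂a.law) / 2 := by
  have h1 : Integrable F a.law := integrable_of_bdd hF (by
    filter_upwards [a.ae_mem] with d hd using hM d hd)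
  have h2 : Integrable F (a.law.map fun d => -d) := by
    refine (integrable_map_measure hF.aestronglyMeasurable measurable_neg.aemeasurable).2 ?_
    exact integrable_of_bdd (hF.comp measurable_neg) (by
      filter_upwards [a.ae_mem] with d hd using hM _ (neg_mem_Icc hd))
  rw [even, integral_smul_measure, integral_add_measure h1 h2,
    integral_map (by fun_prop) hF.aestronglyMeasurable]
  simp
  ring

lemma integral_even_of_even (a : LDensity) {F : ℝ → ℝ} (hF : Measurable F) {M : ℝ}
    (hM : ∀ d ∈ Icc (-1 : ℝ) 1, |F d| ≤ M) (he : ∀ d, F (-d) = F d) :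
    ∫ d, F d ∂a.even = ∫ d, F d ∂a.law := by
  rw [a.integral_even hF hM]; simp only [he]; ring

lemma even_zero : (0 : LDensity).even = Measure.dirac 0 := by
  rw [even, law_zero, Measure.map_dirac' measurable_neg, neg_zero, ← two_smul ENNReal, smul_smul,
    one_div, ENNReal.inv_mul_cancel two_ne_zero ENNReal.ofNat_ne_top, one_smul]

section flips

variable (a b : LDensity) (F : ℝ × ℝ → ℝ)

lemma integral_flip_both :
    ∫ p, F (-p.1, -p.2) ∂a.even.prod b.even = ∫ p, F p ∂a.even.prod b.even :=
  (a.measurePreserving_neg_even.prod b.measurePreserving_neg_even).integral_comp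
    ((MeasurableEquiv.neg ℝ).prodCongr (MeasurableEquiv.neg ℝ)).measurableEmbedding F

lemma integral_flip_fst :
    ∫ p, F (-p.1, p.2) ∂a.even.prod b.even = ∫ p, F p ∂a.even.prod b.even :=
  (a.measurePreserving_neg_even.prod (MeasurePreserving.id b.even)).integral_comp
    ((MeasurableEquiv.neg ℝ).prodCongr (MeasurableEquiv.refl ℝ)).measurableEmbedding F

end flips

lemma integral_law_prod (a b : LDensity) {F : ℝ × ℝ → ℝ} (hF : Measurable F) {M : ℝ}
    (hM : ∀ p : ℝ × ℝ, p.1 ∈ Icc (-1 : ℝ) 1 → p.2 ∈ Icc (-1 : ℝ) 1 → |F p| ≤ M) :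
    ∫ p, F p ∂a.law.prod b.law =
      ∫ p, (1 + p.1) * (1 + p.2) * F p ∂a.even.prod b.even := by
  have h1 : Integrable F (a.law.prod b.law) := integrable_of_bdd hF (by
    filter_upwards [a.ae_prod b] with p hp
    exact hM p (Ioc_subset_Icc_self hp.1) (Ioc_subset_Icc_self hp.2))
  have h2 : Integrable (fun p : ℝ × ℝ => (1 + p.1) * (1 + p.2) * F p) (a.even.prod b.even) :=
    integrable_of_bdd (M := 2 * 2 * M) (by fun_prop) (by
      filter_upwards [a.ae_even_prod b] with p hp
      rw [abs_mul, abs_mul]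
      have := hM p hp.1 hp.2
      have := abs_one_add_le hp.1
      have := abs_one_add_le hp.2
      gcongr)
  rw [integral_prod _ h1, integral_prod _ h2, a.integral_law]
  refine integral_congr_ae (ae_of_all _ fun u => ?_)
  simp only
  rw [b.integral_law, ← integral_const_mul]
  simp only [mul_assoc]

/-- Two observations of the same uniform bit have joint density ((1 + u)(1 + v) + (1 - u)(1 - v)) /
2 = 1 + u v relative to independent ones. -/
lemma integral_even_add (a b : LDensity) {F : ℝ → ℝ} (hF : Measurable F) {M : ℝ}
    (hM : ∀ d ∈ Icc (-1 : ℝ) 1, |F d| ≤ M) :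
    ∫ d, F d ∂(a + b).even =
      ∫ p, (1 + p.1 * p.2) * F (varRule₂ p.1 p.2) ∂a.even.prod b.even := by
  have hM' : ∀ p : ℝ × ℝ, p.1 ∈ Icc (-1 : ℝ) 1 → p.2 ∈ Icc (-1 : ℝ) 1 →
      |F (varRule₂ p.1 p.2)| ≤ M := fun p h1 h2 => hM _ (varRule₂_mem h1 h2)
  have hM'' : ∀ p : ℝ × ℝ, p.1 ∈ Icc (-1 : ℝ) 1 → p.2 ∈ Icc (-1 : ℝ) 1 →
      |F (-varRule₂ p.1 p.2)| ≤ M := fun p h1 h2 => hM _ (neg_mem_Icc (varRule₂_mem h1 h2))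
  have hint : ∀ s : ℝ, |s| = 1 → Integrable (fun p : ℝ × ℝ =>
      (1 + s * p.1) * (1 + s * p.2) * F (varRule₂ p.1 p.2)) (a.even.prod b.even) := fun s hs =>
    integrable_of_bdd (M := 2 * 2 * M) (by fun_prop) (by
      have hs' : s ∈ Icc (-1 : ℝ) 1 := abs_le.1 hs.le
      filter_upwards [a.ae_even_prod b] with p hp
      rw [abs_mul, abs_mul]
      have := hM' p hp.1 hp.2
      have := abs_one_add_le (mul_mem_Icc hs' hp.1)
      have := abs_one_add_le (mul_mem_Icc hs' hp.2)
      gcongr)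
  rw [(a + b).integral_even hF hM, law_add, varConv,
    integral_map (by fun_prop) hF.aestronglyMeasurable,
      integral_map (by fun_prop) (f := fun d => F (-d)) (hF.comp measurable_neg).aestronglyMeasurable,
    a.integral_law_prod b (by fun_prop) hM', a.integral_law_prod b (by fun_prop) hM'',
    ← integral_flip_both a b fun p => (1 + p.1) * (1 + p.2) * F (-varRule₂ p.1 p.2)]
  have e : ∀ u v, varRule₂ (-u) (-v) = -varRule₂ u v := by
    intro u v; unfold varRule₂; rw [neg_mul_neg, ← neg_add, neg_div]
  simp only [e, neg_neg]
  have i1 := hint 1 (by simp)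
  have i2 := hint (-1) (by simp)
  simp only [one_mul, neg_mul] at i1 i2
  rw [← integral_add i1 i2, ← integral_div]
  refine integral_congr_ae (ae_of_all _ fun p => ?_)
  simp only
  ring

/-- A check node combines observations of two different bits. Averaged over both inputs the four
densities (1 ± u)(1 ± v) sum to 4, so no weight remains, in contrast with the variable node. -/
lemma integral_even_mul (a b : LDensity) {F : ℝ → ℝ} (hF : Measurable F) {M : ℝ}
    (hM : ∀ d ∈ Icc (-1 : ℝ) 1, |F d| ≤ M) :
    ∫ d, F d ∂(a * b).even = ∫ p, F (p.1 * p.2) ∂a.even.prod b.even := by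
  have hM' : ∀ p : ℝ × ℝ, p.1 ∈ Icc (-1 : ℝ) 1 → p.2 ∈ Icc (-1 : ℝ) 1 →
      |F (p.1 * p.2)| ≤ M := fun p h1 h2 => hM _ (mul_mem_Icc h1 h2)
  have hM'' : ∀ p : ℝ × ℝ, p.1 ∈ Icc (-1 : ℝ) 1 → p.2 ∈ Icc (-1 : ℝ) 1 →
      |F (-(p.1 * p.2))| ≤ M := fun p h1 h2 => hM _ (neg_mem_Icc (mul_mem_Icc h1 h2))
  set G : ℝ × ℝ → ℝ := fun p => (F (p.1 * p.2) + F (-(p.1 * p.2))) / 2 with hG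
  have hGm : Measurable G := by fun_prop
  have hGb : ∀ p : ℝ × ℝ, p.1 ∈ Icc (-1 : ℝ) 1 → p.2 ∈ Icc (-1 : ℝ) 1 → |G p| ≤ M := by
    intro p h1 h2
    have := abs_le.1 (hM' p h1 h2)
    have := abs_le.1 (hM'' p h1 h2)
    rw [hG, abs_le]; constructor <;> simp only <;> linarith
  have hint : ∀ s t : ℝ, |s| = 1 → |t| = 1 → Integrable (fun p : ℝ × ℝ =>
      (1 + s * p.1) * (1 + t * p.2) * G p) (a.even.prod b.even) := fun s t hs ht =>
    integrable_of_bdd (M := 2 * 2 * M) (by fun_prop) (by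
      have hs' : s ∈ Icc (-1 : ℝ) 1 := abs_le.1 hs.le
      have ht' : t ∈ Icc (-1 : ℝ) 1 := abs_le.1 ht.le
      filter_upwards [a.ae_even_prod b] with p hp
      rw [abs_mul, abs_mul]
      have := hGb p hp.1 hp.2
      have := abs_one_add_le (mul_mem_Icc hs' hp.1)
      have := abs_one_add_le (mul_mem_Icc ht' hp.2)
      gcongr)
  have iF : ∀ (H : ℝ × ℝ → ℝ), Measurable H → (∀ p : ℝ × ℝ, p.1 ∈ Icc (-1 : ℝ) 1 →
      p.2 ∈ Icc (-1 : ℝ) 1 → |H p| ≤ M) → Integrable H (a.even.prod b.even) := fun H h1 h2 =>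
    integrable_of_bdd h1 (by filter_upwards [a.ae_even_prod b] with p hp using h2 p hp.1 hp.2)
  have iL : ∀ (H : ℝ × ℝ → ℝ), Measurable H → (∀ p : ℝ × ℝ, p.1 ∈ Icc (-1 : ℝ) 1 →
      p.2 ∈ Icc (-1 : ℝ) 1 → |H p| ≤ M) → Integrable H (a.law.prod b.law) := fun H h1 h2 =>
    integrable_of_bdd h1 (by
      filter_upwards [a.ae_prod b] with p hp
      exact h2 p (Ioc_subset_Icc_self hp.1) (Ioc_subset_Icc_self hp.2))
  have s1 : ∫ d, F d ∂(a * b).even = ∫ p, (1 + p.1) * (1 + p.2) * G p ∂a.even.prod b.even := by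
    rw [(a * b).integral_even hF hM, law_mul,
      integral_map (by fun_prop) hF.aestronglyMeasurable,
      integral_map (by fun_prop) (f := fun d => F (-d)) (hF.comp measurable_neg).aestronglyMeasurable,
      ← a.integral_law_prod b hGm hGb, ← integral_add (iL _ (by fun_prop) hM')
        (iL _ (by fun_prop) hM''), ← integral_div]
  have s2 : ∫ p, G p ∂a.even.prod b.even = ∫ p, F (p.1 * p.2) ∂a.even.prod b.even := by
    have h1 := integral_flip_fst a b fun p => F (p.1 * p.2)
    simp only [neg_mul] at h1
    rw [hG, integral_div, integral_add (iF _ (by fun_prop) hM') (iF _ (by fun_prop) hM''), h1]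
    ring
  have g1 : ∀ u v, G (-u, -v) = G (u, v) := fun u v => by simp [hG]
  have g2 : ∀ u v, G (-u, v) = G (u, v) := fun u v => by simp [hG, add_comm]
  have f1 := integral_flip_both a b fun p => (1 + p.1) * (1 + p.2) * G p
  have f2 := integral_flip_fst a b fun p => (1 + p.1) * (1 + p.2) * G p
  have f3 := integral_flip_both a b fun p => (1 + -p.1) * (1 + p.2) * G p
  simp only [g1, g2, neg_neg, Prod.mk.eta] at f1 f2 f3
  have i1 := hint 1 1 (by simp) (by simp)
  have i2 := hint (-1) 1 (by simp) (by simp)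
  have i3 := hint 1 (-1) (by simp) (by simp)
  have i4 := hint (-1) (-1) (by simp) (by simp)
  simp only [one_mul, neg_mul] at i1 i2 i3 i4
  -- `G` is invariant under each sign change, so the four weighted integrals agree, and their
  -- weights add up to 4.
  have tot : ∫ p, G p ∂a.even.prod b.even =
      (∫ p, (1 + p.1) * (1 + p.2) * G p ∂a.even.prod b.even +
       ∫ p, (1 + -p.1) * (1 + -p.2) * G p ∂a.even.prod b.even +
       (∫ p, (1 + -p.1) * (1 + p.2) * G p ∂a.even.prod b.even +
       ∫ p, (1 + p.1) * (1 + -p.2) * G p ∂a.even.prod b.even)) / 4 := by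
    rw [← integral_add i1 i4, ← integral_add i2 i3,
      ← integral_add
        (show Integrable (fun p : ℝ × ℝ => (1 + p.1) * (1 + p.2) * G p +
          (1 + -p.1) * (1 + -p.2) * G p) (a.even.prod b.even) from i1.add i4)
        (show Integrable (fun p : ℝ × ℝ => (1 + -p.1) * (1 + p.2) * G p +
          (1 + p.1) * (1 + -p.2) * G p) (a.even.prod b.even) from i2.add i3), ← integral_div]
    refine integral_congr_ae (ae_of_all _ fun p => ?_)
    simp only
    ring
  rw [s1, ← s2, tot, f1, f3, f2]
  ring

/-! Moments and information. -/

/-- The even moments of a density. -/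
noncomputable def moment (a : LDensity) (k : ℕ) : ℝ := ∫ d, d ^ (2 * k + 2) ∂a.law

/-- The mutual information (in nats) between a uniform bit and its observation. -/
noncomputable def mutualInfo (a : LDensity) : ℝ := ∫ d, info d ∂a.law

lemma abs_pow_le {d : ℝ} (hd : d ∈ Icc (-1 : ℝ) 1) (k : ℕ) : |d ^ k| ≤ 1 := by
  rw [abs_pow]; exact pow_le_one₀ (abs_nonneg _) (abs_le.2 hd)

lemma abs_info_le {d : ℝ} (hd : d ∈ Icc (-1 : ℝ) 1) : |info d| ≤ Real.log 2 := by
  rw [abs_of_nonneg (info_nonneg hd)]; exact info_le hd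

lemma even_pow (d : ℝ) (k : ℕ) : (-d) ^ (2 * k + 2) = d ^ (2 * k + 2) :=
  ((even_two_mul k).add even_two).neg_pow d

lemma moment_eq_even (a : LDensity) (k : ℕ) : a.moment k = ∫ d, d ^ (2 * k + 2) ∂a.even :=
  (a.integral_even_of_even (by fun_prop) (fun _ hd => abs_pow_le hd _)
    fun d => even_pow d k).symm

lemma mutualInfo_eq_even (a : LDensity) : a.mutualInfo = ∫ d, info d ∂a.even :=
  (a.integral_even_of_even (by fun_prop) (fun _ hd => abs_info_le hd) info_neg).symm

lemma moment_nonneg (a : LDensity) (k : ℕ) : 0 ≤ a.moment k :=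
  integral_nonneg fun d => ((even_two_mul k).add even_two).pow_nonneg d

lemma moment_le_one (a : LDensity) (k : ℕ) : a.moment k ≤ 1 := by
  have h : a.moment k ≤ ∫ _, (1 : ℝ) ∂a.law := by
    refine integral_mono_ae (integrable_of_bdd (M := 1) (by fun_prop) ?_) (integrable_const _) ?_
    · filter_upwards [a.ae_mem] with d hd using abs_pow_le hd _
    · filter_upwards [a.ae_mem] with d hd using (abs_le.1 (abs_pow_le hd _)).2
  simpa using h

lemma moment_antitone (a : LDensity) {k l : ℕ} (h : k ≤ l) : a.moment l ≤ a.moment k := by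
  have hi : ∀ j, Integrable (fun d : ℝ => d ^ (2 * j + 2)) a.law := fun j =>
    integrable_of_bdd (M := 1) (by fun_prop) (by
      filter_upwards [a.ae_mem] with d hd using abs_pow_le hd _)
  refine integral_mono_ae (hi _) (hi _) ?_
  filter_upwards [a.ae_mem] with d hd
  rw [← ((even_two_mul l).add even_two).pow_abs, ← ((even_two_mul k).add even_two).pow_abs]
  exact pow_le_pow_of_le_one (abs_nonneg _) (abs_le.2 hd) (by omega)

lemma moment_mul (a b : LDensity) (k : ℕ) : (a * b).moment k = a.moment k * b.moment k := by
  rw [moment_eq_even, integral_even_mul a b (by fun_prop) (fun _ hd => abs_pow_le hd _),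
    moment_eq_even, moment_eq_even]
  simp only [mul_pow]
  exact integral_prod_mul (fun x : ℝ => x ^ (2 * k + 2)) fun x : ℝ => x ^ (2 * k + 2)

lemma moment_zero (k : ℕ) : (0 : LDensity).moment k = 0 := by
  simp [moment, law_zero]

lemma moment_one (k : ℕ) : (1 : LDensity).moment k = 1 := by
  simp [moment, law_one]

lemma moment_pow (a : LDensity) (n k : ℕ) : (a ^ n).moment k = a.moment k ^ n := by
  induction n with
  | zero => simp [moment_one]
  | succ n ih => rw [pow_succ, moment_mul, ih, pow_succ]

/-- Integration of the power series of `info`. -/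
lemma hasSum_integral_info {Ω : Type*} [MeasurableSpace Ω] {μ : Measure Ω}
    [IsProbabilityMeasure μ] {U : Ω → ℝ} (hU : Measurable U) (h : ∀ᵐ ω ∂μ, U ω ∈ Icc (-1 : ℝ) 1) :
    HasSum (fun k => coef k * ∫ ω, U ω ^ (2 * k + 2) ∂μ) (∫ ω, info (U ω) ∂μ) := by
  simp_rw [← integral_const_mul]
  refine hasSum_integral_of_dominated_convergence (fun k _ => coef k)
    (fun k => (by fun_prop : Measurable _).aestronglyMeasurable) (fun k => ?_) ?_ ?_ ?_
  · filter_upwards [h] with ω hω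
    rw [norm_mul, Real.norm_of_nonneg (coef_pos k).le]
    exact mul_le_of_le_one_right (coef_pos k).le (abs_pow_le hω _)
  · exact ae_of_all _ fun _ => coef_summable
  · exact integrable_const _
  · filter_upwards [h] with ω hω using info_hasSum hω

lemma hasSum_mutualInfo (a : LDensity) :
    HasSum (fun k => coef k * a.moment k) a.mutualInfo :=
  hasSum_integral_info measurable_id a.ae_mem

lemma mutualInfo_nonneg (a : LDensity) : 0 ≤ a.mutualInfo :=
  a.hasSum_mutualInfo.nonneg fun k => mul_nonneg (coef_pos k).le (a.moment_nonneg k)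

lemma mutualInfo_eq (a : LDensity) : a.mutualInfo = Real.log 2 * (1 - a.entropy) := by
  have hl : Real.log 2 ≠ 0 := (Real.log_pos one_lt_two).ne'
  have h : ∫ d, Real.binEntropy ((1 - d) / 2) ∂a.law = Real.log 2 - a.mutualInfo := by
    simp_rw [binEntropy_eq]
    rw [integral_sub (integrable_const _) (integrable_of_bdd (M := Real.log 2) (by fun_prop) (by
      filter_upwards [a.ae_mem] with d hd using abs_info_le hd))]
    simp [mutualInfo]
  unfold entropy
  rw [h]
  field_simp
  ring

/-- `info_duality` is integrated against the even laws, with the integrand averaged over the sign of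
the second soft bit. This conservation law links variable-node and check-node convolutions. -/
lemma mutualInfo_add (a b : LDensity) :
    (a + b).mutualInfo = a.mutualInfo + b.mutualInfo - (a * b).mutualInfo := by
  have hi : ∀ (H : ℝ × ℝ → ℝ), Measurable H → (∀ p : ℝ × ℝ, p.1 ∈ Icc (-1 : ℝ) 1 →
      p.2 ∈ Icc (-1 : ℝ) 1 → |H p| ≤ 2 * Real.log 2) → Integrable H (a.even.prod b.even) :=
    fun H h1 h2 => integrable_of_bdd h1 (by
      filter_upwards [a.ae_even_prod b] with p hp using h2 p hp.1 hp.2)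
  have hl : 0 < Real.log 2 := Real.log_pos one_lt_two
  rw [mutualInfo_eq_even (a + b), integral_even_add a b (by fun_prop) fun _ hd => abs_info_le hd,
    mutualInfo_eq_even (a * b), integral_even_mul a b (by fun_prop) fun _ hd => abs_info_le hd]
  set F : ℝ × ℝ → ℝ := fun p => (1 + p.1 * p.2) * info (varRule₂ p.1 p.2) with hF
  have bF : ∀ p : ℝ × ℝ, p.1 ∈ Icc (-1 : ℝ) 1 → p.2 ∈ Icc (-1 : ℝ) 1 →
      |F p| ≤ 2 * Real.log 2 := by
    intro p h1 h2
    rw [hF, abs_mul]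
    have := abs_one_add_le (mul_mem_Icc h1 h2)
    have := abs_info_le (varRule₂_mem h1 h2)
    gcongr
  have flip := integral_flip_fst b a fun p => F (p.2, p.1)
  have sw : ∀ H : ℝ × ℝ → ℝ, ∫ p, H p ∂a.even.prod b.even =
      ∫ p, H (p.2, p.1) ∂b.even.prod a.even := fun H => (integral_prod_swap H).symm
  have iF := hi F (by fun_prop) bF
  have iF' := hi (fun p => F (p.1, -p.2)) (by fun_prop) fun p h1 h2 => bF _ h1 (neg_mem_Icc h2)
  have e1 : ∫ p, F p ∂a.even.prod b.even =
      ∫ p, (F p + F (p.1, -p.2)) / 2 ∂a.even.prod b.even := by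
    rw [integral_div, integral_add iF iF']
    rw [show ∫ p, F (p.1, -p.2) ∂a.even.prod b.even = ∫ p, F p ∂a.even.prod b.even by
      rw [sw, sw F]; exact flip]
    ring
  have e2 : ∫ p, (F p + F (p.1, -p.2)) / 2 ∂a.even.prod b.even =
      ∫ p, (info p.1 + info p.2 - info (p.1 * p.2)) ∂a.even.prod b.even := by
    refine integral_congr_ae ?_
    filter_upwards [a.ae_even_prod b] with p hp
    rw [← info_duality hp.1 hp.2]
  have b1 : ∀ p : ℝ × ℝ, p.1 ∈ Icc (-1 : ℝ) 1 → p.2 ∈ Icc (-1 : ℝ) 1 →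
      |info p.1| ≤ 2 * Real.log 2 := fun p h1 _ => (abs_info_le h1).trans (by linarith)
  have b2 : ∀ p : ℝ × ℝ, p.1 ∈ Icc (-1 : ℝ) 1 → p.2 ∈ Icc (-1 : ℝ) 1 →
      |info p.2| ≤ 2 * Real.log 2 := fun p _ h1 => (abs_info_le h1).trans (by linarith)
  have b3 : ∀ p : ℝ × ℝ, p.1 ∈ Icc (-1 : ℝ) 1 → p.2 ∈ Icc (-1 : ℝ) 1 →
      |info (p.1 * p.2)| ≤ 2 * Real.log 2 := fun p h1 h2 =>
    (abs_info_le (mul_mem_Icc h1 h2)).trans (by linarith)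
  rw [e1, e2, integral_sub (show Integrable (fun p : ℝ × ℝ => info p.1 + info p.2)
      (a.even.prod b.even) from (hi _ (by fun_prop) b1).add (hi _ (by fun_prop) b2))
    (hi _ (by fun_prop) b3), integral_add (hi _ (by fun_prop) b1) (hi _ (by fun_prop) b2)]
  rw [integral_fun_fst, integral_fun_snd]
  simp [mutualInfo_eq_even]

/-- Since moments multiply under `*`, each term is 1 - (1 - a_k)(1 - b_k) up to `coef k`. Changing
one summand thus changes the information by a series in the factors 1 - b_k, which is the shape of
every GEXIT quantity below. -/
lemma hasSum_mutualInfo_add (a b : LDensity) :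
    HasSum (fun k => coef k * (a.moment k + b.moment k - a.moment k * b.moment k))
      (a + b).mutualInfo := by
  rw [mutualInfo_add]
  refine ((a.hasSum_mutualInfo.add b.hasSum_mutualInfo).sub (a * b).hasSum_mutualInfo).congr_fun
    fun k => ?_
  rw [moment_mul]; ring

end LDensity
end Gexit
namespace Gexit

/-! ### The degradation order -/

/-- `ψ` is a bounded convex function on `[-1, 1]` with bounded subgradient `g`. -/
structure IsTest (ψ g : ℝ → ℝ) (M : ℝ) : Prop where
  meas : Measurable ψ
  meas_g : Measurable g
  bound : ∀ t ∈ Icc (-1 : ℝ) 1, |ψ t| ≤ M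
  bound_g : ∀ t ∈ Icc (-1 : ℝ) 1, |g t| ≤ M
  tangent : ∀ s ∈ Icc (-1 : ℝ) 1, ∀ t ∈ Icc (-1 : ℝ) 1, ψ s + g s * (t - s) ≤ ψ t

/-- Tests are closed under averaging. The subgradient is carried as explicit data so that it can be
integrated together with the function. -/
lemma IsTest.integral {Ω : Type*} [MeasurableSpace Ω] {μ : Measure Ω} [IsProbabilityMeasure μ]
    {ψ g : Ω → ℝ → ℝ} {M : ℝ} (hψ : Measurable fun p : Ω × ℝ => ψ p.1 p.2)
    (hg : Measurable fun p : Ω × ℝ => g p.1 p.2)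
    (h1 : ∀ᵐ ω ∂μ, ∀ t ∈ Icc (-1 : ℝ) 1, |ψ ω t| ≤ M)
    (h2 : ∀ᵐ ω ∂μ, ∀ t ∈ Icc (-1 : ℝ) 1, |g ω t| ≤ M)
    (h3 : ∀ᵐ ω ∂μ, ∀ s ∈ Icc (-1 : ℝ) 1, ∀ t ∈ Icc (-1 : ℝ) 1,
      ψ ω s + g ω s * (t - s) ≤ ψ ω t) :
    IsTest (fun t => ∫ ω, ψ ω t ∂μ) (fun t => ∫ ω, g ω t ∂μ) M := by
  have hb : ∀ F : Ω → ℝ, (∀ᵐ ω ∂μ, |F ω| ≤ M) → |∫ ω, F ω ∂μ| ≤ M := fun F hF => by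
    have := norm_integral_le_of_norm_le_const (μ := μ) (f := F) (C := M) hF
    simpa using this
  have i1 : ∀ t ∈ Icc (-1 : ℝ) 1, Integrable (fun ω => ψ ω t) μ := fun t ht =>
    integrable_of_bdd (by fun_prop) (h1.mono fun ω h => h t ht)
  have i2 : ∀ t ∈ Icc (-1 : ℝ) 1, Integrable (fun ω => g ω t) μ := fun t ht =>
    integrable_of_bdd (by fun_prop) (h2.mono fun ω h => h t ht)
  refine ⟨?_, ?_, fun t ht => hb _ (h1.mono fun ω h => h t ht),
    fun t ht => hb _ (h2.mono fun ω h => h t ht), fun s hs t ht => ?_⟩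
  · exact (hψ.stronglyMeasurable.integral_prod_left (f := ψ)).measurable
  · exact (hg.stronglyMeasurable.integral_prod_left (f := g)).measurable
  · rw [← integral_mul_const, ← integral_add (i1 s hs) ((i2 s hs).mul_const _)]
    exact integral_mono_ae ((i1 s hs).add ((i2 s hs).mul_const _)) (i1 t ht)
      (h3.mono fun ω h => h s hs t ht)

lemma pow_tangent (s t : ℝ) (k : ℕ) :
    s ^ (2 * k + 2) + (2 * k + 2) * s ^ (2 * k + 1) * (t - s) ≤ t ^ (2 * k + 2) := by
  have hc : ConvexOn ℝ univ fun x : ℝ => x ^ (2 * k + 2) :=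
    ((even_two_mul k).add even_two).convexOn_pow
  have hd : HasDerivAt (fun x : ℝ => x ^ (2 * k + 2)) ((2 * k + 2) * s ^ (2 * k + 1)) s := by
    simpa using hasDerivAt_pow (2 * k + 2) s
  rcases lt_trichotomy s t with h | h | h
  · have := hc.le_slope_of_hasDerivAt (mem_univ s) (mem_univ t) h hd
    rw [slope_def_field, le_div_iff₀ (by linarith)] at this
    linarith
  · simp [h]
  · have := hc.slope_le_of_hasDerivAt (mem_univ t) (mem_univ s) h hd
    rw [slope_def_field, div_le_iff₀ (by linarith)] at this
    linarith

lemma isTest_pow (k : ℕ) : IsTest (fun t => t ^ (2 * k + 2))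
    (fun s => (2 * k + 2) * s ^ (2 * k + 1)) (2 * k + 2) where
  meas := by fun_prop
  meas_g := by fun_prop
  bound t ht := (LDensity.abs_pow_le ht _).trans (by linarith [(Nat.cast_nonneg k : (0 : ℝ) ≤ k)])
  bound_g t ht := by
    rw [abs_mul, abs_of_nonneg (by positivity)]
    exact mul_le_of_le_one_right (by positivity) (LDensity.abs_pow_le ht _)
  tangent s _ t _ := pow_tangent s t k

namespace LDensity

/-- `b ≤ a` if the posterior of `b` is a mean-preserving contraction of that of `a`. -/
instance : LE LDensity :=
  ⟨fun b a => ∀ ψ g M, IsTest ψ g M → ∫ t, ψ t ∂b.even ≤ ∫ t, ψ t ∂a.even⟩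

instance : Preorder LDensity where
  le_refl a ψ g M _ := le_rfl
  le_trans a b c h1 h2 ψ g M h := (h1 ψ g M h).trans (h2 ψ g M h)

lemma moment_mono {a b : LDensity} (h : b ≤ a) (k : ℕ) : b.moment k ≤ a.moment k := by
  rw [moment_eq_even, moment_eq_even]; exact h _ _ _ (isTest_pow k)

/-- Jensen's inequality at the mean of `a.even`, which is 0 by reflection. -/
lemma zero_le' (a : LDensity) : 0 ≤ a := fun ψ g M h => by
  have h0 : (0 : ℝ) ∈ Icc (-1 : ℝ) 1 := by norm_num
  have i1 : Integrable ψ a.even := integrable_of_bdd h.meas (a.ae_mem_even.mono h.bound)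
  have i2 : Integrable (fun t : ℝ => t) a.even :=
    integrable_of_bdd (M := 1) measurable_id (a.ae_mem_even.mono fun t ht => abs_le.2 ht)
  have hz : ∫ t, t ∂a.even = 0 := by
    have := a.integral_even_neg fun t => t
    rw [integral_neg] at this; linarith
  rw [even_zero, integral_dirac]
  have : ∫ t, (ψ 0 + g 0 * t) ∂a.even ≤ ∫ t, ψ t ∂a.even := by
    refine integral_mono_ae ((integrable_const _).add (i2.const_mul _)) i1 ?_
    filter_upwards [a.ae_mem_even] with t ht
    simpa using h.tangent 0 h0 t ht
  rwa [integral_add (integrable_const _) (i2.const_mul _), integral_const_mul, hz, mul_zero,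
    add_zero, integral_const, probReal_univ, one_smul] at this

/-- For fixed v, the map u ↦ (1 + u v) ψ((u + v) / (1 + u v)) is the perspective of a convex
function evaluated at affine arguments, hence convex. Adding `c` therefore pulls tests back to
tests. The bound 3 M is M + 2 M, from the two terms of the subgradient. -/
lemma add_le_add_right' {a b : LDensity} (h : b ≤ a) (c : LDensity) : b + c ≤ a + c := by
  intro ψ g M ht
  have hM : 0 ≤ M := (abs_nonneg _).trans (ht.bound 0 (by norm_num))
  have key : IsTest (fun u => ∫ v, (1 + u * v) * ψ (varRule₂ u v) ∂c.even)
      (fun u => ∫ v, (v * ψ (varRule₂ u v) + g (varRule₂ u v) * (1 - v * varRule₂ u v)) ∂c.even)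
      (3 * M) := by
    have m1 := ht.meas
    have m2 := ht.meas_g
    have m3 : Measurable fun p : ℝ × ℝ => varRule₂ p.2 p.1 :=
      measurable_varRule₂.comp measurable_swap
    refine IsTest.integral (ψ := fun v u => (1 + u * v) * ψ (varRule₂ u v))
      (g := fun v u => v * ψ (varRule₂ u v) + g (varRule₂ u v) * (1 - v * varRule₂ u v))
      (by fun_prop) (by fun_prop) ?_ ?_ ?_
    · filter_upwards [c.ae_mem_even] with v hv u hu
      rw [abs_mul]
      have := abs_one_add_le (mul_mem_Icc hu hv)
      have := ht.bound _ (varRule₂_mem hu hv)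
      calc _ ≤ 2 * M := by gcongr
        _ ≤ _ := by linarith
    · filter_upwards [c.ae_mem_even] with v hv u hu
      have hV := varRule₂_mem hu hv
      have h1 := ht.bound _ hV
      have h2 := ht.bound_g _ hV
      have h3 : |1 - v * varRule₂ u v| ≤ 2 := by
        have := mul_mem_Icc hv hV
        exact abs_le.2 ⟨by linarith [this.2], by linarith [this.1]⟩
      have h4 : |v| ≤ 1 := abs_le.2 hv
      calc _ ≤ |v * ψ (varRule₂ u v)| + |g (varRule₂ u v) * (1 - v * varRule₂ u v)| :=
            abs_add_le _ _
        _ ≤ 1 * M + M * 2 := by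
            rw [abs_mul, abs_mul]; gcongr
        _ = _ := by ring
    · filter_upwards [c.ae_mem_even] with v hv s hs t hts
      have e1 := mul_varRule₂ hs hv
      have e2 := mul_varRule₂ hts hv
      have h1 := ht.tangent _ (varRule₂_mem hs hv) _ (varRule₂_mem hts hv)
      have h2 := mul_le_mul_of_nonneg_left h1 (one_add_mul_nonneg hts hv)
      set S := varRule₂ s v
      set T := varRule₂ t v
      -- The tangent line of the perspective at s is 1 + t v times the tangent line of ψ at S,
      -- because (1 + s v) S = s + v and (1 + t v) T = t + v.
      have : (1 + s * v) * ψ S + (v * ψ S + g S * (1 - v * S)) * (t - s) =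
          (1 + t * v) * (ψ S + g S * (T - S)) := by
        linear_combination g S * (e1 - e2)
      linarith
  have hb : ∀ d : LDensity, ∫ t, ψ t ∂(d + c).even =
      ∫ u, ∫ v, (1 + u * v) * ψ (varRule₂ u v) ∂c.even ∂d.even := fun d => by
    have := ht.meas
    rw [integral_even_add _ _ ht.meas ht.bound, integral_prod]
    refine integrable_of_bdd (M := 2 * M) (by fun_prop) ?_
    filter_upwards [d.ae_even_prod c] with p hp
    rw [abs_mul]
    have := abs_one_add_le (mul_mem_Icc hp.1 hp.2)
    have := ht.bound _ (varRule₂_mem hp.1 hp.2)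
    gcongr
  rw [hb, hb]
  exact h _ _ _ key

/-- Multiplication by a fixed v is linear, so u ↦ ψ(u v) is again convex. -/
lemma mul_le_mul_right'' {a b : LDensity} (h : b ≤ a) (c : LDensity) : b * c ≤ a * c := by
  intro ψ g M ht
  have hM : 0 ≤ M := (abs_nonneg _).trans (ht.bound 0 (by norm_num))
  have key : IsTest (fun u => ∫ v, ψ (u * v) ∂c.even)
      (fun u => ∫ v, v * g (u * v) ∂c.even) M := by
    have m1 := ht.meas
    have m2 := ht.meas_g
    refine IsTest.integral (ψ := fun v u => ψ (u * v))
      (g := fun v u => v * g (u * v)) (by fun_prop) (by fun_prop) ?_ ?_ ?_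
    · filter_upwards [c.ae_mem_even] with v hv u hu
      exact ht.bound _ (mul_mem_Icc hu hv)
    · filter_upwards [c.ae_mem_even] with v hv u hu
      rw [abs_mul]
      calc _ ≤ 1 * M := mul_le_mul (abs_le.2 hv) (ht.bound_g _ (mul_mem_Icc hu hv))
            (abs_nonneg _) zero_le_one
        _ = M := one_mul M
    · filter_upwards [c.ae_mem_even] with v hv s hs t hts
      have h1 := ht.tangent _ (mul_mem_Icc hs hv) _ (mul_mem_Icc hts hv)
      linarith
  have hb : ∀ d : LDensity, ∫ t, ψ t ∂(d * c).even = ∫ u, ∫ v, ψ (u * v) ∂c.even ∂d.even :=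
    fun d => by
    have := ht.meas
    rw [integral_even_mul _ _ ht.meas ht.bound, integral_prod]
    refine integrable_of_bdd (M := M) (by fun_prop) ?_
    filter_upwards [d.ae_even_prod c] with p hp
    exact ht.bound _ (mul_mem_Icc hp.1 hp.2)
  rw [hb, hb]
  exact h _ _ _ key

lemma add_mono {a b c d : LDensity} (h1 : b ≤ a) (h2 : d ≤ c) : b + d ≤ a + c :=
  (add_le_add_right' h1 d).trans (by rw [add_comm a d, add_comm a c]; exact add_le_add_right' h2 a)

lemma mul_mono {a b c d : LDensity} (h1 : b ≤ a) (h2 : d ≤ c) : b * d ≤ a * c :=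
  (mul_le_mul_right'' h1 d).trans
    (by rw [mul_comm a d, mul_comm a c]; exact mul_le_mul_right'' h2 a)

lemma pow_mono {a b : LDensity} (h : b ≤ a) (n : ℕ) : b ^ n ≤ a ^ n := by
  induction n with
  | zero => simp
  | succ n ih => rw [pow_succ, pow_succ]; exact mul_mono ih h

lemma nsmul_mono {a b : LDensity} (h : b ≤ a) (n : ℕ) : n • b ≤ n • a := by
  induction n with
  | zero => simp
  | succ n ih => rw [succ_nsmul, succ_nsmul]; exact add_mono ih h

lemma le_add_right' (a b : LDensity) : a ≤ a + b := by
  conv_lhs => rw [← add_zero a]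
  exact add_mono le_rfl (zero_le' b)

/-- Couple the outputs through the degrading kernel under a uniform input. The degraded soft bit is
then the conditional mean of the original one, and conditional Jensen, in the form of the tangent
inequality, gives the order. Degradation under both inputs is needed to identify the second marginal
with `b.even`. -/
lemma le_of_isDegradedOf {a b : LDensity} (h : b.IsDegradedOf a) : b ≤ a := by
  obtain ⟨κ, hκ, h1, h2⟩ := h
  have hb : b.even = κ ∘ₘ a.even := by
    rw [even, even, h2, h1, Measure.comp_smul, Measure.comp_add]
  set π := a.even ⊗ₘ κ with hπ
  have hfst : π.fst = a.even := Measure.fst_compProd _ _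
  have hsnd : π.snd = b.even := by rw [hb, ← Measure.snd_compProd]
  have a1 : ∀ᵐ p ∂π, p.1 ∈ Icc (-1 : ℝ) 1 := by
    have := a.ae_mem_even
    rw [← hfst] at this
    exact ae_of_ae_map measurable_fst.aemeasurable this
  have a2 : ∀ᵐ p ∂π, p.2 ∈ Icc (-1 : ℝ) 1 := by
    have := b.ae_mem_even
    rw [← hsnd] at this
    exact ae_of_ae_map measurable_snd.aemeasurable this
  have e1 : ∀ f : ℝ → ℝ, Measurable f → ∫ p, f p.1 ∂π = ∫ t, f t ∂a.even := fun f hf => by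
    rw [← hfst, Measure.fst, integral_map (by fun_prop) hf.aestronglyMeasurable]
  have e2 : ∀ f : ℝ → ℝ, Measurable f → ∫ p, f p.2 ∂π = ∫ t, f t ∂b.even := fun f hf => by
    rw [← hsnd, Measure.snd, integral_map (by fun_prop) hf.aestronglyMeasurable]
  -- The martingale property. The expectation of f under `b.law` is computed with the weight 1 + p.2
  -- from the symmetry of `b`, and with the weight 1 + p.1 from the kernel; the difference of the
  -- two formulas is the claim.
  have e3 : ∀ f : ℝ → ℝ, Measurable f → ∀ M, (∀ t ∈ Icc (-1 : ℝ) 1, |f t| ≤ M) →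
      ∫ p, f p.2 * p.1 ∂π = ∫ p, f p.2 * p.2 ∂π := by
    intro f hf M hM
    have hM0 : 0 ≤ M := (abs_nonneg _).trans (hM 0 (by norm_num))
    have bd : ∀ᵐ p ∂π, |f p.2| ≤ M := a2.mono fun p hp => hM _ hp
    have i1 : Integrable (fun p : ℝ × ℝ => f p.2) π := integrable_of_bdd (by fun_prop) bd
    have i2 : Integrable (fun p : ℝ × ℝ => f p.2 * p.1) π :=
      integrable_of_bdd (M := M) (by fun_prop) (by
        filter_upwards [bd, a1] with p h1 h2
        rw [abs_mul]
        exact (mul_le_of_le_one_right (abs_nonneg _) (abs_le.2 h2)).trans h1)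
    have i3 : Integrable (fun p : ℝ × ℝ => f p.2 * p.2) π :=
      integrable_of_bdd (M := M) (by fun_prop) (by
        filter_upwards [bd, a2] with p h1 h2
        rw [abs_mul]
        exact (mul_le_of_le_one_right (abs_nonneg _) (abs_le.2 h2)).trans h1)
    have i1' : Integrable (fun p : ℝ × ℝ => f p.2) (a.law ⊗ₘ κ) := by
      refine integrable_of_bdd (by fun_prop) (M := M) ?_
      have : (a.law ⊗ₘ κ).snd = b.law := by rw [Measure.snd_compProd, h1]
      have h := b.ae_mem
      rw [← this] at h
      filter_upwards [ae_of_ae_map measurable_snd.aemeasurable h] with p hp using hM _ hp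
    have l1 : ∫ t, f t ∂b.law = ∫ p, (1 + p.1) * f p.2 ∂π := by
      have : (a.law ⊗ₘ κ).snd = b.law := by rw [Measure.snd_compProd, h1]
      rw [← this, Measure.snd, integral_map (by fun_prop) hf.aestronglyMeasurable,
        Measure.integral_compProd i1', a.integral_law, hπ, Measure.integral_compProd]
      · simp only [integral_const_mul]
      · rw [← hπ]
        refine (i1.add i2).congr (ae_of_all _ fun p => ?_)
        simp only [Pi.add_apply]; ring
    rw [b.integral_law, ← e2 _ (by fun_prop)] at l1
    have l2 : ∫ p, (1 + p.2) * f p.2 ∂π = ∫ p, f p.2 ∂π + ∫ p, f p.2 * p.2 ∂π := by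
      rw [← integral_add i1 i3]; congr 1; funext p; ring
    have l3 : ∫ p, (1 + p.1) * f p.2 ∂π = ∫ p, f p.2 ∂π + ∫ p, f p.2 * p.1 ∂π := by
      rw [← integral_add i1 i2]; congr 1; funext p; ring
    linarith
  intro ψ g M ht
  have m1 := ht.meas
  have m2 := ht.meas_g
  rw [← e1 ψ ht.meas, ← e2 ψ ht.meas]
  have j1 : Integrable (fun p : ℝ × ℝ => ψ p.1) π :=
    integrable_of_bdd (by fun_prop) (a1.mono fun p hp => ht.bound _ hp)
  have j2 : Integrable (fun p : ℝ × ℝ => ψ p.2) π :=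
    integrable_of_bdd (by fun_prop) (a2.mono fun p hp => ht.bound _ hp)
  have j3 : Integrable (fun p : ℝ × ℝ => g p.2 * p.1) π :=
    integrable_of_bdd (M := M) (by fun_prop) (by
      filter_upwards [a1, a2] with p h1 h2
      rw [abs_mul]
      exact (mul_le_of_le_one_right (abs_nonneg _) (abs_le.2 h1)).trans (ht.bound_g _ h2))
  have j4 : Integrable (fun p : ℝ × ℝ => g p.2 * p.2) π :=
    integrable_of_bdd (M := M) (by fun_prop) (by
      filter_upwards [a2] with p h2
      rw [abs_mul]
      exact (mul_le_of_le_one_right (abs_nonneg _) (abs_le.2 h2)).trans (ht.bound_g _ h2))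
  have hle : ∫ p, (ψ p.2 + (g p.2 * p.1 - g p.2 * p.2)) ∂π ≤ ∫ p, ψ p.1 ∂π := by
    refine integral_mono_ae (j2.add (j3.sub j4)) j1 ?_
    filter_upwards [a1, a2] with p h1 h2
    have := ht.tangent _ h2 _ h1
    linarith
  rw [integral_add j2 (show Integrable (fun p : ℝ × ℝ => g p.2 * p.1 - g p.2 * p.2) π from
    j3.sub j4), integral_sub j3 j4, e3 g ht.meas_g M ht.bound_g, sub_self, add_zero] at hle
  exact hle

/-- A bounded subgradient makes ψ Lipschitz on [-1, 1], so it extends continuously, and averaging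
with the reflection replaces the even law by the law. This is what lets the order pass to weak
limits of density evolution. -/
lemma exists_continuous_of_isTest {ψ g : ℝ → ℝ} {M : ℝ} (ht : IsTest ψ g M) :
    ∃ φ : ℝ → ℝ, Continuous φ ∧ ∀ a : LDensity, ∫ t, ψ t ∂a.even = ∫ t, φ t ∂a.law := by
  have hlip : ∀ s ∈ Icc (-1 : ℝ) 1, ∀ t ∈ Icc (-1 : ℝ) 1, ψ s - ψ t ≤ M * |s - t| := by
    intro s hs t hts
    have h1 := ht.tangent s hs t hts
    have h2 := ht.bound_g s hs
    have h3 : g s * (s - t) ≤ |g s| * |s - t| := by rw [← abs_mul]; exact le_abs_self _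
    have h4 : |g s| * |s - t| ≤ M * |s - t| := by gcongr
    linarith
  have hM : 0 ≤ M := (abs_nonneg _).trans (ht.bound 0 (by norm_num))
  have hc : ContinuousOn ψ (Icc (-1 : ℝ) 1) := by
    refine (LipschitzOnWith.of_dist_le_mul (K := ⟨M, hM⟩) fun s hs t hts => ?_).continuousOn
    rw [Real.dist_eq, Real.dist_eq, abs_le]
    have := hlip s hs t hts
    have h2 := hlip t hts s hs
    rw [abs_sub_comm] at h2
    constructor
    · change -(M * |s - t|) ≤ _; linarith
    · exact this
  set χ : ℝ → ℝ := IccExtend (by norm_num : (-1 : ℝ) ≤ 1) ((Icc (-1 : ℝ) 1).domRestrict ψ) with hχ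
  have hχc : Continuous χ := (continuousOn_iff_continuous_domRestrict.1 hc).Icc_extend'
  have hχe : ∀ t ∈ Icc (-1 : ℝ) 1, χ t = ψ t := fun t h => by
    rw [hχ, IccExtend_of_mem _ _ h]; rfl
  refine ⟨fun t => (χ t + χ (-t)) / 2, by fun_prop, fun a => ?_⟩
  have b1 : ∀ t ∈ Icc (-1 : ℝ) 1, |χ t| ≤ M := fun t h => by rw [hχe t h]; exact ht.bound t h
  have h1 : ∫ t, ψ t ∂a.even = ∫ t, χ t ∂a.even :=
    integral_congr_ae (a.ae_mem_even.mono fun t h => (hχe t h).symm)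
  rw [h1, a.integral_even hχc.measurable b1, integral_div, integral_add]
  · exact integrable_of_bdd hχc.measurable (a.ae_mem.mono b1)
  · exact integrable_of_bdd (by fun_prop) (a.ae_mem.mono fun t h => b1 _ (neg_mem_Icc h))

end LDensity
end Gexit
namespace Gexit

/-! ### Mixtures and density evolution -/

namespace LDensity

/-- The mixture of the densities `D k`, `k ∈ s`, with weights `w k`. -/
noncomputable def mix (s : Finset ℕ) (w : ℕ → ℝ) (h0 : ∀ k, 0 ≤ w k) (h1 : ∑ k ∈ s, w k = 1)
    (D : ℕ → LDensity) : LDensity :=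
  haveI : IsProbabilityMeasure (∑ k ∈ s, ENNReal.ofReal (w k) • (D k).law) := ⟨by
    simp only [Measure.coe_finsetSum, Finset.sum_apply, Measure.smul_apply, measure_univ,
      smul_eq_mul, mul_one]
    rw [← ENNReal.ofReal_sum_of_nonneg fun k _ => h0 k, h1, ENNReal.ofReal_one]⟩
  ofSymm (∑ k ∈ s, ENNReal.ofReal (w k) • (D k).law)
    (by
      rw [ae_iff]
      simp only [Measure.coe_finsetSum, Finset.sum_apply, Measure.smul_apply, smul_eq_mul]
      refine Finset.sum_eq_zero fun k _ => ?_
      have := (D k).ae_mem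
      rw [ae_iff] at this
      rw [this, mul_zero])
    fun f hf => by
      simp only [lintegral_finsetSum_measure, lintegral_smul_measure]
      refine Finset.sum_congr rfl fun k _ => ?_
      rw [(D k).lintegral_symm hf]

section mix

variable {s : Finset ℕ} {w : ℕ → ℝ} {h0 : ∀ k, 0 ≤ w k} {h1 : ∑ k ∈ s, w k = 1}

lemma law_mix (D : ℕ → LDensity) :
    (mix s w h0 h1 D).law = ∑ k ∈ s, ENNReal.ofReal (w k) • (D k).law := rfl

lemma integral_law_mix (D : ℕ → LDensity) {F : ℝ → ℝ} (hF : Measurable F) {M : ℝ}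
    (hM : ∀ d ∈ Icc (-1 : ℝ) 1, |F d| ≤ M) :
    ∫ d, F d ∂(mix s w h0 h1 D).law = ∑ k ∈ s, w k * ∫ d, F d ∂(D k).law := by
  rw [law_mix, integral_finsetSum_measure]
  · refine Finset.sum_congr rfl fun k _ => ?_
    rw [integral_smul_measure, ENNReal.toReal_ofReal (h0 k), smul_eq_mul]
  · intro k _
    refine Integrable.smul_measure ?_ ENNReal.ofReal_ne_top
    exact integrable_of_bdd hF ((D k).ae_mem.mono hM)

lemma integral_even_mix (D : ℕ → LDensity) {F : ℝ → ℝ} (hF : Measurable F) {M : ℝ}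
    (hM : ∀ d ∈ Icc (-1 : ℝ) 1, |F d| ≤ M) :
    ∫ d, F d ∂(mix s w h0 h1 D).even = ∑ k ∈ s, w k * ∫ d, F d ∂(D k).even := by
  rw [integral_even _ hF hM, integral_law_mix D hF hM,
    integral_law_mix D (F := fun d => F (-d)) (by fun_prop) fun d hd => hM _ (neg_mem_Icc hd),
    ← Finset.sum_add_distrib, Finset.sum_div]
  refine Finset.sum_congr rfl fun k _ => ?_
  rw [integral_even _ hF hM]; ring

lemma moment_mix (D : ℕ → LDensity) (k : ℕ) :
    (mix s w h0 h1 D).moment k = ∑ j ∈ s, w j * (D j).moment k :=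
  integral_law_mix D (by fun_prop) fun _ hd => abs_pow_le hd _

lemma mutualInfo_mix (D : ℕ → LDensity) :
    (mix s w h0 h1 D).mutualInfo = ∑ j ∈ s, w j * (D j).mutualInfo :=
  integral_law_mix D (by fun_prop) fun _ hd => abs_info_le hd

lemma mix_mono {D D' : ℕ → LDensity} (h : ∀ k, D k ≤ D' k) :
    mix s w h0 h1 D ≤ mix s w h0 h1 D' := fun ψ g M ht => by
  rw [integral_even_mix D ht.meas ht.bound, integral_even_mix D' ht.meas ht.bound]
  exact Finset.sum_le_sum fun k _ => mul_le_mul_of_nonneg_left (h k ψ g M ht) (h0 k)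

lemma varConv_sum (μ : Measure ℝ) [SFinite μ] (s : Finset ℕ) (r : ℕ → ENNReal)
    (ν : ℕ → Measure ℝ) [∀ k, IsProbabilityMeasure (ν k)] :
    varConv μ (∑ k ∈ s, r k • ν k) = ∑ k ∈ s, r k • varConv μ (ν k) := by
  classical
  refine Measure.ext_of_lintegral _ fun f hf => ?_
  have hk : ∀ ρ : Measure ℝ, SFinite ρ → ∫⁻ x, f x ∂varConv μ ρ =
      ∫⁻ y, ∫⁻ x, f (varRule₂ x y) ∂μ ∂ρ := fun ρ hρ => by
    rw [varConv, lintegral_map hf (by fun_prop), lintegral_prod_symm _ (by fun_prop)]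
  have hs : SFinite (∑ k ∈ s, r k • ν k) := by
    induction s using Finset.induction_on with
    | empty => rw [Finset.sum_empty]; infer_instance
    | insert k s hks ih => rw [Finset.sum_insert hks]; infer_instance
  rw [hk _ hs]
  simp only [lintegral_finsetSum_measure, lintegral_smul_measure]
  exact Finset.sum_congr rfl fun k _ => by rw [hk _ inferInstance]

lemma add_mix (c : LDensity) (D : ℕ → LDensity) :
    c + mix s w h0 h1 D = mix s w h0 h1 fun k => c + D k :=
  ext_law (by
    rw [law_add, law_mix, law_mix]
    exact varConv_sum c.law s _ fun k => (D k).law)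

end mix

lemma map_pi_prod (a : LDensity) (k : ℕ) :
    (Measure.pi fun _ : Fin k => a.law).map (fun d => ∏ i, d i) = (a ^ k).law := by
  have h := map_prod_eq (μ := Measure.pi fun _ : Fin k => a.law) (X := fun i d => d i)
    (fun i => measurable_pi_apply i) (iIndepFun_pi (X := fun _ x => x) fun i => by fun_prop)
    (fun _ => a) (fun i => (measurePreserving_eval (fun _ : Fin k => a.law) i).map_eq) Finset.univ
  simpa using h

lemma map_pi_varRule (a : LDensity) (k : ℕ) :
    (Measure.pi fun _ : Fin k => a.law).map (varRule Finset.univ) = (k • a).law := by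
  have h := map_varRule_eq (μ := Measure.pi fun _ : Fin k => a.law) (X := fun i d => d i)
    (fun i => measurable_pi_apply i) (iIndepFun_pi (X := fun _ x => x) fun i => by fun_prop)
    (fun _ => a) (fun i => (measurePreserving_eval (fun _ : Fin k => a.law) i).map_eq) Finset.univ
  simpa using h

/-! ### Moments and information along ordered densities -/

lemma coef_mul_sub_le {a b : LDensity} (h : b ≤ a) (k : ℕ) :
    coef k * (a.moment k - b.moment k) ≤ a.mutualInfo - b.mutualInfo := by
  have hs := a.hasSum_mutualInfo.sub b.hasSum_mutualInfo
  have := le_hasSum hs k fun j _ => by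
    rw [← mul_sub]; exact mul_nonneg (coef_pos j).le (sub_nonneg.2 (moment_mono h j))
  rwa [mul_sub]

lemma mutualInfo_mono {a b : LDensity} (h : b ≤ a) : b.mutualInfo ≤ a.mutualInfo :=
  sub_nonneg.1 ((mul_nonneg (coef_pos 0).le (sub_nonneg.2 (moment_mono h 0))).trans
    (coef_mul_sub_le h 0))

/-- Convergence of all even moments. -/
def MomentTendsto (a : ℕ → LDensity) (b : LDensity) : Prop :=
  ∀ k, Tendsto (fun l => (a l).moment k) atTop (𝓝 (b.moment k))

lemma MomentTendsto.mutualInfo {a : ℕ → LDensity} {b : LDensity} (h : MomentTendsto a b) :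
    Tendsto (fun l => (a l).mutualInfo) atTop (𝓝 b.mutualInfo) := by
  simp_rw [← fun x : LDensity => x.hasSum_mutualInfo.tsum_eq]
  refine tendsto_tsum_of_dominated_convergence coef_summable
    (fun k => (h k).const_mul _) (Eventually.of_forall fun l k => ?_)
  rw [norm_mul, Real.norm_of_nonneg (coef_pos k).le, Real.norm_of_nonneg (moment_nonneg _ _)]
  exact mul_le_of_le_one_right (coef_pos k).le (moment_le_one _ _)

/-- For ordered densities all terms of the information gap have one sign, so the gap controls each
moment separately. -/
lemma MomentTendsto.of_mutualInfo {a : ℕ → LDensity} {b : LDensity}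
    (h : Tendsto (fun l => (a l).mutualInfo) atTop (𝓝 b.mutualInfo))
    (ho : (∀ l, a l ≤ b) ∨ ∀ l, b ≤ a l) : MomentTendsto a b := by
  intro k
  rw [tendsto_iff_norm_sub_tendsto_zero]
  have h0 : Tendsto (fun l => ‖(a l).mutualInfo - b.mutualInfo‖ / coef k) atTop (𝓝 0) := by
    have := (tendsto_iff_norm_sub_tendsto_zero.1 h).div_const (coef k)
    simpa using this
  refine squeeze_zero (fun _ => norm_nonneg _) (fun l => ?_) h0
  rw [le_div_iff₀ (coef_pos k), Real.norm_eq_abs, Real.norm_eq_abs]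
  rcases ho with ho | ho
  · have := coef_mul_sub_le (ho l) k
    rw [abs_of_nonpos (sub_nonpos.2 (moment_mono (ho l) k)),
      abs_of_nonpos (sub_nonpos.2 (mutualInfo_mono (ho l)))]
    linarith
  · have := coef_mul_sub_le (ho l) k
    rw [abs_of_nonneg (sub_nonneg.2 (moment_mono (ho l) k)),
      abs_of_nonneg (sub_nonneg.2 (mutualInfo_mono (ho l)))]
    linarith

/-- A variable node does not act on single moments. Convergence is passed through the information,
which is determined by the moments, and is brought back to the moments by the order. -/
lemma MomentTendsto.add {a a' : ℕ → LDensity} {b b' : LDensity} (h : MomentTendsto a b)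
    (h' : MomentTendsto a' b')
    (ho : ((∀ l, a l ≤ b) ∧ ∀ l, a' l ≤ b') ∨ ((∀ l, b ≤ a l) ∧ ∀ l, b' ≤ a' l)) :
    MomentTendsto (fun l => a l + a' l) (b + b') := by
  refine MomentTendsto.of_mutualInfo ?_ ?_
  · simp only [mutualInfo_add]
    refine (h.mutualInfo.add h'.mutualInfo).sub (MomentTendsto.mutualInfo fun k => ?_)
    simp only [moment_mul]
    exact (h k).mul (h' k)
  · rcases ho with ho | ho
    · exact Or.inl fun l => add_mono (ho.1 l) (ho.2 l)
    · exact Or.inr fun l => add_mono (ho.1 l) (ho.2 l)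

lemma MomentTendsto.nsmul {a : ℕ → LDensity} {b : LDensity} (h : MomentTendsto a b)
    (ho : (∀ l, a l ≤ b) ∨ ∀ l, b ≤ a l) (n : ℕ) :
    MomentTendsto (fun l => n • a l) (n • b) := by
  induction n with
  | zero => intro k; simp only [zero_smul]; exact tendsto_const_nhds
  | succ n ih =>
    simp only [succ_nsmul]
    refine ih.add h ?_
    rcases ho with ho | ho
    · exact Or.inl ⟨fun l => nsmul_mono (ho l) n, ho⟩
    · exact Or.inr ⟨fun l => nsmul_mono (ho l) n, ho⟩

end LDensity

/-! ### Density evolution of a degree distribution pair -/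

namespace DegreePair

variable (P : DegreePair)

lemma sum_lam : ∑ k ∈ P.lam.support, P.lam.coeff k = 1 := by
  have := P.lam_one
  rw [Polynomial.eval_eq_sum, Polynomial.sum_def] at this
  simpa using this

lemma sum_rho : ∑ k ∈ P.rho.support, P.rho.coeff k = 1 := by
  have := P.rho_one
  rw [Polynomial.eval_eq_sum, Polynomial.sum_def] at this
  simpa using this

lemma integral_poly (p : Polynomial ℝ) :
    ∫ x in (0 : ℝ)..1, p.eval x = ∑ k ∈ p.support, p.coeff k / (k + 1) := by
  simp_rw [Polynomial.eval_eq_sum, Polynomial.sum_def]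
  rw [intervalIntegral.integral_finsetSum fun k _ => by
    exact Continuous.intervalIntegrable (by fun_prop) _ _]
  refine Finset.sum_congr rfl fun k _ => ?_
  rw [intervalIntegral.integral_const_mul, integral_pow]
  simp
  ring

lemma intLam_pos : 0 < P.intLam := by
  rw [intLam, integral_poly]
  refine Finset.sum_pos' (fun k _ => div_nonneg (P.lam_nonneg k) (by positivity)) ?_
  by_contra! h
  have : ∑ k ∈ P.lam.support, P.lam.coeff k ≤ 0 := Finset.sum_nonpos fun k hk => by
    have := h k hk
    rw [div_le_iff₀ (by positivity)] at this
    simpa using this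
  rw [P.sum_lam] at this
  linarith

lemma varFraction_succ (k : ℕ) :
    P.varFraction (k + 1) = P.lam.coeff k / (k + 1) / P.intLam := rfl

lemma varFraction_nonneg (k : ℕ) : 0 ≤ P.varFraction k := by
  cases k with
  | zero => exact le_rfl
  | succ k =>
    exact div_nonneg (div_nonneg (P.lam_nonneg k) (by positivity)) P.intLam_pos.le

lemma checkFraction_nonneg (k : ℕ) : 0 ≤ P.checkFraction k := by
  cases k with
  | zero => exact le_rfl
  | succ k =>
    exact div_nonneg (div_nonneg (P.rho_nonneg k) (by positivity)) P.intLam_pos.le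

lemma sum_varFraction : ∑ k ∈ P.lam.support, P.varFraction (k + 1) = 1 := by
  simp only [varFraction_succ]
  rw [← Finset.sum_div, ← integral_poly, ← intLam, div_self P.intLam_pos.ne']

lemma sum_checkFraction :
    ∑ k ∈ P.rho.support, P.checkFraction (k + 1) = P.intRho / P.intLam := by
  rw [intRho, integral_poly, Finset.sum_div]
  rfl

lemma succ_mul_varFraction (k : ℕ) :
    (k + 1) * P.varFraction (k + 1) = P.lam.coeff k / P.intLam := by
  rw [varFraction_succ]; field_simp

lemma succ_mul_checkFraction (k : ℕ) :
    (k + 1) * P.checkFraction (k + 1) = P.rho.coeff k / P.intLam := by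
  change (k + 1) * (P.rho.coeff k / (k + 1) / P.intLam) = _
  field_simp

/-- `ρ(a)`. -/
noncomputable def checkD (a : LDensity) : LDensity :=
  LDensity.mix P.rho.support P.rho.coeff P.rho_nonneg P.sum_rho fun k => a ^ k

/-- `λ(a)`. -/
noncomputable def varD (a : LDensity) : LDensity :=
  LDensity.mix P.lam.support P.lam.coeff P.lam_nonneg P.sum_lam fun k => k • a

/-- `L(a)`, where `L` is the variable degree distribution from the node perspective. -/
noncomputable def node (a : LDensity) : LDensity :=
  LDensity.mix P.lam.support (fun k => P.varFraction (k + 1)) (fun _ => P.varFraction_nonneg _)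
    P.sum_varFraction fun k => (k + 1) • a

lemma law_checkD (a : LDensity) : (P.checkD a).law = checkPoly P.rho a.law := by
  simp only [checkD, LDensity.law_mix, checkPoly, LDensity.map_pi_prod]

lemma law_varD (a : LDensity) : (P.varD a).law = varPoly P.lam a.law := by
  simp only [varD, LDensity.law_mix, varPoly, LDensity.map_pi_varRule]

/-- One step of density evolution. -/
noncomputable def step (c a : LDensity) : LDensity := c + P.varD (P.checkD a)

lemma law_step (c a : LDensity) : (P.step c a).law = P.deStep c.law a.law := by
  rw [step, LDensity.law_add, law_varD, law_checkD, deStep]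

lemma law_iter (c : LDensity) (l : ℕ) : ((P.step c)^[l] 0).law = P.deIter c.law l := by
  unfold deIter
  induction l with
  | zero => rfl
  | succ l ih => rw [Function.iterate_succ_apply', Function.iterate_succ_apply', law_step, ih]

variable {P}

lemma checkD_mono {a b : LDensity} (h : b ≤ a) : P.checkD b ≤ P.checkD a :=
  LDensity.mix_mono fun k => LDensity.pow_mono h k

lemma varD_mono {a b : LDensity} (h : b ≤ a) : P.varD b ≤ P.varD a :=
  LDensity.mix_mono fun k => LDensity.nsmul_mono h k

lemma node_mono {a b : LDensity} (h : b ≤ a) : P.node b ≤ P.node a :=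
  LDensity.mix_mono fun k => LDensity.nsmul_mono h (k + 1)

lemma step_mono {c c' a b : LDensity} (hc : c ≤ c') (h : b ≤ a) : P.step c b ≤ P.step c' a :=
  LDensity.add_mono hc (varD_mono (checkD_mono h))

variable (P)

lemma moment_checkD (a : LDensity) (k : ℕ) : (P.checkD a).moment k = P.rho.eval (a.moment k) := by
  rw [checkD, LDensity.moment_mix, Polynomial.eval_eq_sum, Polynomial.sum_def]
  simp only [LDensity.moment_pow]

/-- The density of the message from a check node to a variable node after `l` rounds of density
evolution. -/
noncomputable def msg (c : LDensity) : ℕ → LDensity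
  | 0 => 0
  | l + 1 => P.checkD (c + P.varD (msg c l))

/-- The density of the extrinsic estimate after `l` rounds. -/
noncomputable def out (c : LDensity) (l : ℕ) : LDensity := P.node (P.msg c l)

variable {P}

lemma msg_mono {c c' : LDensity} (h : c ≤ c') (l : ℕ) : P.msg c l ≤ P.msg c' l := by
  induction l with
  | zero => exact le_rfl
  | succ l ih => exact checkD_mono (LDensity.add_mono h (varD_mono ih))

lemma msg_le_succ (c : LDensity) (l : ℕ) : P.msg c l ≤ P.msg c (l + 1) := by
  induction l with
  | zero => exact LDensity.zero_le' _
  | succ l ih => exact checkD_mono (LDensity.add_mono le_rfl (varD_mono ih))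

lemma iter_mono {c c' : LDensity} (h : c ≤ c') (l : ℕ) :
    (P.step c)^[l] 0 ≤ (P.step c')^[l] 0 := by
  induction l with
  | zero => exact le_rfl
  | succ l ih =>
    rw [Function.iterate_succ_apply', Function.iterate_succ_apply']; exact step_mono h ih

lemma iter_le_of_fixed {c f : LDensity} (h : f = P.step c f) (l : ℕ) : (P.step c)^[l] 0 ≤ f := by
  induction l with
  | zero => exact LDensity.zero_le' _
  | succ l ih =>
    rw [Function.iterate_succ_apply']
    conv_rhs => rw [h]
    exact step_mono le_rfl ih

/-- `msg` starts from an empty message at the check-to-variable edge and the iterates of `step` from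
an empty message at the variable-to-check edge. The two recursions interleave, which yields the
lower half of the sandwich for `msg`. -/
lemma checkD_iter_le_msg (c : LDensity) (l : ℕ) :
    P.checkD ((P.step c)^[l] 0) ≤ P.msg c (l + 1) := by
  induction l with
  | zero => exact checkD_mono (LDensity.zero_le' _)
  | succ l ih =>
    rw [Function.iterate_succ_apply']
    exact checkD_mono (LDensity.add_mono le_rfl (varD_mono ih))

lemma msg_le_of_fixed {c f : LDensity} (h : f = P.step c f) (l : ℕ) : P.msg c l ≤ P.checkD f := by
  induction l with
  | zero => exact LDensity.zero_le' _
  | succ l ih =>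
    conv_rhs => rw [h]
    exact checkD_mono (LDensity.add_mono le_rfl (varD_mono ih))

open LDensity in
lemma checkD_tendsto {a : ℕ → LDensity} {b : LDensity} (h : MomentTendsto a b) :
    MomentTendsto (fun l => P.checkD (a l)) (P.checkD b) := fun k => by
  simp only [moment_checkD]
  exact (P.rho.continuous.tendsto _).comp (h k)

open LDensity in
lemma node_tendsto {a : ℕ → LDensity} {b : LDensity} (h : MomentTendsto a b)
    (ho : (∀ l, a l ≤ b) ∨ ∀ l, b ≤ a l) :
    MomentTendsto (fun l => P.node (a l)) (P.node b) := fun k => by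
  simp only [node, moment_mix]
  exact tendsto_finsetSum _ fun j _ => (h.nsmul ho (j + 1) k).const_mul _

open LDensity in
lemma IsBPFixedPoint.tendsto {c f : LDensity} (h : P.IsBPFixedPoint c f) :
    MomentTendsto (fun l => (P.step c)^[l] 0) f := fun k => by
  have := h (fun d => d ^ (2 * k + 2)) (by fun_prop)
  simp only [← law_iter] at this
  exact this

/-- The order holds between the iterates, and each test integral is the integral of a continuous
function, so it survives in the weak limit. -/
lemma IsBPFixedPoint.mono {c c' f f' : LDensity} (h : P.IsBPFixedPoint c f)
    (h' : P.IsBPFixedPoint c' f') (hc : c ≤ c') : f ≤ f' := fun ψ g M ht => by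
  obtain ⟨φ, hφ, he⟩ := LDensity.exists_continuous_of_isTest ht
  rw [he, he]
  refine le_of_tendsto_of_tendsto' (h φ hφ) (h' φ hφ) fun l => ?_
  rw [← law_iter, ← law_iter, ← he, ← he]
  exact iter_mono hc l ψ g M ht

-- The messages are squeezed between the image of the iterates under the check-node map and that of
-- the fixed point; both bounds have the same limiting moments after the node map.
open LDensity in
lemma out_tendsto {c f : LDensity} (h : P.IsBPFixedPoint c f) (hf : f = P.step c f) :
    MomentTendsto (fun l => P.out c l) (P.node (P.checkD f)) := fun k => by
  have h1 : MomentTendsto (fun l => P.node (P.checkD ((P.step c)^[l] 0))) (P.node (P.checkD f)) :=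
    node_tendsto (checkD_tendsto h.tendsto) (Or.inl fun l => checkD_mono (iter_le_of_fixed hf l))
  refine (tendsto_add_atTop_iff_nat 1).1 ?_
  refine tendsto_of_tendsto_of_tendsto_of_le_of_le (h1 k) tendsto_const_nhds (fun l => ?_)
    fun l => ?_
  · exact moment_mono (node_mono (checkD_iter_le_msg c l)) k
  · exact moment_mono (node_mono (msg_le_of_fixed hf (l + 1))) k

/-- The even moments of the extrinsic estimate in the limit of many rounds. -/
noncomputable def outLim (P : DegreePair) (c : LDensity) (k : ℕ) : ℝ := ⨆ l, (P.out c l).moment k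

lemma out_moment_monotone (c : LDensity) (k : ℕ) : Monotone fun l => (P.out c l).moment k :=
  monotone_nat_of_le_succ fun l => LDensity.moment_mono (node_mono (msg_le_succ c l)) k

lemma out_bddAbove (c : LDensity) (k : ℕ) : BddAbove (range fun l => (P.out c l).moment k) :=
  ⟨1, by rintro _ ⟨l, rfl⟩; exact LDensity.moment_le_one _ _⟩

lemma tendsto_outLim (c : LDensity) (k : ℕ) :
    Tendsto (fun l => (P.out c l).moment k) atTop (𝓝 (P.outLim c k)) :=
  tendsto_atTop_ciSup (out_moment_monotone c k) (out_bddAbove c k)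

lemma le_outLim (c : LDensity) (k l : ℕ) : (P.out c l).moment k ≤ P.outLim c k :=
  le_ciSup (out_bddAbove c k) l

lemma outLim_mono {c c' : LDensity} (h : c ≤ c') (k : ℕ) : P.outLim c k ≤ P.outLim c' k :=
  ciSup_mono (out_bddAbove c' k) fun l => LDensity.moment_mono (node_mono (msg_mono h l)) k

lemma outLim_nonneg (c : LDensity) (k : ℕ) : 0 ≤ P.outLim c k :=
  (LDensity.moment_nonneg _ _).trans (le_outLim c k 0)

lemma outLim_le_one (c : LDensity) (k : ℕ) : P.outLim c k ≤ 1 :=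
  ciSup_le fun _ => LDensity.moment_le_one _ _

lemma outLim_eq {c f : LDensity} (h : P.IsBPFixedPoint c f) (hf : f = P.step c f) (k : ℕ) :
    P.outLim c k = (P.node (P.checkD f)).moment k :=
  tendsto_nhds_unique (tendsto_outLim c k) (out_tendsto h hf k)

end DegreePair
end Gexit
namespace Gexit

/-! ### Families of channels parameterized by entropy -/

lemma log_two_pos : 0 < Real.log 2 := Real.log_pos one_lt_two

lemma eventually_mem_unit {h : ℝ} (hh : h ∈ Ioo (0 : ℝ) 1) : ∀ᶠ t in 𝓝 h, t ∈ Icc (0 : ℝ) 1 :=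
  Filter.mem_of_superset (isOpen_Ioo.mem_nhds hh) Ioo_subset_Icc_self

lemma summable_coef_mul {g : ℕ → ℝ} {C : ℝ} (h : ∀ k, |g k| ≤ C) :
    Summable fun k => coef k * g k :=
  Summable.of_norm_bounded (coef_summable.mul_right C) fun k => by
    rw [norm_mul, Real.norm_of_nonneg (coef_pos k).le, Real.norm_eq_abs]
    exact mul_le_mul_of_nonneg_left (h k) (coef_pos k).le

/-- Differentiation of a weighted sum of monotone functions whose sum is differentiable term by
term. -/
lemma hasDerivAt_tsum_weighted {u : ℕ → ℝ → ℝ} {v : ℕ → ℝ} {F : ℝ → ℝ} {V h : ℝ}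
    (hu : ∀ k, HasDerivAt (u k) (v k) h) (hF : HasDerivAt F V h) (hv : HasSum v V)
    (hsum : ∀ᶠ t in 𝓝 h, HasSum (fun k => u k t) (F t))
    (hmono : ∀ᶠ t in 𝓝 h, ∀ k, 0 ≤ slope (u k) h t) {M : ℕ → ℝ} (hM : ∀ k, M k ∈ Icc (0 : ℝ) 1) :
    HasDerivAt (fun t => ∑' k, M k * u k t) (∑' k, M k * v k) h := by
  have hv0 : ∀ k, 0 ≤ v k := fun k =>
    ge_of_tendsto (hasDerivAt_iff_tendsto_slope.1 (hu k))
      ((hmono.filter_mono nhdsWithin_le_nhds).mono fun t ht => ht k)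
  -- A Fatou argument: finitely many slopes converge and the remaining ones are nonnegative.
  have hlow : ∀ M : ℕ → ℝ, (∀ k, M k ∈ Icc (0 : ℝ) 1) → ∀ a < ∑' k, M k * v k,
      ∀ᶠ t in 𝓝[≠] h, a < ∑' k, M k * slope (u k) h t := by
    intro M hM a ha
    have hs : Summable fun k => M k * v k :=
      Summable.of_nonneg_of_le (fun k => mul_nonneg (hM k).1 (hv0 k))
        (fun k => mul_le_of_le_one_left (hv0 k) (hM k).2) hv.summable
    obtain ⟨K, hK⟩ := ((hs.hasSum.tendsto_sum_nat).eventually_const_lt ha).exists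
    have ht : Tendsto (fun t => ∑ k ∈ Finset.range K, M k * slope (u k) h t) (𝓝[≠] h)
        (𝓝 (∑ k ∈ Finset.range K, M k * v k)) :=
      tendsto_finsetSum _ fun k _ => (hasDerivAt_iff_tendsto_slope.1 (hu k)).const_mul _
    filter_upwards [ht.eventually_const_lt hK, hsum.filter_mono nhdsWithin_le_nhds,
      hmono.filter_mono nhdsWithin_le_nhds] with t h1 h2 h3
    refine h1.trans_le (Summable.sum_le_tsum _ (fun k _ => mul_nonneg (hM k).1 (h3 k)) ?_)
    have hs : Summable fun k => slope (u k) h t := by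
      simp only [slope_def_module, smul_eq_mul]
      exact (h2.summable.sub hsum.self_of_nhds.summable).mul_left _
    exact Summable.of_nonneg_of_le (fun k => mul_nonneg (hM k).1 (h3 k))
      (fun k => mul_le_of_le_one_left (h3 k) (hM k).2) hs
  rw [hasDerivAt_iff_tendsto_slope]
  have hsl : ∀ᶠ t in 𝓝[≠] h, slope (fun t => ∑' k, M k * u k t) h t =
      ∑' k, M k * slope (u k) h t ∧ Summable (fun k => slope (u k) h t) ∧
      ∑' k, slope (u k) h t = slope F h t ∧ ∀ k, 0 ≤ slope (u k) h t := by
    filter_upwards [hsum.filter_mono nhdsWithin_le_nhds,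
      hmono.filter_mono nhdsWithin_le_nhds] with t h2 h3
    have h1 := hsum.self_of_nhds
    have hs : Summable fun k => slope (u k) h t := by
      simp only [slope_def_module, smul_eq_mul]
      exact (h2.summable.sub h1.summable).mul_left _
    have habs : ∀ t, Summable (fun k => u k t) → Summable fun k => M k * u k t := fun t hs =>
      Summable.of_norm_bounded hs.norm fun k => by
        rw [norm_mul]
        refine mul_le_of_le_one_left (norm_nonneg _) ?_
        rw [Real.norm_of_nonneg (hM k).1]; exact (hM k).2
    refine ⟨?_, hs, ?_, h3⟩
    · simp only [slope_def_module, smul_eq_mul]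
      rw [← (habs t h2.summable).tsum_sub (habs h h1.summable), ← tsum_mul_left]
      refine tsum_congr fun k => by ring
    · simp only [slope_def_module, smul_eq_mul]
      rw [← h2.tsum_eq, ← h1.tsum_eq, ← h2.summable.tsum_sub h1.summable, tsum_mul_left]
  refine tendsto_order.2 ⟨fun a ha => ?_, fun b hb => ?_⟩
  · filter_upwards [hlow M hM a ha, hsl] with t h1 h2
    rwa [h2.1]
  -- The upper bound is the lower bound for the complementary weights 1 - M, subtracted from the
  -- total slope, which converges to V.
  · have hM' : ∀ k, 1 - M k ∈ Icc (0 : ℝ) 1 := fun k =>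
      ⟨by linarith [(hM k).2], by linarith [(hM k).1]⟩
    have hs : Summable fun k => M k * v k :=
      Summable.of_nonneg_of_le (fun k => mul_nonneg (hM k).1 (hv0 k))
        (fun k => mul_le_of_le_one_left (hv0 k) (hM k).2) hv.summable
    have e : ∑' k, (1 - M k) * v k = V - ∑' k, M k * v k := by
      simp only [sub_mul, one_mul]
      rw [hv.summable.tsum_sub hs, hv.tsum_eq]
    -- Half of the available gap: one δ is lost in the total slope and one in the complementary sum.
    set δ := (b - ∑' k, M k * v k) / 2 with hδ
    have h1 := hlow _ hM' (V - ∑' k, M k * v k - δ) (by rw [e]; linarith)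
    have h2 := (hasDerivAt_iff_tendsto_slope.1 hF).eventually_lt_const
      (show V < V + δ by linarith)
    filter_upwards [h1, h2, hsl] with t h1 h2 ⟨h3, h4, h5, h6⟩
    have hs' : Summable fun k => M k * slope (u k) h t :=
      Summable.of_nonneg_of_le (fun k => mul_nonneg (hM k).1 (h6 k))
        (fun k => mul_le_of_le_one_left (h6 k) (hM k).2) h4
    have e' : ∑' k, (1 - M k) * slope (u k) h t = slope F h t - ∑' k, M k * slope (u k) h t := by
      simp only [sub_mul, one_mul]
      rw [h4.tsum_sub hs', h5]
    rw [e'] at h1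
    rw [h3]
    linarith

/-- A smooth family of channels ordered by degradation and parameterized by entropy. -/
structure IsChannelFamily (c : ℝ → LDensity) : Prop where
  ent : EntropyParameterized c
  smooth : SmoothFamily c
  deg : DegradedFamily c

/-- The rate at which the `k`-th term of the entropy series of `c h` grows with `h`. -/
noncomputable def weight (c : ℝ → LDensity) (k : ℕ) (h : ℝ) : ℝ :=
  -(coef k * deriv (fun t => (c t).moment k) h) / Real.log 2

namespace IsChannelFamily

variable {c : ℝ → LDensity} (hc : IsChannelFamily c)
include hc

lemma anti {s t : ℝ} (hs : s ∈ Icc (0 : ℝ) 1) (ht : t ∈ Icc (0 : ℝ) 1) (h : s ≤ t) : c t ≤ c s :=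
  LDensity.le_of_isDegradedOf (hc.deg s hs t ht h)

lemma mutualInfo_eq {t : ℝ} (ht : t ∈ Icc (0 : ℝ) 1) :
    (c t).mutualInfo = Real.log 2 * (1 - t) := by
  rw [LDensity.mutualInfo_eq, hc.ent t ht]

lemma hasSum {t : ℝ} (ht : t ∈ Icc (0 : ℝ) 1) :
    HasSum (fun k => coef k * (c t).moment k) (Real.log 2 * (1 - t)) := by
  rw [← hc.mutualInfo_eq ht]; exact (c t).hasSum_mutualInfo

lemma coef_sub_nonneg {s t : ℝ} (hs : s ∈ Icc (0 : ℝ) 1) (ht : t ∈ Icc (0 : ℝ) 1) (h : s ≤ t)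
    (k : ℕ) : 0 ≤ coef k * ((c s).moment k - (c t).moment k) :=
  mul_nonneg (coef_pos k).le (sub_nonneg.2 (LDensity.moment_mono (hc.anti hs ht h) k))

lemma hasSum_sub {s t : ℝ} (hs : s ∈ Icc (0 : ℝ) 1) (ht : t ∈ Icc (0 : ℝ) 1) :
    HasSum (fun k => coef k * ((c s).moment k - (c t).moment k)) (Real.log 2 * (t - s)) := by
  have e : Real.log 2 * (t - s) = Real.log 2 * (1 - s) - Real.log 2 * (1 - t) := by ring
  simp only [mul_sub (coef _)]
  rw [e]
  exact (hc.hasSum hs).sub (hc.hasSum ht)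

lemma coef_sub_le {s t : ℝ} (hs : s ∈ Icc (0 : ℝ) 1) (ht : t ∈ Icc (0 : ℝ) 1) (h : s ≤ t)
    (k : ℕ) : coef k * ((c s).moment k - (c t).moment k) ≤ Real.log 2 * (t - s) :=
  le_hasSum (hc.hasSum_sub hs ht) k fun j _ => hc.coef_sub_nonneg hs ht h j

lemma moment_antitoneOn (k : ℕ) : AntitoneOn (fun t => (c t).moment k) (Icc 0 1) :=
  fun _ hs _ ht h => LDensity.moment_mono (hc.anti hs ht h) k

lemma contDiffOn (k : ℕ) : ContDiffOn ℝ 1 (fun t => (c t).moment k) (Ioo 0 1) :=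
  hc.smooth (fun d => d ^ (2 * k + 2)) (by fun_prop)

lemma hasDerivAt {h : ℝ} (hh : h ∈ Ioo (0 : ℝ) 1) (k : ℕ) :
    HasDerivAt (fun t => (c t).moment k) (deriv (fun t => (c t).moment k) h) h :=
  (((hc.contDiffOn k).differentiableOn one_ne_zero).differentiableAt
    (isOpen_Ioo.mem_nhds hh)).hasDerivAt

/-- Smoothness is given on the open interval only. Continuity up to the endpoints comes from
entropy: each term of the series is monotone and the total is linear in t, so each term is
Lipschitz. -/
lemma continuousOn_moment (k : ℕ) : ContinuousOn (fun t => (c t).moment k) (Icc 0 1) := by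
  have hle : ∀ s ∈ Icc (0 : ℝ) 1, ∀ t ∈ Icc (0 : ℝ) 1,
      |(c s).moment k - (c t).moment k| ≤ Real.log 2 / coef k * |s - t| := by
    intro s hs t ht
    have h1 : ∀ s ∈ Icc (0 : ℝ) 1, ∀ t ∈ Icc (0 : ℝ) 1, s ≤ t →
        |(c s).moment k - (c t).moment k| ≤ Real.log 2 / coef k * |s - t| := by
      intro s hs t ht h
      rw [abs_of_nonneg (sub_nonneg.2 (LDensity.moment_mono (hc.anti hs ht h) k)),
        abs_of_nonpos (by linarith), div_mul_eq_mul_div, le_div_iff₀ (coef_pos k)]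
      have := hc.coef_sub_le hs ht h k
      linarith
    rcases le_total s t with h | h
    · exact h1 s hs t ht h
    · rw [abs_sub_comm, abs_sub_comm s]; exact h1 t ht s hs h
  have hL : 0 ≤ Real.log 2 / coef k := div_nonneg log_two_pos.le (coef_pos k).le
  exact (LipschitzOnWith.of_dist_le_mul (K := ⟨_, hL⟩) hle).continuousOn

lemma slope_nonneg {h t : ℝ} (hh : h ∈ Icc (0 : ℝ) 1) (ht : t ∈ Icc (0 : ℝ) 1) (k : ℕ) :
    0 ≤ slope (fun t => -(coef k * (c t).moment k)) h t := by
  rw [slope_def_field]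
  rcases le_total h t with h1 | h1
  · have := hc.coef_sub_nonneg hh ht h1 k
    exact div_nonneg (by linarith) (by linarith)
  · have := hc.coef_sub_nonneg ht hh h1 k
    exact div_nonneg_of_nonpos (by linarith) (by linarith)

lemma hasDerivAt_term {h : ℝ} (hh : h ∈ Ioo (0 : ℝ) 1) (k : ℕ) :
    HasDerivAt (fun t => -(coef k * (c t).moment k)) (Real.log 2 * weight c k h) h := by
  have := ((hc.hasDerivAt hh k).const_mul (coef k)).neg
  have e : Real.log 2 * weight c k h = -(coef k * deriv (fun t => (c t).moment k) h) := by
    unfold weight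
    field_simp [log_two_pos.ne']
  rw [e]
  exact this

lemma weight_nonneg {h : ℝ} (hh : h ∈ Ioo (0 : ℝ) 1) (k : ℕ) : 0 ≤ weight c k h := by
  have h1 : 0 ≤ Real.log 2 * weight c k h :=
    ge_of_tendsto (hasDerivAt_iff_tendsto_slope.1 (hc.hasDerivAt_term hh k))
      (((eventually_mem_unit hh).filter_mono nhdsWithin_le_nhds).mono fun t ht =>
        hc.slope_nonneg (Ioo_subset_Icc_self hh) ht k)
  exact nonneg_of_mul_nonneg_right h1 log_two_pos

/-- The full entropy series has slope exactly log 2 and every term contributes with the same sign,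
so finitely many terms contribute at most log 2. Pointwise equality is not claimed, as mass may
escape to large k at exceptional parameters. -/
lemma sum_weight_le {h : ℝ} (hh : h ∈ Ioo (0 : ℝ) 1) (s : Finset ℕ) :
    ∑ k ∈ s, weight c k h ≤ 1 := by
  have hd : Tendsto (fun t => ∑ k ∈ s, slope (fun t => -(coef k * (c t).moment k)) h t) (𝓝[≠] h)
      (𝓝 (∑ k ∈ s, Real.log 2 * weight c k h)) :=
    tendsto_finsetSum _ fun k _ => hasDerivAt_iff_tendsto_slope.1 (hc.hasDerivAt_term hh k)
  have hle : ∑ k ∈ s, Real.log 2 * weight c k h ≤ Real.log 2 := by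
    refine le_of_tendsto hd ?_
    filter_upwards [(eventually_mem_unit hh).filter_mono nhdsWithin_le_nhds, self_mem_nhdsWithin]
      with t ht hne
    have hh' := Ioo_subset_Icc_self hh
    have hs := ((hc.hasSum ht).neg.sub (hc.hasSum hh').neg).mul_left (t - h)⁻¹
    have e : (t - h)⁻¹ * (-(Real.log 2 * (1 - t)) - -(Real.log 2 * (1 - h))) = Real.log 2 := by
      have : t - h ≠ 0 := sub_ne_zero.2 hne
      field_simp
      ring
    rw [e] at hs
    refine sum_le_hasSum s (fun k _ => ?_) hs
    have := hc.slope_nonneg hh' ht k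
    rwa [slope_def_module, smul_eq_mul] at this
  rw [← Finset.mul_sum] at hle
  have := log_two_pos
  by_contra! hlt
  nlinarith

lemma summable_weight {h : ℝ} (hh : h ∈ Ioo (0 : ℝ) 1) : Summable fun k => weight c k h :=
  summable_of_sum_le (fun k => hc.weight_nonneg hh k) fun s => hc.sum_weight_le hh s

lemma weight_le_one {h : ℝ} (hh : h ∈ Ioo (0 : ℝ) 1) (k : ℕ) : weight c k h ≤ 1 := by
  simpa using hc.sum_weight_le hh {k}

lemma tsum_weight_le {h : ℝ} (hh : h ∈ Ioo (0 : ℝ) 1) : ∑' k, weight c k h ≤ 1 :=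
  (hc.summable_weight hh).tsum_le_of_sum_le fun s => hc.sum_weight_le hh s

lemma summable_weight_mul {h : ℝ} (hh : h ∈ Ioo (0 : ℝ) 1) {b : ℕ → ℝ}
    (hb : ∀ k, b k ∈ Icc (0 : ℝ) 1) : Summable fun k => weight c k h * b k :=
  Summable.of_nonneg_of_le (fun k => mul_nonneg (hc.weight_nonneg hh k) (hb k).1)
    (fun k => mul_le_of_le_one_right (hc.weight_nonneg hh k) (hb k).2) (hc.summable_weight hh)

lemma tsum_weight_mul_mem {h : ℝ} (hh : h ∈ Ioo (0 : ℝ) 1) {b : ℕ → ℝ}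
    (hb : ∀ k, b k ∈ Icc (0 : ℝ) 1) : ∑' k, weight c k h * b k ∈ Icc (0 : ℝ) 1 :=
  ⟨tsum_nonneg fun k => mul_nonneg (hc.weight_nonneg hh k) (hb k).1,
    ((hc.summable_weight_mul hh hb).tsum_le_tsum
      (fun k => mul_le_of_le_one_right (hc.weight_nonneg hh k) (hb k).2)
      (hc.summable_weight hh)).trans (hc.tsum_weight_le hh)⟩

lemma continuousOn_weight (k : ℕ) : ContinuousOn (weight c k) (Ioo 0 1) := by
  have := (hc.contDiffOn k).continuousOn_deriv_of_isOpen isOpen_Ioo le_rfl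
  exact ((this.const_smul (coef k)).neg).div_const _

lemma integrableOn_weight (k : ℕ) : IntegrableOn (weight c k) (Ioo 0 1) := by
  refine Integrable.of_bound ((hc.continuousOn_weight k).aestronglyMeasurable measurableSet_Ioo) 1 ?_
  refine (ae_restrict_iff' measurableSet_Ioo).2 (ae_of_all _ fun h hh => ?_)
  rw [Real.norm_of_nonneg (hc.weight_nonneg hh k)]
  exact hc.weight_le_one hh k

lemma integral_weight {s t : ℝ} (hs : 0 ≤ s) (ht : t ≤ 1) (hst : s ≤ t) (k : ℕ) :
    ∫ h in Ioo s t, weight c k h = coef k * ((c s).moment k - (c t).moment k) / Real.log 2 := by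
  have hsub : Icc s t ⊆ Icc 0 1 := Icc_subset_Icc hs ht
  have hi : IntervalIntegrable (fun h => Real.log 2 * weight c k h) volume s t := by
    rw [intervalIntegrable_iff_integrableOn_Ioo_of_le hst]
    exact ((hc.integrableOn_weight k).mono_set (Ioo_subset_Ioo hs ht)).const_mul _
  have := intervalIntegral.integral_eq_sub_of_hasDerivAt_of_le hst
    (f := fun t => -(coef k * (c t).moment k)) (f' := fun h => Real.log 2 * weight c k h)
    (((hc.continuousOn_moment k).mono hsub).const_smul (coef k)).neg
    (fun x hx => hc.hasDerivAt_term ⟨hs.trans_lt hx.1, hx.2.trans_le ht⟩ k) hi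
  rw [intervalIntegral.integral_of_le hst, integral_Ioc_eq_integral_Ioo,
    integral_const_mul] at this
  field_simp [log_two_pos.ne']
  linarith

/-- Term-by-term integration of `∑ weight * b`. -/
lemma hasSum_integral_weight {s t : ℝ} (hs : 0 ≤ s) (ht : t ≤ 1) (hst : s ≤ t) {b : ℕ → ℝ}
    (hb : ∀ k, b k ∈ Icc (0 : ℝ) 1) :
    HasSum (fun k => coef k * ((c s).moment k - (c t).moment k) / Real.log 2 * b k)
      (∫ h in Ioo s t, ∑' k, weight c k h * b k) := by
  have hsI : s ∈ Icc (0 : ℝ) 1 := ⟨hs, hst.trans ht⟩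
  have htI : t ∈ Icc (0 : ℝ) 1 := ⟨hs.trans hst, ht⟩
  have hsub : Ioo s t ⊆ Ioo 0 1 := Ioo_subset_Ioo hs ht
  have hk : ∀ k, ∫ h in Ioo s t, weight c k h * b k =
      coef k * ((c s).moment k - (c t).moment k) / Real.log 2 * b k := fun k => by
    rw [integral_mul_const, hc.integral_weight hs ht hst]
  simp_rw [← hk]
  refine hasSum_integral_of_summable_integral_norm (fun k =>
    ((hc.integrableOn_weight k).mono_set hsub).mul_const _) ?_
  have e : ∀ k, ∫ h in Ioo s t, ‖weight c k h * b k‖ = ∫ h in Ioo s t, weight c k h * b k :=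
    fun k => setIntegral_congr_fun measurableSet_Ioo fun h hh =>
      Real.norm_of_nonneg (mul_nonneg (hc.weight_nonneg (hsub hh) k) (hb k).1)
  simp_rw [e, hk]
  refine Summable.of_nonneg_of_le (fun k => mul_nonneg (div_nonneg
    (hc.coef_sub_nonneg hsI htI hst k) log_two_pos.le) (hb k).1) (fun k =>
    mul_le_of_le_one_right (div_nonneg (hc.coef_sub_nonneg hsI htI hst k) log_two_pos.le)
      (hb k).2) ((hc.hasSum_sub hsI htI).summable.div_const _)

lemma aestronglyMeasurable_tsum {b : ℕ → ℝ → ℝ}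
    (hb : ∀ k, AEMeasurable (b k) (volume.restrict (Ioo 0 1))) :
    AEStronglyMeasurable (fun h => ∑' k, weight c k h * b k h) (volume.restrict (Ioo 0 1)) := by
  have hw : ∀ k, AEMeasurable (weight c k) (volume.restrict (Ioo 0 1)) := fun k =>
    ((hc.continuousOn_weight k).aestronglyMeasurable measurableSet_Ioo).aemeasurable
  exact (AEMeasurable.tsum fun k => (hw k).mul (hb k)).aestronglyMeasurable

/-- The sum of the weights is at most 1 everywhere, while integrating it term by term over the unit
interval gives the whole entropy range, which is 1. Hence it equals 1 almost everywhere; this is the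
exceptional set on which differentiability is not asserted. -/
lemma ae_hasSum_weight :
    ∀ᵐ h ∂(volume.restrict (Ioo (0 : ℝ) 1)), HasSum (fun k => weight c k h) 1 := by
  have h1 := hc.hasSum_integral_weight le_rfl le_rfl zero_le_one (b := fun _ => 1)
    fun _ => by norm_num
  have h2 := (hc.hasSum_sub (s := 0) (t := 1) (by norm_num) (by norm_num)).div_const (Real.log 2)
  simp only [mul_one] at h1
  have h3 := h1.unique h2
  rw [sub_zero, mul_one, div_self log_two_pos.ne'] at h3
  have hm : AEStronglyMeasurable (fun h => ∑' k, weight c k h) (volume.restrict (Ioo 0 1)) := by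
    simpa using hc.aestronglyMeasurable_tsum (b := fun _ _ => 1) fun _ => by fun_prop
  have hi : Integrable (fun h => ∑' k, weight c k h) (volume.restrict (Ioo 0 1)) := by
    refine Integrable.of_bound hm 1 ?_
    refine (ae_restrict_iff' measurableSet_Ioo).2 (ae_of_all _ fun h hh => ?_)
    rw [Real.norm_of_nonneg (tsum_nonneg fun k => hc.weight_nonneg hh k)]
    exact hc.tsum_weight_le hh
  have h0 : ∫ h in Ioo (0 : ℝ) 1, (1 - ∑' k, weight c k h) = 0 := by
    rw [integral_sub (integrable_const _) hi, h3]; simp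
  rw [integral_eq_zero_iff_of_nonneg_ae] at h0
  · filter_upwards [h0, ae_restrict_mem measurableSet_Ioo] with h h1 hh
    have := (hc.summable_weight hh).hasSum
    rwa [← sub_eq_zero.1 h1] at this
  · refine (ae_restrict_iff' measurableSet_Ioo).2 (ae_of_all _ fun h hh => ?_)
    exact sub_nonneg.2 (hc.tsum_weight_le hh)
  · exact (integrable_const _).sub hi

lemma hasDerivAt_tsum {h : ℝ} (hh : h ∈ Ioo (0 : ℝ) 1) (hw : HasSum (fun k => weight c k h) 1)
    {M : ℕ → ℝ} (hM : ∀ k, M k ∈ Icc (0 : ℝ) 1) :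
    HasDerivAt (fun t => ∑' k, M k * -(coef k * (c t).moment k))
      (Real.log 2 * ∑' k, weight c k h * M k) h := by
  have hd : HasDerivAt (fun t => -(Real.log 2 * (1 - t))) (Real.log 2) h := by
    have := (((hasDerivAt_id h).const_sub 1).const_mul (Real.log 2)).neg
    have e : Real.log 2 = -(Real.log 2 * -1) := by ring
    nth_rewrite 2 [e]
    exact this
  have := hasDerivAt_tsum_weighted (u := fun k t => -(coef k * (c t).moment k))
    (v := fun k => Real.log 2 * weight c k h) (V := Real.log 2)
    (F := fun t => -(Real.log 2 * (1 - t))) (hc.hasDerivAt_term hh) hd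
    (by simpa using hw.mul_left (Real.log 2))
    ((eventually_mem_unit hh).mono fun t ht => (hc.hasSum ht).neg)
    ((eventually_mem_unit hh).mono fun t ht => hc.slope_nonneg (Ioo_subset_Icc_self hh) ht) hM
  have e : Real.log 2 * ∑' k, weight c k h * M k = ∑' k, M k * (Real.log 2 * weight c k h) := by
    rw [← tsum_mul_left]
    exact tsum_congr fun k => by ring
  rw [e]
  exact this

lemma integrableOn_tsum {b : ℕ → ℝ → ℝ} (hb : ∀ k, AntitoneOn (b k) (Icc 0 1))
    (hb' : ∀ k, ∀ h ∈ Icc (0 : ℝ) 1, b k h ∈ Icc (0 : ℝ) 1) :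
    IntegrableOn (fun h => ∑' k, weight c k h * (1 - b k h)) (Ioo 0 1) := by
  have hb2 : ∀ h ∈ Ioo (0 : ℝ) 1, ∀ k, 1 - b k h ∈ Icc (0 : ℝ) 1 := fun h hh k =>
    have := hb' k h (Ioo_subset_Icc_self hh)
    ⟨by linarith [this.2], by linarith [this.1]⟩
  refine Integrable.of_bound (hc.aestronglyMeasurable_tsum fun k => ?_) 1 ?_
  · exact (aemeasurable_restrict_of_antitoneOn measurableSet_Ioo
      ((hb k).mono Ioo_subset_Icc_self)).const_sub 1
  · refine (ae_restrict_iff' measurableSet_Ioo).2 (ae_of_all _ fun h hh => ?_)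
    have := hc.tsum_weight_mul_mem hh (hb2 h hh)
    rw [Real.norm_of_nonneg this.1]
    exact this.2

/-- Comparison of the integral of a GEXIT-like function with its Stieltjes sums. -/
lemma integral_bounds {b : ℕ → ℝ → ℝ} (hb : ∀ k, AntitoneOn (b k) (Icc 0 1))
    (hb' : ∀ k, ∀ h ∈ Icc (0 : ℝ) 1, b k h ∈ Icc (0 : ℝ) 1) {s t : ℝ} (hs : 0 ≤ s) (ht : t ≤ 1)
    (hst : s ≤ t) :
    ∑' k, coef k * (((c s).moment k - (c t).moment k) * (1 - b k s)) ≤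
        Real.log 2 * ∫ h in Ioo s t, ∑' k, weight c k h * (1 - b k h) ∧
      Real.log 2 * ∫ h in Ioo s t, ∑' k, weight c k h * (1 - b k h) ≤
        ∑' k, coef k * (((c s).moment k - (c t).moment k) * (1 - b k t)) := by
  have hsI : s ∈ Icc (0 : ℝ) 1 := ⟨hs, hst.trans ht⟩
  have htI : t ∈ Icc (0 : ℝ) 1 := ⟨hs.trans hst, ht⟩
  have hsub : Ioo s t ⊆ Ioo 0 1 := Ioo_subset_Ioo hs ht
  have hb2 : ∀ h ∈ Icc (0 : ℝ) 1, ∀ k, 1 - b k h ∈ Icc (0 : ℝ) 1 := fun h hh k =>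
    have := hb' k h hh
    ⟨by linarith [this.2], by linarith [this.1]⟩
  have hint := (hc.integrableOn_tsum hb hb').mono_set hsub
  have hconst : ∀ x ∈ Icc (0 : ℝ) 1,
      IntegrableOn (fun h => ∑' k, weight c k h * (1 - b k x)) (Ioo s t) := fun x hx =>
    (hc.integrableOn_tsum (b := fun k _ => b k x) (fun k => antitoneOn_const)
      fun k _ _ => hb' k x hx).mono_set hsub
  -- With `b` frozen at x, term-by-term integration turns the integral into the Stieltjes sum.
  have key : ∀ x ∈ Icc (0 : ℝ) 1,
      ∑' k, coef k * (((c s).moment k - (c t).moment k) * (1 - b k x)) =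
      Real.log 2 * ∫ h in Ioo s t, ∑' k, weight c k h * (1 - b k x) := fun x hx => by
    rw [← (hc.hasSum_integral_weight hs ht hst (hb2 x hx)).tsum_eq, ← tsum_mul_left]
    refine tsum_congr fun k => ?_
    field_simp [log_two_pos.ne']
  constructor
  · rw [key s hsI]
    refine mul_le_mul_of_nonneg_left ?_ log_two_pos.le
    refine setIntegral_mono_on (hconst s hsI) hint measurableSet_Ioo fun h hh => ?_
    have hh' := Ioo_subset_Icc_self (hsub hh)
    refine (hc.summable_weight_mul (hsub hh) (hb2 s hsI)).tsum_le_tsum (fun k => ?_)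
      (hc.summable_weight_mul (hsub hh) (hb2 h hh'))
    have := hb k hsI hh' hh.1.le
    exact mul_le_mul_of_nonneg_left (by linarith) (hc.weight_nonneg (hsub hh) k)
  · rw [key t htI]
    refine mul_le_mul_of_nonneg_left ?_ log_two_pos.le
    refine setIntegral_mono_on hint (hconst t htI) measurableSet_Ioo fun h hh => ?_
    have hh' := Ioo_subset_Icc_self (hsub hh)
    refine (hc.summable_weight_mul (hsub hh) (hb2 h hh')).tsum_le_tsum (fun k => ?_)
      (hc.summable_weight_mul (hsub hh) (hb2 t htI))
    have := hb k hh' htI hh.2.le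
    exact mul_le_mul_of_nonneg_left (by linarith) (hc.weight_nonneg (hsub hh) k)

end IsChannelFamily

/-- The error of a Stieltjes sum over a partition of mesh `1 / N`. -/
noncomputable def meshError (N : ℕ) : ℝ := ∑' k, min (Real.log 2 / (N + 1)) (coef k)

lemma tendsto_meshError : Tendsto meshError atTop (𝓝 0) := by
  have : Tendsto meshError atTop (𝓝 (∑' _ : ℕ, (0 : ℝ))) := by
    refine tendsto_tsum_of_dominated_convergence coef_summable (fun k => ?_)
      (Eventually.of_forall fun N k => ?_)
    · have h1 : Tendsto (fun N : ℕ => Real.log 2 / ((N : ℝ) + 1)) atTop (𝓝 0) := by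
        have := (tendsto_one_div_add_atTop_nhds_zero_nat (𝕜 := ℝ)).const_mul (Real.log 2)
        simpa [div_eq_mul_inv] using this
      have := h1.min (tendsto_const_nhds (x := coef k))
      rwa [min_eq_left (coef_pos k).le] at this
    · have := log_two_pos
      rw [Real.norm_of_nonneg (le_min (by positivity) (coef_pos k).le)]
      exact min_le_right _ _
  simpa using this

/-- For fixed k the sum of products of increments is bounded in two ways. Bounding the increments of
A by the mesh and telescoping B gives log 2 / (N + 1); bounding those of B by 1 and telescoping A
gives `coef k`. The second bound makes the minimum summable in k. -/
lemma sum_mesh_le (N : ℕ) {A B : ℕ → ℕ → ℝ} (hA : ∀ k, Antitone (A k)) (hB : ∀ k, Antitone (B k))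
    (hA' : ∀ k j, A k j ∈ Icc (0 : ℝ) 1) (hB' : ∀ k j, B k j ∈ Icc (0 : ℝ) 1)
    (hlip : ∀ k, ∀ j < N + 1, coef k * (A k j - A k (j + 1)) ≤ Real.log 2 / (N + 1)) :
    ∑ j ∈ Finset.range (N + 1), ∑' k, coef k * ((A k j - A k (j + 1)) * (B k j - B k (j + 1))) ≤
      meshError N := by
  have dA : ∀ k j, A k j - A k (j + 1) ∈ Icc (0 : ℝ) 1 := fun k j =>
    ⟨sub_nonneg.2 (hA k j.le_succ), by linarith [(hA' k j).2, (hA' k (j + 1)).1]⟩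
  have dB : ∀ k j, B k j - B k (j + 1) ∈ Icc (0 : ℝ) 1 := fun k j =>
    ⟨sub_nonneg.2 (hB k j.le_succ), by linarith [(hB' k j).2, (hB' k (j + 1)).1]⟩
  have hs : ∀ j, Summable fun k => coef k * ((A k j - A k (j + 1)) * (B k j - B k (j + 1))) :=
    fun j => summable_coef_mul (C := 1) fun k => by
      rw [abs_of_nonneg (mul_nonneg (dA k j).1 (dB k j).1)]
      exact mul_le_one₀ (dA k j).2 (dB k j).1 (dB k j).2
  have hl := log_two_pos
  rw [← Summable.tsum_finsetSum fun j _ => hs j]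
  refine (summable_sum fun j _ => hs j).tsum_le_tsum (fun k => le_min ?_ ?_) ?_
  · calc _ ≤ ∑ j ∈ Finset.range (N + 1), Real.log 2 / (N + 1) * (B k j - B k (j + 1)) :=
          Finset.sum_le_sum fun j hj => by
            rw [← mul_assoc]
            exact mul_le_mul_of_nonneg_right (hlip k j (Finset.mem_range.1 hj)) (dB k j).1
      _ = Real.log 2 / (N + 1) * (B k 0 - B k (N + 1)) := by
          rw [← Finset.mul_sum, Finset.sum_range_sub']
      _ ≤ _ := mul_le_of_le_one_right (by positivity) (by linarith [(hB' k 0).2, (hB' k (N + 1)).1])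
  · calc _ ≤ ∑ j ∈ Finset.range (N + 1), coef k * (A k j - A k (j + 1)) :=
          Finset.sum_le_sum fun j hj => by
            refine mul_le_mul_of_nonneg_left ?_ (coef_pos k).le
            exact mul_le_of_le_one_right (dA k j).1 (dB k j).2
      _ = coef k * (A k 0 - A k (N + 1)) := by
          rw [← Finset.mul_sum, Finset.sum_range_sub']
      _ ≤ _ := mul_le_of_le_one_right (coef_pos k).le
        (by linarith [(hA' k 0).2, (hA' k (N + 1)).1])
  · refine Summable.of_nonneg_of_le (fun k => le_min (by positivity) (coef_pos k).le)
      (fun k => min_le_right _ _) coef_summable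

end Gexit
namespace Gexit

/-! ### The area under the BP GEXIT curve -/

lemma abs_mul_one_sub_le {s t b : ℝ} (hs : s ∈ Icc (0 : ℝ) 1) (ht : t ∈ Icc (0 : ℝ) 1)
    (hb : b ∈ Icc (0 : ℝ) 1) : |(s - t) * (1 - b)| ≤ 1 := by
  rw [abs_mul]
  exact mul_le_one₀ (abs_le.2 ⟨by linarith [hs.1, ht.2], by linarith [hs.2, ht.1]⟩) (abs_nonneg _)
    (abs_le.2 ⟨by linarith [hb.2], by linarith [hb.1]⟩)

namespace LDensity

lemma moment_mem (a : LDensity) (k : ℕ) : a.moment k ∈ Icc (0 : ℝ) 1 :=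
  ⟨a.moment_nonneg k, a.moment_le_one k⟩

lemma summable_moment (a b z : LDensity) :
    Summable fun k => coef k * ((a.moment k - b.moment k) * (1 - z.moment k)) :=
  summable_coef_mul fun k => abs_mul_one_sub_le (a.moment_mem k) (b.moment_mem k) (z.moment_mem k)

lemma hasSum_mutualInfo_add_sub (z a b : LDensity) :
    HasSum (fun k => coef k * ((a.moment k - b.moment k) * (1 - z.moment k)))
      ((z + a).mutualInfo - (z + b).mutualInfo) :=
  ((hasSum_mutualInfo_add z a).sub (hasSum_mutualInfo_add z b)).congr_fun fun k => by ring

lemma tsum_moment_le {a b z z' : LDensity} (h : b ≤ a) (hz : z ≤ z') :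
    ∑' k, coef k * ((a.moment k - b.moment k) * (1 - z'.moment k)) ≤
      ∑' k, coef k * ((a.moment k - b.moment k) * (1 - z.moment k)) :=
  (summable_moment a b z').tsum_le_tsum (fun k => mul_le_mul_of_nonneg_left
    (mul_le_mul_of_nonneg_left (by linarith [moment_mono hz k]) (sub_nonneg.2 (moment_mono h k)))
    (coef_pos k).le) (summable_moment a b z)

/-- The n + 1 copies of `b` are replaced by `a` one at a time. Each replacement happens next to
summands lying below z + n • a, and its gain decreases in those, so it is at least the common lower
bound. -/
lemma mutualInfo_nsmul_sub {a b : LDensity} (h : b ≤ a) (z : LDensity) (n : ℕ) :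
    (n + 1) * ∑' k, coef k * ((a.moment k - b.moment k) * (1 - (z + n • a).moment k)) ≤
      (z + (n + 1) • a).mutualInfo - (z + (n + 1) • b).mutualInfo := by
  induction n generalizing z with
  | zero => simp [(hasSum_mutualInfo_add_sub z a b).tsum_eq]
  | succ n ih =>
    have h1 := (hasSum_mutualInfo_add_sub (z + (n + 1) • a) a b).tsum_eq
    have h2 := ih (z + b)
    have h3 : z + b + n • a ≤ z + (n + 1) • a := by
      rw [succ_nsmul', ← add_assoc]
      exact add_mono (add_mono le_rfl h) le_rfl
    have h4 := tsum_moment_le h h3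
    have e1 : z + (n + 1) • a + a = z + (n + 1 + 1) • a := by rw [succ_nsmul _ (n + 1), add_assoc]
    have e2 : z + (n + 1) • a + b = z + b + (n + 1) • a := by
      rw [add_assoc, add_assoc, add_comm b]
    have e3 : z + b + (n + 1) • b = z + (n + 1 + 1) • b := by
      rw [succ_nsmul' _ (n + 1), add_assoc]
    rw [e1, e2] at h1
    rw [e3] at h2
    push_cast
    have h5 := mul_le_mul_of_nonneg_left h4 (by positivity : (0 : ℝ) ≤ n + 1)
    linarith

lemma moment_eq_zero_of_mutualInfo {a : LDensity} (h : a.mutualInfo = 0) (k : ℕ) :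
    a.moment k = 0 := by
  have h1 := coef_mul_sub_le (zero_le' a) k
  have h0 : (0 : LDensity).mutualInfo = 0 := by
    simp [← (hasSum_mutualInfo (0 : LDensity)).tsum_eq, moment_zero]
  rw [h, h0, moment_zero, sub_zero, sub_zero] at h1
  nlinarith [coef_pos k, a.moment_nonneg k]

lemma mutualInfo_eq_zero_of_moment {a : LDensity} (h : ∀ k, a.moment k = 0) : a.mutualInfo = 0 := by
  simp [← a.hasSum_mutualInfo.tsum_eq, h]

lemma moment_eq_one_of_mutualInfo {a : LDensity} (h : a.mutualInfo = Real.log 2) (k : ℕ) :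
    a.moment k = 1 := by
  have h1 := (coef_hasSum.sub a.hasSum_mutualInfo)
  rw [h, sub_self] at h1
  have hnn : ∀ j, 0 ≤ coef j - coef j * a.moment j := fun j =>
    sub_nonneg.2 (mul_le_of_le_one_right (coef_pos j).le (a.moment_le_one j))
  have h3 : coef k - coef k * a.moment k ≤ 0 := le_hasSum h1 k fun j _ => hnn j
  have := coef_pos k
  have h4 : coef k * (1 - a.moment k) = 0 := by linarith [hnn k]
  rcases mul_eq_zero.1 h4 with h | h <;> linarith

lemma mutualInfo_le (a : LDensity) : a.mutualInfo ≤ Real.log 2 :=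
  hasSum_le (fun k => mul_le_of_le_one_right (coef_pos k).le (a.moment_le_one k))
    a.hasSum_mutualInfo coef_hasSum

lemma le_nsmul (a : LDensity) (n : ℕ) : a ≤ (n + 1) • a := by
  rw [succ_nsmul']; exact le_add_right' _ _

end LDensity

namespace DegreePair

variable {P : DegreePair}

lemma le_node (a : LDensity) (k : ℕ) : a.moment k ≤ (P.node a).moment k := by
  rw [node, LDensity.moment_mix]
  calc a.moment k = ∑ j ∈ P.lam.support, P.varFraction (j + 1) * a.moment k := by
        rw [← Finset.sum_mul, sum_varFraction, one_mul]
    _ ≤ _ := Finset.sum_le_sum fun j _ =>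
        mul_le_mul_of_nonneg_left (LDensity.moment_mono (a.le_nsmul j) k) (P.varFraction_nonneg _)

variable (P) in
/-- The polynomial whose values at the moments of `a` are the averages, over the check nodes, of
the moments of the products of all incoming messages. -/
noncomputable def checkSum (t : ℝ) : ℝ :=
  ∑ k ∈ P.rho.support, P.checkFraction (k + 1) * t ^ (k + 1)

lemma pow_sub_pow_le {s t : ℝ} (ht : 0 ≤ t) (h : t ≤ s) (n : ℕ) :
    s ^ (n + 1) - t ^ (n + 1) ≤ (n + 1) * s ^ n * (s - t) := by
  have hs := ht.trans h
  induction n with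
  | zero => simp
  | succ n ih =>
    have h1 : s ^ (n + 1 + 1) - t ^ (n + 1 + 1) =
        s * (s ^ (n + 1) - t ^ (n + 1)) + t ^ (n + 1) * (s - t) := by ring
    have h2 := mul_le_mul_of_nonneg_left ih hs
    have h3 := mul_le_mul_of_nonneg_right (pow_le_pow_left₀ ht h (n + 1)) (sub_nonneg.2 h)
    rw [h1]
    push_cast
    calc _ ≤ s * ((n + 1) * s ^ n * (s - t)) + s ^ (n + 1) * (s - t) := add_le_add h2 h3
      _ = _ := by ring

/-- The derivative of `checkSum` is ρ / ∫ λ, which increases; the increment is bounded by the slope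
at the right end. -/
lemma checkSum_sub_le {s t : ℝ} (ht : 0 ≤ t) (h : t ≤ s) :
    P.checkSum s - P.checkSum t ≤ P.intLam⁻¹ * (P.rho.eval s * (s - t)) := by
  rw [checkSum, checkSum, ← Finset.sum_sub_distrib, Polynomial.eval_eq_sum, Polynomial.sum_def,
    Finset.sum_mul, Finset.mul_sum]
  refine Finset.sum_le_sum fun k _ => ?_
  rw [← mul_sub]
  have h1 := mul_le_mul_of_nonneg_left (pow_sub_pow_le ht h k) (P.checkFraction_nonneg (k + 1))
  have h2 := P.succ_mul_checkFraction k
  calc _ ≤ _ := h1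
    _ = ((k + 1) * P.checkFraction (k + 1)) * (s ^ k * (s - t)) := by ring
    _ = _ := by rw [h2, div_eq_mul_inv]; ring

lemma checkSum_one : P.checkSum 1 = 1 - P.designRate := by
  simp [checkSum, sum_checkFraction, designRate]

lemma checkSum_zero : P.checkSum 0 = 0 := by simp [checkSum]

lemma checkSum_mono {s t : ℝ} (hs : 0 ≤ s) (h : s ≤ t) : P.checkSum s ≤ P.checkSum t :=
  Finset.sum_le_sum fun _ _ =>
    mul_le_mul_of_nonneg_left (pow_le_pow_left₀ hs h _) (P.checkFraction_nonneg _)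

/-- This is the passage from node to edge perspective: (j + 1) times the fraction of nodes of degree
j + 1 is λ_j / ∫ λ. Replacing the j + 1 messages one at a time leaves j others, which average to
`varD`. -/
lemma mutualInfo_node_sub {y y' : LDensity} (h : y' ≤ y) (c : LDensity) :
    P.intLam⁻¹ * ∑' k, coef k * ((y.moment k - y'.moment k) * (1 - (c + P.varD y).moment k)) ≤
      (c + P.node y).mutualInfo - (c + P.node y').mutualInfo := by
  have hsum : ∀ j : ℕ, Summable fun k =>
      coef k * ((y.moment k - y'.moment k) * (1 - (c + j • y).moment k)) := fun j =>
    LDensity.summable_moment y y' (c + j • y)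
  have e : ∑' k, coef k * ((y.moment k - y'.moment k) * (1 - (c + P.varD y).moment k)) =
      ∑ j ∈ P.lam.support, P.lam.coeff j *
        ∑' k, coef k * ((y.moment k - y'.moment k) * (1 - (c + j • y).moment k)) := by
    simp_rw [← tsum_mul_left]
    rw [← Summable.tsum_finsetSum fun j _ => (hsum j).mul_left _]
    refine tsum_congr fun k => ?_
    have h1 : (1 : ℝ) - (c + P.varD y).moment k =
        ∑ j ∈ P.lam.support, P.lam.coeff j * (1 - (c + j • y).moment k) := by
      simp only [varD, LDensity.add_mix, LDensity.moment_mix, mul_sub, Finset.sum_sub_distrib,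
        mul_one, P.sum_lam]
    rw [h1, Finset.mul_sum, Finset.mul_sum]
    exact Finset.sum_congr rfl fun j _ => by ring
  rw [e, node, node, LDensity.add_mix, LDensity.add_mix, LDensity.mutualInfo_mix,
    LDensity.mutualInfo_mix, ← Finset.sum_sub_distrib, Finset.mul_sum]
  refine Finset.sum_le_sum fun j _ => ?_
  have h1 := mul_le_mul_of_nonneg_left (LDensity.mutualInfo_nsmul_sub h c j)
    (P.varFraction_nonneg (j + 1))
  rw [mul_sub] at h1
  refine le_trans (le_of_eq ?_) h1
  have h2 := P.succ_mul_varFraction j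
  rw [← mul_assoc (P.varFraction _), mul_comm (P.varFraction _), h2]
  ring

variable (P) in
/-- The potential of density evolution, whose increments dominate the area under the BP GEXIT
curve. -/
noncomputable def potential (c a : LDensity) : ℝ :=
  (c + P.node (P.checkD a)).mutualInfo - P.intLam⁻¹ * (P.checkD a).mutualInfo +
    ∑' k, coef k * (P.intLam⁻¹ * (a.moment k * P.rho.eval (a.moment k)) - P.checkSum (a.moment k))

lemma rho_eval_mem {t : ℝ} (ht : t ∈ Icc (0 : ℝ) 1) : P.rho.eval t ∈ Icc (0 : ℝ) 1 := by
  have h := P.sum_rho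
  rw [Polynomial.eval_eq_sum, Polynomial.sum_def]
  refine ⟨Finset.sum_nonneg fun k _ => mul_nonneg (P.rho_nonneg k) (pow_nonneg ht.1 _), ?_⟩
  rw [← h]
  exact Finset.sum_le_sum fun k _ => mul_le_of_le_one_right (P.rho_nonneg k) (pow_le_one₀ ht.1 ht.2)

lemma rho_eval_mono {s t : ℝ} (hs : 0 ≤ s) (h : s ≤ t) : P.rho.eval s ≤ P.rho.eval t := by
  simp only [Polynomial.eval_eq_sum, Polynomial.sum_def]
  exact Finset.sum_le_sum fun k _ =>
    mul_le_mul_of_nonneg_left (pow_le_pow_left₀ hs h _) (P.rho_nonneg k)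

lemma summable_potential (a : LDensity) : Summable fun k => coef k *
    (P.intLam⁻¹ * (a.moment k * P.rho.eval (a.moment k)) - P.checkSum (a.moment k)) := by
  refine summable_coef_mul (C := P.intLam⁻¹ + P.checkSum 1) fun k => ?_
  have h1 := a.moment_mem k
  have h2 := P.rho_eval_mem h1
  have h3 := P.intLam_pos
  have h4 := checkSum_mono (P := P) h1.1 h1.2
  have h5 := checkSum_mono (P := P) le_rfl h1.1
  rw [checkSum_zero] at h5
  have h6 : P.intLam⁻¹ * (a.moment k * P.rho.eval (a.moment k)) ≤ P.intLam⁻¹ :=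
    mul_le_of_le_one_right (inv_pos.2 h3).le (mul_le_one₀ h1.2 h2.1 h2.2)
  have h7 : 0 ≤ P.intLam⁻¹ * (a.moment k * P.rho.eval (a.moment k)) :=
    mul_nonneg (inv_pos.2 h3).le (mul_nonneg h1.1 h2.1)
  exact abs_le.2 ⟨by linarith, by linarith⟩

/-- Write m, m' for the moments of a, a'. Passing from `P.checkD a'` to `P.checkD a` raises the node
information by at least ∑ coef (ρ(m) - ρ(m')) (1 - m) / ∫ λ, since c + λ(ρ(a)) = a at the fixed
point. The potential is chosen so that these terms and the convexity bound for `checkSum` cancel, up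
to the second-order error (m - m') (ρ(m) - ρ(m')). -/
lemma potential_step {c c' a a' : LDensity} (ha : a' ≤ a) (hf : a = P.step c a) :
    (c + P.node (P.checkD a')).mutualInfo - (c' + P.node (P.checkD a')).mutualInfo ≤
      P.potential c a - P.potential c' a' + P.intLam⁻¹ * ∑' k, coef k *
        ((a.moment k - a'.moment k) * (P.rho.eval (a.moment k) - P.rho.eval (a'.moment k))) := by
  have h1 := mutualInfo_node_sub (P := P) (checkD_mono (P := P) ha) c
  have hL : 0 < P.intLam⁻¹ := inv_pos.2 P.intLam_pos
  have e1 : c + P.varD (P.checkD a) = a := hf.symm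
  rw [e1] at h1
  simp only [moment_checkD] at h1
  have hr : ∀ k, P.rho.eval (a.moment k) - P.rho.eval (a'.moment k) ∈ Icc (0 : ℝ) 1 := fun k =>
    ⟨sub_nonneg.2 (rho_eval_mono (a'.moment_nonneg k) (LDensity.moment_mono ha k)),
      by linarith [(P.rho_eval_mem (a.moment_mem k)).2, (P.rho_eval_mem (a'.moment_mem k)).1]⟩
  have hd : ∀ k, a.moment k - a'.moment k ∈ Icc (0 : ℝ) 1 := fun k =>
    ⟨sub_nonneg.2 (LDensity.moment_mono ha k),
      by linarith [(a.moment_mem k).2, (a'.moment_mem k).1]⟩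
  have s1 : Summable fun k => coef k *
      ((P.rho.eval (a.moment k) - P.rho.eval (a'.moment k)) * (1 - a.moment k)) :=
    summable_coef_mul fun k => abs_mul_one_sub_le (P.rho_eval_mem (a.moment_mem k))
      (P.rho_eval_mem (a'.moment_mem k)) (a.moment_mem k)
  have s2 : Summable fun k => coef k *
      ((a.moment k - a'.moment k) * (P.rho.eval (a.moment k) - P.rho.eval (a'.moment k))) :=
    summable_coef_mul (C := 1) fun k => by
      rw [abs_of_nonneg (mul_nonneg (hd k).1 (hr k).1)]
      exact mul_le_one₀ (hd k).2 (hr k).1 (hr k).2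
  have s3 := (P.checkD a).hasSum_mutualInfo.sub (P.checkD a').hasSum_mutualInfo
  have s4 := (summable_potential (P := P) a).hasSum.sub (summable_potential (P := P) a').hasSum
  simp only [moment_checkD] at s3
  have key := hasSum_le (fun k => ?_) (s3.mul_left P.intLam⁻¹)
    ((s4.add (s2.hasSum.mul_left P.intLam⁻¹)).add (s1.hasSum.mul_left P.intLam⁻¹))
  · unfold potential
    linarith
  · have := checkSum_sub_le (P := P) (a'.moment_nonneg k) (LDensity.moment_mono ha k)
    have := mul_le_mul_of_nonneg_left this (coef_pos k).le
    refine le_of_sub_nonneg (le_of_le_of_eq (sub_nonneg.2 this) ?_)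
    ring

/-- At the perfect fixed point the terms with 1 / ∫ λ cancel, and `checkSum 1` is 1 minus the design
rate. -/
lemma potential_of_one {c a : LDensity} (h : ∀ k, a.moment k = 1) :
    P.potential c a ≤ Real.log 2 * P.designRate := by
  have hy : (P.checkD a).mutualInfo = Real.log 2 := by
    rw [← (P.checkD a).hasSum_mutualInfo.tsum_eq, ← coef_hasSum.tsum_eq]
    exact tsum_congr fun k => by rw [moment_checkD, h, P.rho_one, mul_one]
  have h1 := (c + P.node (P.checkD a)).mutualInfo_le
  unfold potential
  simp only [h, P.rho_one, hy, checkSum_one]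
  rw [tsum_mul_right, coef_hasSum.tsum_eq]
  linarith

/-- If the fixed point carries no information, neither does λ(ρ(a)). A variable node of degree at
least two in the support then forces ρ(a) to carry none, so its contribution vanishes; for degree
one the node and edge contributions coincide. -/
lemma potential_of_zero {c a : LDensity} (hf : a = P.step c a) (h : ∀ k, a.moment k = 0) :
    0 ≤ P.potential c a := by
  have h0 : ∀ j ∈ P.lam.support, ∀ k, (j • P.checkD a).moment k = 0 := by
    intro j hj k
    have h1 : (P.varD (P.checkD a)).moment k ≤ 0 := by
      rw [← h k]
      conv_rhs => rw [hf]
      exact LDensity.moment_mono (by rw [step, add_comm]; exact LDensity.le_add_right' _ _) k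
    rw [varD, LDensity.moment_mix] at h1
    have hnn : ∀ j ∈ P.lam.support, 0 ≤ P.lam.coeff j * (j • P.checkD a).moment k := fun j _ =>
      mul_nonneg (P.lam_nonneg j) (LDensity.moment_nonneg _ _)
    have h2 := (Finset.sum_eq_zero_iff_of_nonneg hnn).1 (le_antisymm h1 (Finset.sum_nonneg hnn)) j hj
    exact (mul_eq_zero.1 h2).resolve_left (Polynomial.mem_support_iff.1 hj)
  have h1 : P.intLam⁻¹ * (P.checkD a).mutualInfo ≤ (P.node (P.checkD a)).mutualInfo := by
    rw [node, LDensity.mutualInfo_mix]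
    have e : P.intLam⁻¹ = ∑ j ∈ P.lam.support, (j + 1) * P.varFraction (j + 1) := by
      simp only [succ_mul_varFraction]
      rw [← Finset.sum_div, P.sum_lam, one_div]
    rw [e, Finset.sum_mul]
    refine Finset.sum_le_sum fun j hj => ?_
    rcases j with _ | j
    · simp
    · have hz : (P.checkD a).mutualInfo = 0 :=
        LDensity.mutualInfo_eq_zero_of_moment fun k => le_antisymm
          ((LDensity.moment_mono ((P.checkD a).le_nsmul j) k).trans (h0 _ hj k).le)
          (LDensity.moment_nonneg _ _)
      rw [hz, mul_zero]
      exact mul_nonneg (P.varFraction_nonneg _) (LDensity.mutualInfo_nonneg _)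
  have h2 : (P.node (P.checkD a)).mutualInfo ≤ (c + P.node (P.checkD a)).mutualInfo :=
    LDensity.mutualInfo_mono (by rw [add_comm]; exact LDensity.le_add_right' _ _)
  unfold potential
  simp only [h, checkSum_zero, zero_mul, mul_zero, sub_zero, tsum_zero]
  linarith

end DegreePair

/-- The BP GEXIT function of the limiting ensemble. -/
noncomputable def bpLimit (P : DegreePair) (c : ℝ → LDensity) (h : ℝ) : ℝ :=
  ∑' k, weight c k h * (1 - P.outLim (c h) k)

/-- A complete family of BP fixed points of a family of channels. -/
structure IsBPFamily (P : DegreePair) (c : ℝ → LDensity) (η : ℝ → ℝ) (f : ℝ → LDensity) :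
    Prop where
  mem : ∀ x ∈ Icc (0 : ℝ) 1, η x ∈ Icc (0 : ℝ) 1
  fixed : ∀ x ∈ Icc (0 : ℝ) 1, f x = P.step (c (η x)) (f x)
  ent : ∀ x ∈ Icc (0 : ℝ) 1, (f x).mutualInfo = Real.log 2 * (1 - x)
  bp : ∀ x ∈ Icc (0 : ℝ) 1, P.IsBPFixedPoint (c (η x)) (f x)

lemma HasCompleteBPFamily.exists_isBPFamily {P : DegreePair} {c : ℝ → LDensity}
    (h : HasCompleteBPFamily P c) : ∃ η f, IsBPFamily P c η f := by
  obtain ⟨η, f, hf, hb⟩ := h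
  exact ⟨η, f, hf.mem, fun x hx => LDensity.ext_law (by rw [DegreePair.law_step, ← hf.fixed x hx]),
    fun x hx => by rw [LDensity.mutualInfo_eq, hf.entropy_eq x hx], hb⟩

namespace IsBPFamily

variable {P : DegreePair} {c : ℝ → LDensity} {η : ℝ → ℝ} {f : ℝ → LDensity}

/-- Were η y < η x with x < y, monotonicity of BP in the channel would give f x ≤ f y, against the
entropies x < y. Ordered channels then give ordered fixed points. -/
lemma mono (hc : IsChannelFamily c) (hf : IsBPFamily P c η f) {x y : ℝ} (hx : x ∈ Icc (0 : ℝ) 1)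
    (hy : y ∈ Icc (0 : ℝ) 1) (h : x ≤ y) : η x ≤ η y ∧ f y ≤ f x := by
  rcases h.eq_or_lt with rfl | h
  · exact ⟨le_rfl, le_rfl⟩
  have hη : η x ≤ η y := by
    by_contra! hlt
    have h1 := LDensity.mutualInfo_mono (DegreePair.IsBPFixedPoint.mono (hf.bp x hx) (hf.bp y hy)
      (hc.anti (hf.mem y hy) (hf.mem x hx) hlt.le))
    rw [hf.ent x hx, hf.ent y hy] at h1
    nlinarith [log_two_pos]
  exact ⟨hη, DegreePair.IsBPFixedPoint.mono (hf.bp y hy) (hf.bp x hx)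
    (hc.anti (hf.mem x hx) (hf.mem y hy) hη)⟩

lemma apply_one (hc : IsChannelFamily c) (hf : IsBPFamily P c η f) : η 1 = 1 := by
  have h1 : (1 : ℝ) ∈ Icc (0 : ℝ) 1 := by norm_num
  have h2 : c (η 1) ≤ f 1 := by
    rw [hf.fixed 1 h1]; exact LDensity.le_add_right' _ _
  have h3 := LDensity.mutualInfo_mono h2
  rw [hf.ent 1 h1, hc.mutualInfo_eq (hf.mem 1 h1), sub_self, mul_zero] at h3
  have := (hf.mem 1 h1).2
  nlinarith [log_two_pos]

lemma moment_zero_eq_one (hf : IsBPFamily P c η f) (k : ℕ) : (f 0).moment k = 1 :=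
  LDensity.moment_eq_one_of_mutualInfo (by rw [hf.ent 0 (by norm_num)]; ring) k

lemma moment_one_eq_zero (hf : IsBPFamily P c η f) (k : ℕ) : (f 1).moment k = 0 :=
  LDensity.moment_eq_zero_of_mutualInfo (by rw [hf.ent 1 (by norm_num)]; ring) k

/-- η 0 acts as the BP threshold: the fixed point there is perfect, and better channels do no worse.
The BP curve vanishes below it. -/
lemma outLim_eq_one (hc : IsChannelFamily c) (hf : IsBPFamily P c η f) {h : ℝ} (h0 : 0 ≤ h)
    (hh : h ≤ η 0) (k : ℕ) : P.outLim (c h) k = 1 := by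
  have hz : (0 : ℝ) ∈ Icc (0 : ℝ) 1 := by norm_num
  refine le_antisymm (DegreePair.outLim_le_one _ _) ?_
  have h1 := hc.anti ⟨h0, hh.trans (hf.mem 0 hz).2⟩ (hf.mem 0 hz) hh
  refine le_trans ?_ (DegreePair.outLim_mono h1 k)
  rw [DegreePair.outLim_eq (hf.bp 0 hz) (hf.fixed 0 hz)]
  refine le_trans ?_ (DegreePair.le_node _ _)
  rw [DegreePair.moment_checkD, hf.moment_zero_eq_one, P.rho_one]

end IsBPFamily

lemma outLim_antitoneOn {P : DegreePair} {c : ℝ → LDensity} (hc : IsChannelFamily c) (k : ℕ) :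
    AntitoneOn (fun h => P.outLim (c h) k) (Icc 0 1) :=
  fun _ hs _ ht h => DegreePair.outLim_mono (hc.anti hs ht h) k

lemma outLim_mem (P : DegreePair) (a : LDensity) (k : ℕ) : P.outLim a k ∈ Icc (0 : ℝ) 1 :=
  ⟨DegreePair.outLim_nonneg _ _, DegreePair.outLim_le_one _ _⟩

lemma integrableOn_bpLimit {P : DegreePair} {c : ℝ → LDensity} (hc : IsChannelFamily c) :
    IntegrableOn (bpLimit P c) (Ioo 0 1) :=
  hc.integrableOn_tsum (b := fun k h => P.outLim (c h) k) (fun k => outLim_antitoneOn hc k)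
    fun k h _ => outLim_mem P (c h) k

/-- The area under the BP GEXIT curve is at most the design rate. -/
theorem integral_bpLimit_le {P : DegreePair} {c : ℝ → LDensity} (hc : IsChannelFamily c)
    {η : ℝ → ℝ} {f : ℝ → LDensity} (hf : IsBPFamily P c η f) :
    ∫ h in Ioo (0 : ℝ) 1, bpLimit P c h ≤ P.designRate := by
  have hl := log_two_pos
  have hL : 0 < P.intLam⁻¹ := inv_pos.2 P.intLam_pos
  have hz : (0 : ℝ) ∈ Icc (0 : ℝ) 1 := by norm_num
  have ho : (1 : ℝ) ∈ Icc (0 : ℝ) 1 := by norm_num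
  have key : ∀ N : ℕ, Real.log 2 * ∫ h in Ioo (0 : ℝ) 1, bpLimit P c h ≤
      Real.log 2 * P.designRate + P.intLam⁻¹ * meshError N := by
    intro N
    have hN : (0 : ℝ) < N + 1 := by positivity
    -- The partition is uniform in the entropy of the fixed point, and the parameter interval is cut
    -- at the points η (x j). The error then involves increments of the moments of f only, and no
    -- modulus of continuity of η enters. The minimum with 1 keeps the points in range for every j.
    set x : ℕ → ℝ := fun j => min ((j : ℝ) / (N + 1)) 1 with hx
    have hxm : ∀ j, x j ∈ Icc (0 : ℝ) 1 := fun j =>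
      ⟨le_min (by positivity) zero_le_one, min_le_right _ _⟩
    have hxmono : Monotone x := fun i j h => min_le_min_right _ (by gcongr)
    have hx0 : x 0 = 0 := by simp [hx]
    have hx1 : x (N + 1) = 1 := by simp [hx, div_self hN.ne']
    have hxs : ∀ j < N + 1, x (j + 1) - x j = 1 / (N + 1) := by
      intro j hj
      have hj' : (j : ℝ) + 1 ≤ N + 1 := by exact_mod_cast hj
      have e1 : x j = j / (N + 1) := min_eq_left ((div_le_one hN).2 (by linarith))
      have e2 : x (j + 1) = (j + 1) / (N + 1) := by
        have : ((j + 1 : ℕ) : ℝ) / (N + 1) ≤ 1 := (div_le_one hN).2 (by push_cast; linarith)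
        simp only [hx]
        rw [min_eq_left this]; push_cast; rfl
      rw [e1, e2]; ring
    have hmono : ∀ {i j}, i ≤ j → η (x i) ≤ η (x j) ∧ f (x j) ≤ f (x i) := fun h =>
      hf.mono hc (hxm _) (hxm _) (hxmono h)
    have hint : ∀ s ∈ Icc (0 : ℝ) 1, ∀ t ∈ Icc (0 : ℝ) 1, s ≤ t →
        IntervalIntegrable (bpLimit P c) volume s t := fun s hs t ht h => by
      rw [intervalIntegrable_iff_integrableOn_Ioo_of_le h]
      exact (integrableOn_bpLimit hc).mono_set (Ioo_subset_Ioo hs.1 ht.2)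
    have hIoo : ∀ s t : ℝ, s ≤ t →
        ∫ h in s..t, bpLimit P c h = ∫ h in Ioo s t, bpLimit P c h := fun s t h => by
      rw [intervalIntegral.integral_of_le h, integral_Ioc_eq_integral_Ioo]
    have hη := hf.mem
    -- The interval below η 0 contributes nothing, because all extrinsic moments are 1 there.
    have h0 : ∫ h in (0 : ℝ)..(η 0), bpLimit P c h = 0 := by
      rw [hIoo _ _ (hη 0 hz).1, setIntegral_congr_fun (g := fun _ => 0) measurableSet_Ioo]
      · simp
      · intro h hh
        simp only [bpLimit]
        simp [hf.outLim_eq_one hc hh.1.le hh.2.le]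
    have hsplit : ∫ h in Ioo (0 : ℝ) 1, bpLimit P c h =
        ∑ j ∈ Finset.range (N + 1), ∫ h in (η (x j))..(η (x (j + 1))), bpLimit P c h := by
      rw [intervalIntegral.sum_integral_adjacent_intervals (a := fun j => η (x j)) fun j _ =>
        hint _ (hη _ (hxm j)) _ (hη _ (hxm _)) (hmono j.le_succ).1]
      rw [hx0, hx1, hf.apply_one hc, ← hIoo 0 1 zero_le_one,
        ← intervalIntegral.integral_add_adjacent_intervals
          (hint 0 hz _ (hη 0 hz) (hη 0 hz).1) (hint _ (hη 0 hz) 1 ho (hη 0 hz).2), h0, zero_add]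
    have hstep : ∀ j, Real.log 2 * ∫ h in (η (x j))..(η (x (j + 1))), bpLimit P c h ≤
        P.potential (c (η (x j))) (f (x j)) -
          P.potential (c (η (x (j + 1)))) (f (x (j + 1))) +
        P.intLam⁻¹ * ∑' k, coef k * (((f (x j)).moment k - (f (x (j + 1))).moment k) *
          (P.rho.eval ((f (x j)).moment k) - P.rho.eval ((f (x (j + 1))).moment k))) := by
      intro j
      have h1 := (hmono j.le_succ)
      refine le_trans ?_ (DegreePair.potential_step h1.2 (hf.fixed _ (hxm j)))
      rw [hIoo _ _ h1.1]
      refine ((hc.integral_bounds (b := fun k h => P.outLim (c h) k) (fun k => outLim_antitoneOn hc k)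
        (fun k h _ => outLim_mem P (c h) k) (hη _ (hxm j)).1 (hη _ (hxm (j + 1))).2 h1.1).2).trans ?_
      refine le_of_eq ?_
      -- At the right end of the cell the extrinsic moments are those of the node output at `f (x (j
      -- + 1))`, so the upper Stieltjes sum is exactly an information difference with that output
      -- held fixed.
      simp only [DegreePair.outLim_eq (hf.bp _ (hxm (j + 1))) (hf.fixed _ (hxm (j + 1)))]
      rw [(LDensity.hasSum_mutualInfo_add_sub _ _ _).tsum_eq, add_comm _ (c _), add_comm _ (c _)]
    rw [hsplit, Finset.mul_sum]
    refine (Finset.sum_le_sum fun j _ => hstep j).trans ?_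
    rw [Finset.sum_add_distrib, Finset.sum_range_sub', ← Finset.mul_sum, hx0, hx1]
    have h1 := DegreePair.potential_of_one (P := P) (c := c (η 0)) hf.moment_zero_eq_one
    have h2 := DegreePair.potential_of_zero (hf.fixed 1 ho) hf.moment_one_eq_zero
    have h3 := sum_mesh_le N (A := fun k j => (f (x j)).moment k)
      (B := fun k j => P.rho.eval ((f (x j)).moment k))
      (fun k i j h => LDensity.moment_mono (hmono h).2 k)
      (fun k i j h => DegreePair.rho_eval_mono (LDensity.moment_nonneg _ _)
        (LDensity.moment_mono (hmono h).2 k))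
      (fun k j => LDensity.moment_mem _ _) (fun k j => DegreePair.rho_eval_mem
        (LDensity.moment_mem _ _)) fun k j hj => by
        refine (LDensity.coef_mul_sub_le (hmono j.le_succ).2 k).trans (le_of_eq ?_)
        rw [hf.ent _ (hxm j), hf.ent _ (hxm (j + 1)), div_eq_mul_one_div, ← hxs j hj]
        ring
    have h4 := mul_le_mul_of_nonneg_left h3 hL.le
    linarith
  have hlim : Tendsto (fun N => Real.log 2 * P.designRate + P.intLam⁻¹ * meshError N) atTop
      (𝓝 (Real.log 2 * P.designRate + P.intLam⁻¹ * 0)) :=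
    (tendsto_meshError.const_mul _).const_add _
  have := ge_of_tendsto' hlim key
  rw [mul_zero, add_zero] at this
  exact le_of_mul_le_mul_left this hl

end Gexit
namespace Gexit

/-! ### Conditional entropy of a bit -/

instance : DiscreteMeasurableSpace ℤˣ :=
  ⟨fun s => ⟨Units.val '' s, MeasurableSet.of_discrete, by
    rw [preimage_image_eq _ Units.val_injective]⟩⟩

lemma sign_sq (x : ℤˣ) : ((x : ℤ) : ℝ) * ((x : ℤ) : ℝ) = 1 := by
  rcases Int.units_eq_one_or x with rfl | rfl <;> simp

lemma abs_sign (x : ℤˣ) : |((x : ℤ) : ℝ)| = 1 := by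
  rcases Int.units_eq_one_or x with rfl | rfl <;> simp

lemma sign_mem (x : ℤˣ) : ((x : ℤ) : ℝ) ∈ Icc (-1 : ℝ) 1 := abs_le.1 (abs_sign x).le

/-- `u` is a version of the conditional expectation of the bit `X` given `Z`. -/
structure IsCondMean {Ω S : Type*} [MeasurableSpace Ω] [MeasurableSpace S] (μ : Measure Ω)
    (X : Ω → ℤˣ) (Z : Ω → S) (u : S → ℝ) : Prop where
  meas : Measurable u
  mem : ∀ s, u s ∈ Icc (-1 : ℝ) 1
  eq : ∀ (f : S → ℝ) (M : ℝ), Measurable f → (∀ s, |f s| ≤ M) →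
    ∫ ω, ((X ω : ℤ) : ℝ) * f (Z ω) ∂μ = ∫ ω, u (Z ω) * f (Z ω) ∂μ

/-- Clamping of a real number to `[-1, 1]`. -/
noncomputable def clamp (x : ℝ) : ℝ := max (-1) (min 1 x)

lemma clamp_mem (x : ℝ) : clamp x ∈ Icc (-1 : ℝ) 1 :=
  ⟨le_max_left _ _, max_le (by norm_num) (min_le_left _ _)⟩

lemma clamp_of_mem {x : ℝ} (h : x ∈ Icc (-1 : ℝ) 1) : clamp x = x := by
  rw [clamp, min_eq_right h.2, max_eq_right h.1]

@[fun_prop]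
lemma measurable_clamp : Measurable clamp := by unfold clamp; fun_prop

section condMean

lemma abs_indicator_le {S : Type*} (B : Set S) (s : S) : |B.indicator (1 : S → ℝ) s| ≤ 1 := by
  by_cases h : s ∈ B <;> simp [indicator, h]

variable {Ω S : Type*} [MeasurableSpace Ω] [MeasurableSpace S] {μ : Measure Ω}
  {X : Ω → ℤˣ} {Z : Ω → S} {u : S → ℝ}

lemma measurable_sign (hX : Measurable X) : Measurable fun ω => ((X ω : ℤ) : ℝ) :=
  (Measurable.of_discrete (f := fun x : ℤˣ => ((x : ℤ) : ℝ))).comp hX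

lemma integrable_sign_mul (hX : Measurable X) {f : Ω → ℝ} (hf : Integrable f μ) :
    Integrable (fun ω => ((X ω : ℤ) : ℝ) * f ω) μ :=
  hf.bdd_mul (c := 1) (measurable_sign hX).aestronglyMeasurable
    (ae_of_all _ fun ω => (abs_sign (X ω)).le)

lemma IsCondMean.integrable_mul (h : IsCondMean μ X Z u) (hZ : Measurable Z) {f : Ω → ℝ}
    (hf : Integrable f μ) : Integrable (fun ω => u (Z ω) * f ω) μ :=
  hf.bdd_mul (c := 1) (h.meas.comp hZ).aestronglyMeasurable
    (ae_of_all _ fun ω => abs_le.2 (h.mem (Z ω)))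

lemma setIntegral_comp {B : Set S} (hB : MeasurableSet B) (hZ : Measurable Z) (f : Ω → ℝ) :
    ∫ ω in Z ⁻¹' B, f ω ∂μ = ∫ ω, f ω * B.indicator 1 (Z ω) ∂μ := by
  rw [← integral_indicator (hZ hB)]
  refine integral_congr_ae (ae_of_all _ fun ω => ?_)
  by_cases hω : Z ω ∈ B <;> simp [indicator, hω]

/-- Only the σ-algebra generated by the observation matters. -/
lemma condEntropy_congr_comap {S' : Type*} [MeasurableSpace S'] {Z' : Ω → S'} {e : S → S'}
    {e' : S' → S} (he : Measurable e) (he' : Measurable e') (h : ∀ ω, e (Z ω) = Z' ω)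
    (h' : ∀ ω, e' (Z' ω) = Z ω) : condEntropy μ X Z = condEntropy μ X Z' := by
  have hc : MeasurableSpace.comap Z inferInstance = MeasurableSpace.comap Z' inferInstance := by
    refine le_antisymm ?_ ?_
    · rintro _ ⟨B, hB, rfl⟩
      exact ⟨e' ⁻¹' B, he' hB, by ext ω; simp [h']⟩
    · rintro _ ⟨B, hB, rfl⟩
      exact ⟨e ⁻¹' B, he hB, by ext ω; simp [h]⟩
  unfold condEntropy
  rw [hc]

variable [IsProbabilityMeasure μ]

lemma IsCondMean.condExp_indicator (h : IsCondMean μ X Z u) (hX : Measurable X)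
    (hZ : Measurable Z) (a : ℤˣ) :
    (fun ω => (1 + ((a : ℤ) : ℝ) * u (Z ω)) / 2) =ᵐ[μ]
      μ[(X ⁻¹' {a}).indicator (fun _ => (1 : ℝ)) | MeasurableSpace.comap Z inferInstance] := by
  -- For signs, the indicator of X = a is (1 + a X) / 2, so conditional probabilities reduce to the
  -- conditional mean.
  have e : (X ⁻¹' {a}).indicator (fun _ => (1 : ℝ)) =
      fun ω => (1 + ((a : ℤ) : ℝ) * ((X ω : ℤ) : ℝ)) / 2 := by
    funext ω
    by_cases hω : X ω = a
    · rw [indicator_of_mem (by simpa using hω), hω, sign_sq]; norm_num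
    · rw [indicator_of_notMem (by simpa using hω)]
      have : X ω = -a := Int.units_ne_iff_eq_neg.1 hω
      rw [this]
      push_cast
      rw [mul_neg, sign_sq]; norm_num
  have hi : Integrable (fun ω => u (Z ω)) μ := by
    simpa using h.integrable_mul hZ (integrable_const (1 : ℝ))
  have hXi : Integrable (fun ω => ((X ω : ℤ) : ℝ)) μ := by
    simpa using integrable_sign_mul hX (integrable_const (μ := μ) (1 : ℝ))
  have hi' : ∀ g : Ω → ℝ, Integrable g μ →
      Integrable (fun ω => (1 + ((a : ℤ) : ℝ) * g ω) / 2) μ := fun g hg =>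
    ((integrable_const _).add (hg.const_mul _)).div_const _
  refine ae_eq_condExp_of_forall_setIntegral_eq hZ.comap_le ?_ (fun s _ _ =>
    (hi' _ hi).integrableOn) ?_ ?_
  · rw [e]; exact hi' _ hXi
  · rintro _ ⟨B, hB, rfl⟩ -
    rw [e]
    have h1 : ∀ g : Ω → ℝ, Integrable g μ →
        ∫ ω in Z ⁻¹' B, (1 + ((a : ℤ) : ℝ) * g ω) / 2 ∂μ =
          (∫ ω in Z ⁻¹' B, (1 : ℝ) ∂μ + ((a : ℤ) : ℝ) * ∫ ω in Z ⁻¹' B, g ω ∂μ) / 2 := by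
      intro g hg
      rw [integral_div, integral_add (integrable_const _) (hg.integrableOn.const_mul _),
        integral_const_mul]
    rw [h1 _ hi, h1 _ hXi, setIntegral_comp hB hZ (fun ω => u (Z ω)),
      setIntegral_comp hB hZ (fun ω => ((X ω : ℤ) : ℝ)),
      h.eq _ 1 (measurable_one.indicator hB) (abs_indicator_le B)]
  · refine Measurable.aestronglyMeasurable (Measurable.div_const ?_ _)
    exact ((h.meas.comp (comap_measurable Z)).const_mul _).const_add _

lemma IsCondMean.condEntropy_eq (h : IsCondMean μ X Z u) (hX : Measurable X)
    (hZ : Measurable Z) :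
    condEntropy μ X Z = (Real.log 2 - ∫ ω, info (u (Z ω)) ∂μ) / Real.log 2 := by
  unfold condEntropy
  congr 1
  have hi : Integrable (fun ω => info (u (Z ω))) μ :=
    integrable_of_bdd (M := Real.log 2) (measurable_info.comp (h.meas.comp hZ))
      (ae_of_all _ fun ω => LDensity.abs_info_le (h.mem _))
  have e : ∫ ω, (Real.log 2 - info (u (Z ω))) ∂μ = Real.log 2 - ∫ ω, info (u (Z ω)) ∂μ := by
    rw [integral_sub (integrable_const _) hi]; simp
  rw [← e]
  refine integral_congr_ae ?_
  filter_upwards [h.condExp_indicator hX hZ 1, h.condExp_indicator hX hZ (-1)] with ω h1 h2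
  rw [UnitsInt.univ, Finset.sum_insert (by decide), Finset.sum_singleton, ← h1, ← h2,
    ← negMulLog_add]
  simp [sub_eq_add_neg]

variable (μ) in
lemma exists_isCondMean (hX : Measurable X)
    (hZ : Measurable Z) : ∃ u, IsCondMean μ X Z u := by
  have hXi : Integrable (fun ω => ((X ω : ℤ) : ℝ)) μ := by
    simpa using integrable_sign_mul hX (integrable_const (μ := μ) (1 : ℝ))
  obtain ⟨v, hv, hve⟩ := (stronglyMeasurable_condExp (μ := μ) (m := MeasurableSpace.comap Z
    inferInstance) (f := fun ω => ((X ω : ℤ) : ℝ))).measurable.exists_eq_measurable_comp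
  have hb : ∀ᵐ ω ∂μ, |(μ[fun ω => ((X ω : ℤ) : ℝ) | MeasurableSpace.comap Z inferInstance]) ω| ≤
      1 := by
    refine ae_bdd_abs_condExp_of_ae_bdd_abs (ae_of_all _ fun ω => ?_)
    simp [abs_sign]
  -- The factor through Z is bounded by 1 only almost surely; clamping gives a version bounded
  -- everywhere.
  refine ⟨fun s => clamp (v s), by fun_prop, fun s => clamp_mem _, fun f M hf hM => ?_⟩
  have hfZ : StronglyMeasurable[MeasurableSpace.comap Z inferInstance] fun ω => f (Z ω) :=
    (hf.comp (comap_measurable Z)).stronglyMeasurable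
  have hfi : Integrable (fun ω => f (Z ω)) μ :=
    integrable_of_bdd (hf.comp hZ) (ae_of_all _ fun ω => hM (Z ω))
  have h1 := condExp_mul_of_stronglyMeasurable_right (μ := μ) hfZ
    (integrable_sign_mul hX hfi) hXi
  rw [← integral_condExp hZ.comap_le]
  refine integral_congr_ae ?_
  filter_upwards [h1, hb] with ω h1 h2
  refine h1.trans ?_
  rw [Pi.mul_apply, hve, Function.comp_apply, clamp_of_mem]
  rw [hve] at h2
  exact abs_le.1 h2

/-- Observing less does not increase the moments of the conditional mean. -/
lemma IsCondMean.integral_pow_le {S' : Type*} [MeasurableSpace S'] {φ : S → S'} {u' : S' → ℝ}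
    (h : IsCondMean μ X Z u) (hφ : Measurable φ) (hZ : Measurable Z)
    (h' : IsCondMean μ X (fun ω => φ (Z ω)) u') (k : ℕ) :
    ∫ ω, u' (φ (Z ω)) ^ (2 * k + 2) ∂μ ≤ ∫ ω, u (Z ω) ^ (2 * k + 2) ∂μ := by
  have hm : Measurable fun ω => u (Z ω) := h.meas.comp hZ
  have hm' : Measurable fun ω => u' (φ (Z ω)) := h'.meas.comp (hφ.comp hZ)
  have hb : ∀ (s : S') (j : ℕ), |u' s ^ j| ≤ 1 := fun s j => LDensity.abs_pow_le (h'.mem s) j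
  -- The slope of the power at the coarser mean. It is a function of the coarser observation, so it
  -- pairs equally with both conditional means, and the linear term of the tangent inequality
  -- integrates to zero.
  set g : S' → ℝ := fun s => (2 * k + 2) * u' s ^ (2 * k + 1) with hg
  have hgm : Measurable g := (h'.meas.pow_const _).const_mul _
  have hgb : ∀ s, |g s| ≤ 2 * k + 2 := fun s => by
    rw [hg]
    simp only
    rw [abs_mul, abs_of_nonneg (by positivity : (0 : ℝ) ≤ 2 * k + 2)]
    exact mul_le_of_le_one_right (by positivity) (hb s _)
  have e1 := h.eq (fun s => g (φ s)) _ (hgm.comp hφ) fun s => hgb (φ s)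
  have e2 := h'.eq g _ hgm hgb
  have hi : Integrable (fun ω => g (φ (Z ω))) μ :=
    integrable_of_bdd (hgm.comp (hφ.comp hZ)) (ae_of_all _ fun ω => hgb _)
  have i1 := h.integrable_mul hZ hi
  have i2 := h'.integrable_mul (hφ.comp hZ) hi
  have i3 : Integrable (fun ω => u' (φ (Z ω)) ^ (2 * k + 2)) μ :=
    integrable_of_bdd (hm'.pow_const _) (ae_of_all _ fun ω => hb _ _)
  have i4 : Integrable (fun ω => u (Z ω) ^ (2 * k + 2)) μ :=
    integrable_of_bdd (hm.pow_const _) (ae_of_all _ fun ω => LDensity.abs_pow_le (h.mem _) _)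
  have key : ∫ ω, (u' (φ (Z ω)) ^ (2 * k + 2) +
      (u (Z ω) * g (φ (Z ω)) - u' (φ (Z ω)) * g (φ (Z ω)))) ∂μ ≤
      ∫ ω, u (Z ω) ^ (2 * k + 2) ∂μ := by
    refine integral_mono (i3.add (i1.sub i2)) i4 fun ω => ?_
    refine le_trans (le_of_eq ?_) (pow_tangent (u' (φ (Z ω))) (u (Z ω)) k)
    simp only [hg]
    ring
  have e3 : ∫ ω, (u' (φ (Z ω)) ^ (2 * k + 2) +
      (u (Z ω) * g (φ (Z ω)) - u' (φ (Z ω)) * g (φ (Z ω)))) ∂μ =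
      ∫ ω, u' (φ (Z ω)) ^ (2 * k + 2) ∂μ + (∫ ω, u (Z ω) * g (φ (Z ω)) ∂μ -
        ∫ ω, u' (φ (Z ω)) * g (φ (Z ω)) ∂μ) :=
    (integral_add i3 (i1.sub i2)).trans (congrArg _ (integral_sub i1 i2))
  rwa [e3, ← e1, ← e2, sub_self, add_zero] at key

end condMean

/-! ### Dependence on the channel of a single bit -/

namespace LDensity

lemma integral_law_sign (a : LDensity) (x : ℤˣ) (F : ℝ → ℝ) :
    ∫ d, F (((x : ℤ) : ℝ) * d) ∂a.law = ∫ d, (1 + ((x : ℤ) : ℝ) * d) * F d ∂a.even := by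
  rw [integral_law]
  rcases Int.units_eq_one_or x with rfl | rfl
  · simp
  · simpa using a.integral_even_neg fun d => (1 + -d) * F d

end LDensity

section oneBit

variable {Ω S : Type*} [MeasurableSpace Ω] [MeasurableSpace S] {ν : Measure Ω}
  [IsProbabilityMeasure ν] {X : Ω → ℤˣ} {Z : Ω → S} {u : S → ℝ}

lemma ae_snd_mem (ν : Measure Ω) [IsProbabilityMeasure ν] (a : LDensity) :
    ∀ᵐ p ∂ν.prod a.even, p.2 ∈ Icc (-1 : ℝ) 1 :=
  Measure.quasiMeasurePreserving_snd.ae a.ae_mem_even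

lemma integral_channel (hX : Measurable X) (hZ : Measurable Z)
    (a : LDensity) {F : S × ℝ → ℝ} (hF : Measurable F) {M : ℝ} (hM : ∀ p, |F p| ≤ M) :
    ∫ p, F (Z p.1, ((X p.1 : ℤ) : ℝ) * p.2) ∂ν.prod a.law =
      ∫ p, (1 + ((X p.1 : ℤ) : ℝ) * p.2) * F (Z p.1, p.2) ∂ν.prod a.even := by
  have hs := measurable_sign hX
  rw [integral_prod, integral_prod]
  · exact integral_congr_ae (ae_of_all _ fun ω => a.integral_law_sign (X ω) fun d => F (Z ω, d))
  · refine integrable_of_bdd (M := 2 * M) (by fun_prop) ?_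
    filter_upwards [ae_snd_mem ν a] with p hp
    rw [abs_mul]
    exact mul_le_mul (abs_one_add_le (mul_mem_Icc (sign_mem _) hp)) (hM _) (abs_nonneg _)
      zero_le_two
  · exact integrable_of_bdd (by fun_prop) (ae_of_all _ fun p => hM _)

lemma IsCondMean.integral_prod_swap (h : IsCondMean ν X Z u) (hX : Measurable X)
    (hZ : Measurable Z) (a : LDensity) {F : S × ℝ → ℝ} (hF : Measurable F) {M : ℝ}
    (hM : ∀ p, |F p| ≤ M) :
    ∫ p, ((X p.1 : ℤ) : ℝ) * F (Z p.1, p.2) ∂ν.prod a.even =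
      ∫ p, u (Z p.1) * F (Z p.1, p.2) ∂ν.prod a.even := by
  have hs := measurable_sign hX
  have hu := h.meas
  have hi : Integrable (fun p : Ω × ℝ => F (Z p.1, p.2)) (ν.prod a.even) :=
    integrable_of_bdd (by fun_prop) (ae_of_all _ fun p => hM _)
  rw [integral_prod_symm, integral_prod_symm]
  · exact integral_congr_ae (ae_of_all _ fun d => h.eq (fun s => F (s, d)) M (by fun_prop)
      fun s => hM _)
  · exact hi.bdd_mul (c := 1) (Measurable.aestronglyMeasurable (by fun_prop)) (ae_of_all _ fun p => abs_le.2 (h.mem _))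
  · exact hi.bdd_mul (c := 1) (Measurable.aestronglyMeasurable (by fun_prop)) (ae_of_all _ fun p => (abs_sign _).le)

/-- The expectation of a function of the observations, in terms of the conditional mean. -/
lemma IsCondMean.integral_channel (h : IsCondMean ν X Z u) (hX : Measurable X)
    (hZ : Measurable Z) (a : LDensity) {F : S × ℝ → ℝ} (hF : Measurable F) {M : ℝ}
    (hM : ∀ p, |F p| ≤ M) :
    ∫ p, F (Z p.1, ((X p.1 : ℤ) : ℝ) * p.2) ∂ν.prod a.law =
      ∫ p, (1 + u (Z p.1) * p.2) * F (Z p.1, p.2) ∂ν.prod a.even := by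
  have hs := measurable_sign hX
  have hu := h.meas
  rw [Gexit.integral_channel hX hZ a hF hM]
  set F' : S × ℝ → ℝ := fun p => clamp p.2 * F p with hF'
  have hF'm : Measurable F' := by fun_prop
  have hF'b : ∀ p, |F' p| ≤ M := fun p => by
    rw [hF', abs_mul]
    exact (mul_le_of_le_one_left (abs_nonneg _) (abs_le.2 (clamp_mem _))).trans (hM p)
  have h1 := h.integral_prod_swap hX hZ a hF'm hF'b
  have hi : Integrable (fun p : Ω × ℝ => F (Z p.1, p.2)) (ν.prod a.even) :=
    integrable_of_bdd (by fun_prop) (ae_of_all _ fun p => hM _)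
  have hi' : Integrable (fun p : Ω × ℝ => F' (Z p.1, p.2)) (ν.prod a.even) :=
    integrable_of_bdd (by fun_prop) (ae_of_all _ fun p => hF'b _)
  have e : ∀ w : Ω → ℝ, Measurable w → (∀ ω, |w ω| ≤ 1) →
      ∫ p, (1 + w p.1 * p.2) * F (Z p.1, p.2) ∂ν.prod a.even =
        ∫ p, F (Z p.1, p.2) ∂ν.prod a.even + ∫ p, w p.1 * F' (Z p.1, p.2) ∂ν.prod a.even := by
    intro w hw hb
    rw [← integral_add hi (hi'.bdd_mul (c := 1) (Measurable.aestronglyMeasurable (by fun_prop)) (ae_of_all _ fun p => hb _))]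
    refine integral_congr_ae ?_
    filter_upwards [ae_snd_mem ν a] with p hp
    simp only [hF', clamp_of_mem hp]
    ring
  rw [e _ hs fun ω => (abs_sign _).le, e (fun ω => u (Z ω)) (by fun_prop)
    fun ω => abs_le.2 (h.mem _), h1]

/-- Bayes' rule with prior mean u: as X² = 1, the density 1 + X d times X is X + d, whose mean given
Z is u + d = (1 + u d) `varRule₂ u d`. -/
lemma IsCondMean.channel (h : IsCondMean ν X Z u) (hX : Measurable X) (hZ : Measurable Z)
    (a : LDensity) :
    IsCondMean (ν.prod a.law) (fun p => X p.1) (fun p => (Z p.1, ((X p.1 : ℤ) : ℝ) * p.2))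
      (fun s => clamp (varRule₂ (u s.1) s.2)) where
  meas := by have := h.meas; fun_prop
  mem s := clamp_mem _
  eq f M hf hM := by
    have hs := measurable_sign hX
    have hu := h.meas
    have hM0 : 0 ≤ M ∨ IsEmpty Ω := by
      by_cases hΩ : IsEmpty Ω
      · exact Or.inr hΩ
      · rw [not_isEmpty_iff] at hΩ
        exact Or.inl ((abs_nonneg _).trans (hM (Z hΩ.some, 0)))
    rcases hM0 with hM0 | hΩ
    swap
    · exact integral_congr_ae (ae_of_all _ fun p => (IsEmpty.false p.1).elim)
    have hcl : ∀ s : S × ℝ, |clamp (varRule₂ (u s.1) s.2) * f s| ≤ M := fun s => by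
      rw [abs_mul]
      exact (mul_le_of_le_one_left (abs_nonneg _) (abs_le.2 (clamp_mem _))).trans (hM s)
    rw [h.integral_channel hX hZ a (F := fun s => clamp (varRule₂ (u s.1) s.2) * f s)
      (by fun_prop) hcl]
    set f1 : S × ℝ → ℝ := fun s => clamp s.2 * f s with hf1
    have hf1b : ∀ s, |f1 s| ≤ M := fun s => by
      rw [hf1, abs_mul]
      exact (mul_le_of_le_one_left (abs_nonneg _) (abs_le.2 (clamp_mem _))).trans (hM s)
    have hfm1 : Measurable f1 := by fun_prop
    have e1 : ∫ p, ((X p.1 : ℤ) : ℝ) * f (Z p.1, ((X p.1 : ℤ) : ℝ) * p.2) ∂ν.prod a.law =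
        ∫ p, (((X p.1 : ℤ) : ℝ) + p.2) * f (Z p.1, p.2) ∂ν.prod a.even := by
      have := Gexit.integral_channel (ν := ν) hX (hX.prodMk hZ) a
        (F := fun q : (ℤˣ × S) × ℝ => ((q.1.1 : ℤ) : ℝ) * f (q.1.2, q.2)) (M := M)
        (by
          have := measurable_sign (Ω := (ℤˣ × S) × ℝ) (X := fun q => q.1.1) (by fun_prop)
          fun_prop)
        (fun q => by rw [abs_mul, abs_sign, one_mul]; exact hM _)
      refine this.trans (integral_congr_ae (ae_of_all _ fun p => ?_))
      simp only
      linear_combination p.2 * f (Z p.1, p.2) * sign_sq (X p.1)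
    have hi : Integrable (fun p : Ω × ℝ => f (Z p.1, p.2)) (ν.prod a.even) :=
      integrable_of_bdd (by fun_prop) (ae_of_all _ fun p => hM _)
    have hi1 : Integrable (fun p : Ω × ℝ => f1 (Z p.1, p.2)) (ν.prod a.even) :=
      integrable_of_bdd (by fun_prop) (ae_of_all _ fun p => hf1b _)
    have e2 : ∀ w : Ω → ℝ, Measurable w → (∀ ω, |w ω| ≤ 1) →
        ∫ p, (w p.1 + p.2) * f (Z p.1, p.2) ∂ν.prod a.even =
          ∫ p, w p.1 * f (Z p.1, p.2) ∂ν.prod a.even + ∫ p, f1 (Z p.1, p.2) ∂ν.prod a.even := by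
      intro w hw hb
      rw [← integral_add (hi.bdd_mul (c := 1) (Measurable.aestronglyMeasurable (by fun_prop)) (ae_of_all _ fun p => hb _)) hi1]
      refine integral_congr_ae ?_
      filter_upwards [ae_snd_mem ν a] with p hp
      simp only [hf1, clamp_of_mem hp]
      ring
    rw [e1, e2 _ hs fun ω => (abs_sign _).le, h.integral_prod_swap hX hZ a hf hM,
      ← e2 (fun ω => u (Z ω)) (by fun_prop) fun ω => abs_le.2 (h.mem _)]
    refine integral_congr_ae ?_
    filter_upwards [ae_snd_mem ν a] with p hp
    rw [clamp_of_mem (varRule₂_mem (h.mem _) hp), ← mul_assoc, mul_varRule₂ (h.mem _) hp]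

/-- `info_duality` is averaged over the sign of the channel output, and the information terms that
remain are expanded in even powers. Independence of Z and the noise magnitude factors the mixed
moments. -/
lemma IsCondMean.integral_info_channel (h : IsCondMean ν X Z u) (hX : Measurable X)
    (hZ : Measurable Z) (a : LDensity) :
    ∫ p, info (clamp (varRule₂ (u (Z p.1)) (((X p.1 : ℤ) : ℝ) * p.2))) ∂ν.prod a.law =
      a.mutualInfo + ∑' k, (∫ ω, u (Z ω) ^ (2 * k + 2) ∂ν) * (coef k * (1 - a.moment k)) := by
  have hu := h.meas
  have hl := log_two_pos
  rw [h.integral_channel hX hZ a (F := fun s => info (clamp (varRule₂ (u s.1) s.2)))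
    (M := Real.log 2) (by fun_prop) fun s => LDensity.abs_info_le (clamp_mem _)]
  set F : Ω × ℝ → ℝ := fun p =>
    (1 + u (Z p.1) * p.2) * info (clamp (varRule₂ (u (Z p.1)) p.2)) with hF
  have hFi : Integrable F (ν.prod a.even) := by
    refine integrable_of_bdd (M := 2 * Real.log 2) (by fun_prop) ?_
    filter_upwards [ae_snd_mem ν a] with p hp
    rw [hF, abs_mul]
    exact mul_le_mul (abs_one_add_le (mul_mem_Icc (h.mem _) hp)) (LDensity.abs_info_le (clamp_mem _))
      (abs_nonneg _) zero_le_two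
  have hflip : MeasurePreserving (fun p : Ω × ℝ => (p.1, -p.2)) (ν.prod a.even)
      (ν.prod a.even) := (MeasurePreserving.id ν).prod a.measurePreserving_neg_even
  have e1 : ∫ p, F (p.1, -p.2) ∂ν.prod a.even = ∫ p, F p ∂ν.prod a.even :=
    hflip.integral_comp ((MeasurableEquiv.refl Ω).prodCongr (MeasurableEquiv.neg ℝ)).measurableEmbedding F
  have hFi' : Integrable (fun p : Ω × ℝ => F (p.1, -p.2)) (ν.prod a.even) :=
    hflip.integrable_comp_of_integrable hFi
  have i1 : Integrable (fun p : Ω × ℝ => info (u (Z p.1))) (ν.prod a.even) :=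
    integrable_of_bdd (by fun_prop) (ae_of_all _ fun p => LDensity.abs_info_le (h.mem _))
  have i2 : Integrable (fun p : Ω × ℝ => info p.2) (ν.prod a.even) :=
    integrable_of_bdd (M := Real.log 2) (by fun_prop) ((ae_snd_mem ν a).mono fun p hp =>
      LDensity.abs_info_le hp)
  have i3 : Integrable (fun p : Ω × ℝ => info (u (Z p.1) * p.2)) (ν.prod a.even) :=
    integrable_of_bdd (M := Real.log 2) (by fun_prop) ((ae_snd_mem ν a).mono fun p hp =>
      LDensity.abs_info_le (mul_mem_Icc (h.mem _) hp))
  have e2 : ∫ p, F p ∂ν.prod a.even = ∫ p, (info (u (Z p.1)) + info p.2 -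
      info (u (Z p.1) * p.2)) ∂ν.prod a.even := by
    have : ∫ p, F p ∂ν.prod a.even = ∫ p, (F p + F (p.1, -p.2)) / 2 ∂ν.prod a.even := by
      rw [integral_div, integral_add hFi hFi', e1]; ring
    rw [this]
    refine integral_congr_ae ?_
    filter_upwards [ae_snd_mem ν a] with p hp
    rw [← info_duality (h.mem (Z p.1)) hp]
    simp only [hF]
    rw [clamp_of_mem (varRule₂_mem (h.mem _) hp),
      clamp_of_mem (varRule₂_mem (h.mem _) (neg_mem_Icc hp))]
  have e7 : ∫ p, (info (u (Z p.1)) + info p.2 - info (u (Z p.1) * p.2)) ∂ν.prod a.even =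
      ∫ p, info (u (Z p.1)) ∂ν.prod a.even + ∫ p, info p.2 ∂ν.prod a.even -
        ∫ p, info (u (Z p.1) * p.2) ∂ν.prod a.even :=
    (integral_sub (i1.add i2) i3).trans (congrArg (· - _) (integral_add i1 i2))
  rw [e2, e7]
  have s1 := LDensity.hasSum_integral_info (μ := ν) (U := fun ω => u (Z ω)) (by fun_prop)
    (ae_of_all _ fun ω => h.mem _)
  have s2 := LDensity.hasSum_integral_info (μ := ν.prod a.even) (U := fun p => u (Z p.1) * p.2)
    (by fun_prop) ((ae_snd_mem ν a).mono fun p hp => mul_mem_Icc (h.mem _) hp)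
  have e3 : ∀ k : ℕ, ∫ p : Ω × ℝ, (u (Z p.1) * p.2) ^ (2 * k + 2) ∂ν.prod a.even =
      (∫ ω, u (Z ω) ^ (2 * k + 2) ∂ν) * a.moment k := fun k => by
    simp only [mul_pow]
    rw [a.moment_eq_even]
    exact integral_prod_mul (fun ω => u (Z ω) ^ (2 * k + 2)) fun d : ℝ => d ^ (2 * k + 2)
  simp only [e3] at s2
  have e4 : ∫ p : Ω × ℝ, info (u (Z p.1)) ∂ν.prod a.even = ∫ ω, info (u (Z ω)) ∂ν := by
    rw [integral_fun_fst fun ω => info (u (Z ω))]; simp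
  have e5 : ∫ p : Ω × ℝ, info p.2 ∂ν.prod a.even = a.mutualInfo := by
    rw [integral_fun_snd fun d => info d, a.mutualInfo_eq_even]; simp
  have e6 : ∑' k, (∫ ω, u (Z ω) ^ (2 * k + 2) ∂ν) * (coef k * (1 - a.moment k)) =
      ∫ ω, info (u (Z ω)) ∂ν - ∫ p : Ω × ℝ, info (u (Z p.1) * p.2) ∂ν.prod a.even := by
    rw [← (s1.sub s2).tsum_eq]
    exact tsum_congr fun k => by ring
  rw [e4, e5, e6]
  ring

/-- The entropy of a bit given `Z` and its output, when the bit is sent through the channel `a`. -/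
theorem condEntropy_channel {Ω' : Type*} [MeasurableSpace Ω'] (h : IsCondMean ν X Z u)
    (hX : Measurable X) (hZ : Measurable Z) (a : LDensity) {T : Ω × ℝ → Ω'} (hT : Measurable T)
    {X' : Ω' → ℤˣ} {Y : Ω' → S × ℝ} (hX' : Measurable X') (hY : Measurable Y)
    (hXT : ∀ p, X' (T p) = X p.1) (hYT : ∀ p, Y (T p) = (Z p.1, ((X p.1 : ℤ) : ℝ) * p.2)) :
    condEntropy ((ν.prod a.law).map T) X' Y = (Real.log 2 - (a.mutualInfo +
      ∑' k, (∫ ω, u (Z ω) ^ (2 * k + 2) ∂ν) * (coef k * (1 - a.moment k)))) / Real.log 2 := by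
  have : IsProbabilityMeasure ((ν.prod a.law).map T) := Measure.isProbabilityMeasure_map hT.aemeasurable
  have hu := h.meas
  have hs := measurable_sign hX'
  have hm : IsCondMean ((ν.prod a.law).map T) X' Y
      (fun s => clamp (varRule₂ (u s.1) s.2)) := by
    refine ⟨by fun_prop, fun s => clamp_mem _, fun f M hf hM => ?_⟩
    rw [integral_map hT.aemeasurable (Measurable.aestronglyMeasurable (by fun_prop)), integral_map hT.aemeasurable (Measurable.aestronglyMeasurable (by fun_prop))]
    simp only [hXT, hYT]
    exact (h.channel hX hZ a).eq f M hf hM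
  rw [hm.condEntropy_eq hX' hY, integral_map hT.aemeasurable (Measurable.aestronglyMeasurable (by fun_prop))]
  simp only [hYT]
  rw [h.integral_info_channel hX hZ a]

end oneBit

end Gexit
namespace Gexit

/-! ### GEXIT functions as weighted moments -/

/-- Resampling one coordinate of a product measure. -/
lemma map_update_pi {ι : Type*} [Fintype ι] [DecidableEq ι] (κ : LDensity → Measure ℝ)
    [∀ a, IsProbabilityMeasure (κ a)] (c : ι → LDensity) (i : ι) (a : LDensity) :
    ((Measure.pi fun j => κ (c j)).prod (κ a)).map (fun p => Function.update p.1 i p.2) =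
      Measure.pi fun j => κ (Function.update c i a j) := by
  have hm : Measurable fun p : (ι → ℝ) × ℝ => Function.update p.1 i p.2 := by fun_prop
  refine (Measure.pi_eq fun s hs => ?_).symm
  rw [Measure.map_apply hm (MeasurableSet.univ_pi hs)]
  have e : (fun p : (ι → ℝ) × ℝ => Function.update p.1 i p.2) ⁻¹' univ.pi s =
      univ.pi (Function.update s i univ) ×ˢ s i := by
    ext p
    simp only [mem_preimage, Set.mem_pi, mem_univ, true_implies, mem_prod]
    constructor
    · intro h
      refine ⟨fun j => ?_, by simpa using h i⟩
      by_cases hj : j = i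
      · subst hj; simp
      · simpa [hj] using h j
    · rintro ⟨h1, h2⟩ j
      by_cases hj : j = i
      · subst hj; simpa using h2
      · simpa [hj] using h1 j
  rw [e, Measure.prod_prod, Measure.pi_pi, ← Finset.mul_prod_erase _ _ (Finset.mem_univ i),
    ← Finset.mul_prod_erase Finset.univ (fun j => κ (Function.update c i a j) (s j))
      (Finset.mem_univ i)]
  simp only [Function.update_self, measure_univ, one_mul]
  rw [mul_comm]
  congr 1
  refine Finset.prod_congr rfl fun j hj => ?_
  rw [Function.update_of_ne (Finset.ne_of_mem_erase hj),
    Function.update_of_ne (Finset.ne_of_mem_erase hj)]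

section condMoment

variable {Ω S : Type*} [MeasurableSpace Ω] [MeasurableSpace S] {μ : Measure Ω}
  [IsProbabilityMeasure μ] {X : Ω → ℤˣ} {Z : Ω → S} {u : S → ℝ}

open Classical in
/-- The even moments of the conditional mean of the bit `X` given `Z`. -/
noncomputable def condMoment (μ : Measure Ω) (X : Ω → ℤˣ) (Z : Ω → S) (k : ℕ) : ℝ :=
  if h : ∃ u, IsCondMean μ X Z u then ∫ ω, h.choose (Z ω) ^ (2 * k + 2) ∂μ else 0

/-- Any two versions of the conditional mean have the same moments: the comparison of observations
is applied in both directions with the identity map. -/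
lemma IsCondMean.condMoment_eq (h : IsCondMean μ X Z u) (hZ : Measurable Z) (k : ℕ) :
    condMoment μ X Z k = ∫ ω, u (Z ω) ^ (2 * k + 2) ∂μ := by
  have hex : ∃ u, IsCondMean μ X Z u := ⟨u, h⟩
  rw [condMoment, dif_pos hex]
  exact le_antisymm (h.integral_pow_le (φ := id) measurable_id hZ hex.choose_spec k)
    (hex.choose_spec.integral_pow_le (φ := id) measurable_id hZ h k)

lemma integral_pow_mem {U : Ω → ℝ} (hU : Measurable U) (h : ∀ ω, U ω ∈ Icc (-1 : ℝ) 1) (k : ℕ) :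
    ∫ ω, U ω ^ (2 * k + 2) ∂μ ∈ Icc (0 : ℝ) 1 := by
  refine ⟨integral_nonneg fun ω => ((even_two_mul k).add even_two).pow_nonneg _, ?_⟩
  have hb : ∀ ω, |U ω ^ (2 * k + 2)| ≤ 1 := fun ω => LDensity.abs_pow_le (h ω) _
  calc _ ≤ ∫ _, (1 : ℝ) ∂μ := integral_mono (integrable_of_bdd (by fun_prop)
        (ae_of_all _ hb)) (integrable_const _) fun ω => (abs_le.1 (hb ω)).2
    _ = 1 := by simp

lemma condMoment_mem (hX : Measurable X) (hZ : Measurable Z) (k : ℕ) :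
    condMoment μ X Z k ∈ Icc (0 : ℝ) 1 := by
  obtain ⟨u, hu⟩ := exists_isCondMean μ hX hZ
  rw [hu.condMoment_eq hZ]
  exact integral_pow_mem (hu.meas.comp hZ) (fun ω => hu.mem _) k

lemma condMoment_comp_le {S' : Type*} [MeasurableSpace S'] {φ : S → S'} (hX : Measurable X)
    (hZ : Measurable Z) (hφ : Measurable φ) (k : ℕ) :
    condMoment μ X (fun ω => φ (Z ω)) k ≤ condMoment μ X Z k := by
  obtain ⟨u, hu⟩ := exists_isCondMean μ hX hZ
  obtain ⟨u', hu'⟩ := exists_isCondMean μ hX (Z := fun ω => φ (Z ω)) (hφ.comp hZ)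
  rw [hu.condMoment_eq hZ, hu'.condMoment_eq (hφ.comp hZ)]
  exact hu.integral_pow_le hφ hZ hu' k

/-- Differentiation of the entropy of a bit with respect to the parameter of its channel. -/
theorem IsChannelFamily.hasDerivAt_condEntropy {c : ℝ → LDensity} (hc : IsChannelFamily c) {h : ℝ}
    (hh : h ∈ Ioo (0 : ℝ) 1) (hw : HasSum (fun k => weight c k h) 1) {Ω' : Type*}
    [MeasurableSpace Ω'] (hX : Measurable X) (hZ : Measurable Z) {T : Ω × ℝ → Ω'}
    (hT : Measurable T) {X' : Ω' → ℤˣ} {Y : Ω' → S × ℝ} (hX' : Measurable X') (hY : Measurable Y)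
    (hXT : ∀ p, X' (T p) = X p.1) (hYT : ∀ p, Y (T p) = (Z p.1, ((X p.1 : ℤ) : ℝ) * p.2)) :
    HasDerivAt (fun t => condEntropy ((μ.prod (c t).law).map T) X' Y)
      (∑' k, weight c k h * (1 - condMoment μ X Z k)) h := by
  obtain ⟨u, hu⟩ := exists_isCondMean μ hX hZ
  have hl := log_two_pos
  set M := condMoment μ X Z with hMdef
  have hM : ∀ k, M k ∈ Icc (0 : ℝ) 1 := condMoment_mem hX hZ
  have hsM : Summable fun k => coef k * M k := summable_coef_mul (C := 1) fun k =>
    abs_le.2 ⟨by linarith [(hM k).1], (hM k).2⟩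
  have hs : Summable fun k => weight c k h * M k := hc.summable_weight_mul hh hM
  have e1 : ∑' k, weight c k h * (1 - M k) =
      (Real.log 2 - Real.log 2 * ∑' k, weight c k h * M k) / Real.log 2 := by
    simp only [mul_sub, mul_one]
    rw [hw.summable.tsum_sub hs, hw.tsum_eq]
    field_simp
  have hd : HasDerivAt (fun t => (Real.log 2 * t - ∑' k, coef k * M k -
      ∑' k, M k * -(coef k * (c t).moment k)) / Real.log 2)
      ((Real.log 2 - Real.log 2 * ∑' k, weight c k h * M k) / Real.log 2) h := by
    have h1 : HasDerivAt (fun t : ℝ => Real.log 2 * t) (Real.log 2) h := by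
      simpa using (hasDerivAt_id h).const_mul (Real.log 2)
    exact ((h1.sub_const _).sub (hc.hasDerivAt_tsum hh hw hM)).div_const _
  rw [e1]
  refine hd.congr_of_eventuallyEq ?_
  filter_upwards [eventually_mem_unit hh] with t ht
  rw [condEntropy_channel hu hX hZ (c t) hT hX' hY hXT hYT, hc.mutualInfo_eq ht]
  have e2 : ∑' k, (∫ ω, u (Z ω) ^ (2 * k + 2) ∂μ) * (coef k * (1 - (c t).moment k)) =
      ∑' k, coef k * M k + ∑' k, M k * -(coef k * (c t).moment k) := by
    have hs2 : Summable fun k => M k * -(coef k * (c t).moment k) := by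
      have : Summable fun k => coef k * (-(M k * (c t).moment k)) :=
        summable_coef_mul (C := 1) fun k => by
          rw [abs_neg, abs_of_nonneg (mul_nonneg (hM k).1 (LDensity.moment_nonneg _ _))]
          exact mul_le_one₀ (hM k).2 (LDensity.moment_nonneg _ _) (LDensity.moment_le_one _ _)
      exact this.congr fun k => by ring
    rw [← hsM.tsum_add hs2]
    refine tsum_congr fun k => ?_
    rw [hMdef, hu.condMoment_eq hZ]
    ring
  rw [e2]
  congr 1
  ring

end condMoment

namespace SocketEnsemble

variable (E : SocketEnsemble) (G : E.Graph)

lemma one_mem_code : (1 : Fin E.n → ℤˣ) ∈ E.code G := fun j => by simp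

instance : IsProbabilityMeasure (uniformOn (E.code G)) :=
  isProbabilityMeasure_uniformOn (toFinite _) ⟨1, E.one_mem_code G⟩

instance (c : Fin E.n → LDensity) : IsProbabilityMeasure (E.joint G c) := by
  unfold joint; infer_instance

lemma measurable_bit (i : Fin E.n) :
    Measurable fun ω : (Fin E.n → ℤˣ) × (Fin E.n → ℝ) => ω.1 i := by fun_prop

@[fun_prop]
lemma measurable_output : Measurable E.output :=
  measurable_pi_lambda _ fun i => (measurable_sign (E.measurable_bit i)).mul (by fun_prop)

@[fun_prop]
lemma measurable_varRule {ι α : Type*} [MeasurableSpace α] (s : Finset ι) {f : α → ι → ℝ}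
    (hf : ∀ i, Measurable fun x => f x i) : Measurable fun x => varRule s (f x) := by
  unfold varRule
  fun_prop

lemma measurable_checkMsg (l : ℕ) (e : E.VSocket) : Measurable fun y => E.checkMsg G y l e := by
  induction l generalizing e with
  | zero => exact measurable_const
  | succ l ih =>
    simp only [checkMsg]
    refine Finset.measurable_prod _ fun s _ => ?_
    have := measurable_varRule (Finset.univ.erase (G.symm ⟨(G e).1, s⟩).2)
      (f := fun y b => E.checkMsg G y l ⟨(G.symm ⟨(G e).1, s⟩).1, b⟩) fun b => ih _
    fun_prop

@[fun_prop]
lemma measurable_bpEstimate (l : ℕ) (i : Fin E.n) : Measurable (E.bpEstimate G l i) := by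
  unfold bpEstimate
  refine measurable_varRule _ fun b => ?_
  exact (E.measurable_checkMsg G l _).comp (by fun_prop)

/-- The law with bit i sent through the useless channel serves as a base in which the varying
parameter does not occur; the channel of bit i enters as one additional independent coordinate. -/
lemma joint_update (c : Fin E.n → LDensity) (i : Fin E.n) (a : LDensity) :
    ((E.joint G (Function.update c i 0)).prod a.law).map
      (fun p => (p.1.1, Function.update p.1.2 i p.2)) = E.joint G (Function.update c i a) := by
  have h := map_update_pi LDensity.law (Function.update c i 0) i a
  rw [Function.update_idem] at h
  unfold joint
  rw [← h]
  have e : (fun p : ((Fin E.n → ℤˣ) × (Fin E.n → ℝ)) × ℝ =>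
      (p.1.1, Function.update p.1.2 i p.2)) =
      Prod.map id (fun q : (Fin E.n → ℝ) × ℝ => Function.update q.1 i q.2) ∘
        MeasurableEquiv.prodAssoc := rfl
  rw [e, ← Measure.map_map (by fun_prop) (by fun_prop), (measurePreserving_prodAssoc _ _ _).map_eq,
    ← Measure.map_prod_map _ _ measurable_id (by fun_prop), Measure.map_id]

/-- The even moments of the conditional mean of bit `i` given the outputs of the other bits. -/
noncomputable def mapMoment (c : Fin E.n → LDensity) (i : Fin E.n) (k : ℕ) : ℝ :=
  condMoment (E.joint G (Function.update c i 0)) (fun ω => ω.1 i)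
    (fun ω => Function.update (E.output ω) i 0) k

/-- The even moments of the conditional mean of bit `i` given its extrinsic BP estimate. -/
noncomputable def bpMoment (c : Fin E.n → LDensity) (l : ℕ) (i : Fin E.n) (k : ℕ) : ℝ :=
  condMoment (E.joint G (Function.update c i 0)) (fun ω => ω.1 i)
    (fun ω => E.bpEstimate G l i (E.output ω)) k

lemma mapMoment_mem (c : Fin E.n → LDensity) (i : Fin E.n) (k : ℕ) :
    E.mapMoment G c i k ∈ Icc (0 : ℝ) 1 :=
  condMoment_mem (E.measurable_bit i) (by fun_prop) k

lemma bpMoment_mem (c : Fin E.n → LDensity) (l : ℕ) (i : Fin E.n) (k : ℕ) :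
    E.bpMoment G c l i k ∈ Icc (0 : ℝ) 1 :=
  condMoment_mem (E.measurable_bit i) (by fun_prop) k

lemma bpEstimate_update (l : ℕ) (i : Fin E.n) (y : Fin E.n → ℝ) (t : ℝ) :
    E.bpEstimate G l i (Function.update y i t) = E.bpEstimate G l i y := by
  simp [bpEstimate]

/-- Data processing: the extrinsic estimate is a function of the outputs of the other bits. -/
lemma bpMoment_le_mapMoment (c : Fin E.n → LDensity) (l : ℕ) (i : Fin E.n) (k : ℕ) :
    E.bpMoment G c l i k ≤ E.mapMoment G c i k := by
  have := condMoment_comp_le (μ := E.joint G (Function.update c i 0)) (E.measurable_bit i)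
    (Z := fun ω => Function.update (E.output ω) i 0) (by fun_prop)
    (E.measurable_bpEstimate G l i) k
  simp only [bpEstimate_update] at this
  exact this

lemma output_update (i : Fin E.n) (x : Fin E.n → ℤˣ) (y : Fin E.n → ℝ) (t : ℝ) :
    E.output (x, Function.update y i t) =
      Function.update (E.output (x, y)) i (((x i : ℤ) : ℝ) * t) := by
  funext j
  by_cases hj : j = i
  · subst hj; simp [output]
  · simp [output, hj]

variable {c : ℝ → LDensity} (hc : IsChannelFamily c) {h : ℝ}
include hc

theorem hasDerivAt_mapEntropy (hh : h ∈ Ioo (0 : ℝ) 1) (hw : HasSum (fun k => weight c k h) 1)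
    (i : Fin E.n) : HasDerivAt (E.mapEntropy G c h i)
      (∑' k, weight c k h * (1 - E.mapMoment G (fun _ => c h) i k)) h := by
  have key := hc.hasDerivAt_condEntropy hh hw
    (μ := E.joint G (Function.update (fun _ => c h) i 0)) (E.measurable_bit i)
    (Z := fun ω => Function.update (E.output ω) i 0) (by fun_prop)
    (T := fun p => (p.1.1, Function.update p.1.2 i p.2)) (by fun_prop) (X' := fun ω => ω.1 i)
    (Y := fun ω => (Function.update (E.output ω) i 0, E.output ω i)) (by fun_prop) (by fun_prop)
    (fun p => rfl) fun p => by
      rw [output_update, Function.update_idem, Function.update_self]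
  refine key.congr_of_eventuallyEq (Eventually.of_forall fun t => ?_)
  simp only [mapEntropy, joint_update]
  -- The full output and the pair consisting of the output with coordinate i erased and the erased
  -- coordinate determine each other.
  exact condEntropy_congr_comap (e := fun y => (Function.update y i 0, y i))
    (e' := fun p => Function.update p.1 i p.2) (by fun_prop) (by fun_prop) (fun ω => rfl)
    fun ω => by simp

theorem hasDerivAt_bpEntropy (hh : h ∈ Ioo (0 : ℝ) 1) (hw : HasSum (fun k => weight c k h) 1)
    (l : ℕ) (i : Fin E.n) : HasDerivAt (E.bpEntropy G c l h i)
      (∑' k, weight c k h * (1 - E.bpMoment G (fun _ => c h) l i k)) h := by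
  have key := hc.hasDerivAt_condEntropy hh hw
    (μ := E.joint G (Function.update (fun _ => c h) i 0)) (E.measurable_bit i)
    (Z := fun ω => E.bpEstimate G l i (E.output ω)) (by fun_prop)
    (T := fun p => (p.1.1, Function.update p.1.2 i p.2)) (by fun_prop) (X' := fun ω => ω.1 i)
    (Y := fun ω => (E.bpEstimate G l i (E.output ω), E.output ω i)) (by fun_prop) (by fun_prop)
    (fun p => rfl) fun p => by
      rw [output_update, bpEstimate_update, Function.update_self]
  refine key.congr_of_eventuallyEq (Eventually.of_forall fun t => ?_)
  simp only [bpEntropy, joint_update]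

end SocketEnsemble

end Gexit
namespace Gexit

/-! ### The posterior of a random codeword -/

lemma measurable_update_left {ι : Type*} [DecidableEq ι] (y : ι → ℝ) (i : ι) :
    Measurable fun t => Function.update y i t := measurable_update y

lemma clamp_zero : clamp 0 = 0 := clamp_of_mem (by norm_num)

section codeSum

variable {ι : Type*} [Fintype ι]

/-- The likelihood ratio of the outputs `y` between the input `x` and uniform inputs. -/
noncomputable def wt (x : ι → ℤˣ) (y : ι → ℝ) : ℝ := ∏ j, (1 + ((x j : ℤ) : ℝ) * clamp (y j))

/-- The sum of `f` over the code, weighted with the likelihood of the outputs `y`. -/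
noncomputable def codeSum (C : Finset (ι → ℤˣ)) (f : (ι → ℤˣ) → ℝ) (y : ι → ℝ) : ℝ :=
  ∑ x ∈ C, f x * wt x y

lemma wt_nonneg (x : ι → ℤˣ) (y : ι → ℝ) : 0 ≤ wt x y :=
  Finset.prod_nonneg fun _ _ => one_add_mul_nonneg (sign_mem _) (clamp_mem _)

@[fun_prop]
lemma measurable_wt (x : ι → ℤˣ) : Measurable (wt x) := by unfold wt; fun_prop

@[fun_prop]
lemma measurable_codeSum (C : Finset (ι → ℤˣ)) (f : (ι → ℤˣ) → ℝ) : Measurable (codeSum C f) := by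
  unfold codeSum; fun_prop

lemma codeSum_nonneg (C : Finset (ι → ℤˣ)) (y : ι → ℝ) : 0 ≤ codeSum C 1 y :=
  Finset.sum_nonneg fun x _ => mul_nonneg zero_le_one (wt_nonneg x y)

lemma abs_codeSum_le (C : Finset (ι → ℤˣ)) {f : (ι → ℤˣ) → ℝ} (hf : ∀ x, |f x| ≤ 1) (y : ι → ℝ) :
    |codeSum C f y| ≤ codeSum C 1 y :=
  (Finset.abs_sum_le_sum_abs _ _).trans (Finset.sum_le_sum fun x _ => by
    rw [abs_mul, abs_of_nonneg (wt_nonneg x y)]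
    exact mul_le_mul_of_nonneg_right (hf x) (wt_nonneg x y))

lemma sum_sign (t : ℝ) : ∑ e : ℤˣ, (1 + ((e : ℤ) : ℝ) * t) = 2 := by
  rw [UnitsInt.univ, Finset.sum_insert (by decide), Finset.sum_singleton]
  push_cast; ring

variable [DecidableEq ι]

lemma codeSum_le (C : Finset (ι → ℤˣ)) (y : ι → ℝ) :
    codeSum C 1 y ≤ 2 ^ Fintype.card ι := by
  have h := Finset.prod_univ_sum (fun _ : ι => (Finset.univ : Finset ℤˣ))
    fun j e => 1 + ((e : ℤ) : ℝ) * clamp (y j)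
  simp only [sum_sign, Finset.prod_const, Finset.card_univ, Fintype.piFinset_univ] at h
  rw [h, codeSum]
  simp only [Pi.one_apply, one_mul]
  exact Finset.sum_le_sum_of_subset_of_nonneg (Finset.subset_univ _) fun x _ _ => wt_nonneg x y

lemma wt_update (x : ι → ℤˣ) (y : ι → ℝ) (j : ι) (t : ℝ) :
    wt x (Function.update y j t) =
      (1 + ((x j : ℤ) : ℝ) * clamp t) * wt x (Function.update y j 0) := by
  unfold wt
  rw [← Finset.mul_prod_erase _ _ (Finset.mem_univ j),
    ← Finset.mul_prod_erase Finset.univ (fun i => 1 + ((x i : ℤ) : ℝ) *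
      clamp (Function.update y j 0 i)) (Finset.mem_univ j)]
  simp only [Function.update_self, clamp_zero, mul_zero, add_zero, one_mul]
  congr 1
  refine Finset.prod_congr rfl fun i hi => ?_
  rw [Function.update_of_ne (Finset.ne_of_mem_erase hi),
    Function.update_of_ne (Finset.ne_of_mem_erase hi)]

/-- Code sums are affine in each coordinate on [-1, 1]. Numerator and denominator of the posterior
mean are therefore affine in each output, which makes its weighted even powers convex. -/
lemma codeSum_update (C : Finset (ι → ℤˣ)) (f : (ι → ℤˣ) → ℝ) (y : ι → ℝ) (j : ι) (t : ℝ) :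
    codeSum C f (Function.update y j t) = codeSum C f (Function.update y j 0) +
      clamp t * codeSum C (fun x => ((x j : ℤ) : ℝ) * f x) (Function.update y j 0) := by
  unfold codeSum
  rw [Finset.mul_sum, ← Finset.sum_add_distrib]
  refine Finset.sum_congr rfl fun x _ => ?_
  rw [wt_update]
  ring

/-- The posterior mean of bit `i` given the outputs `y`. -/
noncomputable def postMean (C : Finset (ι → ℤˣ)) (i : ι) (y : ι → ℝ) : ℝ :=
  codeSum C (fun x => ((x i : ℤ) : ℝ)) y / codeSum C 1 y

omit [DecidableEq ι] in
lemma postMean_mem (C : Finset (ι → ℤˣ)) (i : ι) (y : ι → ℝ) :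
    postMean C i y ∈ Icc (-1 : ℝ) 1 := by
  refine abs_le.1 ?_
  rw [postMean, abs_div, abs_of_nonneg (codeSum_nonneg C y)]
  exact div_le_one_of_le₀ (abs_codeSum_le C (fun x => (abs_sign _).le) y) (codeSum_nonneg C y)

omit [DecidableEq ι] in
lemma codeSum_mul_postMean (C : Finset (ι → ℤˣ)) (i : ι) (y : ι → ℝ) :
    codeSum C 1 y * postMean C i y = codeSum C (fun x => ((x i : ℤ) : ℝ)) y := by
  by_cases h : codeSum C 1 y = 0
  · have := abs_codeSum_le C (fun x => (abs_sign (x i)).le) y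
    rw [h] at this
    rw [h, zero_mul, abs_nonpos_iff.1 this]
  · rw [postMean, mul_div_cancel₀ _ h]

omit [DecidableEq ι] in
@[fun_prop]
lemma measurable_postMean (C : Finset (ι → ℤˣ)) (i : ι) : Measurable (postMean C i) := by
  unfold postMean; fun_prop

lemma lintegral_law_sign (a : LDensity) (x : ℤˣ) {f : ℝ → ENNReal} (hf : Measurable f) :
    ∫⁻ d, f (((x : ℤ) : ℝ) * d) ∂a.law =
      ∫⁻ d, ENNReal.ofReal (1 + ((x : ℤ) : ℝ) * clamp d) * f d ∂a.even := by
  have hx : MeasurePreserving (fun d : ℝ => ((x : ℤ) : ℝ) * d) a.even a.even := by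
    rcases Int.units_eq_one_or x with rfl | rfl
    · have h := MeasurePreserving.id a.even
      simp only [Units.val_one, Int.cast_one, one_mul]
      exact h
    · simpa using a.measurePreserving_neg_even
  conv_lhs => rw [a.law_eq_withDensity]
  rw [lintegral_withDensity_eq_lintegral_mul _ (by fun_prop) (by fun_prop),
    ← hx.lintegral_comp (f := fun d => ENNReal.ofReal (1 + ((x : ℤ) : ℝ) * clamp d) * f d)
      (by fun_prop)]
  refine lintegral_congr_ae ?_
  filter_upwards [a.ae_mem_even] with d hd
  rw [clamp_of_mem (mul_mem_Icc (sign_mem _) hd), ← mul_assoc, sign_sq, one_mul]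
  rfl

-- For input x each output has density 1 + x_j y_j relative to a uniform input, and the noise is
-- independent across coordinates. All codewords thus share one reference measure.
omit [DecidableEq ι] in
lemma map_law_pi (c : ι → LDensity) (x : ι → ℤˣ) :
    (Measure.pi fun j => (c j).law).map (fun y j => ((x j : ℤ) : ℝ) * y j) =
      (Measure.pi fun j => (c j).even).withDensity fun y =>
        ∏ j, ENNReal.ofReal (1 + ((x j : ℤ) : ℝ) * clamp (y j)) := by
  have hp : ∀ j, IsProbabilityMeasure ((c j).law.map fun d => ((x j : ℤ) : ℝ) * d) := fun j =>
    Measure.isProbabilityMeasure_map (by fun_prop)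
  rw [Measure.pi_map_pi (f := fun j d => ((x j : ℤ) : ℝ) * d) (fun j => by fun_prop)]
  refine Measure.pi_eq fun s hs => ?_
  rw [withDensity_apply _ (MeasurableSet.univ_pi hs), ← lintegral_indicator (MeasurableSet.univ_pi hs)]
  set g : ι → ℝ → ENNReal := fun j => (s j).indicator fun d =>
    ENNReal.ofReal (1 + ((x j : ℤ) : ℝ) * clamp d) with hg
  have hgm : ∀ j, Measurable (g j) := fun j => Measurable.indicator (by fun_prop) (hs j)
  have e : (univ.pi s).indicator (fun y : ι → ℝ =>
      ∏ j, ENNReal.ofReal (1 + ((x j : ℤ) : ℝ) * clamp (y j))) = fun y => ∏ j, g j (y j) := by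
    funext y
    by_cases hy : y ∈ univ.pi s
    · rw [indicator_of_mem hy]
      refine Finset.prod_congr rfl fun j _ => ?_
      simp only [hg]
      rw [indicator_of_mem (hy j (mem_univ j))]
    · rw [indicator_of_notMem hy]
      simp only [Set.mem_pi, mem_univ, true_implies, not_forall] at hy
      obtain ⟨j, hj⟩ := hy
      exact (Finset.prod_eq_zero (Finset.mem_univ j) (indicator_of_notMem hj _)).symm
  have hi : iIndepFun (fun j (y : ι → ℝ) => g j (y j)) (Measure.pi fun j => (c j).even) :=
    iIndepFun_pi fun j => (hgm j).aemeasurable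
  rw [e, lintegral_prod_eq_prod_lintegral_of_indepFun _ _ hi fun j =>
    (hgm j).comp (measurable_pi_apply j)]
  refine Finset.prod_congr rfl fun j _ => ?_
  rw [(measurePreserving_eval (fun j => (c j).even) j).lintegral_comp (hgm j),
    ← lintegral_indicator_one (hs j), lintegral_map (measurable_one.indicator (hs j))
      (by fun_prop), lintegral_law_sign _ _ (measurable_one.indicator (hs j))]
  refine lintegral_congr fun d => ?_
  by_cases hd : d ∈ s j <;> simp [hg, hd]

omit [DecidableEq ι] in
lemma integral_law_pi (c : ι → LDensity) (x : ι → ℤˣ) {F : (ι → ℝ) → ℝ} (hF : Measurable F) :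
    ∫ y, F (fun j => ((x j : ℤ) : ℝ) * y j) ∂(Measure.pi fun j => (c j).law) =
      ∫ y, wt x y * F y ∂(Measure.pi fun j => (c j).even) := by
  rw [← integral_map (f := F) (φ := fun y : ι → ℝ => fun j => ((x j : ℤ) : ℝ) * y j)
    (Measurable.aemeasurable (by fun_prop)) hF.aestronglyMeasurable, map_law_pi, integral_withDensity_eq_integral_toReal_smul (by fun_prop)
      (ae_of_all _ fun y => ENNReal.prod_lt_top fun j _ => ENNReal.ofReal_lt_top)]
  refine integral_congr_ae (ae_of_all _ fun y => ?_)
  simp only [ENNReal.toReal_prod, smul_eq_mul, wt]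
  congr 1
  exact Finset.prod_congr rfl fun j _ =>
    ENNReal.toReal_ofReal (one_add_mul_nonneg (sign_mem _) (clamp_mem _))

lemma integral_uniformOn {α : Type*} [Finite α] [MeasurableSpace α]
    [MeasurableSingletonClass α] {C : Finset α} (f : α → ℝ) :
    ∫ x, f x ∂uniformOn (C : Set α) = (∑ x ∈ C, f x) / C.card := by
  have h : uniformOn (C : Set α) = (C.card : ENNReal)⁻¹ • Measure.count.restrict (C : Set α) := by
    rw [uniformOn, ProbabilityTheory.cond, Measure.count_apply_finset]
  rw [h, integral_smul_measure, setIntegral_finset]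
  · simp [div_eq_inv_mul, Measure.real]
  · have : IsFiniteMeasure (Measure.count.restrict (C : Set α)) := ⟨by simp⟩
    exact Integrable.of_finite

lemma wt_le (x : ι → ℤˣ) (y : ι → ℝ) : wt x y ≤ 2 ^ Fintype.card ι := by
  simpa [codeSum] using codeSum_le {x} y

/-- The outputs of a code, for the input `ω.1` and the noise `ω.2`. -/
def codeOutput (ω : (ι → ℤˣ) × (ι → ℝ)) : ι → ℝ := fun j => ((ω.1 j : ℤ) : ℝ) * ω.2 j

omit [Fintype ι] [DecidableEq ι] in
@[fun_prop]
lemma measurable_codeOutput : Measurable (codeOutput (ι := ι)) :=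
  measurable_pi_lambda _ fun i =>
    (measurable_sign (X := fun ω : (ι → ℤˣ) × (ι → ℝ) => ω.1 i) (by fun_prop)).mul (by fun_prop)

/-- A uniformly random codeword together with independent noise. -/
noncomputable def codeMeasure (C : Finset (ι → ℤˣ)) (c : ι → LDensity) :
    Measure ((ι → ℤˣ) × (ι → ℝ)) :=
  (uniformOn (C : Set (ι → ℤˣ))).prod (Measure.pi fun i => (c i).law)

variable {C : Finset (ι → ℤˣ)} (hC : C.Nonempty) (c : ι → LDensity)
include hC

omit [DecidableEq ι] in
lemma isProbabilityMeasure_uniformOn_coe :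
    IsProbabilityMeasure (uniformOn (C : Set (ι → ℤˣ))) :=
  isProbabilityMeasure_uniformOn C.finite_toSet hC

omit [DecidableEq ι] in
lemma isProbabilityMeasure_codeMeasure : IsProbabilityMeasure (codeMeasure C c) := by
  have := isProbabilityMeasure_uniformOn_coe hC
  unfold codeMeasure
  infer_instance

lemma integral_codeMeasure {f : (ι → ℤˣ) → ℝ} (hf : ∀ x, |f x| ≤ 1) {F : (ι → ℝ) → ℝ}
    (hF : Measurable F) {M : ℝ} (hM : ∀ y, |F y| ≤ M) :
    ∫ ω, f ω.1 * F (codeOutput ω) ∂codeMeasure C c =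
      (∫ y, codeSum C f y * F y ∂Measure.pi fun j => (c j).even) / C.card := by
  have h1 := isProbabilityMeasure_uniformOn_coe hC
  have hM0 : 0 ≤ M := (abs_nonneg _).trans (hM 0)
  have hfm : Measurable f := Measurable.of_discrete
  rw [codeMeasure, integral_prod, integral_uniformOn]
  · congr 1
    have e : ∀ x : ι → ℤˣ, ∫ y, f x * F (codeOutput (x, y)) ∂(Measure.pi fun j => (c j).law) =
        ∫ y, f x * wt x y * F y ∂(Measure.pi fun j => (c j).even) := fun x => by
      simp only [mul_assoc]
      rw [integral_const_mul, integral_const_mul]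
      exact congrArg _ (integral_law_pi c x hF)
    simp only [e, codeSum, Finset.sum_mul]
    rw [integral_finsetSum]
    · intro x _
      refine integrable_of_bdd (M := 1 * 2 ^ Fintype.card ι * M) (by fun_prop) (ae_of_all _ fun y => ?_)
      rw [abs_mul, abs_mul, abs_of_nonneg (wt_nonneg x y)]
      exact mul_le_mul (mul_le_mul (hf x) (wt_le x y) (wt_nonneg x y) zero_le_one) (hM y)
        (abs_nonneg _) (by positivity)
  · refine integrable_of_bdd (M := 1 * M) (by fun_prop) (ae_of_all _ fun ω => ?_)
    rw [abs_mul]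
    exact mul_le_mul (hf _) (hM _) (abs_nonneg _) zero_le_one

lemma isCondMean_postMean (i : ι) :
    IsCondMean (codeMeasure C c) (fun ω => ω.1 i) codeOutput (postMean C i) where
  meas := measurable_postMean C i
  mem := postMean_mem C i
  eq f M hf hM := by
    rw [integral_codeMeasure hC c (f := fun x => ((x i : ℤ) : ℝ)) (fun x => (abs_sign _).le) hf hM]
    have h := integral_codeMeasure hC c (f := 1) (fun x => by simp)
      (F := fun y => postMean C i y * f y) (M := M) (by fun_prop) fun y => by
        rw [abs_mul]
        exact (mul_le_of_le_one_left (abs_nonneg _) (abs_le.2 (postMean_mem C i y))).trans (hM y)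
    simp only [Pi.one_apply, one_mul] at h
    rw [h]
    simp only [← mul_assoc, codeSum_mul_postMean]

/-- The even moments of the posterior mean of bit `i`, as functions of the channels. -/
noncomputable def postMoment (C : Finset (ι → ℤˣ)) (c : ι → LDensity) (i : ι) (k : ℕ) : ℝ :=
  (∫ y, codeSum C 1 y * postMean C i y ^ (2 * k + 2)
    ∂Measure.pi fun j => (Function.update c i 0 j).even) / C.card

lemma integral_postMean_pow (i : ι) (k : ℕ) :
    ∫ ω, postMean C i (codeOutput ω) ^ (2 * k + 2) ∂codeMeasure C (Function.update c i 0) =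
      postMoment C c i k := by
  have h := integral_codeMeasure hC (Function.update c i 0) (f := 1) (fun x => by simp)
      (F := fun y => postMean C i y ^ (2 * k + 2)) (M := 1) (by fun_prop) fun y =>
        LDensity.abs_pow_le (postMean_mem C i y) _
  simp only [Pi.one_apply, one_mul] at h
  exact h

lemma postMoment_mem (i : ι) (k : ℕ) : postMoment C c i k ∈ Icc (0 : ℝ) 1 := by
  have := isProbabilityMeasure_codeMeasure hC (Function.update c i 0)
  rw [← integral_postMean_pow hC]
  exact integral_pow_mem (by fun_prop) (fun ω => postMean_mem C i _) k

omit hC in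
/-- The integral over a product measure is monotone in every factor for integrands that are
convex in every coordinate. -/
lemma integral_pi_mono {Ψ : (ι → ℝ) → ℝ} (hΨ : Measurable Ψ) {M : ℝ} (hM : ∀ y, |Ψ y| ≤ M)
    (hconv : ∀ (y : ι → ℝ) (j : ι), ∃ g, IsTest (fun t => Ψ (Function.update y j t)) g M)
    {c c' : ι → LDensity} (h : ∀ j, c' j ≤ c j) :
    ∫ y, Ψ y ∂(Measure.pi fun j => (c' j).even) ≤ ∫ y, Ψ y ∂(Measure.pi fun j => (c j).even) := by
  have one : ∀ (d : ι → LDensity) (i : ι) (a : LDensity),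
      ∫ y, Ψ y ∂(Measure.pi fun j => (Function.update d i a j).even) =
        ∫ y, ∫ t, Ψ (Function.update y i t) ∂a.even ∂(Measure.pi fun j => (d j).even) := by
    intro d i a
    have hm : Measurable fun p : (ι → ℝ) × ℝ => Function.update p.1 i p.2 := by fun_prop
    rw [← map_update_pi LDensity.even, integral_map hm.aemeasurable hΨ.aestronglyMeasurable,
      integral_prod]
    exact integrable_of_bdd (hΨ.comp hm) (ae_of_all _ fun p => hM _)
  have hstep : ∀ (d : ι → LDensity) (i : ι) (a a' : LDensity), a' ≤ a →
      ∫ y, Ψ y ∂(Measure.pi fun j => (Function.update d i a' j).even) ≤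
        ∫ y, Ψ y ∂(Measure.pi fun j => (Function.update d i a j).even) := by
    intro d i a a' ha
    rw [one, one]
    have hi : ∀ a : LDensity, Integrable (fun y => ∫ t, Ψ (Function.update y i t) ∂a.even)
        (Measure.pi fun j => (d j).even) := fun a => by
      have hm : Measurable fun p : (ι → ℝ) × ℝ => Ψ (Function.update p.1 i p.2) := by fun_prop
      have : Integrable (fun p : (ι → ℝ) × ℝ => Ψ (Function.update p.1 i p.2))
          ((Measure.pi fun j => (d j).even).prod a.even) :=
        integrable_of_bdd hm (ae_of_all _ fun p => hM _)
      exact this.integral_prod_left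
    refine integral_mono (hi a') (hi a) fun y => ?_
    obtain ⟨g, hg⟩ := hconv y i
    exact ha _ g M hg
  -- A hybrid argument: the factors are replaced one at a time.
  have key : ∀ s : Finset ι, ∫ y, Ψ y ∂(Measure.pi fun j => (c' j).even) ≤
      ∫ y, Ψ y ∂(Measure.pi fun j => (if j ∈ s then c j else c' j).even) := by
    intro s
    induction s using Finset.induction_on with
    | empty => simp
    | insert i s hi ih =>
      refine ih.trans ?_
      have h1 := hstep (fun j => if j ∈ s then c j else c' j) i (c i) (c' i) (h i)
      have e1 : Function.update (fun j => if j ∈ s then c j else c' j) i (c' i) =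
          fun j => if j ∈ s then c j else c' j := by
        funext j
        by_cases hj : j = i
        · subst hj; simp [hi]
        · simp [hj]
      have e2 : Function.update (fun j => if j ∈ s then c j else c' j) i (c i) =
          fun j => if j ∈ insert i s then c j else c' j := by
        funext j
        by_cases hj : j = i
        · subst hj; simp
        · simp [hj]
      rwa [e1, e2] at h1
  simpa using key Finset.univ

omit hC [DecidableEq ι] in
/-- The tangent inequality for the perspective of an even power. -/
lemma perspective_tangent {W N W' N' u u' : ℝ} (h : W * u = N) (h' : W' * u' = N') (hW' : 0 ≤ W')
    (k : ℕ) : W * u ^ (2 * k + 2) + ((2 * k + 2) * u ^ (2 * k + 1) * (N' - N) -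
      (2 * k + 1) * u ^ (2 * k + 2) * (W' - W)) ≤ W' * u' ^ (2 * k + 2) := by
  have h1 := mul_le_mul_of_nonneg_left (pow_tangent u u' k) hW'
  refine le_trans (le_of_eq ?_) h1
  rw [← h, ← h']
  ring

-- Along coordinate j, W = `codeSum C 1` and N = W · `postMean` are affine, and W (N / W)^(2k+2) is
-- the perspective of a convex function. The constant 4k + 3 is (2k + 2) + (2k + 1), from the two
-- parts of the subgradient.
omit hC in
lemma exists_isTest_postMean (i : ι) (k : ℕ) (y : ι → ℝ) (j : ι) :
    ∃ g, IsTest (fun t => codeSum C 1 (Function.update y j t) *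
      postMean C i (Function.update y j t) ^ (2 * k + 2)) g
        ((4 * k + 3) * 2 ^ Fintype.card ι) := by
  set y0 := Function.update y j 0
  set B := codeSum C (fun x => ((x j : ℤ) : ℝ) * 1) y0 with hB
  set B' := codeSum C (fun x => ((x j : ℤ) : ℝ) * ((x i : ℤ) : ℝ)) y0 with hB'
  have hup : Measurable fun t => Function.update y j t := measurable_update_left y j
  have hcard : ∀ y, |codeSum C 1 y| ≤ 2 ^ Fintype.card ι := fun y => by
    rw [abs_of_nonneg (codeSum_nonneg C y)]; exact codeSum_le C y
  have hBb : |B| ≤ 2 ^ Fintype.card ι :=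
    (abs_codeSum_le C (fun x => by rw [mul_one, abs_sign]) y0).trans (codeSum_le C y0)
  have hB'b : |B'| ≤ 2 ^ Fintype.card ι :=
    (abs_codeSum_le C (fun x => by rw [abs_mul, abs_sign, abs_sign, one_mul]) y0).trans
      (codeSum_le C y0)
  have hub : ∀ t n, |postMean C i (Function.update y j t) ^ n| ≤ 1 := fun t n =>
    LDensity.abs_pow_le (postMean_mem C i _) n
  have hk : (0 : ℝ) ≤ k := Nat.cast_nonneg k
  have hpos : (0 : ℝ) < 2 ^ Fintype.card ι := by positivity
  refine ⟨fun s => (2 * k + 2) * postMean C i (Function.update y j s) ^ (2 * k + 1) * B' -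
    (2 * k + 1) * postMean C i (Function.update y j s) ^ (2 * k + 2) * B,
    by fun_prop, by fun_prop, fun t _ => ?_, fun t _ => ?_, fun s hs t ht => ?_⟩
  · rw [abs_mul]
    refine (mul_le_mul (hcard _) (hub t _) (abs_nonneg _) hpos.le).trans ?_
    nlinarith
  · refine (abs_sub _ _).trans ?_
    rw [abs_mul, abs_mul, abs_mul, abs_mul, abs_of_nonneg (by positivity : (0 : ℝ) ≤ 2 * k + 2),
      abs_of_nonneg (by positivity : (0 : ℝ) ≤ 2 * k + 1)]
    have h1 := mul_le_mul (hub t (2 * k + 1)) hB'b (abs_nonneg _) zero_le_one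
    have h2 := mul_le_mul (hub t (2 * k + 2)) hBb (abs_nonneg _) zero_le_one
    have h3 := mul_le_mul_of_nonneg_left h1 (by positivity : (0 : ℝ) ≤ 2 * k + 2)
    have h4 := mul_le_mul_of_nonneg_left h2 (by positivity : (0 : ℝ) ≤ 2 * k + 1)
    linarith
  · have h := perspective_tangent (codeSum_mul_postMean C i (Function.update y j s))
      (codeSum_mul_postMean C i (Function.update y j t)) (codeSum_nonneg C _) k
    have e1 := codeSum_update C 1 y j s
    have e2 := codeSum_update C 1 y j t
    have e3 := codeSum_update C (fun x => ((x i : ℤ) : ℝ)) y j s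
    have e4 := codeSum_update C (fun x => ((x i : ℤ) : ℝ)) y j t
    rw [clamp_of_mem hs] at e1 e3
    rw [clamp_of_mem ht] at e2 e4
    have e5 : codeSum C (fun x => ((x i : ℤ) : ℝ)) (Function.update y j t) -
        codeSum C (fun x => ((x i : ℤ) : ℝ)) (Function.update y j s) = (t - s) * B' := by
      rw [e3, e4]; ring
    have e6 : codeSum C 1 (Function.update y j t) - codeSum C 1 (Function.update y j s) =
        (t - s) * B := by
      rw [e1, e2]
      simp only [Pi.one_apply]
      ring
    rw [e5, e6] at h
    linarith

omit hC in
lemma postMoment_mono {c c' : ι → LDensity} (h : ∀ j, c' j ≤ c j) (i : ι) (k : ℕ) :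
    postMoment C c' i k ≤ postMoment C c i k := by
  refine div_le_div_of_nonneg_right ?_ (Nat.cast_nonneg _)
  refine integral_pi_mono (M := (4 * k + 3) * 2 ^ Fintype.card ι) (by fun_prop) (fun y => ?_)
    (fun y j => exists_isTest_postMean i k y j) fun j => ?_
  · rw [abs_mul, abs_of_nonneg (codeSum_nonneg C y)]
    refine (mul_le_mul (codeSum_le C y) (LDensity.abs_pow_le (postMean_mem C i _) _)
      (abs_nonneg _) (by positivity)).trans ?_
    have : (0 : ℝ) ≤ k := Nat.cast_nonneg k
    nlinarith [(by positivity : (0 : ℝ) < 2 ^ Fintype.card ι)]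
  · by_cases hj : j = i
    · subst hj; simp
    · simpa [hj] using h j

end codeSum

end Gexit
namespace Gexit

/-! ### The area under the MAP GEXIT curve -/

/-- The points `j / (N + 1)` of the unit interval. -/
noncomputable def grid (N j : ℕ) : ℝ := min ((j : ℝ) / (N + 1)) 1

lemma grid_mem (N j : ℕ) : grid N j ∈ Icc (0 : ℝ) 1 :=
  ⟨le_min (by positivity) zero_le_one, min_le_right _ _⟩

lemma grid_mono (N : ℕ) : Monotone (grid N) := fun i j h => min_le_min_right _ (by gcongr)

lemma grid_zero (N : ℕ) : grid N 0 = 0 := by simp [grid]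

lemma grid_last (N : ℕ) : grid N (N + 1) = 1 := by
  have : (N : ℝ) + 1 ≠ 0 := by positivity
  simp [grid, div_self this]

lemma grid_succ_sub {N j : ℕ} (hj : j < N + 1) : grid N (j + 1) - grid N j = 1 / (N + 1) := by
  have hN : (0 : ℝ) < N + 1 := by positivity
  have hj' : (j : ℝ) + 1 ≤ N + 1 := by exact_mod_cast hj
  have e1 : grid N j = j / (N + 1) := min_eq_left ((div_le_one hN).2 (by linarith))
  have e2 : grid N (j + 1) = (j + 1) / (N + 1) := by
    have : ((j + 1 : ℕ) : ℝ) / (N + 1) ≤ 1 := (div_le_one hN).2 (by push_cast; linarith)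
    rw [grid, min_eq_left this]; push_cast; rfl
  rw [e1, e2]; ring

/-- Comparison of upper Stieltjes sums with the integral. -/
lemma IsChannelFamily.sum_grid_le {c : ℝ → LDensity} (hc : IsChannelFamily c) {b : ℕ → ℝ → ℝ}
    (hb : ∀ k, AntitoneOn (b k) (Icc 0 1)) (hb' : ∀ k, ∀ h ∈ Icc (0 : ℝ) 1, b k h ∈ Icc (0 : ℝ) 1)
    (N : ℕ) :
    ∑ j ∈ Finset.range (N + 1), ∑' k, coef k * (((c (grid N j)).moment k -
        (c (grid N (j + 1))).moment k) * (1 - b k (grid N (j + 1)))) ≤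
      Real.log 2 * (∫ h in Ioo (0 : ℝ) 1, ∑' k, weight c k h * (1 - b k h)) + meshError N := by
  set F : ℝ → ℝ := fun h => ∑' k, weight c k h * (1 - b k h) with hF
  have hle : ∀ j, grid N j ≤ grid N (j + 1) := fun j => grid_mono N j.le_succ
  have hint : ∀ s ∈ Icc (0 : ℝ) 1, ∀ t ∈ Icc (0 : ℝ) 1, s ≤ t →
      IntervalIntegrable F volume s t := fun s hs t ht h => by
    rw [intervalIntegrable_iff_integrableOn_Ioo_of_le h]
    exact (hc.integrableOn_tsum hb hb').mono_set (Ioo_subset_Ioo hs.1 ht.2)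
  have hIoo : ∀ s t : ℝ, s ≤ t → ∫ h in s..t, F h = ∫ h in Ioo s t, F h := fun s t h => by
    rw [intervalIntegral.integral_of_le h, integral_Ioc_eq_integral_Ioo]
  have hsplit : ∫ h in Ioo (0 : ℝ) 1, F h =
      ∑ j ∈ Finset.range (N + 1), ∫ h in (grid N j)..(grid N (j + 1)), F h := by
    rw [intervalIntegral.sum_integral_adjacent_intervals (a := fun j => grid N j) fun j _ =>
      hint _ (grid_mem N j) _ (grid_mem N _) (hle j), grid_zero, grid_last, hIoo 0 1 zero_le_one]
  have hd : ∀ k j, |b k (grid N j) - b k (grid N (j + 1))| ≤ 1 := fun k j =>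
    abs_le.2 ⟨by linarith [(hb' k _ (grid_mem N j)).1, (hb' k _ (grid_mem N (j + 1))).2],
      by linarith [(hb' k _ (grid_mem N j)).2, (hb' k _ (grid_mem N (j + 1))).1]⟩
  -- The sum evaluated at right endpoints is split into the one at left endpoints, which the
  -- integral dominates, and a sum of products of increments, which is the mesh error.
  have hstep : ∀ j, ∑' k, coef k * (((c (grid N j)).moment k -
        (c (grid N (j + 1))).moment k) * (1 - b k (grid N (j + 1)))) ≤
      Real.log 2 * (∫ h in (grid N j)..(grid N (j + 1)), F h) +
        ∑' k, coef k * (((c (grid N j)).moment k - (c (grid N (j + 1))).moment k) *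
          (b k (grid N j) - b k (grid N (j + 1)))) := by
    intro j
    have h1 := (hc.integral_bounds hb hb' (grid_mem N j).1 (grid_mem N (j + 1)).2 (hle j)).1
    rw [hIoo _ _ (hle j)]
    refine le_trans (le_of_eq ?_) (add_le_add_left h1 _)
    rw [← Summable.tsum_add]
    · exact tsum_congr fun k => by ring
    · exact summable_coef_mul fun k => abs_mul_one_sub_le (LDensity.moment_mem _ _)
        (LDensity.moment_mem _ _) (hb' k _ (grid_mem N _))
    · refine summable_coef_mul (C := 1) fun k => ?_
      rw [abs_mul]
      have h2 := (c (grid N j)).moment_mem k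
      have h3 := (c (grid N (j + 1))).moment_mem k
      exact mul_le_one₀ (abs_le.2 ⟨by linarith [h2.1, h3.2], by linarith [h2.2, h3.1]⟩)
        (abs_nonneg _) (hd k j)
  refine (Finset.sum_le_sum fun j _ => hstep j).trans ?_
  rw [Finset.sum_add_distrib, ← Finset.mul_sum, ← hsplit]
  refine add_le_add_right (sum_mesh_le N (A := fun k j => (c (grid N j)).moment k)
    (B := fun k j => b k (grid N j)) (fun k i j h => hc.moment_antitoneOn k (grid_mem N i)
      (grid_mem N j) (grid_mono N h)) (fun k i j h => hb k (grid_mem N i) (grid_mem N j)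
      (grid_mono N h)) (fun k j => LDensity.moment_mem _ _) (fun k j => hb' k _ (grid_mem N j))
    fun k j hj => ?_) _
  refine (hc.coef_sub_le (grid_mem N j) (grid_mem N (j + 1)) (hle j) k).trans (le_of_eq ?_)
  rw [grid_succ_sub hj]; ring

section potential

variable {ι : Type*} [Fintype ι] [DecidableEq ι] {C : Finset (ι → ℤˣ)} (hC : C.Nonempty)

/-- The likelihood ratio between the output distribution of the code and that of uniform inputs. -/
noncomputable def codeRatio (C : Finset (ι → ℤˣ)) (y : ι → ℝ) : ℝ := codeSum C 1 y / C.card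

/-- The entropy of a random codeword given its outputs. -/
noncomputable def codePotential (C : Finset (ι → ℤˣ)) (c : ι → LDensity) : ℝ :=
  Real.log C.card - ∑ j, (c j).mutualInfo -
    ∫ y, Real.negMulLog (codeRatio C y) ∂Measure.pi fun j => (c j).even

omit [DecidableEq ι] in
lemma codeRatio_nonneg (C : Finset (ι → ℤˣ)) (y : ι → ℝ) : 0 ≤ codeRatio C y :=
  div_nonneg (codeSum_nonneg C y) (Nat.cast_nonneg _)

lemma codeRatio_le (C : Finset (ι → ℤˣ)) (y : ι → ℝ) :
    codeRatio C y ≤ 2 ^ Fintype.card ι / C.card :=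
  div_le_div_of_nonneg_right (codeSum_le C y) (Nat.cast_nonneg _)

omit [DecidableEq ι] in
@[fun_prop]
lemma measurable_codeRatio (C : Finset (ι → ℤˣ)) : Measurable (codeRatio C) := by
  unfold codeRatio; fun_prop

lemma exists_abs_negMulLog_codeRatio_le (C : Finset (ι → ℤˣ)) :
    ∃ M, ∀ y, |Real.negMulLog (codeRatio C y)| ≤ M := by
  obtain ⟨M, hM⟩ := (isCompact_Icc (a := (0 : ℝ)) (b := 2 ^ Fintype.card ι / C.card))
    |>.exists_bound_of_continuousOn Real.continuous_negMulLog.continuousOn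
  exact ⟨M, fun y => hM _ ⟨codeRatio_nonneg C y, codeRatio_le C y⟩⟩

lemma ae_coord_eq_zero (d : ι → LDensity) (i : ι) :
    ∀ᵐ y ∂Measure.pi fun j => (Function.update d i 0 j).even, y i = 0 := by
  have h : ∀ᵐ t ∂(Function.update d i 0 i).even, t = 0 := by
    rw [Function.update_self, LDensity.even_zero]
    exact (ae_dirac_iff (measurableSet_singleton (0 : ℝ))).2 rfl
  exact (Measure.quasiMeasurePreserving_eval (fun j => (Function.update d i 0 j).even) i).ae h

lemma codeRatio_update (C : Finset (ι → ℤˣ)) {y : ι → ℝ} {i : ι} (hy : y i = 0) {t : ℝ}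
    (ht : t ∈ Icc (-1 : ℝ) 1) :
    codeRatio C (Function.update y i t) = codeRatio C y * (1 + postMean C i y * t) := by
  have h := codeSum_update C 1 y i t
  have e : Function.update y i 0 = y := by rw [← hy, Function.update_eq_self]
  rw [e, clamp_of_mem ht] at h
  simp only [Pi.one_apply, mul_one] at h
  have h2 := codeSum_mul_postMean C i y
  unfold codeRatio
  rw [h, ← h2]
  ring

/-- The logarithm of z occurs with total weight one and separates; what is left, averaged over the
sign of v, is `info v`. -/
lemma negMulLog_symmetrize (z v : ℝ) :
    (Real.negMulLog (z * (1 + v)) + Real.negMulLog (z * (1 - v))) / 2 =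
      Real.negMulLog z - z * info v := by
  rw [Real.negMulLog_mul, Real.negMulLog_mul]
  unfold info Real.negMulLog
  ring

include hC

lemma integral_ratio_mul (c : ι → LDensity) {F : (ι → ℝ) → ℝ} (hF : Measurable F) {M : ℝ}
    (hM : ∀ y, |F y| ≤ M) :
    ∫ y, codeRatio C y * F y ∂(Measure.pi fun j => (c j).even) =
      ∫ ω, F (codeOutput ω) ∂codeMeasure C c := by
  have h := integral_codeMeasure hC c (f := 1) (fun x => by simp) hF hM
  simp only [Pi.one_apply, one_mul] at h
  rw [h, ← integral_div]
  refine integral_congr_ae (ae_of_all _ fun y => ?_)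
  simp only [codeRatio]
  ring

/-- Observing t on a coordinate that was erased multiplies `codeRatio` by 1 + (posterior mean) · t.
After symmetrization in t the change is the mean of `info` of the product, under the output law of
the code, whose density is `codeRatio`; the power series turns it into moments. -/
lemma integral_negMulLog_update (d : ι → LDensity) (i : ι) (a : LDensity) :
    ∫ y, Real.negMulLog (codeRatio C y) ∂(Measure.pi fun j => (Function.update d i a j).even) =
      ∫ y, Real.negMulLog (codeRatio C y) ∂(Measure.pi fun j => (Function.update d i 0 j).even) -
        ∑' k, coef k * (a.moment k * postMoment C d i k) := by
  have hprob := isProbabilityMeasure_codeMeasure hC (Function.update d i 0)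
  obtain ⟨M, hM⟩ := exists_abs_negMulLog_codeRatio_le C
  have hneg : Measurable Real.negMulLog := Real.continuous_negMulLog.measurable
  have hm : Measurable fun p : (ι → ℝ) × ℝ => Function.update p.1 i p.2 := by fun_prop
  have h0 := map_update_pi LDensity.even (Function.update d i 0) i a
  rw [Function.update_idem] at h0
  rw [← h0, integral_map hm.aemeasurable (Measurable.aestronglyMeasurable (by fun_prop))]
  set π₀ : Measure (ι → ℝ) := Measure.pi fun j => (Function.update d i 0 j).even with hπ
  set F : (ι → ℝ) × ℝ → ℝ := fun p => Real.negMulLog (codeRatio C (Function.update p.1 i p.2))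
    with hF
  have hFi : Integrable F (π₀.prod a.even) :=
    integrable_of_bdd (by fun_prop) (ae_of_all _ fun p => hM _)
  have hflip : MeasurePreserving (fun p : (ι → ℝ) × ℝ => (p.1, -p.2)) (π₀.prod a.even)
      (π₀.prod a.even) := (MeasurePreserving.id π₀).prod a.measurePreserving_neg_even
  have e1 : ∫ p, F (p.1, -p.2) ∂π₀.prod a.even = ∫ p, F p ∂π₀.prod a.even :=
    hflip.integral_comp
      ((MeasurableEquiv.refl (ι → ℝ)).prodCongr (MeasurableEquiv.neg ℝ)).measurableEmbedding F
  have hFi' : Integrable (fun p : (ι → ℝ) × ℝ => F (p.1, -p.2)) (π₀.prod a.even) :=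
    hflip.integrable_comp_of_integrable hFi
  have i1 : Integrable (fun p : (ι → ℝ) × ℝ => Real.negMulLog (codeRatio C p.1))
      (π₀.prod a.even) := integrable_of_bdd (by fun_prop) (ae_of_all _ fun p => hM _)
  have i2 : Integrable (fun p : (ι → ℝ) × ℝ => codeRatio C p.1 * info (postMean C i p.1 * p.2))
      (π₀.prod a.even) := by
    refine integrable_of_bdd (M := 2 ^ Fintype.card ι / C.card * Real.log 2) (by fun_prop) ?_
    filter_upwards [ae_snd_mem π₀ a] with p hp
    rw [abs_mul, abs_of_nonneg (codeRatio_nonneg C _)]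
    exact mul_le_mul (codeRatio_le C _) (LDensity.abs_info_le (mul_mem_Icc (postMean_mem C i _) hp))
      (abs_nonneg _) (by positivity)
  have e2 : ∫ p, F p ∂π₀.prod a.even = ∫ p, (Real.negMulLog (codeRatio C p.1) -
      codeRatio C p.1 * info (postMean C i p.1 * p.2)) ∂π₀.prod a.even := by
    have : ∫ p, F p ∂π₀.prod a.even = ∫ p, (F p + F (p.1, -p.2)) / 2 ∂π₀.prod a.even := by
      rw [integral_div, integral_add hFi hFi', e1]; ring
    rw [this]
    refine integral_congr_ae ?_
    filter_upwards [ae_snd_mem π₀ a, Measure.quasiMeasurePreserving_fst.ae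
      (ae_coord_eq_zero d i)] with p hp hz
    simp only [hF]
    rw [codeRatio_update C hz hp, codeRatio_update C hz (neg_mem_Icc hp), ← negMulLog_symmetrize]
    ring_nf
  have e3 : ∫ p : (ι → ℝ) × ℝ, Real.negMulLog (codeRatio C p.1) ∂π₀.prod a.even =
      ∫ y, Real.negMulLog (codeRatio C y) ∂π₀ := by
    rw [integral_fun_fst fun y => Real.negMulLog (codeRatio C y)]; simp
  set φ : (ι → ℝ) → ℝ := fun y => ∫ t, info (postMean C i y * t) ∂a.even with hφ
  have hφm : Measurable φ := by
    have : StronglyMeasurable fun p : (ι → ℝ) × ℝ => info (postMean C i p.1 * p.2) :=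
      Measurable.stronglyMeasurable (by fun_prop)
    exact (this.integral_prod_right' (ν := a.even)).measurable
  have hφb : ∀ y, |φ y| ≤ Real.log 2 := fun y => by
    have h := norm_integral_le_of_norm_le_const (μ := a.even) (C := Real.log 2)
      (f := fun t => info (postMean C i y * t)) (a.ae_mem_even.mono fun t ht =>
        LDensity.abs_info_le (mul_mem_Icc (postMean_mem C i y) ht))
    simpa using h
  have e4 : ∫ p : (ι → ℝ) × ℝ, codeRatio C p.1 * info (postMean C i p.1 * p.2) ∂π₀.prod a.even =
      ∑' k, coef k * (a.moment k * postMoment C d i k) := by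
    rw [integral_prod _ i2]
    simp only [integral_const_mul]
    rw [integral_ratio_mul hC _ hφm hφb]
    have hb : ∀ᵐ p ∂(codeMeasure C (Function.update d i 0)).prod a.even,
        postMean C i (codeOutput p.1) * p.2 ∈ Icc (-1 : ℝ) 1 :=
      (ae_snd_mem _ a).mono fun p hp => mul_mem_Icc (postMean_mem C i _) hp
    have hs := LDensity.hasSum_integral_info
      (U := fun p : ((ι → ℤˣ) × (ι → ℝ)) × ℝ => postMean C i (codeOutput p.1) * p.2)
      (by fun_prop) hb
    have hi : Integrable (fun p : ((ι → ℤˣ) × (ι → ℝ)) × ℝ =>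
        info (postMean C i (codeOutput p.1) * p.2))
        ((codeMeasure C (Function.update d i 0)).prod a.even) :=
      integrable_of_bdd (by fun_prop) (hb.mono fun p hp => LDensity.abs_info_le hp)
    rw [integral_prod _ hi] at hs
    rw [← hs.tsum_eq]
    refine tsum_congr fun k => ?_
    have e5 := integral_prod_mul (μ := codeMeasure C (Function.update d i 0)) (ν := a.even)
      (fun ω => postMean C i (codeOutput ω) ^ (2 * k + 2)) fun t : ℝ => t ^ (2 * k + 2)
    simp only [mul_pow]
    rw [e5, integral_postMean_pow hC, ← a.moment_eq_even]
    ring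
  refine e2.trans ?_
  rw [integral_sub i1 i2, e3, e4]

/-- The exact finite-difference form of the GEXIT formula for the entropy of the whole codeword: the
channel information and the change of the output entropy combine into the factors 1 - M_k. -/
lemma codePotential_update_sub (d : ι → LDensity) (i : ι) (a a' : LDensity) :
    codePotential C (Function.update d i a') - codePotential C (Function.update d i a) =
      ∑' k, coef k * ((a.moment k - a'.moment k) * (1 - postMoment C d i k)) := by
  have hM := postMoment_mem hC d i
  have hs : ∀ a : LDensity, Summable fun k => coef k * (a.moment k * postMoment C d i k) :=
    fun a => summable_coef_mul (C := 1) fun k => by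
      rw [abs_of_nonneg (mul_nonneg (a.moment_nonneg k) (hM k).1)]
      exact mul_le_one₀ (a.moment_le_one k) (hM k).1 (hM k).2
  have hJ : ∀ a : LDensity, ∑ j, (Function.update d i a j).mutualInfo =
      a.mutualInfo + ∑ j ∈ Finset.univ.erase i, (d j).mutualInfo := fun a => by
    rw [← Finset.add_sum_erase _ _ (Finset.mem_univ i), Function.update_self]
    congr 1
    exact Finset.sum_congr rfl fun j hj => by
      rw [Function.update_of_ne (Finset.ne_of_mem_erase hj)]
  unfold codePotential
  rw [integral_negMulLog_update hC d i a, integral_negMulLog_update hC d i a', hJ, hJ]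
  have h1 := (a.hasSum_mutualInfo.sub a'.hasSum_mutualInfo).sub
    ((hs a).hasSum.sub (hs a').hasSum)
  have h2 := (h1.congr_fun (g := fun k => coef k * ((a.moment k - a'.moment k) *
    (1 - postMoment C d i k))) fun k => by ring).tsum_eq
  rw [h2]
  ring

lemma integral_codeRatio (c : ι → LDensity) :
    ∫ y, codeRatio C y ∂(Measure.pi fun j => (c j).even) = 1 := by
  have := isProbabilityMeasure_codeMeasure hC c
  have h := integral_ratio_mul hC c (F := fun _ => 1) (M := 1) measurable_const (by simp)
  simpa using h

omit hC in
lemma integrable_codeRatio (c : ι → LDensity) :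
    Integrable (codeRatio C) (Measure.pi fun j => (c j).even) :=
  integrable_of_bdd (M := 2 ^ Fintype.card ι / C.card) (by fun_prop) (ae_of_all _ fun y => by
    rw [abs_of_nonneg (codeRatio_nonneg C y)]; exact codeRatio_le C y)

omit hC in
lemma integrable_negMulLog_codeRatio (c : ι → LDensity) :
    Integrable (fun y => Real.negMulLog (codeRatio C y)) (Measure.pi fun j => (c j).even) := by
  obtain ⟨M, hM⟩ := exists_abs_negMulLog_codeRatio_le C
  exact integrable_of_bdd (Real.continuous_negMulLog.measurable.comp (by fun_prop))
    (ae_of_all _ hM)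

/-- For useless channels the outputs carry nothing. Jensen appears as z ↦ -z log z ≤ 1 - z, and
`codeRatio` has mean 1. -/
lemma log_card_le_codePotential {c : ι → LDensity} (h : ∀ j, (c j).mutualInfo = 0) :
    Real.log C.card ≤ codePotential C c := by
  have h1 : ∫ y, Real.negMulLog (codeRatio C y) ∂(Measure.pi fun j => (c j).even) ≤ 0 := by
    calc _ ≤ ∫ y, (1 - codeRatio C y) ∂(Measure.pi fun j => (c j).even) :=
          integral_mono (integrable_negMulLog_codeRatio c)
            ((integrable_const _).sub (integrable_codeRatio c)) fun y =>
              Real.negMulLog_le_one_sub_self (codeRatio_nonneg C y)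
      _ = 0 := by
        rw [integral_sub (integrable_const _) (integrable_codeRatio c), integral_codeRatio hC]
        simp
  unfold codePotential
  simp only [h, Finset.sum_const_zero]
  linarith

/-- For perfect channels it suffices that `codeRatio` never exceeds 2 ^ n / |C|, which bounds its
logarithm under a probability density. -/
lemma codePotential_nonpos {c : ι → LDensity} (h : ∀ j, (c j).mutualInfo = Real.log 2) :
    codePotential C c ≤ 0 := by
  have hcard : (0 : ℝ) < C.card := Nat.cast_pos.2 hC.card_pos
  have h1 : -(Fintype.card ι * Real.log 2 - Real.log C.card) ≤
      ∫ y, Real.negMulLog (codeRatio C y) ∂(Measure.pi fun j => (c j).even) := by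
    have e : (Fintype.card ι : ℝ) * Real.log 2 - Real.log C.card =
        Real.log (2 ^ Fintype.card ι / C.card) := by
      rw [Real.log_div (by positivity) hcard.ne', Real.log_pow]
    calc _ = ∫ y, codeRatio C y * -Real.log (2 ^ Fintype.card ι / C.card)
            ∂(Measure.pi fun j => (c j).even) := by
          rw [integral_mul_const, integral_codeRatio hC, one_mul, e]
      _ ≤ _ := integral_mono ((integrable_codeRatio c).mul_const _)
          (integrable_negMulLog_codeRatio c) fun y => by
            rcases (codeRatio_nonneg C y).eq_or_lt with h0 | h0
            · simp [← h0]
            · have := Real.log_le_log h0 (codeRatio_le C y)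
              simp only [Real.negMulLog]
              nlinarith
  unfold codePotential
  simp only [h, Finset.sum_const, Finset.card_univ, nsmul_eq_mul]
  linarith

/-- The bits are degraded one at a time. At each stage the other channels are at least as good as
a', so the extrinsic moments are at least those for a' everywhere, and the increment is at most the
stated one. -/
lemma codePotential_sub_le {a a' : LDensity} (h : a' ≤ a) :
    codePotential C (fun _ => a') - codePotential C (fun _ => a) ≤
      ∑ i, ∑' k, coef k *
        ((a.moment k - a'.moment k) * (1 - postMoment C (fun _ => a') i k)) := by
  have key : ∀ s : Finset ι, codePotential C (fun j => if j ∈ s then a' else a) -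
      codePotential C (fun _ => a) ≤ ∑ i ∈ s, ∑' k, coef k *
        ((a.moment k - a'.moment k) * (1 - postMoment C (fun _ => a') i k)) := by
    intro s
    induction s using Finset.induction_on with
    | empty => simp
    | insert i s hi ih =>
      set d : ι → LDensity := fun j => if j ∈ s then a' else a with hd
      have e1 : Function.update d i a = d := by
        have : d i = a := by simp [hd, hi]
        rw [← this, Function.update_eq_self]
      have e2 : Function.update d i a' = fun j => if j ∈ insert i s then a' else a := by
        funext j
        by_cases hj : j = i
        · subst hj; simp
        · simp [hj, hd]
      have h1 := codePotential_update_sub hC d i a a'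
      rw [e1, e2] at h1
      have h2 : ∑' k, coef k * ((a.moment k - a'.moment k) * (1 - postMoment C d i k)) ≤
          ∑' k, coef k * ((a.moment k - a'.moment k) * (1 - postMoment C (fun _ => a') i k)) := by
        refine Summable.tsum_le_tsum (fun k => ?_) ?_ ?_
        · refine mul_le_mul_of_nonneg_left (mul_le_mul_of_nonneg_left ?_
            (sub_nonneg.2 (LDensity.moment_mono h k))) (coef_pos k).le
          have := postMoment_mono (C := C) (c := d) (c' := fun _ => a') (fun j => by
            simp only [hd]; split_ifs
            · exact le_rfl
            · exact h) i k
          linarith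
        · exact summable_coef_mul fun k => abs_mul_one_sub_le (a.moment_mem k) (a'.moment_mem k)
            (postMoment_mem hC _ i k)
        · exact summable_coef_mul fun k => abs_mul_one_sub_le (a.moment_mem k) (a'.moment_mem k)
            (postMoment_mem hC _ i k)
      rw [Finset.sum_insert hi]
      linarith
  simpa using key Finset.univ

/-- The area under the MAP GEXIT curves of a code is at least its size. -/
theorem log_card_le_integral {c : ℝ → LDensity} (hc : IsChannelFamily c) :
    Real.log C.card ≤ Real.log 2 * ∑ i, ∫ h in Ioo (0 : ℝ) 1,
      ∑' k, weight c k h * (1 - postMoment C (fun _ => c h) i k) := by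
  have hb : ∀ i k, AntitoneOn (fun h => postMoment C (fun _ => c h) i k) (Icc 0 1) :=
    fun i k s hs t ht h => postMoment_mono (fun _ => hc.anti hs ht h) i k
  have hb' : ∀ i k, ∀ h ∈ Icc (0 : ℝ) 1, postMoment C (fun _ => c h) i k ∈ Icc (0 : ℝ) 1 :=
    fun i k h _ => postMoment_mem hC _ i k
  have key : ∀ N : ℕ, Real.log C.card ≤ Real.log 2 * ∑ i, (∫ h in Ioo (0 : ℝ) 1,
      ∑' k, weight c k h * (1 - postMoment C (fun _ => c h) i k)) +
        Fintype.card ι * meshError N := by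
    intro N
    have h1 := log_card_le_codePotential hC (c := fun _ => c (grid N (N + 1))) fun j => by
      rw [hc.mutualInfo_eq (grid_mem N _), grid_last]; ring
    have h0 := codePotential_nonpos hC (c := fun _ => c (grid N 0)) fun j => by
      rw [hc.mutualInfo_eq (grid_mem N _), grid_zero]; ring
    have h2 := Finset.sum_range_sub (fun j => codePotential C fun _ => c (grid N j)) (N + 1)
    have h3 := Finset.sum_le_sum fun j (_ : j ∈ Finset.range (N + 1)) =>
      codePotential_sub_le hC (hc.anti (grid_mem N j) (grid_mem N (j + 1))
        (grid_mono N j.le_succ))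
    rw [h2, Finset.sum_comm] at h3
    have h4 := Finset.sum_le_sum fun i (_ : i ∈ Finset.univ) =>
      hc.sum_grid_le (hb i) (hb' i) N
    rw [Finset.sum_add_distrib, ← Finset.mul_sum, Finset.sum_const, Finset.card_univ,
      nsmul_eq_mul] at h4
    linarith
  have hlim := (tendsto_meshError.const_mul (Fintype.card ι : ℝ)).const_add
    (Real.log 2 * ∑ i, (∫ h in Ioo (0 : ℝ) 1,
      ∑' k, weight c k h * (1 - postMoment C (fun _ => c h) i k)))
  rw [mul_zero, add_zero] at hlim
  exact ge_of_tendsto' hlim key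

end potential

namespace SocketEnsemble

variable (E : SocketEnsemble) (G : E.Graph)

/-- The code of `G` as a finite set. -/
noncomputable def codeFinset : Finset (Fin E.n → ℤˣ) := (toFinite (E.code G)).toFinset

lemma coe_codeFinset : (E.codeFinset G : Set (Fin E.n → ℤˣ)) = E.code G :=
  Finite.coe_toFinset _

lemma codeFinset_nonempty : (E.codeFinset G).Nonempty :=
  ⟨1, (Finite.mem_toFinset _).2 (E.one_mem_code G)⟩

lemma codeMeasure_codeFinset (c : Fin E.n → LDensity) :
    codeMeasure (E.codeFinset G) c = E.joint G c := by
  rw [codeMeasure, coe_codeFinset]; rfl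

lemma mapMoment_eq (c : Fin E.n → LDensity) (i : Fin E.n) (k : ℕ) :
    E.mapMoment G c i k = postMoment (E.codeFinset G) c i k := by
  have h := isCondMean_postMean (E.codeFinset_nonempty G) (Function.update c i 0) i
  rw [codeMeasure_codeFinset] at h
  -- Under the useless channel output i already vanishes almost surely, so erasing it changes
  -- nothing.
  have hae : ∀ᵐ ω ∂E.joint G (Function.update c i 0),
      Function.update (E.output ω) i 0 = codeOutput ω := by
    have hz : ∀ᵐ t ∂(Function.update c i 0 i).law, t = 0 := by
      rw [Function.update_self, LDensity.law_zero]
      exact (ae_dirac_iff (measurableSet_singleton (0 : ℝ))).2 rfl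
    have h1 := (Measure.quasiMeasurePreserving_eval (fun j => (Function.update c i 0 j).law) i).ae hz
    have h2 : ∀ᵐ ω ∂E.joint G (Function.update c i 0), ω.2 i = 0 :=
      Measure.quasiMeasurePreserving_snd.ae h1
    filter_upwards [h2] with ω hω
    funext j
    by_cases hj : j = i
    · subst hj; simp [codeOutput, hω]
    · simp [hj, codeOutput, output]
  have h' : IsCondMean (E.joint G (Function.update c i 0)) (fun ω => ω.1 i)
      (fun ω => Function.update (E.output ω) i 0) (postMean (E.codeFinset G) i) := by
    refine ⟨h.meas, h.mem, fun f M hf hM => ?_⟩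
    have h1 := h.eq f M hf hM
    refine (integral_congr_ae (hae.mono fun ω hω => ?_)).trans
      (h1.trans (integral_congr_ae (hae.mono fun ω hω => ?_)))
    · simp only [hω]
    · simp only [hω]
  rw [mapMoment, h'.condMoment_eq (by fun_prop), ← integral_postMean_pow (E.codeFinset_nonempty G),
    codeMeasure_codeFinset]
  exact integral_congr_ae (hae.mono fun ω hω => by simp only [hω])

/-- The rate of a code is at most the area under its average MAP GEXIT curve. -/
theorem rate_le_integral {c : ℝ → LDensity} (hc : IsChannelFamily c) :
    E.rate G * E.n ≤ ∑ i, ∫ h in Ioo (0 : ℝ) 1,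
      ∑' k, weight c k h * (1 - E.mapMoment G (fun _ => c h) i k) := by
  have h := log_card_le_integral (E.codeFinset_nonempty G) hc
  simp only [mapMoment_eq]
  have hcard : (E.code G).ncard = (E.codeFinset G).card := by
    rw [← coe_codeFinset, ncard_coe_finset]
  rcases Nat.eq_zero_or_pos E.n with hn | hn
  · have : IsEmpty (Fin E.n) := by rw [hn]; infer_instance
    simp [hn]
  · rw [rate, div_mul_cancel₀ _ (by positivity), hcard, Real.logb, div_le_iff₀ log_two_pos]
    linarith

end SocketEnsemble

end Gexit
namespace Gexit

/-! ### Symmetry of belief propagation -/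

lemma varRule_sign {ι : Type*} (e : ℤˣ) (s : Finset ι) (d : ι → ℝ) :
    varRule s (fun i => ((e : ℤ) : ℝ) * d i) = ((e : ℤ) : ℝ) * varRule s d := by
  rcases Int.units_eq_one_or e with rfl | rfl
  · simp
  · unfold varRule
    push_cast
    simp only [neg_mul, one_mul, sub_neg_eq_add, ← sub_eq_add_neg]
    rw [add_comm (∏ i ∈ s, (1 - d i)), ← neg_div]
    congr 1
    ring

lemma varRule₂_sign (e : ℤˣ) (u v : ℝ) :
    varRule₂ (((e : ℤ) : ℝ) * u) (((e : ℤ) : ℝ) * v) = ((e : ℤ) : ℝ) * varRule₂ u v := by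
  unfold varRule₂
  have h : ((e : ℤ) : ℝ) * u * (((e : ℤ) : ℝ) * v) = u * v := by
    linear_combination u * v * sign_sq e
  rw [h, ← mul_add, mul_div_assoc]

namespace SocketEnsemble

variable (E : SocketEnsemble) (G : E.Graph)

lemma prod_erase_of_mem_code {x : Fin E.n → ℤˣ} (hx : x ∈ E.code G) (e : E.VSocket) :
    ∏ s ∈ Finset.univ.erase (G e).2, x (G.symm ⟨(G e).1, s⟩).1 = x e.1 := by
  have h := hx (G e).1
  rw [← Finset.mul_prod_erase _ _ (Finset.mem_univ (G e).2)] at h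
  have e1 : G.symm ⟨(G e).1, (G e).2⟩ = e := by simp
  rw [e1] at h
  have h2 := eq_inv_of_mul_eq_one_right h
  rw [h2, Int.units_inv_eq_self]

/-- BP commutes with the sign changes given by a codeword, since the signs around a check node
multiply to 1. This reduces its analysis to the all-one codeword. -/
lemma checkMsg_sign {x : Fin E.n → ℤˣ} (hx : x ∈ E.code G) (y : Fin E.n → ℝ) (l : ℕ)
    (e : E.VSocket) :
    E.checkMsg G (fun j => ((x j : ℤ) : ℝ) * y j) l e = ((x e.1 : ℤ) : ℝ) * E.checkMsg G y l e := by
  induction l generalizing e with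
  | zero => simp [checkMsg]
  | succ l ih =>
    simp only [checkMsg, ih]
    simp only [varRule_sign, varRule₂_sign]
    rw [Finset.prod_mul_distrib]
    congr 1
    have h := congrArg (fun u : ℤˣ => ((u : ℤ) : ℝ)) (E.prod_erase_of_mem_code G hx e)
    simpa only [Units.coe_prod, Int.cast_prod] using h

lemma bpEstimate_sign {x : Fin E.n → ℤˣ} (hx : x ∈ E.code G) (y : Fin E.n → ℝ) (l : ℕ)
    (i : Fin E.n) :
    E.bpEstimate G l i (fun j => ((x j : ℤ) : ℝ) * y j) =
      ((x i : ℤ) : ℝ) * E.bpEstimate G l i y := by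
  have h : Function.update (fun j => ((x j : ℤ) : ℝ) * y j) i 0 =
      fun j => ((x j : ℤ) : ℝ) * Function.update y i 0 j := by
    funext j
    by_cases hj : j = i
    · subst hj; simp
    · simp [hj]
  unfold bpEstimate
  rw [h]
  simp only [E.checkMsg_sign G hx]
  exact varRule_sign (x i) _ fun b => E.checkMsg G (Function.update y i 0) l ⟨i, b⟩

/-- A bit is forced if it takes the same value in all codewords. -/
def Forced (i : Fin E.n) : Prop := ∀ x ∈ E.code G, x i = 1

lemma ae_mem_code (c : Fin E.n → LDensity) : ∀ᵐ ω ∂E.joint G c, ω.1 ∈ E.code G := by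
  refine Measure.quasiMeasurePreserving_fst.ae ?_
  have h := uniformOn_self (toFinite (E.code G)) ⟨1, E.one_mem_code G⟩
  exact (prob_compl_eq_zero_iff (MeasurableSet.of_discrete)).2 h

/-- A forced bit is known before anything is observed, so its conditional mean is 1 whatever the
estimate is. This is the only way in which the moments can differ from those of the message density.
-/
lemma bpMoment_of_forced (c : Fin E.n → LDensity) {i : Fin E.n} (h : E.Forced G i) (l k : ℕ) :
    E.bpMoment G c l i k = 1 := by
  have hm : IsCondMean (E.joint G (Function.update c i 0)) (fun ω => ω.1 i)
      (fun ω => E.bpEstimate G l i (E.output ω)) (fun _ => 1) := by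
    refine ⟨measurable_const, fun _ => by norm_num, fun f M hf hM => ?_⟩
    refine integral_congr_ae ?_
    filter_upwards [E.ae_mem_code G _] with ω hω
    simp [h _ hω]
  rw [bpMoment, hm.condMoment_eq (by fun_prop)]
  simp

lemma mul_mem_code {x z : Fin E.n → ℤˣ} (hx : x ∈ E.code G) (hz : z ∈ E.code G) :
    x * z ∈ E.code G := fun j => by
  simp only [Pi.mul_apply, Finset.prod_mul_distrib, hx j, hz j, mul_one]

/-- Translation by a codeword with value -1 at i permutes the code and flips bit i, so the bit is
uniform. -/
lemma sum_code_of_not_forced {i : Fin E.n} (h : ¬E.Forced G i) (f : ℤˣ → ℝ) :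
    (∑ x ∈ E.codeFinset G, f (x i)) / (E.codeFinset G).card = (f 1 + f (-1)) / 2 := by
  unfold Forced at h
  push Not at h
  obtain ⟨z, hz, hzi⟩ := h
  have hzi : z i = -1 := (Int.units_eq_one_or _).resolve_left hzi
  have hmem : ∀ x, x ∈ E.codeFinset G ↔ x ∈ E.code G := fun x => Finite.mem_toFinset _
  have h1 : ∑ x ∈ E.codeFinset G, f (x i) = ∑ x ∈ E.codeFinset G, f (-x i) := by
    refine Finset.sum_nbij' (fun x => x * z) (fun x => x * z) ?_ ?_ ?_ ?_ ?_
    · exact fun x hx => (hmem _).2 (E.mul_mem_code G ((hmem _).1 hx) hz)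
    · exact fun x hx => (hmem _).2 (E.mul_mem_code G ((hmem _).1 hx) hz)
    · intro x _; ext j; simp [mul_assoc, Int.units_mul_self]
    · intro x _; ext j; simp [mul_assoc, Int.units_mul_self]
    · intro x _; simp [hzi]
  have h2 : 2 * ∑ x ∈ E.codeFinset G, f (x i) = (E.codeFinset G).card * (f 1 + f (-1)) := by
    rw [two_mul]
    nth_rewrite 2 [h1]
    rw [← Finset.sum_add_distrib, ← nsmul_eq_mul, ← Finset.sum_const]
    refine Finset.sum_congr rfl fun x _ => ?_
    rcases Int.units_eq_one_or (x i) with hx | hx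
    · rw [hx]
    · rw [hx, neg_neg, add_comm]
  have hc : ((E.codeFinset G).card : ℝ) ≠ 0 :=
    Nat.cast_ne_zero.2 (E.codeFinset_nonempty G).card_pos.ne'
  rw [div_eq_div_iff hc two_ne_zero]
  linarith

/-- By sign symmetry the estimate given x is x_i times a variable of law D, and the bit x_i is
uniform. -/
lemma integral_joint_bpEstimate (c : Fin E.n → LDensity) {l : ℕ} {i : Fin E.n} {D : LDensity}
    (hD : (Measure.pi fun j => (c j).law).map (E.bpEstimate G l i) = D.law)
    (hf : ¬E.Forced G i) {H : ℤˣ → ℝ → ℝ} (hH : ∀ e, Measurable (H e)) {M : ℝ}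
    (hM : ∀ e t, |H e t| ≤ M) :
    ∫ ω, H (ω.1 i) (E.bpEstimate G l i (E.output ω)) ∂E.joint G c =
      (∫ t, H 1 t ∂D.law + ∫ t, H (-1) (-t) ∂D.law) / 2 := by
  have hHm : Measurable fun p : ℤˣ × ℝ => H p.1 p.2 := measurable_from_prod_countable_right hH
  have hm : Measurable fun ω : (Fin E.n → ℤˣ) × (Fin E.n → ℝ) =>
      H (ω.1 i) (E.bpEstimate G l i (E.output ω)) :=
    hHm.comp ((E.measurable_bit i).prodMk ((E.measurable_bpEstimate G l i).comp E.measurable_output))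
  have key : ∀ x ∈ E.codeFinset G, ∫ y, H (x i) (E.bpEstimate G l i (E.output (x, y)))
      ∂(Measure.pi fun j => (c j).law) = ∫ t, H (x i) (((x i : ℤ) : ℝ) * t) ∂D.law := by
    intro x hx
    rw [← hD, integral_map (E.measurable_bpEstimate G l i).aemeasurable
      (Measurable.aestronglyMeasurable (by have := hH (x i); fun_prop))]
    refine integral_congr_ae (ae_of_all _ fun y => ?_)
    have e : E.output (x, y) = fun j => ((x j : ℤ) : ℝ) * y j := rfl
    beta_reduce
    rw [e, E.bpEstimate_sign G ((Finite.mem_toFinset _).1 hx)]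
  rw [joint, integral_prod _ (integrable_of_bdd hm (ae_of_all _ fun ω => hM _ _)),
    ← coe_codeFinset, integral_uniformOn, Finset.sum_congr rfl key,
    E.sum_code_of_not_forced G hf fun e => ∫ t, H e (((e : ℤ) : ℝ) * t) ∂D.law]
  simp

/-- If the law of the estimate for the all-one codeword is a symmetric density and the bit is
uniform, the estimate is its own posterior mean. Clamping only serves to have a version bounded
everywhere. -/
lemma bpMoment_of_law (c : Fin E.n → LDensity) {l : ℕ} {i : Fin E.n} {D : LDensity}
    (hD : (Measure.pi fun j => (Function.update c i 0 j).law).map (E.bpEstimate G l i) = D.law)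
    (hf : ¬E.Forced G i) (k : ℕ) : E.bpMoment G c l i k = D.moment k := by
  have hm : IsCondMean (E.joint G (Function.update c i 0)) (fun ω => ω.1 i)
      (fun ω => E.bpEstimate G l i (E.output ω)) clamp := by
    refine ⟨by fun_prop, clamp_mem, fun f M hfm hM => ?_⟩
    rw [E.integral_joint_bpEstimate G _ hD hf (H := fun e t => ((e : ℤ) : ℝ) * f t) (M := M)
      (fun e => by fun_prop) fun e t => by rw [abs_mul, abs_sign, one_mul]; exact hM t,
      E.integral_joint_bpEstimate G _ hD hf (H := fun _ t => clamp t * f t) (M := M)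
      (fun e => by fun_prop) fun e t => by
        rw [abs_mul]
        exact (mul_le_of_le_one_left (abs_nonneg _) (abs_le.2 (clamp_mem _))).trans (hM t)]
    have hM0 : 0 ≤ M := (abs_nonneg _).trans (hM 0)
    have hi : ∀ g : ℝ → ℝ, Measurable g → (∀ t ∈ Icc (-1 : ℝ) 1, |g t| ≤ 2 * M) →
        Integrable g D.even := fun g hg hb => integrable_of_bdd hg (D.ae_mem_even.mono hb)
    simp only [D.integral_law]
    have hb1 : ∀ t ∈ Icc (-1 : ℝ) 1, ∀ r, |r| ≤ M → |(1 + t) * r| ≤ 2 * M := fun t ht r hr => by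
      rw [abs_mul]; exact mul_le_mul (abs_one_add_le ht) hr (abs_nonneg _) zero_le_two
    have hcl : ∀ t r, |r| ≤ M → |clamp t * r| ≤ M := fun t r hr => by
      rw [abs_mul]
      exact (mul_le_of_le_one_left (abs_nonneg _) (abs_le.2 (clamp_mem _))).trans hr
    have e1 : ∫ d, (1 + d) * (((((-1 : ℤˣ) : ℤ)) : ℝ) * f (-d)) ∂D.even =
        ∫ d, (1 + -d) * (((((-1 : ℤˣ) : ℤ)) : ℝ) * f d) ∂D.even := by
      rw [← D.integral_even_neg]
      simp
    have e2 : ∫ d, (1 + d) * (clamp (-d) * f (-d)) ∂D.even =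
        ∫ d, (1 + -d) * (clamp d * f d) ∂D.even := by
      rw [← D.integral_even_neg]
      simp
    rw [e1, e2, ← integral_add, ← integral_add]
    · congr 1
      refine integral_congr_ae (D.ae_mem_even.mono fun d hd => ?_)
      simp only [clamp_of_mem hd]
      push_cast
      ring
    · exact hi _ (by fun_prop) fun t ht => hb1 t ht _ (hcl _ _ (hM t))
    · exact hi _ (by fun_prop) fun t ht => hb1 _ (neg_mem_Icc ht) _ (hcl _ _ (hM t))
    · exact hi _ (by fun_prop) fun t ht => hb1 t ht _ (by simpa using hM t)
    · exact hi _ (by fun_prop) fun t ht => hb1 _ (neg_mem_Icc ht) _ (by simpa using hM t)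
  have h1 := E.integral_joint_bpEstimate G _ hD hf (H := fun _ t => clamp t ^ (2 * k + 2))
    (M := 1) (fun e => by fun_prop) fun e t => LDensity.abs_pow_le (clamp_mem t) _
  rw [bpMoment, hm.condMoment_eq (by fun_prop), h1]
  have e1 : ∫ t, clamp t ^ (2 * k + 2) ∂D.law = D.moment k :=
    integral_congr_ae (D.ae_mem.mono fun t ht => by simp only [clamp_of_mem ht])
  have e2 : ∫ t, clamp (-t) ^ (2 * k + 2) ∂D.law = D.moment k :=
    integral_congr_ae (D.ae_mem.mono fun t ht => by
      simp only [clamp_of_mem (neg_mem_Icc ht), LDensity.even_pow])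
  rw [e1, e2]
  ring

end SocketEnsemble

end Gexit
namespace Gexit

/-! ### Node operations

The two node types are distinguished by a Boolean, `true` for variable nodes. -/

/-- The rule for two messages. -/
noncomputable def op : Bool → ℝ → ℝ → ℝ
  | true => varRule₂
  | false => (· * ·)

/-- The rule for any number of messages. -/
noncomputable def agg {ι : Type*} : Bool → Finset ι → (ι → ℝ) → ℝ
  | true => varRule
  | false => fun s d => ∏ i ∈ s, d i

/-- The convolution of densities corresponding to `op`. -/
noncomputable def comb : Bool → LDensity → LDensity → LDensity
  | true => (· + ·)
  | false => (· * ·)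

/-- The density of the combination of `k` independent messages. -/
noncomputable def pw : Bool → ℕ → LDensity → LDensity
  | true => fun k a => k • a
  | false => fun k a => a ^ k

lemma pw_succ (b : Bool) (k : ℕ) (a : LDensity) : pw b (k + 1) a = comb b a (pw b k a) := by
  cases b
  · exact pow_succ' a k
  · exact succ_nsmul' a k

@[fun_prop]
lemma measurable_op (b : Bool) : Measurable fun p : ℝ × ℝ => op b p.1 p.2 := by
  cases b
  · exact measurable_fst.mul measurable_snd
  · exact measurable_varRule₂

lemma measurable_op_right (b : Bool) (x : ℝ) : Measurable (op b x) :=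
  (measurable_op b).comp (measurable_const.prodMk measurable_id)

lemma measurable_op_left (b : Bool) (z : ℝ) : Measurable fun x => op b x z :=
  (measurable_op b).comp (measurable_id.prodMk measurable_const)

lemma varRule₂_eq_lratio {u v : ℝ} (hu : u ∈ Ioc (-1 : ℝ) 1) (hv : v ∈ Ioc (-1 : ℝ) 1) :
    varRule₂ u v = lratio (lratio u * lratio v) ∧ 0 ≤ lratio u * lratio v := by
  have h := one_add_mul_pos hu hv
  have h1 : 0 < 1 + u := by linarith [hu.1]
  have h2 : 0 < 1 + v := by linarith [hv.1]
  have e1 : 1 + varRule₂ u v = (1 + u) * (1 + v) / (1 + u * v) := by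
    unfold varRule₂; field_simp; ring
  have e2 : 0 < 1 + varRule₂ u v := by rw [e1]; positivity
  refine ⟨by rw [← lratio_varRule₂ hu hv, lratio_lratio (by linarith)], ?_⟩
  unfold lratio
  exact mul_nonneg (div_nonneg (by linarith [hu.2]) h1.le) (div_nonneg (by linarith [hv.2]) h2.le)

lemma mul_mem_Ioc {u v : ℝ} (hu : u ∈ Ioc (-1 : ℝ) 1) (hv : v ∈ Ioc (-1 : ℝ) 1) :
    u * v ∈ Ioc (-1 : ℝ) 1 :=
  ⟨by linarith [one_add_mul_pos hu hv],
    (mul_mem_Icc (Ioc_subset_Icc_self hu) (Ioc_subset_Icc_self hv)).2⟩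

lemma op_mem {b : Bool} {u v : ℝ} (hu : u ∈ Ioc (-1 : ℝ) 1) (hv : v ∈ Ioc (-1 : ℝ) 1) :
    op b u v ∈ Ioc (-1 : ℝ) 1 := by
  cases b
  · exact mul_mem_Ioc hu hv
  · obtain ⟨h1, h2⟩ := varRule₂_eq_lratio hu hv
    change varRule₂ u v ∈ _
    rw [h1]
    exact lratio_mem h2

lemma agg_mem {ι : Type*} {b : Bool} (s : Finset ι) {d : ι → ℝ}
    (hd : ∀ i ∈ s, d i ∈ Ioc (-1 : ℝ) 1) : agg b s d ∈ Ioc (-1 : ℝ) 1 := by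
  cases b
  · exact Finset.prod_induction _ (· ∈ Ioc (-1 : ℝ) 1) (fun _ _ => mul_mem_Ioc) (by norm_num) hd
  · exact varRule_mem s hd

lemma agg_insert {ι : Type*} [DecidableEq ι] {b : Bool} {i : ι} {s : Finset ι} (hi : i ∉ s)
    {d : ι → ℝ} (hd : ∀ j ∈ insert i s, d j ∈ Ioc (-1 : ℝ) 1) :
    agg b (insert i s) d = op b (d i) (agg b s d) := by
  cases b
  · exact Finset.prod_insert hi
  · have hs := fun j hj => hd j (Finset.mem_insert_of_mem hj)
    have h1 := varRule₂_eq_lratio (hd i (Finset.mem_insert_self _ _)) (varRule_mem s hs)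
    change varRule (insert i s) d = varRule₂ (d i) (varRule s d)
    rw [h1.1, (lratio_prod_eq _ hd).1, Finset.prod_insert hi, lratio_varRule s hs]

lemma law_comb (b : Bool) (D D' : LDensity) :
    (comb b D D').law = (D.law.prod D'.law).map fun p => op b p.1 p.2 := by
  cases b <;> rfl

lemma integral_law_comb (b : Bool) (D D' : LDensity) {φ : ℝ → ℝ} (hφ : Measurable φ)
    (h : ∀ x, φ x ∈ Icc (0 : ℝ) 1) :
    ∫ x, φ x ∂(comb b D D').law = ∫ x, ∫ z, φ (op b x z) ∂D'.law ∂D.law ∧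
    ∫ x, φ x ∂(comb b D D').law = ∫ z, ∫ x, φ (op b x z) ∂D.law ∂D'.law := by
  have hi : Integrable (fun p : ℝ × ℝ => φ (op b p.1 p.2)) (D.law.prod D'.law) :=
    integrable_of_bdd (M := 1) (hφ.comp (measurable_op b))
      (ae_of_all _ fun p => abs_le.2 ⟨by linarith [(h (op b p.1 p.2)).1], (h _).2⟩)
  rw [law_comb, integral_map (measurable_op b).aemeasurable hφ.aestronglyMeasurable]
  exact ⟨integral_prod _ hi, integral_prod_symm _ hi⟩

lemma integral_unit_mem {μ : Measure ℝ} [IsProbabilityMeasure μ] {φ : ℝ → ℝ} (hφ : Measurable φ)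
    (h : ∀ x, φ x ∈ Icc (0 : ℝ) 1) : ∫ x, φ x ∂μ ∈ Icc (0 : ℝ) 1 := by
  refine ⟨integral_nonneg fun x => (h x).1, ?_⟩
  have hi : Integrable φ μ := integrable_of_bdd (M := 1) hφ
    (ae_of_all _ fun p => abs_le.2 ⟨by linarith [(h p).1], (h p).2⟩)
  simpa using integral_mono hi (integrable_const (1 : ℝ)) fun x => (h x).2

lemma measurable_integral_op_left (b : Bool) (D : LDensity) {φ : ℝ → ℝ} (hφ : Measurable φ) :
    Measurable fun z => ∫ x, φ (op b x z) ∂D.law :=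
  (StronglyMeasurable.integral_prod_right (f := fun z x => φ (op b x z))
    ((hφ.comp (measurable_op b)).comp measurable_swap).stronglyMeasurable).measurable

lemma measurable_integral_op_right (b : Bool) (D : LDensity) {φ : ℝ → ℝ} (hφ : Measurable φ) :
    Measurable fun x => ∫ z, φ (op b x z) ∂D.law :=
  (StronglyMeasurable.integral_prod_right (f := fun x z => φ (op b x z))
    (hφ.comp (measurable_op b)).stronglyMeasurable).measurable

/-! ### Functions of disjoint sets of coordinates -/

lemma indepFun_of_dependsOn {ι : Type*} [Fintype ι] (μ : ι → Measure ℝ)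
    [∀ i, IsProbabilityMeasure (μ i)] {f g : (ι → ℝ) → ℝ} (hf : Measurable f) (hg : Measurable g)
    {S T : Set ι} (hS : DependsOn f S) (hT : DependsOn g T) (hST : Disjoint S T) :
    IndepFun f g (Measure.pi μ) := by
  classical
  have ext : ∀ {f : (ι → ℝ) → ℝ} {S : Set ι}, Measurable f → DependsOn f S →
      ∃ F : ((toFinite S).toFinset → ℝ) → ℝ, Measurable F ∧ f = F ∘ fun y i => y i := by
    intro f S hf hS
    refine ⟨fun z => f fun j => if h : j ∈ (toFinite S).toFinset then z ⟨j, h⟩ else 0, ?_, ?_⟩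
    · refine hf.comp (measurable_pi_lambda _ fun j => ?_)
      by_cases h : j ∈ (toFinite S).toFinset
      · simp only [h, dite_true]; fun_prop
      · simp only [h, dite_false]; fun_prop
    · funext y
      refine hS fun j hj => ?_
      have : j ∈ (toFinite S).toFinset := (toFinite S).mem_toFinset.2 hj
      simp [hj]
  obtain ⟨F, hF, rfl⟩ := ext hf hS
  obtain ⟨K, hK, rfl⟩ := ext hg hT
  have hi : iIndepFun (fun (i : ι) (ω : ι → ℝ) => ω i) (Measure.pi μ) :=
    iIndepFun_pi (X := fun _ => id) fun _ => aemeasurable_id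
  have hd : Disjoint (toFinite S).toFinset (toFinite T).toFinset := by
    rw [Finset.disjoint_left]
    intro i h1 h2
    exact Set.disjoint_left.1 hST ((toFinite S).mem_toFinset.1 h1) ((toFinite T).mem_toFinset.1 h2)
  exact (hi.indepFun_finset _ _ hd fun i => measurable_pi_apply i).comp hF hK

lemma DependsOn.mono' {ι : Type*} {f : (ι → ℝ) → ℝ} {S T : Set ι} (h : DependsOn f S)
    (hST : S ⊆ T) : DependsOn f T := fun _ _ hxy => h fun i hi => hxy i (hST hi)

lemma map_op_of_dependsOn {ι : Type*} [Fintype ι] (μ : ι → Measure ℝ)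
    [∀ i, IsProbabilityMeasure (μ i)] {f g : (ι → ℝ) → ℝ} (hf : Measurable f) (hg : Measurable g)
    {S T : Set ι} (hS : DependsOn f S) (hT : DependsOn g T) (hST : Disjoint S T) {D D' : LDensity}
    (hD : (Measure.pi μ).map f = D.law) (hD' : (Measure.pi μ).map g = D'.law) (b : Bool) :
    (Measure.pi μ).map (fun y => op b (f y) (g y)) = (comb b D D').law := by
  have h := (indepFun_iff_map_prod_eq_prod_map_map hf.aemeasurable hg.aemeasurable).1
    (indepFun_of_dependsOn μ hf hg hS hT hST)
  rw [law_comb, ← hD, ← hD', ← h, Measure.map_map (measurable_op b) (hf.prodMk hg)]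
  rfl

namespace SocketEnsemble

variable (E : SocketEnsemble)

/-! ### Sockets -/

abbrev Socket : Type := E.VSocket ⊕ E.CSocket

abbrev Node : Type := Fin E.n ⊕ Fin E.m

variable {E}

def nodeOf : E.Socket → E.Node := Sum.map Sigma.fst Sigma.fst

/-- The socket matched with a given one. -/
def partner (G : E.Graph) : E.Socket → E.Socket
  | Sum.inl e => Sum.inr (G e)
  | Sum.inr x => Sum.inl (G.symm x)

/-- The other sockets of the node of `q`. -/
def siblings (q : E.Socket) : Finset E.Socket :=
  Finset.univ.filter fun p => nodeOf p = nodeOf q ∧ p ≠ q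

lemma mem_siblings {p q : E.Socket} : p ∈ siblings q ↔ nodeOf p = nodeOf q ∧ p ≠ q := by
  rw [siblings, Finset.mem_filter]
  simp

lemma siblings_inl (e : E.VSocket) : siblings (Sum.inl e) =
    (Finset.univ.erase e.2).map ((Function.Embedding.sigmaMk e.1).trans Function.Embedding.inl) := by
  obtain ⟨i, b⟩ := e
  ext p
  rw [mem_siblings, Finset.mem_map]
  rcases p with ⟨j, b'⟩ | ⟨j, b'⟩
  · constructor
    · rintro ⟨h1, h⟩
      obtain rfl : j = i := Sum.inl_injective h1
      exact ⟨b', Finset.mem_erase.2 ⟨fun hb => h (by rw [hb]), Finset.mem_univ _⟩, rfl⟩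
    · rintro ⟨a, h, h2⟩
      obtain ⟨rfl, h3⟩ := Sigma.mk.inj_iff.1 (Sum.inl_injective h2)
      rw [heq_eq_eq] at h3
      subst h3
      exact ⟨rfl, fun h4 => (Finset.mem_erase.1 h).1
        (eq_of_heq (Sigma.mk.inj_iff.1 (Sum.inl_injective h4)).2)⟩
  · simp [nodeOf]

lemma siblings_inr (e : E.CSocket) : siblings (Sum.inr e) =
    (Finset.univ.erase e.2).map ((Function.Embedding.sigmaMk e.1).trans Function.Embedding.inr) := by
  obtain ⟨i, b⟩ := e
  ext p
  rw [mem_siblings, Finset.mem_map]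
  rcases p with ⟨j, b'⟩ | ⟨j, b'⟩
  · simp [nodeOf]
  · constructor
    · rintro ⟨h1, h⟩
      obtain rfl : j = i := Sum.inr_injective h1
      exact ⟨b', Finset.mem_erase.2 ⟨fun hb => h (by rw [hb]), Finset.mem_univ _⟩, rfl⟩
    · rintro ⟨a, h, h2⟩
      obtain ⟨rfl, h3⟩ := Sigma.mk.inj_iff.1 (Sum.inr_injective h2)
      rw [heq_eq_eq] at h3
      subst h3
      exact ⟨rfl, fun h4 => (Finset.mem_erase.1 h).1
        (eq_of_heq (Sigma.mk.inj_iff.1 (Sum.inr_injective h4)).2)⟩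

open scoped Classical in
/-- The truncation of a soft bit to the range `(-1, 1]`. -/
noncomputable def trunc (t : ℝ) : ℝ := if t ∈ Ioc (-1 : ℝ) 1 then t else 0

lemma trunc_mem (t : ℝ) : trunc t ∈ Ioc (-1 : ℝ) 1 := by
  unfold trunc
  split_ifs with h
  · exact h
  · norm_num

lemma measurable_trunc : Measurable trunc :=
  Measurable.ite measurableSet_Ioc measurable_id measurable_const

/-- What the node of a socket contributes itself to its messages. -/
noncomputable def own (y : Fin E.n → ℝ) : E.Socket → ℝ
  | Sum.inl e => trunc (y e.1)
  | Sum.inr _ => 1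

/-- The message received at a socket after `h` half-rounds of belief propagation. -/
noncomputable def halfMsg (G : E.Graph) (y : Fin E.n → ℝ) : ℕ → E.Socket → ℝ
  | 0, _ => 0
  | h + 1, p => op (partner G p).isLeft (own y (partner G p))
      (agg (partner G p).isLeft (siblings (partner G p)) (halfMsg G y h))

/-- One round of flooding is two half-rounds. `halfMsg` truncates the outputs in order to remain in
(-1, 1] for every argument, hence the hypothesis on y. -/
lemma checkMsg_eq (G : E.Graph) {y : Fin E.n → ℝ} (hy : ∀ i, y i ∈ Ioc (-1 : ℝ) 1) (l : ℕ) (e : E.VSocket) :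
    E.checkMsg G y l e = halfMsg G y (2 * l) (Sum.inl e) := by
  induction l generalizing e with
  | zero => simp [checkMsg, halfMsg]
  | succ l ih =>
    change _ = (1 : ℝ) * ∏ s ∈ siblings (Sum.inr (G e)), halfMsg G y (2 * l + 1) s
    rw [one_mul, siblings_inr, Finset.prod_map, checkMsg]
    refine Finset.prod_congr rfl fun s _ => ?_
    change _ = varRule₂ (trunc (y (G.symm ⟨(G e).1, s⟩).1))
      (varRule (siblings (Sum.inl (G.symm ⟨(G e).1, s⟩))) (halfMsg G y (2 * l)))
    rw [siblings_inl, trunc, if_pos (hy _)]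
    simp only [varRule, Finset.prod_map, ih]
    rfl

lemma own_mem (y : Fin E.n → ℝ) (q : E.Socket) : own y q ∈ Ioc (-1 : ℝ) 1 := by
  cases q
  · exact trunc_mem _
  · norm_num [own]

lemma halfMsg_mem (G : E.Graph) (y : Fin E.n → ℝ) (h : ℕ) (p : E.Socket) :
    halfMsg G y h p ∈ Ioc (-1 : ℝ) 1 := by
  induction h generalizing p with
  | zero => norm_num [halfMsg]
  | succ h ih => exact op_mem (own_mem y _) (agg_mem _ fun q _ => ih q)

lemma measurable_own (q : E.Socket) : Measurable fun y => own y q := by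
  cases q
  · exact measurable_trunc.comp (measurable_pi_apply _)
  · exact measurable_const

end SocketEnsemble
end Gexit
namespace Gexit
namespace SocketEnsemble

variable (E : SocketEnsemble)

/-! ### Partial exploration of a random graph -/

/-- Number of edges. -/
abbrev numEdges : ℕ := ∑ i, E.vdeg i

lemma card_vSocket : Fintype.card E.VSocket = E.numEdges := by simp [Fintype.card_sigma]

lemma card_cSocket : Fintype.card E.CSocket = E.numEdges := by
  simp [Fintype.card_sigma, numEdges, E.sum_eq]

/-- A partial matching of sockets, and a set of visited nodes containing the matched sockets. -/
structure Exploration where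
  pairs : Finset (E.Socket × E.Socket)
  nodes : Finset E.Node
  mem : ∀ r ∈ pairs, nodeOf r.1 ∈ nodes ∧ nodeOf r.2 ∈ nodes

namespace Exploration

variable {E} (S : Exploration E)

def Used (q : E.Socket) : Prop := ∃ r ∈ S.pairs, q = r.1 ∨ q = r.2

/-- The graphs compatible with the partial matching. -/
def graphs : Finset E.Graph := Finset.univ.filter fun G => ∀ r ∈ S.pairs, partner G r.1 = r.2

lemma mem_graphs {S : Exploration E} {G : E.Graph} :
    G ∈ S.graphs ↔ ∀ r ∈ S.pairs, partner G r.1 = r.2 := by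
  rw [graphs, Finset.mem_filter]
  simp

/-- `S'` extends `S` by exploring from the sockets in `s`. -/
structure Ext (s : Finset E.Socket) (S S' : Exploration E) : Prop where
  pairs : S.pairs ⊆ S'.pairs
  nodes : S.nodes ⊆ S'.nodes
  used : ∀ q, S'.Used q → S.Used q ∨ q ∈ s ∨ nodeOf q ∉ S.nodes

lemma Used.node_mem {S : Exploration E} {q : E.Socket} (h : S.Used q) : nodeOf q ∈ S.nodes := by
  obtain ⟨r, hr, rfl | rfl⟩ := h
  · exact (S.mem r hr).1
  · exact (S.mem r hr).2

lemma Ext.graphs {s : Finset E.Socket} {S S' : Exploration E} (h : S.Ext s S') :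
    S'.graphs ⊆ S.graphs := fun _ hG => mem_graphs.2 fun r hr => mem_graphs.1 hG r (h.pairs hr)

lemma Ext.refl (s : Finset E.Socket) : S.Ext s S := ⟨subset_rfl, subset_rfl, fun _ h => Or.inl h⟩

lemma Ext.trans {s t u : Finset E.Socket} {S S' S'' : Exploration E} (h : S.Ext s S')
    (h' : S'.Ext t S'') (hs : s ⊆ u) (ht : ∀ q ∈ t, q ∈ u ∨ nodeOf q ∉ S.nodes) : S.Ext u S'' := by
  refine ⟨h.pairs.trans h'.pairs, h.nodes.trans h'.nodes, fun q hq => ?_⟩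
  rcases h'.used q hq with h1 | h1 | h1
  · rcases h.used q h1 with h2 | h2 | h2
    · exact Or.inl h2
    · exact Or.inr (Or.inl (hs h2))
    · exact Or.inr (Or.inr h2)
  · exact Or.inr (ht q h1)
  · exact Or.inr (Or.inr fun h2 => h1 (h.nodes h2))

/-- Reveal that `p` is matched with `q`. -/
def link (p q : E.Socket) (hp : nodeOf p ∈ S.nodes) : Exploration E where
  pairs := insert (p, q) S.pairs
  nodes := insert (nodeOf q) S.nodes
  mem r hr := by
    rcases Finset.mem_insert.1 hr with rfl | hr
    · exact ⟨Finset.mem_insert_of_mem hp, Finset.mem_insert_self _ _⟩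
    · exact ⟨Finset.mem_insert_of_mem (S.mem r hr).1, Finset.mem_insert_of_mem (S.mem r hr).2⟩

lemma mem_graphs_link {p q : E.Socket} (hp : nodeOf p ∈ S.nodes) {G : E.Graph} :
    G ∈ (S.link p q hp).graphs ↔ G ∈ S.graphs ∧ partner G p = q := by
  rw [mem_graphs, mem_graphs, link, Finset.forall_mem_insert, and_comm]

lemma ext_link {p q : E.Socket} (hp : nodeOf p ∈ S.nodes) (hq : nodeOf q ∉ S.nodes) :
    S.Ext {p} (S.link p q hp) := by
  refine ⟨Finset.subset_insert _ _, Finset.subset_insert _ _, ?_⟩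
  rintro q' ⟨r, hr, h⟩
  rcases Finset.mem_insert.1 hr with rfl | hr
  · rcases h with rfl | rfl
    · exact Or.inr (Or.inl (Finset.mem_singleton_self _))
    · exact Or.inr (Or.inr hq)
  · exact Or.inl ⟨r, hr, h⟩

/-- Switching: the check socket of e is exchanged with x. Neither e nor x is matched so far, so no
revealed pair is affected. -/
lemma swap_mem_graphs {e : E.VSocket} {x : E.CSocket} (he : ¬S.Used (Sum.inl e))
    (hx : ¬S.Used (Sum.inr x)) {G : E.Graph} (hG : G ∈ S.graphs) :
    G.trans (Equiv.swap (G e) x) ∈ S.graphs := by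
  rw [mem_graphs] at hG ⊢
  intro r hr
  have h := hG r hr
  have h1 : ∀ q, q = r.1 ∨ q = r.2 → S.Used q := fun q hq => ⟨r, hr, hq⟩
  rcases r with ⟨e' | x', q⟩
  · simp only [partner] at h ⊢
    subst h
    have n1 : G e' ≠ G e := fun h => he (h1 _ (Or.inl (by rw [G.injective h])))
    have n2 : G e' ≠ x := fun h => hx (h1 _ (Or.inr (by rw [h])))
    simp [Equiv.swap_apply_of_ne_of_ne n1 n2]
  · simp only [partner] at h ⊢
    subst h
    have n1 : x' ≠ G e := fun h => he (h1 _ (Or.inr (by simp [h])))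
    have n2 : x' ≠ x := fun h => hx (h1 _ (Or.inl (by rw [h])))
    simp [Equiv.swap_apply_of_ne_of_ne n1 n2]

/-- The switched graph together with the old partner of e determines the graph. Hence each
admissible partner is taken by at least the fraction 1 / `numEdges` of the compatible graphs; no
matching upper bound is needed. -/
lemma card_graphs_le_aux {e : E.VSocket} {x : E.CSocket} (he : ¬S.Used (Sum.inl e))
    (hx : ¬S.Used (Sum.inr x)) :
    S.graphs.card ≤ E.numEdges * (S.graphs.filter fun G => G e = x).card := by
  rw [← E.card_cSocket, ← Finset.card_univ, ← Finset.card_product]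
  refine Finset.card_le_card_of_injOn (fun G => (G e, G.trans (Equiv.swap (G e) x))) ?_ ?_
  · intro G hG
    refine Finset.mem_coe.2 (Finset.mem_product.2 ⟨Finset.mem_univ _, Finset.mem_filter.2 ⟨?_, ?_⟩⟩)
    · exact S.swap_mem_graphs he hx hG
    · simp
  · intro G _ G' _ h
    obtain ⟨h1, h2⟩ := Prod.ext_iff.1 h
    refine Equiv.ext fun e' => ?_
    have := Equiv.congr_fun h2 e'
    simp only [Equiv.trans_apply] at this h1
    rw [h1] at this
    exact (Equiv.swap (G' e) x).injective this

lemma card_graphs_le {p q : E.Socket} (hp : nodeOf p ∈ S.nodes) (hpu : ¬S.Used p)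
    (hqu : ¬S.Used q) (hpq : q.isLeft = !p.isLeft) :
    S.graphs.card ≤ E.numEdges * (S.link p q hp).graphs.card := by
  rcases p with e | x <;> rcases q with e' | x'
  · simp at hpq
  · refine (S.card_graphs_le_aux hpu hqu).trans_eq ?_
    congr 2
    ext G
    rw [Finset.mem_filter, mem_graphs_link]
    simp [partner]
  · refine (S.card_graphs_le_aux hqu hpu).trans_eq ?_
    congr 2
    ext G
    rw [Finset.mem_filter, mem_graphs_link]
    simp only [partner, Sum.inl.injEq]
    rw [Equiv.symm_apply_eq, eq_comm]
  · simp at hpq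

/-- The average of `F` over the compatible graphs is at least `v`. -/
def LB (F : E.Graph → ℝ) (v : ℝ) : Prop := (S.graphs.card : ℝ) * v ≤ ∑ G ∈ S.graphs, F G

lemma LB.mono {S : Exploration E} {F : E.Graph → ℝ} {v v' : ℝ} (h : S.LB F v) (hv : v' ≤ v) :
    S.LB F v' := (mul_le_mul_of_nonneg_left hv (Nat.cast_nonneg _)).trans h

/-- The compatible graphs are split by the partner of p. Graphs whose partner is outside X are
dropped, which is harmless because F is nonnegative. -/
lemma LB_of_link {F : E.Graph → ℝ} (hF : ∀ G, 0 ≤ F G) {p : E.Socket} (hp : nodeOf p ∈ S.nodes)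
    (hpu : ¬S.Used p) (X : Finset E.Socket) (hX : ∀ q ∈ X, ¬S.Used q ∧ q.isLeft = !p.isLeft)
    {v : E.Socket → ℝ} (hv : ∀ q ∈ X, (S.link p q hp).LB F (v q)) :
    S.LB F ((∑ q ∈ X, v q) / E.numEdges) := by
  have h1 : ∀ q ∈ X, (S.graphs.card : ℝ) / E.numEdges * v q ≤
      ∑ G ∈ S.graphs, if partner G p = q then F G else 0 := by
    intro q hq
    have e : (S.link p q hp).graphs = S.graphs.filter fun G => partner G p = q := by
      ext G; rw [Finset.mem_filter, mem_graphs_link]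
    rw [← Finset.sum_filter, ← e]
    rcases le_total (v q) 0 with h0 | h0
    · exact (mul_nonpos_of_nonneg_of_nonpos (by positivity) h0).trans
        (Finset.sum_nonneg fun G _ => hF G)
    · refine (mul_le_mul_of_nonneg_right ?_ h0).trans (hv q hq)
      refine div_le_of_le_mul₀ (Nat.cast_nonneg _) (Nat.cast_nonneg _) ?_
      rw [mul_comm]
      exact_mod_cast S.card_graphs_le hp hpu (hX q hq).1 (hX q hq).2
  unfold LB
  calc (S.graphs.card : ℝ) * ((∑ q ∈ X, v q) / E.numEdges)
      = ∑ q ∈ X, (S.graphs.card : ℝ) / E.numEdges * v q := by rw [← Finset.mul_sum]; ring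
    _ ≤ ∑ q ∈ X, ∑ G ∈ S.graphs, if partner G p = q then F G else 0 := Finset.sum_le_sum h1
    _ = ∑ G ∈ S.graphs, ∑ q ∈ X, if partner G p = q then F G else 0 := Finset.sum_comm
    _ ≤ ∑ G ∈ S.graphs, F G := by
        refine Finset.sum_le_sum fun G _ => ?_
        rw [Finset.sum_ite_eq]
        split_ifs
        · exact le_rfl
        · exact hF G

/-- After the exploration from `S` to `S'`, `f` has law `D` and depends on the channels explored
in between. -/
def Determined (c : Fin E.n → LDensity) (S S' : Exploration E)
    (f : E.Graph → (Fin E.n → ℝ) → ℝ) (D : LDensity) : Prop :=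
  ∀ G ∈ S'.graphs, Measurable (f G) ∧
    DependsOn (f G) {j | Sum.inl j ∈ S'.nodes ∧ Sum.inl j ∉ S.nodes} ∧
    (Measure.pi fun j => (c j).law).map (f G) = D.law

end Exploration
end SocketEnsemble
end Gexit
namespace Gexit

/-! ### Laws of BP messages on a random graph -/

namespace DegreePair

variable (P : DegreePair)

/-- The edge degree distribution on the side of the variable nodes or of the check nodes. -/
noncomputable def poly : Bool → Polynomial ℝ
  | true => P.lam
  | false => P.rho

/-- The density obtained from a node of random degree. -/
noncomputable def side : Bool → LDensity → LDensity
  | true => P.varD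
  | false => P.checkD

lemma integral_side (b : Bool) (a : LDensity) {φ : ℝ → ℝ} (hφ : Measurable φ)
    (h : ∀ x, φ x ∈ Icc (0 : ℝ) 1) :
    ∫ x, φ x ∂(P.side b a).law =
      ∑ k ∈ (P.poly b).support, (P.poly b).coeff k * ∫ x, φ x ∂(pw b k a).law := by
  have hM : ∀ d ∈ Icc (-1 : ℝ) 1, |φ d| ≤ 1 := fun d _ =>
    abs_le.2 ⟨by linarith [(h d).1], (h d).2⟩
  cases b
  · exact LDensity.integral_law_mix (h0 := P.rho_nonneg) (h1 := P.sum_rho) _ hφ hM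
  · exact LDensity.integral_law_mix (h0 := P.lam_nonneg) (h1 := P.sum_lam) _ hφ hM

/-- The density contributed by a node itself. -/
noncomputable def ownD (c : LDensity) : Bool → LDensity
  | true => c
  | false => 1

/-- Density evolution by half-rounds, for the messages received at sockets of the given side. -/
noncomputable def halfD (c : LDensity) : ℕ → Bool → LDensity
  | 0, _ => 0
  | h + 1, b => comb (!b) (ownD c !b) (P.side (!b) (halfD c h !b))

lemma halfD_two_mul (c : LDensity) (l : ℕ) : P.halfD c (2 * l) true = P.msg c l := by
  induction l with
  | zero => rfl
  | succ l ih =>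
    change (1 : LDensity) * P.checkD (c + P.varD (P.halfD c (2 * l) true)) = _
    rw [one_mul, ih, msg]

end DegreePair

namespace SocketEnsemble

variable {E : SocketEnsemble}

/-- Outside of any `M` nodes, the sockets have nearly the prescribed degree distribution. -/
def Regular (P : DegreePair) (E : SocketEnsemble) (ε : ℝ) (M : ℕ) : Prop :=
  ∀ W : Finset E.Node, W.card ≤ M → ∀ b, ∀ k ∈ (P.poly b).support,
    ((P.poly b).coeff k - ε) * E.numEdges ≤ ((Finset.univ.filter fun q : E.Socket =>
      q.isLeft = b ∧ nodeOf q ∉ W ∧ (siblings q).card = k).card : ℝ)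

lemma Regular.mono {P : DegreePair} {ε : ℝ} {M M' : ℕ} (h : Regular P E ε M') (hM : M ≤ M') :
    Regular P E ε M := fun W hW => h W (hW.trans hM)

lemma card_isLeft_eq (b : Bool) :
    (Finset.univ.filter fun q : E.Socket => q.isLeft = b).card = E.numEdges := by
  cases b
  · rw [← E.card_cSocket, ← Finset.card_univ,
      ← Finset.card_map (Function.Embedding.inr : E.CSocket ↪ E.Socket)]
    refine congrArg Finset.card (Finset.ext fun q => ?_)
    cases q <;> simp
  · rw [← E.card_vSocket, ← Finset.card_univ,
      ← Finset.card_map (Function.Embedding.inl : E.VSocket ↪ E.Socket)]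
    refine congrArg Finset.card (Finset.ext fun q => ?_)
    cases q <;> simp

lemma map_own (c : LDensity) (cv : Fin E.n → LDensity) {q : E.Socket} {W : Finset E.Node}
    (hcv : ∀ j, Sum.inl j ∉ W → cv j = c) (hq : nodeOf q ∉ W) :
    (Measure.pi fun j => (cv j).law).map (fun y => own y q) =
      (DegreePair.ownD c q.isLeft).law ∧
    DependsOn (fun y => own y q) {j | (Sum.inl j : E.Node) = nodeOf q} := by
  rcases q with e | x
  · refine ⟨?_, fun y y' h => congrArg trunc (h e.1 rfl)⟩
    change (Measure.pi fun j => (cv j).law).map (trunc ∘ Function.eval e.1) = c.law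
    rw [← Measure.map_map measurable_trunc (measurable_pi_apply _),
      (measurePreserving_eval (fun j => (cv j).law) e.1).map_eq, hcv e.1 hq]
    conv_rhs => rw [← Measure.map_id (μ := c.law)]
    exact Measure.map_congr (c.ae_mem_Ioc.mono fun t ht => if_pos ht)
  · refine ⟨?_, fun y y' _ => rfl⟩
    change (Measure.pi fun j => (cv j).law).map (fun _ => (1 : ℝ)) = (1 : LDensity).law
    rw [Measure.map_const, measure_univ, one_smul, LDensity.law_one]

lemma ae_pi_mem (cv : Fin E.n → LDensity) :
    ∀ᵐ y ∂(Measure.pi fun j => (cv j).law), ∀ j, y j ∈ Ioc (-1 : ℝ) 1 :=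
  (eventually_all).2 fun j =>
    (Measure.quasiMeasurePreserving_eval (fun j => (cv j).law) j).ae (cv j).ae_mem_Ioc

open Exploration

/-- Lower bound for averages given the law of the message at one socket. -/
def MessageBound (P : DegreePair) (h m M : ℕ) (C : ℝ) : Prop :=
  ∀ (E : SocketEnsemble) (ε : ℝ), 0 ≤ ε → Regular P E ε M →
  ∀ (c : LDensity) (cv : Fin E.n → LDensity) (S : Exploration E),
    (∀ j, Sum.inl j ∉ S.nodes → cv j = c) → S.nodes.card ≤ m →
  ∀ p, ¬S.Used p → nodeOf p ∈ S.nodes →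
  ∀ φ : ℝ → ℝ, Measurable φ → (∀ x, φ x ∈ Icc (0 : ℝ) 1) →
  ∀ F : E.Graph → ℝ, (∀ G, 0 ≤ F G) → ∀ θ : ℝ, 0 ≤ θ →
  (∀ S' D, S.Ext {p} S' → S'.nodes.card ≤ M →
    Determined cv S S' (fun G y => halfMsg G y h p) D → S'.LB F (∫ x, φ x ∂D.law - θ)) →
  S.LB F (∫ x, φ x ∂(P.halfD c h p.isLeft).law - θ - C * ε)

/-- Lower bound for averages given the law of the combination of the messages at `r` sockets. -/
def AggregateBound (P : DegreePair) (h : ℕ) (b : Bool) (r m M : ℕ) (C : ℝ) : Prop :=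
  ∀ (E : SocketEnsemble) (ε : ℝ), 0 ≤ ε → Regular P E ε M →
  ∀ (c : LDensity) (cv : Fin E.n → LDensity) (S : Exploration E),
    (∀ j, Sum.inl j ∉ S.nodes → cv j = c) → S.nodes.card ≤ m →
  ∀ s : Finset E.Socket, s.card = r →
    (∀ p ∈ s, ¬S.Used p ∧ nodeOf p ∈ S.nodes ∧ p.isLeft = b) →
  ∀ φ : ℝ → ℝ, Measurable φ → (∀ x, φ x ∈ Icc (0 : ℝ) 1) →
  ∀ F : E.Graph → ℝ, (∀ G, 0 ≤ F G) → ∀ θ : ℝ, 0 ≤ θ →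
  (∀ S' D, S.Ext s S' → S'.nodes.card ≤ M →
    Determined cv S S' (fun G y => agg b s (halfMsg G y h)) D →
      S'.LB F (∫ x, φ x ∂D.law - θ)) →
  S.LB F (∫ x, φ x ∂(pw b r (P.halfD c h b)).law - θ - C * ε)

lemma agg_empty_law (b : Bool) (a : LDensity) :
    (pw b 0 a).law = Measure.dirac (agg b (∅ : Finset ℕ) fun _ => (0 : ℝ)) := by
  cases b
  · simp [pw, agg, LDensity.law_one]
  · simp [pw, agg, varRule, LDensity.law_zero]

lemma agg_empty {ι : Type*} (b : Bool) (d : ι → ℝ) :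
    agg b ∅ d = agg b (∅ : Finset ℕ) fun _ => (0 : ℝ) := by
  cases b <;> simp [agg, varRule]

lemma aggregateBound_zero (P : DegreePair) (h : ℕ) (b : Bool) (m : ℕ) :
    AggregateBound P h b 0 m m 0 := by
  intro E ε _ _ c cv S _ hm s hs _ φ _ _ F _ θ _ H
  obtain rfl := Finset.card_eq_zero.1 hs
  rw [zero_mul, sub_zero]
  refine H S (pw b 0 (P.halfD c h b)) (Ext.refl S _) hm fun G _ => ?_
  simp only [agg_empty]
  refine ⟨measurable_const, fun _ _ _ => rfl, ?_⟩
  rw [Measure.map_const, measure_univ, one_smul, agg_empty_law]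

/-- The two functions depend on the channels of disjoint sets of newly visited variable nodes, so
they are independent. -/
lemma Determined.comb {cv : Fin E.n → LDensity} {S S' S'' : Exploration E} (b : Bool)
    {D D' : LDensity} {t u : Finset E.Socket} {f g : E.Graph → (Fin E.n → ℝ) → ℝ}
    (hS : S.Ext t S') (hS' : S'.Ext u S'') (h1 : Determined cv S S' f D)
    (h2 : Determined cv S' S'' g D') :
    Determined cv S S'' (fun G y => op b (f G y) (g G y)) (comb b D D') := by
  intro G hG
  obtain ⟨m1, d1, l1⟩ := h1 G (hS'.graphs hG)
  obtain ⟨m2, d2, l2⟩ := h2 G hG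
  refine ⟨(measurable_op b).comp (m1.prodMk m2), fun y y' hy => ?_, ?_⟩
  · have e1 : f G y = f G y' := d1 fun j hj => hy j ⟨hS'.nodes hj.1, hj.2⟩
    have e2 : g G y = g G y' := d2 fun j hj => hy j ⟨hj.1, fun h => hj.2 (hS.nodes h)⟩
    simp only [e1, e2]
  · exact map_op_of_dependsOn _ m1 m2 d1 d2
      (Set.disjoint_left.2 fun j h h' => h'.2 h.1) l1 l2 b

/-- First the neighbourhood of p is explored, with the test function averaged over the ideal law of
the other messages. Once the actual law D at p is known, the others are explored, with the test
function averaged over D, and Fubini matches the two. The quantification over continuations in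
`MessageBound` and `AggregateBound` is what makes this chaining possible. -/
lemma aggregateBound_succ {P : DegreePair} {h : ℕ} {b : Bool} {r m M₁ M₂ : ℕ} {C₁ C₂ : ℝ}
    (hC₂ : 0 ≤ C₂) (h1 : MessageBound P h m M₁ C₁) (h2 : AggregateBound P h b r M₁ M₂ C₂) :
    AggregateBound P h b (r + 1) m (max M₁ M₂) (C₁ + C₂) := by
  intro E ε hε hR c cv S hcv hm s hs hsS φ hφ hφ' F hF θ hθ H
  obtain ⟨p, s, hps, rfl, hcard⟩ := Finset.card_eq_succ.1 hs
  obtain ⟨hpu, hpn, hpb⟩ := hsS p (Finset.mem_insert_self _ _)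
  set a := P.halfD c h b
  have key := h1 E ε hε (hR.mono (le_max_left _ _)) c cv S hcv hm p hpu hpn
    (fun x => ∫ z, φ (op b x z) ∂(pw b r a).law) (measurable_integral_op_right b _ hφ)
    (fun x => integral_unit_mem (hφ.comp (measurable_op_right b x)) fun z => hφ' _)
    F hF (θ + C₂ * ε) (by positivity) ?_
  · rw [hpb, ← (integral_law_comb b _ _ hφ hφ').1, ← pw_succ] at key
    exact key.mono (by linarith)
  · intro S' D hS' hS'm hD
    have key2 := h2 E ε hε (hR.mono (le_max_right _ _)) c cv S'
      (fun j hj => hcv j fun h => hj (hS'.nodes h)) hS'm s hcard ?_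
      (fun z => ∫ x, φ (op b x z) ∂D.law) (measurable_integral_op_left b _ hφ)
      (fun z => integral_unit_mem (hφ.comp (measurable_op_left b z)) fun x => hφ' _)
      F hF θ hθ ?_
    · rw [← (integral_law_comb b _ _ hφ hφ').2, (integral_law_comb b _ _ hφ hφ').1] at key2
      exact key2.mono (by linarith)
    · intro q hq
      obtain ⟨hqu, hqn, hqb⟩ := hsS q (Finset.mem_insert_of_mem hq)
      refine ⟨fun h => ?_, hS'.nodes hqn, hqb⟩
      rcases hS'.used q h with h3 | h3 | h3
      · exact hqu h3
      · exact hps (Finset.mem_singleton.1 h3 ▸ hq)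
      · exact h3 hqn
    · intro S'' D' hS'' hS''m hD'
      rw [← (integral_law_comb b _ _ hφ hφ').2]
      refine H S'' _ (hS'.trans hS'' ?_ ?_) (hS''m.trans (le_max_right _ _)) ?_
      · exact Finset.singleton_subset_iff.2 (Finset.mem_insert_self _ _)
      · exact fun q hq => Or.inl (Finset.mem_insert_of_mem hq)
      · have := Determined.comb b hS' hS'' hD hD'
        convert this using 3 with G y
        exact agg_insert hps fun j _ => halfMsg_mem _ _ _ _

lemma exists_aggregateBound {P : DegreePair} {h : ℕ}
    (H : ∀ m, ∃ M C, 0 ≤ C ∧ MessageBound P h m M C) (b : Bool) (r m : ℕ) :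
    ∃ M C, 0 ≤ C ∧ AggregateBound P h b r m M C := by
  induction r generalizing m with
  | zero => exact ⟨m, 0, le_rfl, aggregateBound_zero P h b m⟩
  | succ r ih =>
    obtain ⟨M₁, C₁, hC₁, h1⟩ := H m
    obtain ⟨M₂, C₂, hC₂, h2⟩ := ih M₁
    exact ⟨_, _, add_nonneg hC₁ hC₂, aggregateBound_succ hC₂ h1 h2⟩

lemma messageBound_zero (P : DegreePair) (m : ℕ) : MessageBound P 0 m m 0 := by
  intro E ε _ _ c cv S _ hm p _ _ φ _ _ F _ θ _ H
  rw [zero_mul, sub_zero]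
  refine H S 0 (Ext.refl S _) hm fun G _ => ⟨measurable_const, fun _ _ _ => rfl, ?_⟩
  change (Measure.pi fun j => (cv j).law).map (fun _ => (0 : ℝ)) = (0 : LDensity).law
  rw [Measure.map_const, measure_univ, one_smul, LDensity.law_zero]

/-- Reveal the partner of a socket, and then explore from the siblings of the partner. -/
lemma LB_link_of_aggregateBound {P : DegreePair} {h k m M : ℕ} {C ε : ℝ} (hε : 0 ≤ ε)
    (hR : Regular P E ε M) {c : LDensity} {cv : Fin E.n → LDensity} {S : Exploration E}
    (hcv : ∀ j, Sum.inl j ∉ S.nodes → cv j = c) (hm : S.nodes.card ≤ m) {p q : E.Socket}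
    (hp : nodeOf p ∈ S.nodes) {b : Bool} (hqb : q.isLeft = b)
    (hq : nodeOf q ∉ S.nodes) (hqk : (siblings q).card = k)
    (hA : AggregateBound P h b k (m + 1) M C)
    {φ : ℝ → ℝ} (hφ : Measurable φ) (hφ' : ∀ x, φ x ∈ Icc (0 : ℝ) 1)
    {F : E.Graph → ℝ} (hF : ∀ G, 0 ≤ F G) {θ : ℝ} (hθ : 0 ≤ θ)
    (H : ∀ S' D, S.Ext {p} S' → S'.nodes.card ≤ M →
      Determined cv S S' (fun G y => halfMsg G y (h + 1) p) D → S'.LB F (∫ x, φ x ∂D.law - θ)) :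
    (S.link p q hp).LB F (∫ z, ∫ x, φ (op b x z) ∂(DegreePair.ownD c b).law
      ∂(pw b k (P.halfD c h b)).law - θ - C * ε) := by
  have hext := S.ext_link hp hq
  refine hA E ε hε hR c cv (S.link p q hp) (fun j hj => hcv j fun h => hj (hext.nodes h))
    ((Finset.card_insert_le _ _).trans (by omega)) (siblings q) hqk ?_ _
    (measurable_integral_op_left b _ hφ)
    (fun z => integral_unit_mem (hφ.comp (measurable_op_left b z)) fun x => hφ' _)
    F hF θ hθ ?_
  · intro q' hq'
    obtain ⟨h1, h2⟩ := mem_siblings.1 hq'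
    refine ⟨fun h => ?_, ?_, ?_⟩
    · obtain ⟨r, hr, h3⟩ := h
      rcases Finset.mem_insert.1 hr with rfl | hr
      · rcases h3 with h3 | h3
        · exact hq (h1 ▸ h3 ▸ hp)
        · exact h2 h3
      · exact hq (h1 ▸ (show S.Used q' from ⟨r, hr, h3⟩).node_mem)
    · rw [h1]; exact Finset.mem_insert_self _ _
    · rw [← hqb]
      rcases q with q | q <;> rcases q' with q' | q' <;> simp_all [nodeOf]
  · intro S' D hS' hS'm hD
    rw [← (integral_law_comb b _ _ hφ hφ').2]
    refine H S' _ (hext.trans hS' subset_rfl ?_) hS'm ?_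
    · intro q' hq'
      rw [(mem_siblings.1 hq').1]
      exact Or.inr hq
    · have hown : Determined cv S (S.link p q hp) (fun _ y => own y q)
          (DegreePair.ownD c b) := by
        intro G _
        obtain ⟨h1, h2⟩ := map_own c cv hcv hq
        refine ⟨measurable_own q, DependsOn.mono' h2 ?_, hqb ▸ h1⟩
        intro j hj
        rw [mem_ofPred_eq] at hj ⊢
        rw [hj]
        exact ⟨Finset.mem_insert_self _ _, hq⟩
      have h3 := Determined.comb b hext hS' hown hD
      intro G hG
      have h4 : partner G p = q := ((S.mem_graphs_link hp).1 (hS'.graphs hG)).2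
      have h5 : (fun y => halfMsg G y (h + 1) p) =
          fun y => op b (own y q) (agg b (siblings q) (halfMsg G y h)) := by
        funext y
        rw [halfMsg, h4, hqb]
      beta_reduce
      rw [h5]
      exact h3 G hG

/-- The partner of p is revealed. The unvisited sockets of each degree on the opposite side number
about coeff k · `numEdges`, each being the partner with probability at least 1 / `numEdges`, so the
degree follows the edge distribution up to ε. The siblings of the partner are then explored.
Partners at visited nodes are discarded. -/
lemma exists_messageBound_succ {P : DegreePair} {h : ℕ}
    (H : ∀ b r m, ∃ M C, 0 ≤ C ∧ AggregateBound P h b r m M C) (m : ℕ) :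
    ∃ M C, 0 ≤ C ∧ MessageBound P (h + 1) m M C := by
  choose M₀ C₀ hC₀ hA using fun b r => H b r (m + 1)
  have key : ∀ b : Bool, ∃ M C, m ≤ M ∧ 0 ≤ C ∧ ∀ k ∈ (P.poly b).support,
      M₀ b k ≤ M ∧ C₀ b k ≤ C := by
    intro b
    -- M also exceeds m, so that regularity applies to the set of nodes already visited.
    refine ⟨m + ∑ k ∈ (P.poly b).support, M₀ b k, ∑ k ∈ (P.poly b).support, C₀ b k,
      Nat.le_add_right _ _, Finset.sum_nonneg fun k _ => hC₀ b k, fun k hk => ⟨?_, ?_⟩⟩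
    · exact (Finset.single_le_sum (f := fun k => M₀ b k) (fun _ _ => Nat.zero_le _) hk).trans
        (Nat.le_add_left _ _)
    · exact Finset.single_le_sum (f := fun k => C₀ b k) (fun k _ => hC₀ b k) hk
  choose M C hmM hC hMC using key
  -- The constants must not depend on the side of p, so both sides are added; each degree in the
  -- support loses one further ε.
  refine ⟨M true + M false, (C true + (P.poly true).support.card) +
    (C false + (P.poly false).support.card), by have := hC true; have := hC false; positivity, ?_⟩
  intro E ε hε hR c cv S hcv hm p hpu hpn φ hφ hφ' F hF θ hθ HH
  set b := !p.isLeft with hb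
  set a := P.halfD c h b
  set ψ : ℝ → ℝ := fun z => ∫ x, φ (op b x z) ∂(DegreePair.ownD c b).law
  have hψ : Measurable ψ := measurable_integral_op_left b _ hφ
  have hψ' : ∀ z, ψ z ∈ Icc (0 : ℝ) 1 := fun z =>
    integral_unit_mem (hφ.comp (measurable_op_left b z)) fun x => hφ' _
  set s := (P.poly b).support
  set X : ℕ → Finset E.Socket := fun k => Finset.univ.filter fun q : E.Socket =>
      q.isLeft = b ∧ nodeOf q ∉ S.nodes ∧ (siblings q).card = k
  have hX : ∀ {k q}, q ∈ X k ↔ q.isLeft = b ∧ nodeOf q ∉ S.nodes ∧ (siblings q).card = k := by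
    intro k q
    rw [Finset.mem_filter]
    simp
  have hMb : M b ≤ M true + M false := by
    cases b
    · exact Nat.le_add_left _ _
    · exact Nat.le_add_right _ _
  have hRS := fun k hk => hR S.nodes (hm.trans ((hmM b).trans hMb)) b k hk
  have hdisj : (s : Set ℕ).PairwiseDisjoint X := by
    intro k _ k' _ hkk
    refine Finset.disjoint_left.2 fun q h1 h2 => hkk ?_
    rw [← (hX.1 h1).2.2, ← (hX.1 h2).2.2]
  have hlink := S.LB_of_link hF hpn hpu (s.biUnion X) (v := fun q =>
      ∫ z, ψ z ∂(pw b (siblings q).card a).law - (θ + C b * ε)) ?_ ?_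
  · refine hlink.mono ?_
    rw [Finset.sum_biUnion hdisj]
    have e1 : ∀ k ∈ s, ∑ q ∈ X k, (∫ z, ψ z ∂(pw b (siblings q).card a).law - (θ + C b * ε)) =
        (X k).card * (∫ z, ψ z ∂(pw b k a).law - (θ + C b * ε)) := by
      intro k _
      rw [← nsmul_eq_mul, ← Finset.sum_const]
      exact Finset.sum_congr rfl fun q hq => by rw [(hX.1 hq).2.2]
    rw [Finset.sum_congr rfl e1]
    have hN : (0 : ℝ) < E.numEdges := by
      rw [← card_isLeft_eq p.isLeft]
      exact Nat.cast_pos.2 (Finset.card_pos.2 ⟨p, Finset.mem_filter.2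
        ⟨Finset.mem_univ _, (rfl : p.isLeft = p.isLeft)⟩⟩)
    have hcard : ∑ k ∈ s, ((X k).card : ℝ) ≤ E.numEdges := by
      rw [← card_isLeft_eq b, ← Nat.cast_sum, ← Finset.card_biUnion fun k hk k' hk' h => hdisj hk hk' h]
      refine Nat.cast_le.2 (Finset.card_le_card fun q hq => ?_)
      obtain ⟨k, _, hk⟩ := Finset.mem_biUnion.1 hq
      exact Finset.mem_filter.2 ⟨Finset.mem_univ _, (hX.1 hk).1⟩
    have hCb : C b + s.card ≤ C true + (P.poly true).support.card +
        (C false + (P.poly false).support.card) := by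
      have h1 := hC true
      have h2 := hC false
      have h3 : (0 : ℝ) ≤ (P.poly true).support.card := Nat.cast_nonneg _
      have h4 : (0 : ℝ) ≤ (P.poly false).support.card := Nat.cast_nonneg _
      change C b + (P.poly b).support.card ≤ _
      cases b <;> linarith
    have hI : ∫ x, φ x ∂(P.halfD c (h + 1) p.isLeft).law =
        ∑ k ∈ s, (P.poly b).coeff k * ∫ z, ψ z ∂(pw b k a).law := by
      rw [← P.integral_side b a hψ hψ']
      exact (integral_law_comb b _ _ hφ hφ').2
    rw [hI, le_div_iff₀ hN]
    have hθ' : 0 ≤ θ + C b * ε := by have := hC b; positivity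
    -- The regularity deficit of ε costs at most ε per degree, because the integral of ψ lies in [0,
    -- 1].
    have e2 : ∀ k ∈ s, ((P.poly b).coeff k * ∫ z, ψ z ∂(pw b k a).law - ε) * E.numEdges ≤
        (X k).card * ∫ z, ψ z ∂(pw b k a).law := by
      intro k hk
      have h1 := integral_unit_mem (μ := (pw b k a).law) hψ hψ'
      have h2 := mul_le_mul_of_nonneg_right (hRS k hk) h1.1
      have h3 : ε * E.numEdges * (∫ z, ψ z ∂(pw b k a).law) ≤ ε * E.numEdges * 1 :=
        mul_le_mul_of_nonneg_left h1.2 (by positivity)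
      nlinarith
    have e3 := Finset.sum_le_sum e2
    rw [← Finset.sum_mul, Finset.sum_sub_distrib, Finset.sum_const, nsmul_eq_mul] at e3
    simp only [mul_sub, Finset.sum_sub_distrib]
    rw [← Finset.sum_mul]
    have e4 := mul_le_mul_of_nonneg_right hcard hθ'
    have e5 := mul_le_mul_of_nonneg_right (mul_le_mul_of_nonneg_right hCb hε) hN.le
    nlinarith
  · intro q hq
    obtain ⟨k, _, hk⟩ := Finset.mem_biUnion.1 hq
    obtain ⟨h1, h2, _⟩ := hX.1 hk
    exact ⟨fun h => h2 h.node_mem, h1⟩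
  · intro q hq
    obtain ⟨k, hks, hk⟩ := Finset.mem_biUnion.1 hq
    obtain ⟨h1, h2, h3⟩ := hX.1 hk
    obtain ⟨hM', hC'⟩ := hMC b k hks
    rw [h3]
    refine (LB_link_of_aggregateBound hε (hR.mono (hM'.trans hMb)) hcv hm hpn h1 h2 h3 (hA b k) hφ
      hφ' hF hθ fun S' D e1 e2 e3 => HH S' D e1 (e2.trans (hM'.trans hMb)) e3).mono ?_
    have := mul_le_mul_of_nonneg_right hC' hε
    linarith

lemma exists_messageBound (P : DegreePair) (h m : ℕ) : ∃ M C, 0 ≤ C ∧ MessageBound P h m M C := by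
  induction h generalizing m with
  | zero => exact ⟨m, 0, le_rfl, messageBound_zero P m⟩
  | succ h ih => exact exists_messageBound_succ (fun b r m => exists_aggregateBound ih b r m) m

end SocketEnsemble
end Gexit
namespace Gexit

/-! ### Degree statistics of the ensembles -/

lemma card_sigma_ge {ι : Type*} [Fintype ι] [DecidableEq ι] (deg : ι → ℕ) (V : Finset ι) (k : ℕ) :
    ((k : ℝ) + 1) * (Fintype.card {i // deg i = k + 1} - V.card) ≤
      (Finset.univ.filter fun e : (Σ i, Fin (deg i)) => e.1 ∉ V ∧ deg e.1 = k + 1).card := by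
  have e1 : (Finset.univ.filter fun e : (Σ i, Fin (deg i)) => e.1 ∉ V ∧ deg e.1 = k + 1) =
      ((Finset.univ.filter fun i => deg i = k + 1) \ V).sigma fun _ => Finset.univ := by
    ext e
    simp [and_comm]
  have e2 : ∀ i ∈ (Finset.univ.filter fun i => deg i = k + 1) \ V,
      (Finset.univ : Finset (Fin (deg i))).card = k + 1 := fun i hi => by
    simpa using (Finset.mem_filter.1 (Finset.mem_sdiff.1 hi).1).2
  rw [e1, Finset.card_sigma, Finset.sum_congr rfl e2, Finset.sum_const, smul_eq_mul,
    Fintype.card_subtype]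
  push_cast
  rw [mul_comm]
  refine mul_le_mul_of_nonneg_right ?_ (by positivity)
  rw [sub_le_iff_le_add]
  exact_mod_cast (Finset.card_le_card_sdiff_add_card)

namespace SocketEnsemble

variable (E : SocketEnsemble)

/-- Number of nodes of degree `d` of the given type. -/
noncomputable def degCount : Bool → ℕ → ℝ
  | true => fun d => Fintype.card {i // E.vdeg i = d}
  | false => fun d => Fintype.card {j // E.cdeg j = d}

lemma card_sockets_ge (b : Bool) (W : Finset E.Node) (k : ℕ) :
    ((k : ℝ) + 1) * (E.degCount b (k + 1) - W.card) ≤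
      (Finset.univ.filter fun q : E.Socket =>
        q.isLeft = b ∧ nodeOf q ∉ W ∧ (siblings q).card = k).card := by
  cases b
  · set V : Finset (Fin E.m) := Finset.univ.filter fun j => Sum.inr j ∈ W
    have hV : (V.card : ℝ) ≤ W.card := Nat.cast_le.2
      (Finset.card_le_card_of_injOn Sum.inr (fun j hj => (Finset.mem_filter.1 hj).2)
        Sum.inr_injective.injOn)
    refine (mul_le_mul_of_nonneg_left (sub_le_sub_left hV _) (by positivity)).trans
      ((card_sigma_ge E.cdeg V k).trans (Nat.cast_le.2 ?_))
    refine Finset.card_le_card_of_injOn (Sum.inr : E.CSocket → E.Socket) (fun e he => ?_)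
      Sum.inr_injective.injOn
    obtain ⟨-, h1, h2⟩ := Finset.mem_filter.1 (Finset.mem_coe.1 he)
    refine Finset.mem_coe.2 (Finset.mem_filter.2 ⟨Finset.mem_univ _, rfl, fun h => h1 ?_, ?_⟩)
    · exact Finset.mem_filter.2 ⟨Finset.mem_univ _, h⟩
    · rw [siblings_inr, Finset.card_map, Finset.card_erase_of_mem (Finset.mem_univ _),
        Finset.card_univ, Fintype.card_fin, h2, Nat.add_sub_cancel]
  · set V : Finset (Fin E.n) := Finset.univ.filter fun j => Sum.inl j ∈ W
    have hV : (V.card : ℝ) ≤ W.card := Nat.cast_le.2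
      (Finset.card_le_card_of_injOn Sum.inl (fun j hj => (Finset.mem_filter.1 hj).2)
        Sum.inl_injective.injOn)
    refine (mul_le_mul_of_nonneg_left (sub_le_sub_left hV _) (by positivity)).trans
      ((card_sigma_ge E.vdeg V k).trans (Nat.cast_le.2 ?_))
    refine Finset.card_le_card_of_injOn (Sum.inl : E.VSocket → E.Socket) (fun e he => ?_)
      Sum.inl_injective.injOn
    obtain ⟨-, h1, h2⟩ := Finset.mem_filter.1 (Finset.mem_coe.1 he)
    refine Finset.mem_coe.2 (Finset.mem_filter.2 ⟨Finset.mem_univ _, rfl, fun h => h1 ?_, ?_⟩)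
    · exact Finset.mem_filter.2 ⟨Finset.mem_univ _, h⟩
    · rw [siblings_inl, Finset.card_map, Finset.card_erase_of_mem (Finset.mem_univ _),
        Finset.card_univ, Fintype.card_fin, h2, Nat.add_sub_cancel]

lemma numEdges_eq {B : ℕ} (hB : ∀ i, E.vdeg i ≤ B) :
    (E.numEdges : ℝ) = ∑ d ∈ Finset.range (B + 1), d * E.degCount true d := by
  have h : ∀ i ∈ Finset.univ, E.vdeg i ∈ Finset.range (B + 1) := fun i _ => by
    have := hB i; simp; omega
  rw [numEdges, ← Finset.sum_fiberwise_of_maps_to h, Nat.cast_sum]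
  refine Finset.sum_congr rfl fun d _ => ?_
  rw [Finset.sum_congr rfl fun i hi => (Finset.mem_filter.1 hi).2, Finset.sum_const, smul_eq_mul,
    Nat.cast_mul, mul_comm]
  simp only [degCount, Fintype.card_subtype]

lemma avg_eq {ι : Type*} (s : Finset ι) (F : E.Graph → ι → ℝ) (r : ℝ) :
    (E.avg fun G => (∑ i ∈ s, F G i) / r) = (∑ i ∈ s, E.avg fun G => F G i) / r := by
  unfold avg
  rw [← Finset.sum_div, ← Finset.sum_div, Finset.sum_comm, div_right_comm]

lemma avg_mono {F F' : E.Graph → ℝ} (h : ∀ G, F G ≤ F' G) : E.avg F ≤ E.avg F' :=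
  div_le_div_of_nonneg_right (Finset.sum_le_sum fun G _ => h G) (Nat.cast_nonneg _)

lemma avg_nonneg {F : E.Graph → ℝ} (h : ∀ G, 0 ≤ F G) : 0 ≤ E.avg F :=
  div_nonneg (Finset.sum_nonneg fun G _ => h G) (Nat.cast_nonneg _)

instance : Nonempty E.Graph :=
  ⟨Fintype.equivOfCardEq (by rw [E.card_vSocket, E.card_cSocket])⟩

lemma card_graph_pos : (0 : ℝ) < Fintype.card E.Graph := Nat.cast_pos.2 Fintype.card_pos

end SocketEnsemble

namespace IsLDPCSequence

variable {P : DegreePair} {E : ℕ → SocketEnsemble}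

lemma tendsto_degCount (hE : IsLDPCSequence P E) (b : Bool) (k : ℕ) :
    Tendsto (fun t => ((k : ℝ) + 1) * ((E t).degCount b (k + 1) / (E t).n)) atTop
      (𝓝 ((P.poly b).coeff k / P.intLam)) := by
  cases b
  · have := (hE.check_fraction (k + 1)).const_mul ((k : ℝ) + 1)
    rwa [P.succ_mul_checkFraction] at this
  · have := (hE.var_fraction (k + 1)).const_mul ((k : ℝ) + 1)
    rwa [P.succ_mul_varFraction] at this

lemma tendsto_numEdges (hE : IsLDPCSequence P E) :
    Tendsto (fun t => ((E t).numEdges : ℝ) / (E t).n) atTop (𝓝 (1 / P.intLam)) := by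
  obtain ⟨B₀, hB₀⟩ := hE.bounded
  -- B bounds both the degrees in the graphs and those occurring in λ, so that one finite sum
  -- represents the number of edges and its limit.
  set B := max B₀ (P.lam.natDegree + 1)
  have h1 : ∀ t, ((E t).numEdges : ℝ) / (E t).n = ∑ k ∈ Finset.range B,
      ((k : ℝ) + 1) * ((E t).degCount true (k + 1) / (E t).n) := by
    intro t
    rw [(E t).numEdges_eq (B := B) fun i => ((hB₀ t).1 i).trans (le_max_left _ _),
      Finset.sum_range_succ']
    simp only [Nat.cast_zero, zero_mul, add_zero, Finset.sum_div]
    refine Finset.sum_congr rfl fun k _ => ?_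
    push_cast
    ring
  simp only [h1]
  have h2 := tendsto_finsetSum (Finset.range B) fun k _ => hE.tendsto_degCount true k
  rw [← Finset.sum_div] at h2
  have h3 : ∑ k ∈ Finset.range B, (P.poly true).coeff k = 1 := by
    rw [← P.lam_one, Polynomial.eval_eq_sum_range' (n := B)
      (lt_of_lt_of_le (Nat.lt_succ_self _) (le_max_right _ _))]
    simp [DegreePair.poly]
  rwa [h3] at h2

lemma tendsto_length (hE : IsLDPCSequence P E) :
    Tendsto (fun t => ((E t).n : ℝ)) atTop atTop :=
  tendsto_natCast_atTop_atTop.comp hE.length_tendsto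

/-- M nodes carry at most M (k + 1) sockets of sibling number k, negligible against the number of
edges, which grows like n / ∫ λ. -/
lemma eventually_regular (hE : IsLDPCSequence P E) {ε : ℝ} (hε : 0 < ε) (M : ℕ) :
    ∀ᶠ t in atTop, SocketEnsemble.Regular P (E t) ε M := by
  have key : ∀ b, ∀ k ∈ (P.poly b).support, ∀ᶠ t in atTop,
      ((P.poly b).coeff k - ε) * (E t).numEdges ≤
        ((k : ℝ) + 1) * ((E t).degCount b (k + 1) - M) := by
    intro b k _
    have hL := P.intLam_pos
    have h1 := hE.tendsto_numEdges.const_mul ((P.poly b).coeff k - ε)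
    have h2 := (hE.tendsto_degCount b k).sub
      ((tendsto_const_nhds (x := ((k : ℝ) + 1) * M)).div_atTop hE.tendsto_length)
    have hlt : ((P.poly b).coeff k - ε) * (1 / P.intLam) < (P.poly b).coeff k / P.intLam - 0 := by
      rw [mul_one_div, sub_zero]
      exact div_lt_div_of_pos_right (by linarith) hL
    filter_upwards [h1.eventually_lt h2 hlt, hE.tendsto_length.eventually_gt_atTop 0] with t ht hn
    have := mul_le_mul_of_nonneg_right ht.le hn.le
    field_simp at this
    linarith
  have key' : ∀ᶠ t in atTop, ∀ b, ∀ k ∈ (P.poly b).support,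
      ((P.poly b).coeff k - ε) * (E t).numEdges ≤
        ((k : ℝ) + 1) * ((E t).degCount b (k + 1) - M) :=
    eventually_all.2 fun b => (Finset.eventually_all _).2 fun k hk => key b k hk
  filter_upwards [key'] with t ht W hW b k hk
  refine (ht b k hk).trans (le_trans ?_ ((E t).card_sockets_ge b W k))
  have : (W.card : ℝ) ≤ M := Nat.cast_le.2 hW
  exact mul_le_mul_of_nonneg_left (by linarith) (by positivity)

end IsLDPCSequence

/-! ### Averages of BP estimates over graphs and bits -/

namespace SocketEnsemble

variable {E : SocketEnsemble}

open Exploration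

/-- The initial exploration, at a variable node. -/
def root (i : Fin E.n) : Exploration E where
  pairs := ∅
  nodes := {Sum.inl i}
  mem r hr := absurd hr (Finset.notMem_empty r)

lemma bpEstimate_ae_eq (G : E.Graph) (l : ℕ) (i : Fin E.n) (c : Fin E.n → LDensity) :
    E.bpEstimate G l i =ᵐ[Measure.pi fun j => (Function.update c i 0 j).law] fun y =>
      agg true (Finset.univ.map ((Function.Embedding.sigmaMk i).trans Function.Embedding.inl))
        (halfMsg G y (2 * l)) := by
  have h0 : ∀ᵐ y ∂(Measure.pi fun j => (Function.update c i 0 j).law), y i = 0 := by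
    refine (Measure.quasiMeasurePreserving_eval
      (fun j => (Function.update c i 0 j).law) i).ae (p := fun t => t = 0) ?_
    rw [Function.update_self, LDensity.law_zero]
    exact (ae_dirac_iff (measurableSet_singleton _)).2 rfl
  filter_upwards [ae_pi_mem (Function.update c i 0), h0] with y hy hy0
  rw [bpEstimate, show Function.update y i 0 = y by rw [← hy0, Function.update_eq_self]]
  simp only [checkMsg_eq G hy, agg, varRule, Finset.prod_map]
  rfl

/-- The exploration starts with bit i as the only visited node and nothing matched, so all graphs
are compatible. Bit i has the useless channel, which does not interfere as only unvisited nodes are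
required to have channel `c`. -/
lemma le_avg_of_aggregateBound {P : DegreePair} {l M : ℕ} {C ε : ℝ} (hε : 0 ≤ ε)
    (hR : Regular P E ε M) (i : Fin E.n) (hA : AggregateBound P (2 * l) true (E.vdeg i) 1 M C)
    (c : LDensity) {φ : ℝ → ℝ} (hφ : Measurable φ) (hφ' : ∀ x, φ x ∈ Icc (0 : ℝ) 1)
    {F : E.Graph → ℝ} (hF : ∀ G, 0 ≤ F G)
    (hFD : ∀ (G : E.Graph) (D : LDensity), (Measure.pi fun j =>
      (Function.update (fun _ => c) i 0 j : LDensity).law).map (E.bpEstimate G l i) = D.law →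
        ∫ x, φ x ∂D.law ≤ F G) :
    ∫ x, φ x ∂(E.vdeg i • P.msg c l).law - C * ε ≤ E.avg F := by
  have key := hA E ε hε hR c (Function.update (fun _ => c) i 0) (root i) ?_
    (Finset.card_singleton _).le
    (Finset.univ.map ((Function.Embedding.sigmaMk i).trans Function.Embedding.inl)) ?_ ?_
    φ hφ hφ' F hF 0 le_rfl ?_
  · rw [P.halfD_two_mul, sub_zero] at key
    have e : (root i).graphs = Finset.univ := Finset.eq_univ_of_forall fun G =>
      mem_graphs.2 fun r hr => absurd hr (Finset.notMem_empty r)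
    rw [LB, e, Finset.card_univ] at key
    rw [avg, le_div_iff₀ E.card_graph_pos, mul_comm]
    exact key
  · intro j hj
    refine Function.update_of_ne (fun h => hj ?_) _ _
    rw [h]
    exact Finset.mem_singleton_self _
  · rw [Finset.card_map, Finset.card_univ, Fintype.card_fin]
  · intro p hp
    obtain ⟨b, -, rfl⟩ := Finset.mem_map.1 hp
    refine ⟨?_, Finset.mem_singleton_self _, rfl⟩
    rintro ⟨r, hr, -⟩
    exact Finset.notMem_empty r hr
  · intro S' D _ _ hD
    rw [LB, ← nsmul_eq_mul]
    refine Finset.card_nsmul_le_sum _ _ _ fun G hG => ?_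
    rw [sub_zero]
    refine hFD G D ?_
    rw [Measure.map_congr (bpEstimate_ae_eq G l i _)]
    exact (hD G hG).2.2

end SocketEnsemble

namespace IsLDPCSequence

variable {P : DegreePair} {E : ℕ → SocketEnsemble}

/-- Lower bounds for averages over the ensemble, given the law of the BP estimates. -/
theorem eventually_le_avg (hE : IsLDPCSequence P E) (c : LDensity) (l : ℕ) {φ : ℝ → ℝ}
    (hφ : Measurable φ) (hφ' : ∀ x, φ x ∈ Icc (0 : ℝ) 1) {ε : ℝ} (hε : 0 < ε) :
    ∀ᶠ t in atTop, ∀ F : (E t).Graph → Fin (E t).n → ℝ, (∀ G i, 0 ≤ F G i) →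
      (∀ G i (D : LDensity), (Measure.pi fun j =>
        (Function.update (fun _ => c) i 0 j : LDensity).law).map ((E t).bpEstimate G l i) = D.law →
          ∫ x, φ x ∂D.law ≤ F G i) →
      ∫ x, φ x ∂(P.out c l).law - ε ≤ (E t).avg fun G => (∑ i, F G i) / (E t).n := by
  choose M C hC hA using fun d => SocketEnsemble.exists_aggregateBound
    (fun m => SocketEnsemble.exists_messageBound P (2 * l) m) true d 1
  set s := P.lam.support
  set I : ℕ → ℝ := fun k => ∫ x, φ x ∂((k + 1) • P.msg c l).law
  set C' : ℝ := ∑ k ∈ s, C (k + 1)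
  have hC' : 0 ≤ C' := Finset.sum_nonneg fun k _ => hC _
  -- Chosen so that C' δ < ε; the added 1 covers C' = 0.
  set δ : ℝ := ε / (2 * (C' + 1))
  have hδ : 0 < δ := by positivity
  have hCδ : C' * δ < ε := by
    have : C' * δ = ε * (C' / (2 * (C' + 1))) := by simp only [δ]; ring
    rw [this]
    refine mul_lt_of_lt_one_right hε ?_
    rw [div_lt_one (by positivity)]
    linarith
  have hlim := tendsto_finsetSum s fun k _ => (hE.var_fraction (k + 1)).mul_const (I k - C' * δ)
  have hI : ∑ k ∈ s, P.varFraction (k + 1) * (I k - C' * δ) =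
      ∫ x, φ x ∂(P.out c l).law - C' * δ := by
    simp only [mul_sub, Finset.sum_sub_distrib]
    rw [← Finset.sum_mul, P.sum_varFraction, one_mul]
    congr 1
    exact (LDensity.integral_law_mix (h0 := fun _ => P.varFraction_nonneg _)
      (h1 := P.sum_varFraction) (fun k => (k + 1) • P.msg c l) hφ (M := 1)
      fun d _ => abs_le.2 ⟨by linarith [(hφ' d).1], (hφ' d).2⟩).symm
  rw [hI] at hlim
  have hreg : ∀ᶠ t in atTop, ∀ k ∈ s, SocketEnsemble.Regular P (E t) δ (M (k + 1)) :=
    (Finset.eventually_all _).2 fun k _ => hE.eventually_regular hδ _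
  filter_upwards [hreg, hlim.eventually (lt_mem_nhds (show
    ∫ x, φ x ∂(P.out c l).law - ε < ∫ x, φ x ∂(P.out c l).law - C' * δ by linarith))]
    with t ht hlt F hF hFD
  refine hlt.le.trans ?_
  rw [(E t).avg_eq]
  have h1 : ∀ k ∈ s, ∀ i ∈ Finset.univ.filter (fun i => (E t).vdeg i = k + 1),
      I k - C' * δ ≤ (E t).avg fun G => F G i := by
    intro k hk i hi
    have hi := (Finset.mem_filter.1 hi).2
    have := SocketEnsemble.le_avg_of_aggregateBound hδ.le (ht k hk) i (by rw [hi]; exact hA (k + 1))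
      c hφ hφ' (fun G => hF G i) fun G D => hFD G i D
    rw [hi] at this
    refine le_trans ?_ this
    have hle : C (k + 1) ≤ C' := Finset.single_le_sum (f := fun k => C (k + 1)) (fun k _ => hC _) hk
    have := mul_le_mul_of_nonneg_right hle hδ.le
    change I k - C' * δ ≤ I k - C (k + 1) * δ
    linarith
  calc ∑ k ∈ s, (Fintype.card {i // (E t).vdeg i = k + 1} : ℝ) / (E t).n * (I k - C' * δ)
      = (∑ k ∈ s, ∑ i ∈ Finset.univ.filter (fun i => (E t).vdeg i = k + 1),
          (I k - C' * δ)) / (E t).n := by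
        rw [Finset.sum_div]
        refine Finset.sum_congr rfl fun k _ => ?_
        rw [Finset.sum_const, nsmul_eq_mul, Fintype.card_subtype]
        ring
    _ ≤ (∑ k ∈ s, ∑ i ∈ Finset.univ.filter (fun i => (E t).vdeg i = k + 1),
          (E t).avg fun G => F G i) / (E t).n :=
        div_le_div_of_nonneg_right (Finset.sum_le_sum fun k hk => Finset.sum_le_sum (h1 k hk))
          (Nat.cast_nonneg _)
    _ ≤ (∑ i, (E t).avg fun G => F G i) / (E t).n := by
        refine div_le_div_of_nonneg_right ?_ (Nat.cast_nonneg _)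
        rw [← Finset.sum_biUnion]
        · exact Finset.sum_le_sum_of_subset_of_nonneg (Finset.subset_univ _)
            fun i _ _ => (E t).avg_nonneg fun G => hF G i
        · intro k _ k' _ hkk
          refine Finset.disjoint_left.2 fun i hi hi' => hkk ?_
          have := (Finset.mem_filter.1 hi).2.symm.trans (Finset.mem_filter.1 hi').2
          omega

end IsLDPCSequence
end Gexit
namespace Gexit

/-! ### Moments of BP estimates and the effect of forced bits -/

lemma clamp_pow_mem (k : ℕ) (x : ℝ) : clamp x ^ (2 * k + 2) ∈ Icc (0 : ℝ) 1 :=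
  ⟨Even.pow_nonneg ⟨k + 1, by ring⟩ _, (le_abs_self _).trans (LDensity.abs_pow_le (clamp_mem x) _)⟩

lemma measurable_clamp_pow (k : ℕ) : Measurable fun x => clamp x ^ (2 * k + 2) := by fun_prop

lemma integral_clamp_pow (D : LDensity) (k : ℕ) :
    ∫ x, clamp x ^ (2 * k + 2) ∂D.law = D.moment k :=
  integral_congr_ae (D.ae_mem.mono fun t ht => by simp only [clamp_of_mem ht])

lemma integral_one_sub_clamp_pow (D : LDensity) (k : ℕ) :
    ∫ x, (1 - clamp x ^ (2 * k + 2)) ∂D.law = 1 - D.moment k := by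
  have hi : Integrable (fun x => clamp x ^ (2 * k + 2)) D.law := integrable_of_bdd (M := 1)
    (measurable_clamp_pow k) (ae_of_all _ fun x => LDensity.abs_pow_le (clamp_mem x) _)
  rw [integral_sub (integrable_const _) hi, integral_clamp_pow]
  simp

namespace SocketEnsemble

variable (E : SocketEnsemble) (G : E.Graph)

/-! ### Bits attached to a check node of degree one -/

def Attached (i : Fin E.n) : Prop := ∃ b : Fin (E.vdeg i), E.cdeg (G ⟨i, b⟩).1 = 1

variable {E G}

lemma Attached.forced {i : Fin E.n} (h : E.Attached G i) : E.Forced G i := by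
  obtain ⟨b, hb⟩ := h
  intro x hx
  have h1 := hx (G ⟨i, b⟩).1
  have h2 : Subsingleton (Fin (E.cdeg (G ⟨i, b⟩).1)) := by rw [hb]; infer_instance
  rw [Fintype.prod_subsingleton _ (G ⟨i, b⟩).2] at h1
  simpa using h1

lemma checkMsg_of_attached {i : Fin E.n} {b : Fin (E.vdeg i)} (hb : E.cdeg (G ⟨i, b⟩).1 = 1)
    (y : Fin E.n → ℝ) (l : ℕ) : E.checkMsg G y (l + 1) ⟨i, b⟩ = 1 := by
  have h2 : Subsingleton (Fin (E.cdeg (G ⟨i, b⟩).1)) := by rw [hb]; infer_instance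
  rw [checkMsg]
  refine Finset.prod_eq_one fun s hs => ?_
  exact absurd (Subsingleton.elim _ _) (Finset.mem_erase.1 hs).1

lemma bpEstimate_of_attached {i : Fin E.n} (h : E.Attached G i) {y : Fin E.n → ℝ}
    (hy : ∀ j, y j ∈ Ioc (-1 : ℝ) 1) (l : ℕ) : E.bpEstimate G (l + 1) i y = 1 := by
  obtain ⟨b, hb⟩ := h
  have hy' : ∀ j, Function.update y i 0 j ∈ Ioc (-1 : ℝ) 1 := fun j => by
    by_cases hj : j = i
    · subst hj; norm_num
    · simpa [hj] using hy j
  have hm : ∀ b', 0 < 1 + E.checkMsg G (Function.update y i 0) (l + 1) ⟨i, b'⟩ := fun b' => by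
    rw [checkMsg_eq G hy']
    linarith [(halfMsg_mem G (Function.update y i 0) (2 * (l + 1)) (Sum.inl ⟨i, b'⟩)).1]
  have h0 : ∏ b', (1 - E.checkMsg G (Function.update y i 0) (l + 1) ⟨i, b'⟩) = 0 :=
    Finset.prod_eq_zero (Finset.mem_univ b) (by rw [checkMsg_of_attached hb, sub_self])
  rw [bpEstimate, varRule, h0, sub_zero, add_zero]
  exact div_self (Finset.prod_pos fun b' _ => hm b').ne'

/-- With all outputs erased, a check node with another socket sends back a product containing a
zero. For the useless channel the one-round estimate is therefore 1 or 0 according to attachment,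
and the first moment of `P.out 0 1` estimates the proportion of attached bits. -/
lemma bpEstimate_of_not_attached {i : Fin E.n} (h : ¬E.Attached G i) :
    E.bpEstimate G 1 i 0 = 0 := by
  unfold Attached at h
  push Not at h
  have h0 : ∀ b : Fin (E.vdeg i), E.checkMsg G (Function.update 0 i 0) 1 ⟨i, b⟩ = 0 := by
    intro b
    have hpos := (G ⟨i, b⟩).2.pos
    have : Nontrivial (Fin (E.cdeg (G ⟨i, b⟩).1)) := by
      have := h b
      exact Fin.nontrivial_iff_two_le.2 (by omega)
    obtain ⟨s, hs⟩ := exists_ne (G ⟨i, b⟩).2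
    rw [checkMsg]
    refine Finset.prod_eq_zero (Finset.mem_erase.2 ⟨hs, Finset.mem_univ _⟩) ?_
    simp [checkMsg, varRule, varRule₂]
  simp only [bpEstimate, h0, varRule]
  simp

lemma map_bpEstimate_of_attached {i : Fin E.n} (h : E.Attached G i) (c : Fin E.n → LDensity)
    (l : ℕ) : (Measure.pi fun j => (c j).law).map (E.bpEstimate G (l + 1) i) =
      (1 : LDensity).law := by
  rw [Measure.map_congr (g := fun _ => (1 : ℝ))
    ((ae_pi_mem c).mono fun y hy => bpEstimate_of_attached h hy l), Measure.map_const,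
    measure_univ, one_smul, LDensity.law_one]

lemma map_bpEstimate_zero_channel (i : Fin E.n) :
    (Measure.pi fun j => (Function.update (fun _ => (0 : LDensity)) i 0 j).law).map
      (E.bpEstimate G 1 i) = Measure.dirac (E.bpEstimate G 1 i 0) := by
  have h : ∀ᵐ y ∂(Measure.pi fun j => (Function.update (fun _ => (0 : LDensity)) i 0 j).law),
      ∀ j, y j = 0 := eventually_all.2 fun j => by
    refine (Measure.quasiMeasurePreserving_eval (fun j =>
      (Function.update (fun _ => (0 : LDensity)) i 0 j).law) j).ae (p := fun t => t = 0) ?_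
    rw [Function.update_eq_self (f := fun _ : Fin E.n => (0 : LDensity)) i, LDensity.law_zero]
    exact (ae_dirac_iff (measurableSet_singleton _)).2 rfl
  rw [Measure.map_congr (g := fun _ => E.bpEstimate G 1 i 0)
    (h.mono fun y hy => by rw [show y = 0 from funext hy]), Measure.map_const, measure_univ, one_smul]

lemma map_bpEstimate_zero_rounds (i : Fin E.n) (c : Fin E.n → LDensity) :
    (Measure.pi fun j => (c j).law).map (E.bpEstimate G 0 i) = (0 : LDensity).law := by
  have e : E.bpEstimate G 0 i = fun _ => 0 := by
    funext y
    simp [bpEstimate, checkMsg, varRule]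
  rw [e, Measure.map_const, measure_univ, one_smul, LDensity.law_zero]

/-! ### Averages over bits and graphs -/

variable (E)

/-- The average of a quantity over the bits and the graphs. -/
noncomputable def bitAvg (F : E.Graph → Fin E.n → ℝ) : ℝ := E.avg fun G => (∑ i, F G i) / E.n

lemma bitAvg_mono {F F' : E.Graph → Fin E.n → ℝ} (h : ∀ G i, F G i ≤ F' G i) :
    E.bitAvg F ≤ E.bitAvg F' :=
  E.avg_mono fun G => div_le_div_of_nonneg_right (Finset.sum_le_sum fun i _ => h G i)
    (Nat.cast_nonneg _)

lemma bitAvg_eq (F : E.Graph → Fin E.n → ℝ) :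
    E.bitAvg F = ∑ G, ∑ i, F G i / (E.n * Fintype.card E.Graph) := by
  unfold bitAvg avg
  rw [Finset.sum_div]
  refine Finset.sum_congr rfl fun G _ => ?_
  rw [Finset.sum_div, Finset.sum_div]
  exact Finset.sum_congr rfl fun i _ => by rw [div_div]

lemma bitAvg_add (F F' : E.Graph → Fin E.n → ℝ) :
    E.bitAvg (fun G i => F G i + F' G i) = E.bitAvg F + E.bitAvg F' := by
  simp only [bitAvg_eq, add_div, Finset.sum_add_distrib]

lemma bitAvg_sub (F F' : E.Graph → Fin E.n → ℝ) :
    E.bitAvg (fun G i => F G i - F' G i) = E.bitAvg F - E.bitAvg F' := by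
  simp only [bitAvg_eq, sub_div, Finset.sum_sub_distrib]

lemma bitAvg_const_mul (r : ℝ) (F : E.Graph → Fin E.n → ℝ) :
    E.bitAvg (fun G i => r * F G i) = r * E.bitAvg F := by
  simp only [bitAvg_eq, mul_div_assoc, Finset.mul_sum]

lemma bitAvg_one (hn : 0 < E.n) : E.bitAvg (fun _ _ => 1) = 1 := by
  have h : (0 : ℝ) < E.n := Nat.cast_pos.2 hn
  unfold bitAvg avg
  simp only [Finset.sum_const, Finset.card_univ, Fintype.card_fin, nsmul_eq_mul, mul_one]
  rw [div_self h.ne', mul_one, div_self E.card_graph_pos.ne']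

lemma bitAvg_mem (hn : 0 < E.n) {F : E.Graph → Fin E.n → ℝ} (h : ∀ G i, F G i ∈ Icc (0 : ℝ) 1) :
    E.bitAvg F ∈ Icc (0 : ℝ) 1 :=
  ⟨E.avg_nonneg fun G => div_nonneg (Finset.sum_nonneg fun i _ => (h G i).1) (Nat.cast_nonneg _),
    (E.bitAvg_mono fun G i => (h G i).2).trans_eq (E.bitAvg_one hn)⟩

open scoped Classical in
noncomputable def forcedInd (G : E.Graph) (i : Fin E.n) : ℝ := if E.Forced G i then 1 else 0

open scoped Classical in
noncomputable def attachedInd (G : E.Graph) (i : Fin E.n) : ℝ := if E.Attached G i then 1 else 0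

variable {E}

lemma attachedInd_le_forcedInd (G : E.Graph) (i : Fin E.n) :
    E.attachedInd G i ≤ E.forcedInd G i := by
  unfold attachedInd forcedInd
  split_ifs with h1 h2 h2
  · exact le_rfl
  · exact absurd h1.forced h2
  · exact zero_le_one
  · exact le_rfl

lemma bpMoment_zero_rounds (c : Fin E.n → LDensity) (G : E.Graph) (i : Fin E.n) (k : ℕ) :
    E.bpMoment G c 0 i k = E.forcedInd G i := by
  unfold forcedInd
  split_ifs with h
  · exact E.bpMoment_of_forced G c h 0 k
  · rw [E.bpMoment_of_law G c (map_bpEstimate_zero_rounds i _) h, LDensity.moment_zero]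

end SocketEnsemble

namespace IsLDPCSequence

variable {P : DegreePair} {E : ℕ → SocketEnsemble}

/-- Forced bits have the largest possible moment 1, so they do not disturb the lower bound. -/
lemma eventually_le_bpMoment (hE : IsLDPCSequence P E) (c : LDensity) (l k : ℕ) {ε : ℝ}
    (hε : 0 < ε) : ∀ᶠ t in atTop, (P.out c l).moment k - ε ≤
      (E t).bitAvg fun G i => (E t).bpMoment G (fun _ => c) l i k := by
  filter_upwards [hE.eventually_le_avg c l (measurable_clamp_pow k) (clamp_pow_mem k) hε] with t ht
  rw [← integral_clamp_pow]
  refine ht _ (fun G i => ((E t).bpMoment_mem G _ l i k).1) fun G i D hD => ?_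
  rw [integral_clamp_pow]
  by_cases hf : (E t).Forced G i
  · rw [(E t).bpMoment_of_forced G _ hf]
    exact D.moment_le_one k
  · rw [(E t).bpMoment_of_law G _ hD hf]

/-- The upper bound on moments uses the complementary test function. Here forced bits do matter and
are compensated by an indicator; attached bits need no compensation, as their estimate equals 1
after at least one round. -/
lemma eventually_le_one_sub_bpMoment (hE : IsLDPCSequence P E) (c : LDensity) (l k : ℕ) {ε : ℝ}
    (hε : 0 < ε) : ∀ᶠ t in atTop, 1 - (P.out c (l + 1)).moment k - ε ≤
      (E t).bitAvg fun G i => 1 - (E t).bpMoment G (fun _ => c) (l + 1) i k +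
        ((E t).forcedInd G i - (E t).attachedInd G i) := by
  filter_upwards [hE.eventually_le_avg c (l + 1) (measurable_const.sub (measurable_clamp_pow k))
    (fun x => ⟨sub_nonneg.2 (clamp_pow_mem k x).2, sub_le_self _ (clamp_pow_mem k x).1⟩) hε]
    with t ht
  rw [← integral_one_sub_clamp_pow]
  refine ht _ (fun G i => ?_) fun G i D hD => ?_
  · have h1 := ((E t).bpMoment_mem G (fun _ => c) (l + 1) i k).2
    have h2 := SocketEnsemble.attachedInd_le_forcedInd G i
    linarith
  · simp only [Pi.sub_apply]
    rw [integral_one_sub_clamp_pow]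
    by_cases ha : (E t).Attached G i
    · rw [SocketEnsemble.map_bpEstimate_of_attached ha] at hD
      rw [LDensity.ext_law hD.symm, LDensity.moment_one, (E t).bpMoment_of_forced G _ ha.forced]
      have h2 := SocketEnsemble.attachedInd_le_forcedInd G i
      linarith
    · by_cases hf : (E t).Forced G i
      · rw [(E t).bpMoment_of_forced G _ hf]
        simp only [SocketEnsemble.forcedInd, SocketEnsemble.attachedInd, hf, ha, if_true, if_false]
        linarith [D.moment_nonneg k]
      · rw [(E t).bpMoment_of_law G _ hD hf]
        have h2 := SocketEnsemble.attachedInd_le_forcedInd G i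
        linarith

lemma eventually_le_attached (hE : IsLDPCSequence P E) {ε : ℝ} (hε : 0 < ε) :
    ∀ᶠ t in atTop, (P.out 0 1).moment 0 - ε ≤ (E t).bitAvg fun G i => (E t).attachedInd G i := by
  filter_upwards [hE.eventually_le_avg 0 1 (measurable_clamp_pow 0) (clamp_pow_mem 0) hε] with t ht
  rw [← integral_clamp_pow]
  refine ht _ (fun G i => ?_) fun G i D hD => ?_
  · unfold SocketEnsemble.attachedInd
    split_ifs <;> norm_num
  · rw [integral_clamp_pow]
    by_cases ha : (E t).Attached G i
    · simp only [SocketEnsemble.attachedInd, ha, if_true]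
      exact D.moment_le_one 0
    · have h0 : D = 0 := LDensity.ext_law (by
        rw [← hD, SocketEnsemble.map_bpEstimate_zero_channel,
          SocketEnsemble.bpEstimate_of_not_attached ha, LDensity.law_zero])
      rw [h0, LDensity.moment_zero]
      simp only [SocketEnsemble.attachedInd, ha, if_false, le_refl]

end IsLDPCSequence
end Gexit
namespace Gexit

/-! ### Comparison of the average MAP curve with the BP limit -/

lemma tendsto_max_zero {u : ℕ → ℝ} (h : ∀ ε > 0, ∀ᶠ t in atTop, u t ≤ ε) :
    Tendsto (fun t => max (u t) 0) atTop (𝓝 0) := by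
  refine Metric.tendsto_nhds.2 fun ε hε => ?_
  filter_upwards [h (ε / 2) (by positivity)] with t ht
  rw [Real.dist_eq, sub_zero, abs_of_nonneg (le_max_right _ _)]
  exact max_lt (by linarith) hε

namespace SocketEnsemble

variable (E : SocketEnsemble)

/-- The average MAP GEXIT function of an ensemble. -/
noncomputable def mapAvg (c : ℝ → LDensity) (h : ℝ) : ℝ :=
  E.bitAvg fun G i => ∑' k, weight c k h * (1 - E.mapMoment G (fun _ => c h) i k)

lemma bitAvg_tsum (hn : 0 < E.n) {w : ℕ → ℝ} (hw0 : ∀ k, 0 ≤ w k) (hw : Summable w)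
    {b : E.Graph → Fin E.n → ℕ → ℝ} (hb : ∀ G i k, b G i k ∈ Icc (0 : ℝ) 1) :
    (E.bitAvg fun G i => ∑' k, w k * (1 - b G i k)) =
      ∑' k, w k * (1 - E.bitAvg fun G i => b G i k) := by
  have hs : ∀ G i, Summable fun k => w k * (1 - b G i k) / (E.n * Fintype.card E.Graph) :=
    fun G i => Summable.div_const (Summable.of_nonneg_of_le
      (fun k => mul_nonneg (hw0 k) (sub_nonneg.2 (hb G i k).2))
      (fun k => mul_le_of_le_one_right (hw0 k) (sub_le_self _ (hb G i k).1)) hw) _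
  have h1 : ∀ k, w k * (1 - E.bitAvg fun G i => b G i k) =
      ∑ G, ∑ i, w k * (1 - b G i k) / (E.n * Fintype.card E.Graph) := fun k => by
    rw [← E.bitAvg_eq, bitAvg_const_mul, bitAvg_sub, E.bitAvg_one hn]
  simp only [h1]
  rw [Summable.tsum_finsetSum fun G _ => summable_sum fun i _ => hs G i, bitAvg_eq]
  refine Finset.sum_congr rfl fun G _ => ?_
  rw [Summable.tsum_finsetSum fun i _ => hs G i]
  exact Finset.sum_congr rfl fun i _ => tsum_div_const.symm

variable {c : ℝ → LDensity}

lemma integrableOn_mapCurve (hc : IsChannelFamily c) (G : E.Graph) (i : Fin E.n) :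
    IntegrableOn (fun h => ∑' k, weight c k h * (1 - E.mapMoment G (fun _ => c h) i k))
      (Ioo 0 1) := by
  simp only [mapMoment_eq]
  exact hc.integrableOn_tsum (b := fun k h => postMoment (E.codeFinset G) (fun _ => c h) i k)
    (fun k s hs t ht h => postMoment_mono (fun _ => hc.anti hs ht h) i k)
    fun k h _ => by
      rw [← mapMoment_eq]
      exact E.mapMoment_mem G _ i k

lemma integrableOn_mapAvg (hc : IsChannelFamily c) : IntegrableOn (E.mapAvg c) (Ioo 0 1) := by
  have h : E.mapAvg c = fun h => ∑ G, ∑ i,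
      (∑' k, weight c k h * (1 - E.mapMoment G (fun _ => c h) i k)) /
        (E.n * Fintype.card E.Graph) := funext fun h => E.bitAvg_eq _
  rw [h]
  exact integrable_finsetSum _ fun G _ => integrable_finsetSum _ fun i _ =>
    (E.integrableOn_mapCurve hc G i).div_const _

lemma avg_rate_le (hc : IsChannelFamily c) (hn : 0 < E.n) :
    (E.avg fun G => E.rate G) ≤ ∫ h in Ioo (0 : ℝ) 1, E.mapAvg c h := by
  have hn' : (0 : ℝ) < E.n := Nat.cast_pos.2 hn
  have h : ∫ h in Ioo (0 : ℝ) 1, E.mapAvg c h = E.bitAvg fun G i => ∫ h in Ioo (0 : ℝ) 1,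
      ∑' k, weight c k h * (1 - E.mapMoment G (fun _ => c h) i k) := by
    simp only [mapAvg, bitAvg_eq]
    rw [integral_finsetSum _ fun G _ => integrable_finsetSum _ fun i _ =>
      (E.integrableOn_mapCurve hc G i).div_const _]
    refine Finset.sum_congr rfl fun G _ => ?_
    rw [integral_finsetSum _ fun i _ => (E.integrableOn_mapCurve hc G i).div_const _]
    exact Finset.sum_congr rfl fun i _ => integral_div _ _
  rw [h]
  refine E.avg_mono fun G => ?_
  rw [le_div_iff₀ hn']
  exact E.rate_le_integral G hc

lemma mapAvg_eq (hc : IsChannelFamily c) (hn : 0 < E.n) {h : ℝ} (hh : h ∈ Ioo (0 : ℝ) 1) :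
    E.mapAvg c h =
      ∑' k, weight c k h * (1 - E.bitAvg fun G i => E.mapMoment G (fun _ => c h) i k) :=
  E.bitAvg_tsum hn (hc.weight_nonneg hh) (hc.summable_weight hh) fun G i k =>
    E.mapMoment_mem G _ i k

lemma mapAvg_mem (hc : IsChannelFamily c) (hn : 0 < E.n) {h : ℝ} (hh : h ∈ Ioo (0 : ℝ) 1) :
    E.mapAvg c h ∈ Icc (0 : ℝ) 1 :=
  E.bitAvg_mem hn fun G i => hc.tsum_weight_mul_mem hh fun k =>
    have := E.mapMoment_mem G (fun _ => c h) i k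
    ⟨sub_nonneg.2 this.2, sub_le_self _ this.1⟩

/-- A forced bit has all moments equal to 1 and contributes nothing; any other contributes at most
the total weight. -/
lemma mapAvg_le_forced (hc : IsChannelFamily c) (hn : 0 < E.n) {h : ℝ}
    (hh : h ∈ Ioo (0 : ℝ) 1) : E.mapAvg c h ≤ 1 - E.bitAvg fun G i => E.forcedInd G i := by
  rw [← E.bitAvg_one hn, ← bitAvg_sub]
  refine E.bitAvg_mono fun G i => ?_
  have hm := fun k => E.mapMoment_mem G (fun _ => c h) i k
  unfold forcedInd
  split_ifs with hf
  · have : ∀ k, E.mapMoment G (fun _ => c h) i k = 1 := fun k =>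
      le_antisymm (hm k).2 ((E.bpMoment_of_forced G (fun _ => c h) hf 0 k).symm.le.trans
        (E.bpMoment_le_mapMoment G _ 0 i k))
    simp [this]
  · rw [sub_zero]
    exact (hc.tsum_weight_mul_mem hh fun k => ⟨sub_nonneg.2 (hm k).2, sub_le_self _ (hm k).1⟩).2

end SocketEnsemble

lemma bpLimit_mem (P : DegreePair) {c : ℝ → LDensity} (hc : IsChannelFamily c) {h : ℝ}
    (hh : h ∈ Ioo (0 : ℝ) 1) : bpLimit P c h ∈ Icc (0 : ℝ) 1 :=
  hc.tsum_weight_mul_mem hh fun k =>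
    ⟨sub_nonneg.2 (outLim_mem P _ k).2, sub_le_self _ (outLim_mem P _ k).1⟩

/-- Convergence of weighted sums. -/
lemma IsChannelFamily.tendsto_tsum {c : ℝ → LDensity} (hc : IsChannelFamily c) {h : ℝ}
    (hh : h ∈ Ioo (0 : ℝ) 1) {b : ℕ → ℕ → ℝ} {b' : ℕ → ℝ}
    (hb : ∀ k, Tendsto (fun t => b t k) atTop (𝓝 (b' k)))
    (hb' : ∀ᶠ t in atTop, ∀ k, b t k ∈ Icc (0 : ℝ) 1) :
    Tendsto (fun t => ∑' k, weight c k h * b t k) atTop (𝓝 (∑' k, weight c k h * b' k)) := by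
  refine tendsto_tsum_of_dominated_convergence (hc.summable_weight hh)
    (fun k => (hb k).const_mul _) ?_
  filter_upwards [hb'] with t ht k
  rw [Real.norm_of_nonneg (mul_nonneg (hc.weight_nonneg hh k) (ht k).1)]
  exact mul_le_of_le_one_right (hc.weight_nonneg hh k) (ht k).2

namespace IsLDPCSequence

variable {P : DegreePair} {E : ℕ → SocketEnsemble} {c : ℝ → LDensity}

lemma eventually_pos (hE : IsLDPCSequence P E) : ∀ᶠ t in atTop, 0 < (E t).n :=
  hE.length_tendsto.eventually_gt_atTop 0

/-- For each k, the average MAP moment exceeds the average BP moment after l rounds, which is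
asymptotically at least the moment of `P.out`, and l is arbitrary. Dominated summation over k then
shows that the excess of the MAP curve over the BP limit disappears. Only this one-sided statement
holds at each parameter. -/
lemma tendsto_excess (hE : IsLDPCSequence P E) (hc : IsChannelFamily c) {h : ℝ}
    (hh : h ∈ Ioo (0 : ℝ) 1) :
    Tendsto (fun t => max ((E t).mapAvg c h - bpLimit P c h) 0) atTop (𝓝 0) := by
  have hk : ∀ k, Tendsto (fun t => max (P.outLim (c h) k -
      (E t).bitAvg fun G i => (E t).mapMoment G (fun _ => c h) i k) 0) atTop (𝓝 0) := by
    refine fun k => tendsto_max_zero fun ε hε => ?_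
    obtain ⟨l, hl⟩ := ((DegreePair.tendsto_outLim (P := P) (c h) k).eventually
      (lt_mem_nhds (show P.outLim (c h) k - ε / 2 < P.outLim (c h) k by linarith))).exists
    filter_upwards [hE.eventually_le_bpMoment (c h) l k (half_pos hε)] with t ht
    have := (E t).bitAvg_mono fun G i => (E t).bpMoment_le_mapMoment G (fun _ => c h) l i k
    linarith
  have hlim := hc.tendsto_tsum hh hk (by
    filter_upwards [hE.eventually_pos] with t hn k
    have h1 := (E t).bitAvg_mem hn fun G i => (E t).mapMoment_mem G (fun _ => c h) i k
    have h2 := outLim_mem P (c h) k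
    exact ⟨le_max_right _ _, max_le (by linarith [h1.1, h2.2]) zero_le_one⟩)
  simp only [mul_zero, tsum_zero] at hlim
  refine tendsto_of_tendsto_of_tendsto_of_le_of_le' tendsto_const_nhds hlim
    (Eventually.of_forall fun t => le_max_right _ _) ?_
  filter_upwards [hE.eventually_pos] with t hn
  have h1 := fun k => (E t).bitAvg_mem hn fun G i => (E t).mapMoment_mem G (fun _ => c h) i k
  have h2 := outLim_mem P (c h)
  have hm : ∀ k, max (P.outLim (c h) k -
      (E t).bitAvg fun G i => (E t).mapMoment G (fun _ => c h) i k) 0 ∈ Icc (0 : ℝ) 1 := fun k =>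
    ⟨le_max_right _ _, max_le (by linarith [(h1 k).1, (h2 k).2]) zero_le_one⟩
  refine max_le ?_ (tsum_nonneg fun k => mul_nonneg (hc.weight_nonneg hh k) (hm k).1)
  have hs1 := hc.summable_weight_mul hh (b := fun k => 1 - (E t).bitAvg fun G i =>
    (E t).mapMoment G (fun _ => c h) i k) fun k =>
      ⟨sub_nonneg.2 (h1 k).2, sub_le_self _ (h1 k).1⟩
  have hs2 := hc.summable_weight_mul hh (b := fun k => 1 - P.outLim (c h) k) fun k =>
      ⟨sub_nonneg.2 (h2 k).2, sub_le_self _ (h2 k).1⟩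
  rw [(E t).mapAvg_eq hc hn hh, bpLimit, ← hs1.tsum_sub hs2]
  refine (hs1.sub hs2).tsum_le_tsum (fun k => ?_) (hc.summable_weight_mul hh hm)
  rw [← mul_sub]
  exact mul_le_mul_of_nonneg_left (le_trans (le_of_eq (by ring)) (le_max_left _ _))
    (hc.weight_nonneg hh k)

lemma integrableOn_excess (E : SocketEnsemble) (P : DegreePair) (hc : IsChannelFamily c) :
    IntegrableOn (fun h => max (E.mapAvg c h - bpLimit P c h) 0) (Ioo 0 1) :=
  ((E.integrableOn_mapAvg hc).sub (integrableOn_bpLimit hc)).pos_part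

lemma tendsto_integral_excess (hE : IsLDPCSequence P E) (hc : IsChannelFamily c) :
    Tendsto (fun t => ∫ h in Ioo (0 : ℝ) 1, max ((E t).mapAvg c h - bpLimit P c h) 0) atTop
      (𝓝 0) := by
  obtain ⟨T, hT⟩ := eventually_atTop.1 hE.eventually_pos
  rw [← tendsto_add_atTop_iff_nat T]
  have := tendsto_integral_of_dominated_convergence (μ := volume.restrict (Ioo (0 : ℝ) 1))
    (F := fun t h => max ((E (t + T)).mapAvg c h - bpLimit P c h) 0) (f := fun _ => 0)
    (fun _ => 1) (fun t => (integrableOn_excess _ P hc).aestronglyMeasurable)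
    (integrable_const _) ?_ ?_
  · simpa using this
  · intro t
    refine (ae_restrict_iff' measurableSet_Ioo).2 (ae_of_all _ fun h hh => ?_)
    rw [Real.norm_of_nonneg (le_max_right _ _)]
    refine max_le ?_ zero_le_one
    linarith [((E (t + T)).mapAvg_mem hc (hT _ (Nat.le_add_left _ _)) hh).2,
      (bpLimit_mem P hc hh).1]
  · refine (ae_restrict_iff' measurableSet_Ioo).2 (ae_of_all _ fun h hh => ?_)
    exact (tendsto_add_atTop_iff_nat T).2 (hE.tendsto_excess hc hh)

end IsLDPCSequence

namespace IsBPFamily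

variable {P : DegreePair} {c : ℝ → LDensity} {η : ℝ → ℝ} {f : ℝ → LDensity}

/-- Otherwise f x would lie below f 1, which carries no information. -/
lemma apply_lt_one (hc : IsChannelFamily c) (hf : IsBPFamily P c η f) {x : ℝ} (hx : 0 ≤ x)
    (hx1 : x < 1) : η x < 1 := by
  have hxm : x ∈ Icc (0 : ℝ) 1 := ⟨hx, hx1.le⟩
  have ho : (1 : ℝ) ∈ Icc (0 : ℝ) 1 := by norm_num
  refine lt_of_le_of_ne (hf.mem x hxm).2 fun h => ?_
  have h1 := LDensity.mutualInfo_mono (DegreePair.IsBPFixedPoint.mono (hf.bp x hxm) (hf.bp 1 ho)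
    (by rw [h, hf.apply_one hc]))
  rw [hf.ent x hxm, hf.ent 1 ho] at h1
  nlinarith [log_two_pos]

/-- Near the useless channel, the BP fixed points approach the estimates from check nodes of degree
one alone. -/
lemma exists_moment_le (hf : IsBPFamily P c η f) {ε : ℝ} (hε : 0 < ε) :
    ∃ x, 0 ≤ x ∧ x < 1 ∧
      (P.node (P.checkD (f x))).moment 0 ≤ (P.node (P.checkD 0)).moment 0 + ε := by
  set x : ℕ → ℝ := fun j => 1 - 1 / ((j : ℝ) + 1)
  have hx : ∀ j, x j ∈ Ico (0 : ℝ) 1 := fun j => by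
    have h1 : (0 : ℝ) < (j : ℝ) + 1 := by positivity
    refine ⟨sub_nonneg.2 ((div_le_one h1).2 (by linarith [(Nat.cast_nonneg j : (0 : ℝ) ≤ j)])), ?_⟩
    exact sub_lt_self _ (by positivity)
  have hlim : Tendsto (fun j => (f (x j)).mutualInfo) atTop (𝓝 (0 : LDensity).mutualInfo) := by
    have h0 : (0 : LDensity).mutualInfo = Real.log 2 * (1 - (1 - 0)) := by
      simp [LDensity.mutualInfo, LDensity.law_zero, info]
    simp only [hf.ent _ (Ico_subset_Icc_self (hx _)), h0]
    exact ((tendsto_one_div_add_atTop_nhds_zero_nat.const_sub 1).const_sub 1).const_mul _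
  have ho : (∀ l, f (x l) ≤ 0) ∨ ∀ l, 0 ≤ f (x l) := Or.inr fun l => LDensity.zero_le' _
  have hm := DegreePair.node_tendsto (P := P) (DegreePair.checkD_tendsto (P := P)
    (LDensity.MomentTendsto.of_mutualInfo hlim ho))
    (Or.inr fun l => DegreePair.checkD_mono (LDensity.zero_le' _)) 0
  obtain ⟨j, hj⟩ := (hm.eventually (gt_mem_nhds (show (P.node (P.checkD 0)).moment 0 <
    (P.node (P.checkD 0)).moment 0 + ε by linarith))).exists
  exact ⟨x j, (hx j).1, (hx j).2, hj.le⟩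

/-- Above η x the extrinsic moments are at most those at f x, the largest of which is the one with
index 0; the weights sum to 1 almost everywhere. -/
lemma le_integral_bpLimit (hc : IsChannelFamily c) (hf : IsBPFamily P c η f) {x : ℝ}
    (hx : x ∈ Icc (0 : ℝ) 1) :
    (1 - η x) * (1 - (P.node (P.checkD (f x))).moment 0) ≤
      ∫ h in Ioo (η x) 1, bpLimit P c h := by
  have hsub : Ioo (η x) 1 ⊆ Ioo 0 1 := Ioo_subset_Ioo (hf.mem x hx).1 le_rfl
  have hw := ae_restrict_of_ae_restrict_of_subset hsub hc.ae_hasSum_weight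
  have h := integral_mono_ae (μ := volume.restrict (Ioo (η x) 1))
    (f := fun _ => 1 - (P.node (P.checkD (f x))).moment 0) (integrable_const _)
    ((integrableOn_bpLimit (P := P) hc).mono_set hsub) ?_
  · refine le_trans (le_of_eq ?_) h
    rw [integral_const, smul_eq_mul, measureReal_restrict_apply_univ, Real.volume_real_Ioo_of_le (hf.mem x hx).2]
  · filter_upwards [hw, ae_restrict_mem measurableSet_Ioo] with h hw hh
    have hh0 := hsub hh
    set a := P.node (P.checkD (f x))
    have h1 : ∑' k, weight c k h * (1 - a.moment 0) = 1 - a.moment 0 := by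
      rw [tsum_mul_right, hw.tsum_eq, one_mul]
    rw [← h1, bpLimit]
    refine (hc.summable_weight_mul hh0 (b := fun _ => 1 - a.moment 0) fun k =>
      ⟨sub_nonneg.2 (a.moment_le_one 0), sub_le_self _ (a.moment_nonneg 0)⟩).tsum_le_tsum
      (fun k => mul_le_mul_of_nonneg_left (sub_le_sub_left ?_ _) (hc.weight_nonneg hh0 k))
      (hc.summable_weight_mul hh0 fun k =>
        ⟨sub_nonneg.2 (outLim_mem P _ k).2, sub_le_self _ (outLim_mem P _ k).1⟩)
    refine (DegreePair.outLim_mono (hc.anti (hf.mem x hx) (Ioo_subset_Icc_self hh0) hh.1.le)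
      k).trans ?_
    rw [DegreePair.outLim_eq (hf.bp x hx) (hf.fixed x hx)]
    exact a.moment_antitone (Nat.zero_le k)

end IsBPFamily

end Gexit
namespace Gexit

namespace IsLDPCSequence

variable {P : DegreePair} {E : ℕ → SocketEnsemble} {c : ℝ → LDensity} {η : ℝ → ℝ}
  {f : ℝ → LDensity}

/-- The areas are balanced on both sides of η x for x near 1. To the left the MAP area is at most
the BP area plus a vanishing excess, to the right at most (1 - η x) (1 - q), with q the proportion
of forced bits. Since the MAP area is nearly the BP area or more, q cannot exceed the moment of the
fixed point's node output, which approaches that of attached bits alone. -/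
lemma eventually_forced_le (hE : IsLDPCSequence P E) (hc : IsChannelFamily c)
    (hf : IsBPFamily P c η f)
    (hrate : Tendsto (fun k => (E k).avg fun G => (E k).rate G) atTop (𝓝 P.designRate))
    {ε : ℝ} (hε : 0 < ε) : ∀ᶠ t in atTop,
      (E t).bitAvg (fun G i => (E t).forcedInd G i) ≤ (P.out 0 1).moment 0 + ε := by
  obtain ⟨x, hx0, hx1, hx⟩ := hf.exists_moment_le (half_pos hε)
  have hxm : x ∈ Icc (0 : ℝ) 1 := ⟨hx0, hx1.le⟩
  have hη := hf.mem x hxm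
  have hη1 : 0 < 1 - η x := sub_pos.2 (hf.apply_lt_one hc hx0 hx1)
  have hψ : (P.node (P.checkD 0)).moment 0 ≤ (P.out 0 1).moment 0 :=
    LDensity.moment_mono (DegreePair.node_mono (DegreePair.checkD_mono (LDensity.zero_le' _))) 0
  -- Excess and rate deficit each cost δ, together (1 - η x) ε / 2; the other ε / 2 was spent on the
  -- choice of x.
  set δ : ℝ := (1 - η x) * (ε / 4)
  have hδ : 0 < δ := by positivity
  have hs1 : Ioo 0 (η x) ⊆ Ioo (0 : ℝ) 1 := Ioo_subset_Ioo le_rfl hη.2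
  have hs2 : Ioo (η x) 1 ⊆ Ioo (0 : ℝ) 1 := Ioo_subset_Ioo hη.1 le_rfl
  have hsplit : ∀ {F : ℝ → ℝ}, IntegrableOn F (Ioo 0 1) →
      ∫ h in Ioo (0 : ℝ) 1, F h = (∫ h in Ioo 0 (η x), F h) + ∫ h in Ioo (η x) 1, F h := by
    intro F hF
    have hi : ∀ s ∈ Icc (0 : ℝ) 1, ∀ t ∈ Icc (0 : ℝ) 1, s ≤ t → IntervalIntegrable F volume s t :=
      fun s hs t ht h => by
        rw [intervalIntegrable_iff_integrableOn_Ioo_of_le h]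
        exact hF.mono_set (Ioo_subset_Ioo hs.1 ht.2)
    have h0 : (0 : ℝ) ∈ Icc (0 : ℝ) 1 := by norm_num
    have h1 : (1 : ℝ) ∈ Icc (0 : ℝ) 1 := by norm_num
    have := intervalIntegral.integral_add_adjacent_intervals (hi 0 h0 _ hη hη.1)
      (hi _ hη 1 h1 hη.2)
    rw [intervalIntegral.integral_of_le hη.1, intervalIntegral.integral_of_le hη.2,
      intervalIntegral.integral_of_le zero_le_one] at this
    simp only [integral_Ioc_eq_integral_Ioo] at this
    exact this.symm
  filter_upwards [hE.eventually_pos,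
    (hE.tendsto_integral_excess hc).eventually (gt_mem_nhds hδ),
    hrate.eventually (lt_mem_nhds (show P.designRate - δ < P.designRate by linarith))]
    with t hn hex hr
  set q := (E t).bitAvg fun G i => (E t).forcedInd G i
  have hM := (E t).integrableOn_mapAvg hc
  have hB := integrableOn_bpLimit (P := P) hc
  have hX := integrableOn_excess (E t) P hc
  have e1 : ∫ h in Ioo 0 (η x), (E t).mapAvg c h ≤ (∫ h in Ioo 0 (η x), bpLimit P c h) +
      ∫ h in Ioo (0 : ℝ) 1, max ((E t).mapAvg c h - bpLimit P c h) 0 := by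
    have h1 : ∫ h in Ioo 0 (η x), max ((E t).mapAvg c h - bpLimit P c h) 0 ≤
        ∫ h in Ioo (0 : ℝ) 1, max ((E t).mapAvg c h - bpLimit P c h) 0 :=
      setIntegral_mono_set hX (ae_of_all _ fun h => le_max_right _ _) hs1.eventuallyLE
    refine le_trans ?_ (add_le_add_right h1 _)
    rw [← integral_add (hB.mono_set hs1) (hX.mono_set hs1)]
    refine integral_mono (hM.mono_set hs1) ((hB.mono_set hs1).add (hX.mono_set hs1)) fun h => ?_
    have := le_max_left ((E t).mapAvg c h - bpLimit P c h) 0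
    beta_reduce
    linarith
  have e2 : ∫ h in Ioo (η x) 1, (E t).mapAvg c h ≤ (1 - η x) * (1 - q) := by
    have h1 := setIntegral_mono_on (hM.mono_set hs2) (integrable_const (1 - q)) measurableSet_Ioo
      fun h hh => (E t).mapAvg_le_forced hc hn (hs2 hh)
    refine h1.trans (le_of_eq ?_)
    rw [integral_const, smul_eq_mul, measureReal_restrict_apply_univ,
      Real.volume_real_Ioo_of_le hη.2]
  have e3 := (E t).avg_rate_le hc hn
  rw [hsplit hM] at e3
  have e4 := integral_bpLimit_le hc hf
  rw [hsplit hB] at e4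
  have e5 := hf.le_integral_bpLimit hc hxm
  have e6 : (1 - η x) * q ≤ (1 - η x) * ((P.out 0 1).moment 0 + ε) := by
    have h2 := mul_le_mul_of_nonneg_left (hx.trans (add_le_add_left hψ _)) hη1.le
    have h3 : δ + δ = (1 - η x) * (ε / 2) := by simp only [δ]; ring
    nlinarith
  exact le_of_mul_le_mul_left e6 hη1

lemma tendsto_of_eventually {u : ℕ → ℝ} {a : ℝ} (h1 : ∀ ε > 0, ∀ᶠ t in atTop, a - ε ≤ u t)
    (h2 : ∀ ε > 0, ∀ᶠ t in atTop, u t ≤ a + ε) : Tendsto u atTop (𝓝 a) := by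
  refine Metric.tendsto_nhds.2 fun ε hε => ?_
  filter_upwards [h1 (ε / 2) (by positivity), h2 (ε / 2) (by positivity)] with t h3 h4
  rw [Real.dist_eq]
  exact abs_lt.2 ⟨by linarith, by linarith⟩

/-- Attached bits are forced, which supplies the lower bound. -/
lemma tendsto_bitAvg_forced (hE : IsLDPCSequence P E) (hc : IsChannelFamily c)
    (hf : IsBPFamily P c η f)
    (hrate : Tendsto (fun k => (E k).avg fun G => (E k).rate G) atTop (𝓝 P.designRate)) :
    Tendsto (fun t => (E t).bitAvg fun G i => (E t).forcedInd G i) atTop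
      (𝓝 ((P.out 0 1).moment 0)) := by
  refine tendsto_of_eventually (fun ε hε => ?_) fun ε hε =>
    hE.eventually_forced_le hc hf hrate hε
  filter_upwards [hE.eventually_le_attached hε] with t ht
  exact ht.trans ((E t).bitAvg_mono SocketEnsemble.attachedInd_le_forcedInd)

/-- The limit of the moments of the BP estimates. -/
noncomputable def bpMomentLimit (P : DegreePair) (c : LDensity) : ℕ → ℕ → ℝ
  | 0, _ => (P.out 0 1).moment 0
  | l + 1, k => (P.out c (l + 1)).moment k

/-- Without any round the estimate is 0 and only forced bits count. From one round on, attached bits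
are recognized, and the remaining forced bits have vanishing proportion. -/
lemma tendsto_bitAvg_bpMoment (hE : IsLDPCSequence P E) (hc : IsChannelFamily c)
    (hf : IsBPFamily P c η f)
    (hrate : Tendsto (fun k => (E k).avg fun G => (E k).rate G) atTop (𝓝 P.designRate))
    (a : LDensity) (l k : ℕ) :
    Tendsto (fun t => (E t).bitAvg fun G i => (E t).bpMoment G (fun _ => a) l i k) atTop
      (𝓝 (bpMomentLimit P a l k)) := by
  cases l with
  | zero =>
    simp only [SocketEnsemble.bpMoment_zero_rounds]
    exact hE.tendsto_bitAvg_forced hc hf hrate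
  | succ l =>
    refine tendsto_of_eventually (fun ε hε => hE.eventually_le_bpMoment a (l + 1) k hε)
      fun ε hε => ?_
    have hε3 : 0 < ε / 3 := by positivity
    filter_upwards [hE.eventually_pos, hE.eventually_le_one_sub_bpMoment a l k hε3,
      hE.eventually_le_attached hε3, hE.eventually_forced_le hc hf hrate hε3] with t hn h1 h2 h3
    rw [(E t).bitAvg_add, (E t).bitAvg_sub, (E t).bitAvg_sub, (E t).bitAvg_one hn] at h1
    simp only [bpMomentLimit]
    linarith

lemma bpMomentLimit_mem (P : DegreePair) (a : LDensity) (l k : ℕ) :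
    bpMomentLimit P a l k ∈ Icc (0 : ℝ) 1 := by
  cases l
  · exact LDensity.moment_mem _ _
  · exact LDensity.moment_mem _ _

/-- The asymptotic BP GEXIT function. -/
theorem isAsymptoticBPGexit (hE : IsLDPCSequence P E) (hc : IsChannelFamily c)
    (hf : IsBPFamily P c η f)
    (hrate : Tendsto (fun k => (E k).avg fun G => (E k).rate G) atTop (𝓝 P.designRate))
    {h : ℝ} (hh : h ∈ Ioo (0 : ℝ) 1) (hw : HasSum (fun k => weight c k h) 1) :
    IsAsymptoticBPGexit E c h (bpLimit P c h) := by
  refine ⟨fun l => ∑' k, weight c k h * (1 - bpMomentLimit P (c h) l k), fun l => ?_, ?_⟩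
  · have hlim := hc.tendsto_tsum hh (b := fun t k => 1 - (E t).bitAvg fun G i =>
      (E t).bpMoment G (fun _ => c h) l i k)
      (fun k => (hE.tendsto_bitAvg_bpMoment hc hf hrate (c h) l k).const_sub 1) (by
        filter_upwards [hE.eventually_pos] with t hn k
        have := (E t).bitAvg_mem hn fun G i => (E t).bpMoment_mem G (fun _ => c h) l i k
        exact ⟨sub_nonneg.2 this.2, sub_le_self _ this.1⟩)
    refine hlim.congr' ?_
    filter_upwards [hE.eventually_pos] with t hn
    rw [← (E t).bitAvg_tsum hn (hc.weight_nonneg hh) (hc.summable_weight hh)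
      fun G i k => (E t).bpMoment_mem G _ l i k]
    simp only [SocketEnsemble.bitAvg, SocketEnsemble.bpGexit,
      ((E t).hasDerivAt_bpEntropy _ hc hh hw l _).deriv]
  · refine hc.tendsto_tsum hh (fun k => ?_) (Eventually.of_forall fun l k =>
      have := bpMomentLimit_mem P (c h) l k
      ⟨sub_nonneg.2 this.2, sub_le_self _ this.1⟩)
    refine Tendsto.const_sub 1 ((tendsto_add_atTop_iff_nat 1).1 ?_)
    exact (tendsto_add_atTop_iff_nat 1).2 (DegreePair.tendsto_outLim (P := P) (c h) k)

/-- The average MAP GEXIT functions converge to the BP limit in mean. -/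
lemma tendsto_eLpNorm_mapAvg (hE : IsLDPCSequence P E) (hc : IsChannelFamily c)
    (hf : IsBPFamily P c η f)
    (hrate : Tendsto (fun k => (E k).avg fun G => (E k).rate G) atTop (𝓝 P.designRate)) :
    Tendsto (fun t => eLpNorm ((E t).mapAvg c - bpLimit P c) 1 (volume.restrict (Ioo 0 1)))
      atTop (𝓝 0) := by
  have hB := integrableOn_bpLimit (P := P) hc
  have hI : ∀ t, eLpNorm ((E t).mapAvg c - bpLimit P c) 1 (volume.restrict (Ioo 0 1)) =
      ENNReal.ofReal (∫ h in Ioo (0 : ℝ) 1, |(E t).mapAvg c h - bpLimit P c h|) := fun t => by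
    rw [eLpNorm_one_eq_lintegral_enorm,
      ← ofReal_integral_norm_eq_lintegral_enorm (((E t).integrableOn_mapAvg hc).sub hB)]
    rfl
  simp only [hI]
  rw [← ENNReal.ofReal_zero]
  refine ENNReal.tendsto_ofReal ?_
  have hup := ((hE.tendsto_integral_excess hc).const_mul 2).add (hrate.const_sub P.designRate)
  rw [mul_zero, sub_self, add_zero] at hup
  refine tendsto_of_tendsto_of_tendsto_of_le_of_le' tendsto_const_nhds hup
    (Eventually.of_forall fun t => integral_nonneg fun h => abs_nonneg _) ?_
  filter_upwards [hE.eventually_pos] with t hn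
  have hM := (E t).integrableOn_mapAvg hc
  have hX := integrableOn_excess (E t) P hc
  have h1 := (E t).avg_rate_le hc hn
  have h2 := integral_bpLimit_le hc hf
  have hMB : IntegrableOn (fun h => (E t).mapAvg c h - bpLimit P c h) (Ioo 0 1) := hM.sub hB
  -- |z| = 2 max z 0 - z: the positive part vanishes in the limit by the pointwise comparison, and
  -- the signed area is controlled by the rate.
  have h3 : ∫ h in Ioo (0 : ℝ) 1, |(E t).mapAvg c h - bpLimit P c h| =
      2 * (∫ h in Ioo (0 : ℝ) 1, max ((E t).mapAvg c h - bpLimit P c h) 0) -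
        ((∫ h in Ioo (0 : ℝ) 1, (E t).mapAvg c h) - ∫ h in Ioo (0 : ℝ) 1, bpLimit P c h) := by
    rw [← integral_sub hM hB, ← integral_const_mul, ← integral_sub (hX.const_mul 2) hMB]
    refine integral_congr_ae (ae_of_all _ fun h => ?_)
    simp only
    rcases le_total ((E t).mapAvg c h - bpLimit P c h) 0 with h0 | h0
    · rw [abs_of_nonpos h0, max_eq_right h0]; ring
    · rw [abs_of_nonneg h0, max_eq_left h0]; ring
  rw [h3]
  linarith

/-- The asymptotic MAP GEXIT function. -/
theorem ae_limsup_mapAvg (hE : IsLDPCSequence P E) (hc : IsChannelFamily c)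
    (hf : IsBPFamily P c η f)
    (hrate : Tendsto (fun k => (E k).avg fun G => (E k).rate G) atTop (𝓝 P.designRate)) :
    ∀ᵐ h ∂(volume.restrict (Ioo (0 : ℝ) 1)),
      limsup (fun t => (((E t).mapAvg c h : ℝ) : EReal)) atTop = (bpLimit P c h : EReal) := by
  obtain ⟨ns, hns, hlim⟩ := (tendstoInMeasure_of_tendsto_eLpNorm one_ne_zero
    (fun t => ((E t).integrableOn_mapAvg hc).aestronglyMeasurable)
    (integrableOn_bpLimit (P := P) hc).aestronglyMeasurable
    (hE.tendsto_eLpNorm_mapAvg hc hf hrate)).exists_seq_tendsto_ae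
  filter_upwards [hlim, ae_restrict_mem measurableSet_Ioo] with h hlim hh
  refine le_antisymm ?_ ?_
  -- The upper bound holds along the full sequence, by the vanishing of the positive part.
  · have h1 : Tendsto (fun t => bpLimit P c h + max ((E t).mapAvg c h - bpLimit P c h) 0) atTop
        (𝓝 (bpLimit P c h)) := by simpa using (hE.tendsto_excess hc hh).const_add (bpLimit P c h)
    have h2 := ((continuous_coe_real_ereal.tendsto _).comp h1).limsup_eq
    rw [← h2]
    refine limsup_le_limsup (Eventually.of_forall fun t => EReal.coe_le_coe_iff.2 ?_)
    linarith [le_max_left ((E t).mapAvg c h - bpLimit P c h) 0]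
  -- The lower bound needs only the subsequence extracted from convergence in measure, since a
  -- limsup is at least the limit along any subsequence.
  · have h2 := ((continuous_coe_real_ereal.tendsto _).comp hlim).limsup_eq
    rw [← h2]
    exact limsup_le_limsup_of_le (u := fun t => (((E t).mapAvg c h : ℝ) : EReal))
      hns.tendsto_atTop

end IsLDPCSequence
end Gexit

theorem mainTheorem5 (P : Gexit.DegreePair) (E : ℕ → Gexit.SocketEnsemble)
    (hE : Gexit.IsLDPCSequence P E)
    (hrate : Tendsto (fun k => (E k).avg fun G => (E k).rate G) atTop (𝓝 P.designRate))
    (c : ℝ → Gexit.LDensity) (hent : Gexit.EntropyParameterized c)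
    (hsmooth : Gexit.SmoothFamily c) (hdeg : Gexit.DegradedFamily c)
    (hBP : Gexit.HasCompleteBPFamily P c) :
    ∀ᵐ h ∂(volume.restrict (Icc (0 : ℝ) 1)),
      (∀ k (G : (E k).Graph) i, DifferentiableAt ℝ ((E k).mapEntropy G c h i) h) ∧
      (∀ k (G : (E k).Graph) l i, DifferentiableAt ℝ ((E k).bpEntropy G c l h i) h) ∧
      ∃ g : ℝ, Gexit.IsAsymptoticBPGexit E c h g ∧
        Gexit.asymptoticMapGexit E c h = (g : EReal) := by
  have hc : Gexit.IsChannelFamily c := ⟨hent, hsmooth, hdeg⟩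
  obtain ⟨η, f, hf⟩ := hBP.exists_isBPFamily
  -- The endpoints form a null set, and smoothness of the channels is available inside only.
  rw [← restrict_Ioo_eq_restrict_Icc]
  filter_upwards [hc.ae_hasSum_weight, ae_restrict_mem measurableSet_Ioo,
    hE.ae_limsup_mapAvg hc hf hrate] with h hw hh hlim
  refine ⟨fun k G i => ((E k).hasDerivAt_mapEntropy G hc hh hw i).differentiableAt,
    fun k G l i => ((E k).hasDerivAt_bpEntropy G hc hh hw l i).differentiableAt,
    Gexit.bpLimit P c h, hE.isAsymptoticBPGexit hc hf hrate hh hw, ?_⟩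
  rw [← hlim]
  unfold Gexit.asymptoticMapGexit
  simp only [Gexit.SocketEnsemble.mapAvg, Gexit.SocketEnsemble.bitAvg,
    Gexit.SocketEnsemble.mapGexit, ((E _).hasDerivAt_mapEntropy _ hc hh hw _).deriv]
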